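/- Let $L$ be a locally compact non-archimedean field with non-trivial absolute value, and let $K\supseteq L$ be a spherically complete non-archimedean field whose absolute value extends that of $L$ (of any characteristic). Let $G$ be a locally $L$-analytic Lie group (finite-dimensional, Hausdorff, second countable) with identity element $e$, and let $V\neq\{0\}$ be a Hausdorff locally convex $K$-vector space. Notation. A BH-subspace of $V$ is a subspace $E\subseteq V$ admitting a $K$-Banach space structure $\overline E$ for which $\overline E\hookrightarrow V$ is continuous. For an open $U\subseteq G$, $C^{\mathrm{la}}(U,V)$ is the space of functions $U\to V$ which in charts are locally given by convergent power series with coefficients in $\overline E$ for BH-subspaces $E\subseteq V$. For a chart $\varphi\colon U\to B^n_{\underline r}(a)\subseteq L^n$ onto a closed polydisc, $C^{\mathrm{rig}}(U,\overline E)$ is the Banach space of functions $x\mapsto g(\varphi(x)-a)$ with $g=\sum_i v_iX^i$ a power series over $\overline E$ such that $\underline r^{i}\|v_i\|\to0$, with norm $\sup_i \underline r^{i}\|v_i\|$. $C^{\mathrm{la}}(U,V)$ carries the locally convex inductive limit topology with respect to its subspaces $\prod_i C^{\mathrm{rig}}(U_i,\overline{E_i})$, for disjoint coverings $U=\bigcup_i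 U_i$ by such charts and BH-subspaces $E_i$ of $V$, and $C^{\mathrm{la}}_e(G,V)=\varinjlim_{e\in U}C^{\mathrm{la}}(U,V)$ carries the locally convex inductive limit topology. Let $D(G)=C^{\mathrm{la}}(G,K)'_b$ and $D_e(G)=C^{\mathrm{la}}_e(G,K)'_b$ be the strong duals; the transpose of $C^{\mathrm{la}}(G,K)\to C^{\mathrm{la}}_e(G,K)$ is an injection $D_e(G)\hookrightarrow D(G)$, by which $D_e(G)$ is regarded as a subspace of $D(G)$. Let $\delta_g\in D(G)$ denote the Dirac distribution at $g\in G$. Let $\mathfrak m_e$ be the ideal of germs in $C^{\mathrm{la}}_e(G,K)$ vanishing at $e$, and let $$\mathrm{hy}(G)=\bigcup_{k\ge0}\{\mu\in D_e(G)\mid \mu(\mathfrak m_e^{k+1})=0\}.$$ Then: 1. There is a unique continuous $K$-linear map $I\colon C^{\mathrm{la}}(G,V)\to\mathcal L_b(D(G),V)$ with $I(f)(\delta_g)=f(g)$ for all $f$ and $g$. The pairing $D(G)\times C^{\mathrm{la}}(G,V)\to V$, $(\mu,f)\mapsto\mu(f):=I(f)(\mu)$, induces a unique $K$-bilinear pairing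 $$D_e(G)\times C^{\mathrm{la}}_e(G,V)\to V,\qquad (\mu,f)\mapsto\mu(f):=\mu(\tilde f),$$ where $\tilde f\in C^{\mathrm{la}}(G,V)$ is any lift of $f$. This pairing is separately continuous, non-degenerate (in both arguments), and natural in $G$ and $V$, i.e. compatible with homomorphisms of locally $L$-analytic Lie groups and with continuous $K$-linear maps $V\to W$, for $W\neq\{0\}$ Hausdorff locally convex. 2. For a chart $U$ around $e$ onto a closed polydisc and a BH-subspace $E\subseteq V$, the map $C^{\mathrm{rig}}(U,\overline E)\to C^{\mathrm{la}}_e(G,V)$ is continuous and injective, and the restriction of the pairing to $D_e(G)\times C^{\mathrm{rig}}(U,\overline E)$ is the composite $$D_e(G)\times C^{\mathrm{rig}}(U,\overline E)\to D_e(G)\times \big(C^{\mathrm{la}}_e(G,K)\,\widehat\otimes_K\,\overline E\big)\to\overline E,$$ where the first map is induced by the continuous linear map with $f(\cdot)\,v\mapsto f\otimes v$ for $f\in C^{\mathrm{rig}}(U,K)$ and $v\in\overline E$, and the last map is $(\mu,f\otimes v)\mapsto\mu(f)\,v$, extended continuously in the second argument. 3. There is a unique separately continuous $K$-bilinear convolution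 product $*$ on $D(G)$ with $\delta_g*\delta_h=\delta_{gh}$ for all $g,h\in G$. It makes $D(G)$ into an associative algebra with unit $\delta_e$. Both $D_e(G)$ and $\mathrm{hy}(G)$ are $K$-subalgebras of $D(G)$, and $\mathrm{hy}(G)$ is dense in $D_e(G)$. 4. The pairing $\mathrm{hy}(G)\times C^{\mathrm{la}}_e(G,V)\to V$ obtained by restriction is non-degenerate (in both arguments). -/

import Mathlib

open Filter Topology TopologicalSpace
open scoped Manifold ContDiff NNReal TensorProduct

set_option linter.unusedSectionVars false

universe u v w uL uK uG uH uV uW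

namespace LocAn

noncomputable section

section LocallyConvex

/-- The ring of integers `{x : K | ‖x‖ ≤ 1}` of a non-archimedean field. -/
abbrev IntegerRing (K : Type*) [NormedField K] [IsUltrametricDist K] : Subring K :=
  (NormedField.valuation (K := K)).integer

/-- A non-archimedean field is spherically complete if every decreasing sequence of closed balls
has non-empty intersection. -/
def SphericallyComplete (K : Type*) [NormedField K] : Prop :=
  ∀ (c : ℕ → K) (ρ : ℕ → ℝ), (∀ k, 0 < ρ k) →
    Antitone (fun k => Metric.closedBall (c k) (ρ k)) →
    (⋂ k, Metric.closedBall (c k) (ρ k)).Nonempty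

variable (K : Type*) [NontriviallyNormedField K] [IsUltrametricDist K]

/-- `t` makes the `K`-vector space `F` into a (non-archimedean) locally convex `K`-vector space:
a topological `K`-vector space in which `0` has a basis of neighbourhoods consisting of
submodules over the ring of integers of `K`. -/
structure IsLocConvex {F : Type*} [AddCommGroup F] [Module K F] (t : TopologicalSpace F) :
    Prop where
  isTopologicalAddGroup : @IsTopologicalAddGroup F t _
  continuousSMul : @ContinuousSMul K F _ _ t
  isLinearTopology : @IsLinearTopology (IntegerRing K) F _ _ _ t

/-- The finest locally convex topology on `F` that is coarser than `t₀`.  For linear maps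
`fᵢ : Fᵢ → F`, the locally convex final topology with respect to all `fᵢ` is `lcFinal K t₀` for
`t₀ = ⨆ i, coinduced fᵢ`. -/
@[reducible]
def lcFinal {F : Type*} [AddCommGroup F] [Module K F] (t₀ : TopologicalSpace F) :
    TopologicalSpace F :=
  sInf {t | t₀ ≤ t ∧ IsLocConvex K t}

variable {K}

theorem le_lcFinal {F : Type*} [AddCommGroup F] [Module K F] (t₀ : TopologicalSpace F) :
    t₀ ≤ lcFinal K t₀ :=
  le_sInf fun _ ht => ht.1

theorem lcFinal_le {F : Type*} [AddCommGroup F] [Module K F] {t₀ t : TopologicalSpace F}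
    (h : t₀ ≤ t) (ht : IsLocConvex K t) : lcFinal K t₀ ≤ t :=
  sInf_le ⟨h, ht⟩

theorem lcFinal_isTopologicalAddGroup {F : Type*} [AddCommGroup F] [Module K F]
    (t₀ : TopologicalSpace F) : @IsTopologicalAddGroup F (lcFinal K t₀) _ :=
  topologicalAddGroup_sInf fun _ ht => ht.2.isTopologicalAddGroup

theorem lcFinal_continuousSMul {F : Type*} [AddCommGroup F] [Module K F]
    (t₀ : TopologicalSpace F) : @ContinuousSMul K F _ _ (lcFinal K t₀) :=
  continuousSMul_sInf fun _ ht => ht.2.continuousSMul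

theorem IsLocConvex.induced {F F' : Type*} [AddCommGroup F] [Module K F] [AddCommGroup F']
    [Module K F'] (f : F →ₗ[K] F') {t : TopologicalSpace F'} (ht : IsLocConvex K t) :
    IsLocConvex K (t.induced f) := by
  let := t
  have := ht.isTopologicalAddGroup
  have := ht.continuousSMul
  have := ht.isLinearTopology
  refine ⟨topologicalAddGroup_induced f, continuousSMul_induced f, ?_⟩
  let : TopologicalSpace F := t.induced f
  refine ⟨⟨fun s => ?_⟩⟩
  rw [nhds_induced, map_zero]
  constructor
  · rintro ⟨u, hu, hus⟩
    obtain ⟨N, hN, hNu⟩ := (IsLinearTopology.hasBasis_submodule (IntegerRing K)).mem_iff.1 hu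
    refine ⟨N.comap (f.restrictScalars (IntegerRing K)), ⟨N, hN, fun x hx => hx⟩, ?_⟩
    exact fun x hx => hus (hNu hx)
  · rintro ⟨N, hN, hNs⟩
    exact Filter.mem_of_superset hN hNs

theorem isLocConvex_self : IsLocConvex K (inferInstance : TopologicalSpace K) := by
  refine ⟨inferInstance, inferInstance, ⟨?_⟩⟩
  refine Metric.nhds_basis_ball.to_hasBasis (fun ε hε => ?_) fun N hN => Metric.mem_nhds_iff.1 hN
  let N : Submodule (IntegerRing K) K :=
    { carrier := Metric.ball 0 ε
      zero_mem' := Metric.mem_ball_self hε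
      add_mem' := by
        intro a b ha hb
        rw [mem_ball_zero_iff] at *
        exact (IsUltrametricDist.norm_add_le_max a b).trans_lt (max_lt ha hb)
      smul_mem' := by
        rintro ⟨c, hc⟩ a ha
        rw [mem_ball_zero_iff] at *
        have hc' : ‖c‖ ≤ 1 := by
          rw [Valuation.mem_integer_iff, NormedField.valuation_apply] at hc
          exact_mod_cast hc
        rw [Subring.smul_def, smul_eq_mul, norm_mul]
        exact (mul_le_of_le_one_left (norm_nonneg _) hc').trans_lt ha }
  exact ⟨N, Metric.ball_mem_nhds 0 hε, subset_rfl⟩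

/-- A BH-subspace of `V`, given as a `K`-Banach space `E` with a continuous linear injection into
`V`; the subspace is the range of the injection.  (In the non-archimedean setting the norm of a
Banach space is ultrametric.) -/
structure BHSubspace (K : Type u) [NontriviallyNormedField K] (V : Type v) [AddCommGroup V]
    [Module K V] [TopologicalSpace V] where
  E : Type v
  [normedAddCommGroup : NormedAddCommGroup E]
  [normedSpace : NormedSpace K E]
  [isUltrametricDist : IsUltrametricDist E]
  [completeSpace : CompleteSpace E]
  ι : E →L[K] V
  injective : Function.Injective ι


attribute [instance] BHSubspace.normedAddCommGroup BHSubspace.normedSpace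
  BHSubspace.isUltrametricDist BHSubspace.completeSpace

/-- The zero BH-subspace. -/
def BHSubspace.bot (K : Type u) [NontriviallyNormedField K] (V : Type v) [AddCommGroup V]
    [Module K V] [TopologicalSpace V] : BHSubspace K V where
  E := PUnit.{v + 1}
  isUltrametricDist := ⟨fun _ _ _ => by simp⟩
  ι := 0
  injective := fun _ _ _ => rfl

/-- `K` as a BH-subspace of itself. -/
def BHSubspace.self (K : Type u) [NontriviallyNormedField K] [IsUltrametricDist K]
    [CompleteSpace K] : BHSubspace K K where
  E := K
  ι := ContinuousLinearMap.id K K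
  injective := Function.injective_id

/-- Any two BH-subspaces of a Hausdorff space are contained in a third one (their sum). -/
theorem BHSubspace.exists_sup {V : Type v} [AddCommGroup V] [Module K V] [TopologicalSpace V]
    [IsTopologicalAddGroup V] [ContinuousSMul K V] [T2Space V] (B₁ B₂ : BHSubspace K V) :
    ∃ (B : BHSubspace K V) (i₁ : B₁.E →L[K] B.E) (i₂ : B₂.E →L[K] B.E),
      (∀ e, B.ι (i₁ e) = B₁.ι e) ∧ (∀ e, B.ι (i₂ e) = B₂.ι e) := by
  let T : (B₁.E × B₂.E) →L[K] V := B₁.ι.coprod B₂.ι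
  let S : Submodule K (B₁.E × B₂.E) := LinearMap.ker T.toLinearMap
  have hS : IsClosed (S : Set (B₁.E × B₂.E)) := T.isClosed_ker
  have : IsClosed (S.toAddSubgroup : Set (B₁.E × B₂.E)) := hS
  have hult : IsUltrametricDist ((B₁.E × B₂.E) ⧸ S) := by
    apply IsUltrametricDist.isUltrametricDist_of_forall_norm_add_le_max_norm
    intro x y
    refine le_of_forall_pos_lt_add fun ε hε => ?_
    obtain ⟨a, rfl, ha⟩ := Submodule.Quotient.norm_mk_lt x hε
    obtain ⟨b, rfl, hb⟩ := Submodule.Quotient.norm_mk_lt y hε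
    rw [← Submodule.Quotient.mk_add]
    refine (Submodule.Quotient.norm_mk_le S (a + b)).trans_lt ?_
    rw [← max_add_add_right]
    have hab : ‖a + b‖ ≤ max ‖a‖ ‖b‖ := by
      rw [Prod.norm_def, Prod.norm_def a, Prod.norm_def b]
      refine max_le ?_ ?_
      · exact (IsUltrametricDist.norm_add_le_max _ _).trans
          (max_le_max (le_max_left _ _) (le_max_left _ _))
      · exact (IsUltrametricDist.norm_add_le_max _ _).trans
          (max_le_max (le_max_right _ _) (le_max_right _ _))
    exact hab.trans_lt (max_lt_max ha hb)
  let B : BHSubspace K V :=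
    { E := (B₁.E × B₂.E) ⧸ S
      ι := 
        { toLinearMap := S.liftQ T.toLinearMap le_rfl
          cont := T.continuous.quotient_lift _ }
      injective := by
        have : LinearMap.ker (S.liftQ T.toLinearMap le_rfl) = ⊥ :=
          Submodule.ker_liftQ_eq_bot _ _ _ le_rfl
        exact LinearMap.ker_eq_bot.1 this }
  let q : (B₁.E × B₂.E) →L[K] B.E :=
    { toLinearMap := S.mkQ
      cont := continuous_quot_mk }
  refine ⟨B, q.comp (ContinuousLinearMap.inl K _ _), q.comp (ContinuousLinearMap.inr K _ _), ?_, ?_⟩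
  · intro e
    change T (e, 0) = _
    simp [T]
  · intro e
    change T (0, e) = _
    simp [T]

end LocallyConvex

section PowerSeries

variable {L : Type*} [NontriviallyNormedField L] {K : Type*} [NontriviallyNormedField K]
  [NormedAlgebra L K] {n : ℕ}

/-- `r ^ i = r₁ ^ i₁ ⋯ rₙ ^ iₙ`. -/
def weight (r : Fin n → ℝ≥0) (i : Fin n →₀ ℕ) : ℝ := ∏ j, (r j : ℝ) ^ i j

theorem weight_nonneg (r : Fin n → ℝ≥0) (i : Fin n →₀ ℕ) : 0 ≤ weight r i :=
  Finset.prod_nonneg fun _ _ => pow_nonneg (NNReal.coe_nonneg _) _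

theorem weight_mono {r s : Fin n → ℝ≥0} (h : r ≤ s) (i : Fin n →₀ ℕ) : weight r i ≤ weight s i :=
  Finset.prod_le_prod (fun _ _ => pow_nonneg (NNReal.coe_nonneg _) _)
    fun j _ => pow_le_pow_left₀ (NNReal.coe_nonneg _) (by exact_mod_cast h j) _

theorem weight_add (r : Fin n → ℝ≥0) (i j : Fin n →₀ ℕ) :
    weight r (i + j) = weight r i * weight r j := by
  simp [weight, pow_add, Finset.prod_mul_distrib]

/-- The monomial `y ^ i = y₁ ^ i₁ ⋯ yₙ ^ iₙ`. -/
def monom (y : Fin n → L) (i : Fin n →₀ ℕ) : L := ∏ j, y j ^ i j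

theorem monom_add (y : Fin n → L) (i j : Fin n →₀ ℕ) :
    monom y (i + j) = monom y i * monom y j := by
  simp [monom, pow_add, Finset.prod_mul_distrib]

/-- The closed polydisc of multiradius `r` around `a`. -/
def polyBall (a : Fin n → L) (r : Fin n → ℝ≥0) : Set (Fin n → L) := {y | ∀ j, ‖y j - a j‖ ≤ r j}

theorem norm_monom_le {y : Fin n → L} {r : Fin n → ℝ≥0} (hy : ∀ j, ‖y j‖ ≤ r j)
    (i : Fin n →₀ ℕ) : ‖monom y i‖ ≤ weight r i := by
  rw [monom, norm_prod, weight]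
  refine Finset.prod_le_prod (fun _ _ => norm_nonneg _) fun j _ => ?_
  rw [norm_pow]
  exact pow_le_pow_left₀ (norm_nonneg _) (hy j) _

variable (K) in
/-- Families `v` of coefficients in `E` with `r ^ i * ‖v i‖ → 0` for `|i| → ∞`. -/
def strictSeries (r : Fin n → ℝ≥0) (E : Type w) [NormedAddCommGroup E] [NormedSpace K E] :
    Submodule K ((Fin n →₀ ℕ) → E) where
  carrier := {v | Tendsto (fun i => weight r i * ‖v i‖) cofinite (𝓝 0)}
  zero_mem' := by simp [tendsto_const_nhds]
  add_mem' := by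
    intro a b ha hb
    have h := Tendsto.add ha hb
    rw [add_zero] at h
    refine squeeze_zero (fun i => mul_nonneg (weight_nonneg r i) (norm_nonneg _)) (fun i => ?_) h
    rw [← mul_add]
    exact mul_le_mul_of_nonneg_left (norm_add_le _ _) (weight_nonneg r i)
  smul_mem' := by
    intro c a ha
    have h := Tendsto.const_mul ‖c‖ ha
    rw [mul_zero] at h
    refine h.congr fun i => ?_
    simp only [Pi.smul_apply, norm_smul]
    ring

variable (K) in
/-- The space `𝒜_r(Lⁿ, E)` of power series `∑ vᵢ Xⁱ` with values in the Banach space `E` that are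
strictly convergent on the closed polydisc of multiradius `r` around `0`. -/
def PowSer (r : Fin n → ℝ≥0) (E : Type w) [NormedAddCommGroup E] [NormedSpace K E] : Type w :=
  strictSeries K r E

namespace PowSer

variable {r s : Fin n → ℝ≥0} {E : Type w} [NormedAddCommGroup E] [NormedSpace K E]
  {F : Type*} [NormedAddCommGroup F] [NormedSpace K F]

/-- The coefficients of a power series. -/
def coeff (g : PowSer K r E) : (Fin n →₀ ℕ) → E := g.1

theorem tendsto_coeff (g : PowSer K r E) :
    Tendsto (fun i => weight r i * ‖g.coeff i‖) cofinite (𝓝 0) := g.2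

instance : AddCommGroup (PowSer K r E) := inferInstanceAs (AddCommGroup (strictSeries K r E))

instance : Module K (PowSer K r E) := inferInstanceAs (Module K (strictSeries K r E))

theorem bddAbove (g : PowSer K r E) :
    BddAbove (Set.range fun i => weight r i * ‖g.coeff i‖) := by
  have h := g.tendsto_coeff.eventually (gt_mem_nhds (zero_lt_one' ℝ))
  have hf : {i | ¬ weight r i * ‖g.coeff i‖ < 1}.Finite := h
  obtain ⟨C, hC⟩ := (hf.image fun i => weight r i * ‖g.coeff i‖).bddAbove
  refine ⟨max C 1, ?_⟩
  rintro _ ⟨i, rfl⟩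
  by_cases hi : weight r i * ‖g.coeff i‖ < 1
  · exact hi.le.trans (le_max_right _ _)
  · exact (hC ⟨i, hi, rfl⟩).trans (le_max_left _ _)

/-- The norm `‖∑ vᵢ Xⁱ‖ = sup r ^ i * ‖vᵢ‖`. -/
instance : Norm (PowSer K r E) := ⟨fun g => ⨆ i, weight r i * ‖g.coeff i‖⟩

theorem norm_def (g : PowSer K r E) : ‖g‖ = ⨆ i, weight r i * ‖g.coeff i‖ := rfl

theorem le_norm (g : PowSer K r E) (i : Fin n →₀ ℕ) : weight r i * ‖g.coeff i‖ ≤ ‖g‖ :=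
  le_ciSup g.bddAbove i

/-- A norm if all `r j > 0`, in general a seminorm. -/
instance : SeminormedAddCommGroup (PowSer K r E) :=
  { AddGroupSeminorm.toSeminormedAddCommGroup
      { toFun := fun g : PowSer K r E => ‖g‖
        map_zero' := by
          have : ∀ i, weight r i * ‖(0 : PowSer K r E).coeff i‖ = 0 := fun i => by
            change weight r i * ‖(0 : E)‖ = 0
            simp
          rw [norm_def]
          simp [this]
        add_le' := fun g h => ciSup_le fun i => by
          refine le_trans ?_ (add_le_add (g.le_norm i) (h.le_norm i))
          rw [← mul_add]
          exact mul_le_mul_of_nonneg_left (norm_add_le _ _) (weight_nonneg r i)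
        neg' := fun g => by
          have : ∀ i, ‖(-g).coeff i‖ = ‖g.coeff i‖ := fun i => norm_neg (g.coeff i)
          simp only [norm_def, this] } with
    norm := fun g => ‖g‖ }

instance : NormedSpace K (PowSer K r E) where
  norm_smul_le c g := ciSup_le fun i => by
    have h : ‖(c • g).coeff i‖ = ‖c‖ * ‖g.coeff i‖ := norm_smul c (g.coeff i)
    rw [h, mul_left_comm]
    exact mul_le_mul_of_nonneg_left (g.le_norm i) (norm_nonneg c)

/-- The value of a power series at a point `y` of the polydisc of multiradius `r` around `0`. -/
def eval (g : PowSer K r E) (y : Fin n → L) : E := ∑' i, algebraMap L K (monom y i) • g.coeff i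

/-- Apply a continuous linear map to all coefficients. -/
def map (T : E →L[K] F) (g : PowSer K r E) : PowSer K r F :=
  ⟨fun i => T (g.coeff i), by
    have h := g.tendsto_coeff.const_mul ‖T‖
    rw [mul_zero] at h
    refine squeeze_zero (fun i => mul_nonneg (weight_nonneg r i) (norm_nonneg _)) (fun i => ?_) h
    rw [mul_left_comm]
    exact mul_le_mul_of_nonneg_left (T.le_opNorm _) (weight_nonneg r i)⟩

/-- Restriction to a smaller polydisc. -/
def restrict (h : s ≤ r) (g : PowSer K r E) : PowSer K s E :=
  ⟨g.coeff, squeeze_zero (fun i => mul_nonneg (weight_nonneg s i) (norm_nonneg _))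
    (fun i => mul_le_mul_of_nonneg_right (weight_mono h i) (norm_nonneg _)) g.tendsto_coeff⟩

theorem eval_restrict (h : s ≤ r) (g : PowSer K r E) (y : Fin n → L) :
    (g.restrict h).eval y = g.eval y := rfl

theorem norm_term_le (g : PowSer K r E) {y : Fin n → L} (hy : ∀ j, ‖y j‖ ≤ r j)
    (i : Fin n →₀ ℕ) : ‖algebraMap L K (monom y i) • g.coeff i‖ ≤ weight r i * ‖g.coeff i‖ := by
  rw [norm_smul, norm_algebraMap']
  exact mul_le_mul_of_nonneg_right (norm_monom_le hy i) (norm_nonneg _)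

theorem tendsto_term (g : PowSer K r E) {y : Fin n → L} (hy : ∀ j, ‖y j‖ ≤ r j) :
    Tendsto (fun i => algebraMap L K (monom y i) • g.coeff i) cofinite (𝓝 0) :=
  squeeze_zero_norm (fun i => g.norm_term_le hy i) g.tendsto_coeff

variable [IsUltrametricDist E] [CompleteSpace E]

theorem summable (g : PowSer K r E) {y : Fin n → L} (hy : ∀ j, ‖y j‖ ≤ r j) :
    Summable (fun i => algebraMap L K (monom y i) • g.coeff i) :=
  NonarchimedeanAddGroup.summable_of_tendsto_cofinite_zero (g.tendsto_term hy)

theorem norm_eval_le (g : PowSer K r E) {y : Fin n → L} (hy : ∀ j, ‖y j‖ ≤ r j) :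
    ‖g.eval y‖ ≤ ‖g‖ :=
  IsUltrametricDist.norm_tsum_le_of_forall_le fun i => (g.norm_term_le hy i).trans (g.le_norm i)

theorem eval_add (g h : PowSer K r E) {y : Fin n → L} (hy : ∀ j, ‖y j‖ ≤ r j) :
    (g + h).eval y = g.eval y + h.eval y := by
  rw [eval, eval, eval, ← (g.summable hy).tsum_add (h.summable hy)]
  refine tsum_congr fun i => ?_
  rw [← smul_add]
  rfl

theorem eval_smul (c : K) (g : PowSer K r E) {y : Fin n → L} (hy : ∀ j, ‖y j‖ ≤ r j) :
    (c • g).eval y = c • g.eval y := by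
  rw [eval, eval, ← (g.summable hy).tsum_const_smul]
  refine tsum_congr fun i => ?_
  rw [smul_comm]
  rfl

theorem map_eval (T : E →L[K] F) (g : PowSer K r E) {y : Fin n → L} (hy : ∀ j, ‖y j‖ ≤ r j) :
    (g.map T).eval y = T (g.eval y) := by
  rw [eval, eval, T.map_tsum (g.summable hy)]
  refine tsum_congr fun i => ?_
  rw [map_smul]
  rfl

end PowSer

section Mul

variable [IsUltrametricDist K] {r : Fin n → ℝ≥0}

/-- The constant power series. -/
def PowSer.const (r : Fin n → ℝ≥0) (c : K) : PowSer K r K :=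
  ⟨fun i => if i = 0 then c else 0, by
    refine tendsto_nhds_of_eventually_eq ?_
    refine (Set.finite_singleton (0 : Fin n →₀ ℕ)).subset fun i hi => ?_
    by_contra h
    exact hi (by simp [show i ≠ 0 from h])⟩

theorem PowSer.eval_const (c : K) (y : Fin n → L) : (PowSer.const r c).eval y = c := by
  rw [PowSer.eval, tsum_eq_single 0]
  · simp [PowSer.coeff, PowSer.const, monom]
  · intro i hi
    simp [PowSer.coeff, PowSer.const, hi]

/-- The Cauchy product of two power series. -/
def PowSer.mul (g h : PowSer K r K) : PowSer K r K :=
  ⟨fun i => ∑ p ∈ Finset.HasAntidiagonal.antidiagonal i, g.coeff p.1 * h.coeff p.2, by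
    have hprod : Tendsto (fun p : (Fin n →₀ ℕ) × (Fin n →₀ ℕ) =>
        (weight r p.1 * ‖g.coeff p.1‖) * (weight r p.2 * ‖h.coeff p.2‖)) cofinite (𝓝 0) :=
      tendsto_mul_cofinite_nhds_zero g.tendsto_coeff h.tendsto_coeff
    rw [Metric.tendsto_nhds] at hprod
    refine Metric.tendsto_nhds.2 fun ε hε => ?_
    have hfin : {p : (Fin n →₀ ℕ) × (Fin n →₀ ℕ) | ¬ dist
        ((weight r p.1 * ‖g.coeff p.1‖) * (weight r p.2 * ‖h.coeff p.2‖)) 0 < ε / 2}.Finite :=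
      hprod (ε / 2) (half_pos hε)
    refine (hfin.image fun p => p.1 + p.2).subset fun i hi => ?_
    by_contra hcon
    apply hi
    have key : ∀ p ∈ Finset.HasAntidiagonal.antidiagonal i, ‖g.coeff p.1 * h.coeff p.2‖ * weight r i ≤ ε / 2 := by
      intro p hp
      rw [Finset.HasAntidiagonal.mem_antidiagonal] at hp
      by_contra hlt
      refine hcon ⟨p, ?_, hp⟩
      intro hd
      rw [Real.dist_0_eq_abs] at hd
      refine hlt (le_trans (le_of_eq ?_) ((le_abs_self _).trans hd.le))
      rw [← hp, weight_add, norm_mul]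
      ring
    have hle : ‖∑ p ∈ Finset.HasAntidiagonal.antidiagonal i, g.coeff p.1 * h.coeff p.2‖ * weight r i ≤ ε / 2 := by
      obtain ⟨p, hp, hpn⟩ := IsUltrametricDist.exists_norm_finsetSum_le_of_nonempty
        (t := Finset.HasAntidiagonal.antidiagonal i) ⟨(0, i), Finset.HasAntidiagonal.mem_antidiagonal.2 (zero_add i)⟩ (fun p => g.coeff p.1 * h.coeff p.2)
      exact (mul_le_mul_of_nonneg_right hpn (weight_nonneg r i)).trans (key p hp)
    change dist _ _ < ε
    rw [Real.dist_0_eq_abs, abs_of_nonneg (mul_nonneg (weight_nonneg r i) (norm_nonneg _)), mul_comm]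
    exact hle.trans_lt (half_lt_self hε)⟩

theorem PowSer.eval_mul [CompleteSpace K] (g h : PowSer K r K) {y : Fin n → L}
    (hy : ∀ j, ‖y j‖ ≤ r j) : (g.mul h).eval y = g.eval y * h.eval y := by
  have : NonarchimedeanRing K := { is_nonarchimedean := NonarchimedeanAddGroup.is_nonarchimedean }
  have hs := (g.summable hy).mul_of_nonarchimedean (h.summable hy)
  rw [PowSer.eval, PowSer.eval, PowSer.eval,
    (g.summable hy).tsum_mul_tsum_eq_tsum_sum_antidiagonal (h.summable hy) hs]
  refine tsum_congr fun i => ?_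
  simp only [PowSer.coeff, PowSer.mul, smul_eq_mul, Finset.mul_sum]
  refine Finset.sum_congr rfl fun p hp => ?_
  rw [Finset.HasAntidiagonal.mem_antidiagonal] at hp
  rw [← hp, monom_add, map_mul]
  ring

end Mul

end PowerSeries

section LocallyAnalytic

variable (L : Type*) [NontriviallyNormedField L] (n : ℕ) (K : Type u) [NontriviallyNormedField K]
  [IsUltrametricDist K] [NormedAlgebra L K]
  {X : Type*} [TopologicalSpace X] [ChartedSpace (Fin n → L) X]

variable (X) in
/-- The charts of a locally `L`-analytic manifold `X` are those of its maximal (analytic) atlas. -/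
abbrev charts : Set (OpenPartialHomeomorph X (Fin n → L)) :=
  IsManifold.maximalAtlas 𝓘(L, Fin n → L) ω X

section

variable {V : Type v} [AddCommGroup V] [Module K V] [TopologicalSpace V]

/-- `f` is locally analytic at `x`: in the charts `φ` around `x`, it is given near `x` by a power
series in `φ - φ x` with coefficients in some BH-subspace of `V`. -/
def IsLocAnAt (f : X → V) (x : X) : Prop :=
  ∀ φ ∈ charts L n X, x ∈ φ.source → ∃ (B : BHSubspace K V) (r : Fin n → ℝ≥0) (_ : ∀ j, 0 < r j)
    (g : PowSer K r B.E), ∀ᶠ y in 𝓝 x, f y = B.ι (g.eval (φ y - φ x))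

variable {L n K}

theorem IsLocAnAt.congr {f g : X → V} {x : X} (hf : IsLocAnAt L n K f x) (h : f =ᶠ[𝓝 x] g) :
    IsLocAnAt L n K g x := by
  intro φ hφ hx
  obtain ⟨B, r, hr, p, hp⟩ := hf φ hφ hx
  exact ⟨B, r, hr, p, by filter_upwards [hp, h] with y h₁ h₂ using h₂ ▸ h₁⟩

theorem eventually_sub_le {φ : OpenPartialHomeomorph X (Fin n → L)} {x : X} (hx : x ∈ φ.source)
    {r : Fin n → ℝ≥0} (hr : ∀ j, 0 < r j) : ∀ᶠ y in 𝓝 x, ∀ j, ‖(φ y - φ x) j‖ ≤ r j := by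
  rw [eventually_all]
  intro j
  have h : Tendsto (fun y => (φ y - φ x) j) (𝓝 x) (𝓝 0) := by
    have h₁ : Tendsto (fun y => φ y j) (𝓝 x) (𝓝 (φ x j)) :=
      ((continuous_apply j).tendsto _).comp (φ.continuousAt hx)
    simpa using h₁.sub_const (φ x j)
  have h₂ := h.norm
  rw [norm_zero] at h₂
  exact h₂.eventually (ge_mem_nhds (by exact_mod_cast hr j))

theorem isLocAnAt_zero (x : X) : IsLocAnAt L n K (0 : X → V) x := fun _ _ _ =>
  ⟨BHSubspace.bot K V, fun _ => 1, fun _ => one_pos, 0, Eventually.of_forall fun _ => rfl⟩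

theorem IsLocAnAt.smul (c : K) {f : X → V} {x : X} (hf : IsLocAnAt L n K f x) :
    IsLocAnAt L n K (c • f) x := by
  intro φ hφ hx
  obtain ⟨B, r, hr, p, hp⟩ := hf φ hφ hx
  refine ⟨B, r, hr, c • p, ?_⟩
  filter_upwards [hp, eventually_sub_le hx hr] with y h₁ h₂
  rw [p.eval_smul c h₂, map_smul, ← h₁, Pi.smul_apply]

theorem IsLocAnAt.add [IsTopologicalAddGroup V] [ContinuousSMul K V] [T2Space V] {f g : X → V}
    {x : X} (hf : IsLocAnAt L n K f x) (hg : IsLocAnAt L n K g x) :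
    IsLocAnAt L n K (f + g) x := by
  intro φ hφ hx
  obtain ⟨B₁, r₁, hr₁, p₁, hp₁⟩ := hf φ hφ hx
  obtain ⟨B₂, r₂, hr₂, p₂, hp₂⟩ := hg φ hφ hx
  obtain ⟨B, i₁, i₂, h₁, h₂⟩ := B₁.exists_sup B₂
  have hr : ∀ j, 0 < (r₁ ⊓ r₂) j := fun j => lt_min (hr₁ j) (hr₂ j)
  refine ⟨B, r₁ ⊓ r₂, hr,
    (p₁.map i₁).restrict inf_le_left + (p₂.map i₂).restrict inf_le_right, ?_⟩
  filter_upwards [hp₁, hp₂, eventually_sub_le hx hr₁, eventually_sub_le hx hr₂,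
    eventually_sub_le hx hr] with y e₁ e₂ b₁ b₂ b
  rw [PowSer.eval_add _ _ b, PowSer.eval_restrict, PowSer.eval_restrict, PowSer.map_eval _ _ b₁,
    PowSer.map_eval _ _ b₂, map_add, h₁, h₂, Pi.add_apply, e₁, e₂]

theorem isLocAnAt_const [CompleteSpace K] (c : K) (x : X) : IsLocAnAt L n K (fun _ => c) x :=
  fun _ _ _ => ⟨BHSubspace.self K, fun _ => 1, fun _ => one_pos, PowSer.const _ c,
    Eventually.of_forall fun _ => (PowSer.eval_const c _).symm⟩

theorem IsLocAnAt.mul [CompleteSpace K] {f g : X → K} {x : X} (hf : IsLocAnAt L n K f x)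
    (hg : IsLocAnAt L n K g x) : IsLocAnAt L n K (f * g) x := by
  intro φ hφ hx
  obtain ⟨B₁, r₁, hr₁, p₁, hp₁⟩ := hf φ hφ hx
  obtain ⟨B₂, r₂, hr₂, p₂, hp₂⟩ := hg φ hφ hx
  have hr : ∀ j, 0 < (r₁ ⊓ r₂) j := fun j => lt_min (hr₁ j) (hr₂ j)
  refine ⟨BHSubspace.self K, r₁ ⊓ r₂, hr,
    PowSer.mul ((p₁.map B₁.ι).restrict inf_le_left) ((p₂.map B₂.ι).restrict inf_le_right), ?_⟩
  filter_upwards [hp₁, hp₂, eventually_sub_le hx hr₁, eventually_sub_le hx hr₂,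
    eventually_sub_le hx hr] with y e₁ e₂ b₁ b₂ b
  change _ = PowSer.eval (PowSer.mul _ _) _
  rw [PowSer.eval_mul _ _ b, PowSer.eval_restrict, PowSer.eval_restrict, PowSer.map_eval _ _ b₁,
    PowSer.map_eval _ _ b₂, Pi.mul_apply, e₁, e₂]

end

variable (V : Type v) [AddCommGroup V] [Module K V] [TopologicalSpace V]
  [IsTopologicalAddGroup V] [ContinuousSMul K V] [T2Space V]

/-- Extension of a function on an open subset by zero. -/
def extendZero {V : Type v} [Zero V] {U : Opens X} (f : U → V) : X → V :=
  Function.extend (Subtype.val : U → X) f 0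

theorem extendZero_apply {V : Type v} [Zero V] {U : Opens X} (f : U → V) (x : U) :
    extendZero f (x : X) = f x :=
  Subtype.val_injective.extend_apply _ _ _

theorem extendZero_add {U : Opens X} (f g : U → V) :
    extendZero (f + g) = extendZero f + extendZero g := by
  simpa [extendZero] using Function.extend_add (Subtype.val : U → X) f g 0 0

theorem extendZero_smul {U : Opens X} (c : K) (f : U → V) :
    extendZero (c • f) = c • extendZero f := by
  simpa [extendZero] using Function.extend_smul c (Subtype.val : U → X) f 0

/-- The locally analytic functions on `U` as a subspace of all functions. -/
def claSubmodule (U : Opens X) : Submodule K (U → V) where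
  carrier := {f | ∀ x ∈ U, IsLocAnAt L n K (extendZero f) x}
  zero_mem' := fun x _ => by
    have : extendZero (0 : U → V) = (0 : X → V) := Function.extend_zero _
    rw [this]
    exact isLocAnAt_zero x
  add_mem' := fun hf hg x hx => by
    rw [extendZero_add]
    exact (hf x hx).add (hg x hx)
  smul_mem' := fun c f hf x hx => by
    rw [extendZero_smul]
    exact (hf x hx).smul c

/-- The space `C^la(U, V)` of locally analytic functions on the open subset `U` of `X`. -/
def Cla (U : Opens X) : Type _ := claSubmodule L n K V U

variable {L n K V} in
instance {U : Opens X} : CoeFun (Cla L n K V U) (fun _ => U → V) := ⟨fun f => f.1⟩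

instance (U : Opens X) : AddCommGroup (Cla L n K V U) :=
  inferInstanceAs (AddCommGroup (claSubmodule L n K V U))

instance (U : Opens X) : Module K (Cla L n K V U) :=
  inferInstanceAs (Module K (claSubmodule L n K V U))

/-- A `V`-index of the open subset `U`: a disjoint covering of `U` by charts onto polydiscs,
together with a BH-subspace of `V` for each of them. -/
structure VIndex {X : Type w} [TopologicalSpace X] [ChartedSpace (Fin n → L) X] (U : Opens X) where
  I : Type w
  chart : I → OpenPartialHomeomorph X (Fin n → L)
  chart_mem : ∀ i, chart i ∈ charts L n X
  center : I → Fin n → L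
  radius : I → Fin n → ℝ≥0
  radius_pos : ∀ i j, 0 < radius i j
  target_eq : ∀ i, (chart i).target = polyBall (center i) (radius i)
  disjoint : Pairwise fun i j => Disjoint (chart i).source (chart j).source
  cover : ⋃ i, (chart i).source = (U : Set X)
  B : I → BHSubspace K V

variable {L n K V} in
/-- The functions subordinate to a `V`-index, together with the families of power series (elements
of `∏ᵢ C^rig(φᵢ, Eᵢ) ≅ ∏ᵢ 𝒜_{rᵢ}(Lⁿ, Eᵢ)`) which represent them. -/
def VIndex.Subordinate {X : Type w} [TopologicalSpace X] [ChartedSpace (Fin n → L) X]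
    {U : Opens X} (J : VIndex L n K V U) : Type _ :=
  {p : (∀ i, PowSer K (J.radius i) (J.B i).E) × Cla L n K V U //
    ∀ i (x : U), (x : X) ∈ (J.chart i).source →
      p.2 x = (J.B i).ι ((p.1 i).eval (J.chart i x - J.center i))}

variable {L n K V} in
/-- `C^la_J(U, V)` carries the product topology of the Banach spaces `C^rig(φᵢ, Eᵢ)`. -/
instance VIndex.Subordinate.instTopologicalSpace {X : Type w} [TopologicalSpace X]
    [ChartedSpace (Fin n → L) X] {U : Opens X} (J : VIndex L n K V U) :
    TopologicalSpace J.Subordinate :=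
  TopologicalSpace.induced (fun p => p.1.1) Pi.topologicalSpace

/-- `C^la(U, V)` carries the locally convex inductive limit topology of the `C^la_J(U, V)`. -/
instance Cla.instTopologicalSpace (U : Opens X) : TopologicalSpace (Cla L n K V U) :=
  lcFinal K (⨆ J : VIndex L n K V U,
    TopologicalSpace.coinduced (fun p : J.Subordinate => p.1.2) inferInstance)

instance (U : Opens X) : IsTopologicalAddGroup (Cla L n K V U) := lcFinal_isTopologicalAddGroup _

instance (U : Opens X) : ContinuousSMul K (Cla L n K V U) := lcFinal_continuousSMul _

/-- Evaluation at a point, as a continuous linear map. -/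
def Cla.evalAt (hV : IsLocConvex K (inferInstance : TopologicalSpace V)) (U : Opens X) (x : U) :
    Cla L n K V U →L[K] V where
  toFun f := f x
  map_add' _ _ := rfl
  map_smul' _ _ := rfl
  cont := by
    let ev : Cla L n K V U →ₗ[K] V :=
      { toFun := fun f => f x, map_add' := fun _ _ => rfl, map_smul' := fun _ _ => rfl }
    change Continuous ev
    rw [continuous_iff_le_induced]
    refine lcFinal_le (iSup_le fun J => ?_) (hV.induced ev)
    rw [← continuous_iff_coinduced_le, continuous_induced_rng]
    obtain ⟨i, hi⟩ : ∃ i, (x : X) ∈ (J.chart i).source := by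
      have := x.2
      rw [← SetLike.mem_coe, ← J.cover] at this
      exact Set.mem_iUnion.1 this
    have hy : ∀ j, ‖(J.chart i x - J.center i) j‖ ≤ J.radius i j := by
      have := (J.chart i).map_source hi
      rw [J.target_eq] at this
      exact this
    let e : PowSer K (J.radius i) (J.B i).E →ₗ[K] (J.B i).E :=
      { toFun := fun g => g.eval (J.chart i x - J.center i)
        map_add' := fun g h => PowSer.eval_add g h hy
        map_smul' := fun c g => PowSer.eval_smul c g hy }
    have he : Continuous e :=
      AddMonoidHomClass.continuous_of_bound e 1 fun g => by
        rw [one_mul]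
        exact g.norm_eval_le hy
    have : (ev ∘ fun p : J.Subordinate => p.1.2) = fun p => (J.B i).ι (e (p.1.1 i)) := by
      funext p
      exact p.2 i x hi
    rw [this]
    exact (J.B i).ι.continuous.comp (he.comp ((continuous_apply i).comp continuous_induced_dom))

/-- The germs at `x` of locally analytic functions, as a subspace of all germs of functions. -/
def claGermSubmodule (x : X) : Submodule K (Germ (𝓝 x) V) where
  carrier := {F | ∃ f : X → V, (f : Germ (𝓝 x) V) = F ∧ IsLocAnAt L n K f x}
  zero_mem' := ⟨0, rfl, isLocAnAt_zero x⟩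
  add_mem' := by
    rintro _ _ ⟨f, rfl, hf⟩ ⟨g, rfl, hg⟩
    exact ⟨f + g, rfl, hf.add hg⟩
  smul_mem' := by
    rintro c _ ⟨f, rfl, hf⟩
    exact ⟨c • f, rfl, hf.smul c⟩

/-- The space `C^la_x(X, V)` of germs at `x` of locally analytic functions, i.e. the direct limit
of the `C^la(U, V)` over the open neighbourhoods `U` of `x`. -/
def ClaGerm (x : X) : Type _ := claGermSubmodule L n K V x

instance (x : X) : AddCommGroup (ClaGerm L n K V x) :=
  inferInstanceAs (AddCommGroup (claGermSubmodule L n K V x))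

instance (x : X) : Module K (ClaGerm L n K V x) :=
  inferInstanceAs (Module K (claGermSubmodule L n K V x))

variable {L n K V} in
/-- The underlying germ of functions. -/
def ClaGerm.germ {x : X} (F : ClaGerm L n K V x) : Germ (𝓝 x) V := F.1

/-- The canonical map `C^la(U, V) → C^la_x(X, V)` for an open neighbourhood `U` of `x`. -/
def Cla.toGermₗ {U : Opens X} {x : X} (hx : x ∈ U) : Cla L n K V U →ₗ[K] ClaGerm L n K V x where
  toFun f := ⟨(extendZero f : X → V), extendZero f, rfl, f.2 x hx⟩
  map_add' f g := Subtype.ext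
    (congrArg (fun h : X → V => (h : Germ (𝓝 x) V)) (extendZero_add V f.1 g.1))
  map_smul' c f := Subtype.ext
    (congrArg (fun h : X → V => (h : Germ (𝓝 x) V)) (extendZero_smul K V c f.1))

/-- `C^la_x(X, V)` carries the locally convex inductive limit topology of the `C^la(U, V)`. -/
instance ClaGerm.instTopologicalSpace (x : X) : TopologicalSpace (ClaGerm L n K V x) :=
  lcFinal K (⨆ (U : Opens X) (hx : x ∈ U),
    TopologicalSpace.coinduced (Cla.toGermₗ L n K V hx) inferInstance)

instance (x : X) : IsTopologicalAddGroup (ClaGerm L n K V x) := lcFinal_isTopologicalAddGroup _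

instance (x : X) : ContinuousSMul K (ClaGerm L n K V x) := lcFinal_continuousSMul _

/-- The canonical map `C^la(U, V) → C^la_x(X, V)` is continuous. -/
def Cla.toGerm {U : Opens X} {x : X} (hx : x ∈ U) : Cla L n K V U →L[K] ClaGerm L n K V x where
  toLinearMap := Cla.toGermₗ L n K V hx
  cont := continuous_iff_coinduced_le.2
    ((le_iSup₂_of_le U hx le_rfl).trans (le_lcFinal _))

variable [CompleteSpace K]

/-- `C^la_x(X, K)` as a ring, with the pointwise multiplication. -/
def claGermSubring (x : X) : Subring (Germ (𝓝 x) K) where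
  carrier := claGermSubmodule L n K K x
  zero_mem' := (claGermSubmodule L n K K x).zero_mem
  add_mem' := (claGermSubmodule L n K K x).add_mem
  neg_mem' := (claGermSubmodule L n K K x).neg_mem
  one_mem' := ⟨fun _ => 1, rfl, isLocAnAt_const 1 x⟩
  mul_mem' := by
    rintro _ _ ⟨f, rfl, hf⟩ ⟨g, rfl, hg⟩
    exact ⟨f * g, rfl, hf.mul hg⟩

/-- The maximal ideal `𝔪_x` of `C^la_x(X, K)`, the kernel of the evaluation at `x`. -/
def maxIdeal (x : X) : Ideal (claGermSubring L n K x) :=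
  RingHom.ker ((Germ.valueRingHom (x := x) (E := K)).comp (claGermSubring L n K x).subtype)

variable (X) in
/-- The space `D(X) = D(X, K)` of locally analytic distributions: the strong dual of
`C^la(X, K)`. -/
abbrev LaDistribution : Type _ := Cla L n K K (⊤ : Opens X) →L[K] K

/-- The space `D_x(X) = D_x(X, K)`: the strong dual of `C^la_x(X, K)`. -/
abbrev DistributionAt (x : X) : Type _ := ClaGerm L n K K x →L[K] K

/-- The Dirac distribution supported at `x`. -/
def dirac (x : X) : LaDistribution L n K X := Cla.evalAt L n K K isLocConvex_self ⊤ ⟨x, trivial⟩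

/-- The inclusion `D_x(X) → D(X)`, the transpose of `C^la(X, K) → C^la_x(X, K)`. -/
def DistributionAt.incl (x : X) : DistributionAt L n K x →ₗ[K] LaDistribution L n K X where
  toFun μ := μ.comp (Cla.toGerm L n K K (Opens.mem_top x))
  map_add' _ _ := rfl
  map_smul' _ _ := rfl

/-- The distributions `μ ∈ D_x(X)` which vanish on `𝔪_x ^ (k + 1)`. -/
def hyFil (x : X) (k : ℕ) : Submodule K (DistributionAt L n K x) where
  carrier := {μ | ∀ F : ClaGerm L n K K x,
    (⟨F.1, F.2⟩ : claGermSubring L n K x) ∈ maxIdeal L n K x ^ (k + 1) → μ F = 0}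
  zero_mem' := fun _ _ => rfl
  add_mem' := fun hμ hν F hF => by
    rw [add_apply, hμ F hF, hν F hF, add_zero]
  smul_mem' := fun c μ hμ F hF => by
    rw [smul_apply, hμ F hF, smul_zero]

/-- The hyperalgebra: all distributions in `D_x(X)` which vanish on some power of `𝔪_x`
(to be used for `x` the identity element of a Lie group). -/
def hy (x : X) : Submodule K (DistributionAt L n K x) where
  carrier := {μ | ∃ k, μ ∈ hyFil L n K x k}
  zero_mem' := ⟨0, Submodule.zero_mem _⟩
  add_mem' := by
    rintro μ ν ⟨k, hk⟩ ⟨l, hl⟩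
    exact ⟨max k l, Submodule.add_mem _
      (fun F hF => hk F (Ideal.pow_le_pow_right (by gcongr; exact le_max_left _ _) hF))
      (fun F hF => hl F (Ideal.pow_le_pow_right (by gcongr; exact le_max_right _ _) hF))⟩
  smul_mem' := by
    rintro c μ ⟨k, hk⟩
    exact ⟨k, Submodule.smul_mem _ c hk⟩

end LocallyAnalytic

section Tensor

variable (K : Type*) [NontriviallyNormedField K] [IsUltrametricDist K]
  (A : Type*) [AddCommGroup A] [Module K A] [TopologicalSpace A]
  (B : Type*) [AddCommGroup B] [Module K B] [TopologicalSpace B]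

/-- The projective tensor product `A ⊗_{K, π} B` of locally convex spaces: the tensor product with
the finest locally convex topology for which `A × B → A ⊗ B` is continuous. -/
def ProjTensor : Type _ := A ⊗[K] B

instance : AddCommGroup (ProjTensor K A B) := inferInstanceAs (AddCommGroup (A ⊗[K] B))

instance : Module K (ProjTensor K A B) := inferInstanceAs (Module K (A ⊗[K] B))

instance ProjTensor.instTopologicalSpace : TopologicalSpace (ProjTensor K A B) :=
  lcFinal K (TopologicalSpace.coinduced (fun p : A × B => (p.1 ⊗ₜ[K] p.2 : A ⊗[K] B))
    inferInstance)

instance : IsTopologicalAddGroup (ProjTensor K A B) := lcFinal_isTopologicalAddGroup _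

instance : ContinuousSMul K (ProjTensor K A B) := lcFinal_continuousSMul _

instance : UniformSpace (ProjTensor K A B) := IsTopologicalAddGroup.rightUniformSpace _

instance : IsUniformAddGroup (ProjTensor K A B) := isUniformAddGroup_of_addCommGroup

instance : UniformContinuousConstSMul K (ProjTensor K A B) :=
  uniformContinuousConstSMul_of_continuousConstSMul K _

/-- The completed tensor product, i.e. the Hausdorff completion of `A ⊗_{K, π} B`. -/
abbrev CompletedTensor : Type _ := UniformSpace.Completion (ProjTensor K A B)

variable {A B} in
/-- The element `a ⊗ b` of the completed tensor product. -/
def ctmul (a : A) (b : B) : CompletedTensor K A B :=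
  ((show ProjTensor K A B from a ⊗ₜ[K] b) : UniformSpace.Completion (ProjTensor K A B))

end Tensor

section Pairing

variable (L : Type*) [NontriviallyNormedField L] (n : ℕ) (K : Type u) [NontriviallyNormedField K]
  [IsUltrametricDist K] [CompleteSpace K] [NormedAlgebra L K]

/-- A bilinear map is separately continuous if it is continuous in each of its arguments. -/
def SeparatelyContinuous {K : Type*} [Field K] {A B C : Type*} [AddCommGroup A] [Module K A]
    [TopologicalSpace A] [AddCommGroup B] [Module K B] [TopologicalSpace B] [AddCommGroup C]
    [Module K C] [TopologicalSpace C] (P : A →ₗ[K] B →ₗ[K] C) : Prop :=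
  (∀ a, Continuous fun b => P a b) ∧ (∀ b, Continuous fun a => P a b)

variable {X : Type*} [TopologicalSpace X] [ChartedSpace (Fin n → L) X]
  {V : Type v} [AddCommGroup V] [Module K V] [TopologicalSpace V]
  [IsTopologicalAddGroup V] [ContinuousSMul K V] [T2Space V]

variable {K} in
/-- `I : C^la(X, V) → ℒ_b(D(X), V)` is the integration map: it is continuous and linear and
satisfies `I(f)(δ_x) = f(x)`. -/
def IsIntegrationMap (I : Cla L n K V (⊤ : Opens X) →L[K] (LaDistribution L n K X →L[K] V)) : Prop :=
  ∀ (f : Cla L n K V (⊤ : Opens X)) (x : X), I f (dirac L n K x) = f ⟨x, trivial⟩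

variable {K} in
/-- `P` is the pairing `D_x(X) × C^la_x(X, V) → V` induced by the pairing
`D(X) × C^la(X, V) → V`, `(μ, f) ↦ μ(f) = I(f)(μ)`: one has `P(μ, f) = μ(f̃)` for all lifts
`f̃ ∈ C^la(X, V)` of `f`. -/
def IsGermPairing (x : X) (P : DistributionAt L n K x →ₗ[K] ClaGerm L n K V x →ₗ[K] V) : Prop :=
  ∃ I : Cla L n K V (⊤ : Opens X) →L[K] (LaDistribution L n K X →L[K] V),
    IsIntegrationMap L n I ∧
      ∀ (μ : DistributionAt L n K x) (f : Cla L n K V (⊤ : Opens X)),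
        P μ (Cla.toGerm L n K V (Opens.mem_top x) f) = I f (DistributionAt.incl L n K x μ)

variable {K} in
/-- `m` is the convolution product on `D(G)`: it is bilinear, separately continuous and satisfies
`δ_g * δ_h = δ_{gh}`. -/
def IsConvolution {G : Type*} [TopologicalSpace G] [ChartedSpace (Fin n → L) G] [Group G]
    (m : LaDistribution L n K G →ₗ[K] LaDistribution L n K G →ₗ[K] LaDistribution L n K G) : Prop :=
  SeparatelyContinuous m ∧ ∀ g h : G, m (dirac L n K g) (dirac L n K h) = dirac L n K (g * h)

end Pairing

end

end LocAn

open LocAn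

/-!
The spaces of locally analytic functions and of germs are locally convex inductive limits of
products of Banach spaces of power series, so that a linear map on them is continuous as soon as it
is so on power series (`Cla.continuous_of_toCla`, `ClaGerm.continuous_of_rigGerm`). Everything below
is reduced to computations with power series on polydiscs.

**Density.** The Dirac distributions span a dense subspace of `D(X)` (`dense_span_dirac`), which
gives all uniqueness assertions, and the identities in `D(G)`, by checking them on Dirac
distributions. Since `D(X)` carries the topology of uniform convergence on bounded sets, one has to
know bounded sets of functions: around each point, the functions in a bounded set are given by power
series on a common polydisc, with bounded norms (`Cla.exists_ballAt_of_bounded`). Otherwise there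
would be a sequence of functionals which is eventually bounded near zero on each step of the
inductive limit, but unbounded on the bounded set; such a sequence would be a continuous map to the
Banach space of bounded sequences, which is absurd (`exists_bound_of_steps`). On a bounded set, a
distribution is therefore, up to small error, a combination of finitely many Taylor coefficients.
Taylor coefficients are in turn uniform limits of combinations of values: on polynomials of degree
at most `|i|`, the coefficient at `i` is a combination of evaluations, and after scaling by `t → 0`
the terms of higher degree become small (`PowSer.exists_norm_coeff_sub_interpSum_le`). No
derivatives are involved, so this is valid in every characteristic. In the same way `hy(G)` is dense
in `D_e(G)` (`dense_hy`), as it contains the functionals `taylorK` given by the Taylor coefficients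
at `e` (`taylorK_mem_hy`).

**Integration.** A functional `μ` on scalar power series extends to power series over a Banach space
by `∑ vᵢ Xⁱ ↦ ∑ μ(Xⁱ) vᵢ` (`PowSer.pair`). A distribution is non-zero on finitely many members of a
disjoint covering only, and this holds uniformly on bounded sets of distributions
(`VIndex.finite_component_of_bounded`); hence the integral of a function is the finite sum of the
integrals over the polydiscs, and it is continuous as a map to `ℒ_b(D(X), V)`
(`VIndex.continuous_integral`). By construction, the induced pairing on germs is given on power
series by `PowSer.pair` (`germPairing_rigGerm`), which is the description by the completed tensor
product (`germPairing_rigGerm_eq`). Germs are separated by their Taylor coefficients, which are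
values of the pairing at elements of `hy(G)`; distributions are separated by the germs `F(·) v`.
Hence the pairing is non-degenerate, already on `hy(G)` (`nondegenerate_germPairing_domRestrict`).

**Convolution.** The product is `(μ * ν)(f) = μ(g ↦ ν(h ↦ f(gh)))`. For an analytic map
`a : X × X' → Y`, the operator `f ↦ (x ↦ ν(f(a(x, ·))))` is well-defined and continuous:
distributions have compact support (`exists_finset_support`), so that around a point of `X` finitely
many power series in two groups of variables describe `f ∘ a` near the support of `ν`, and `ν` can
be applied to them in one group of variables (`exists_local_fibreIntegral`). The order of integration can be
interchanged (`apply_fibreIntegral`), so that the product is continuous in each of its arguments. If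
`f` vanishes near `a(x, x')`, its integral along the fibres against a distribution supported at `x'`
vanishes near `x`; this shows that `D_e(G)` is a subalgebra (`exists_incl_comp_fibreIntegral`).
Pulling back power series along the multiplication does not lower their order, so that the orders of
point distributions add up (`mem_hyFil_of_incl_eq`), and `hy(G)` is a subalgebra as well.
-/

namespace LocAn

noncomputable section

/-! ### Banach spaces of strictly convergent power series -/

section PowSerBasic

variable {L : Type*} [NontriviallyNormedField L] {K : Type*} [NontriviallyNormedField K]
  [NormedAlgebra L K] {n : ℕ}

theorem weight_pos (r : Fin n → ℝ≥0) [hr : Fact (∀ j, 0 < r j)] (i : Fin n →₀ ℕ) :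
    0 < weight r i :=
  Finset.prod_pos fun j _ => pow_pos (by exact_mod_cast hr.out j) _

theorem weight_zero (r : Fin n → ℝ≥0) : weight r 0 = 1 := by simp [weight]

theorem weight_const (ρ : ℝ≥0) (i : Fin n →₀ ℕ) :
    weight (fun _ : Fin n => ρ) i = (ρ : ℝ) ^ i.degree := by
  rw [weight, Finset.prod_pow_eq_pow_sum, Finsupp.degree_eq_sum]

theorem monom_zero (y : Fin n → L) : monom y 0 = 1 := by simp [monom]

theorem monom_smul (t : L) (y : Fin n → L) (i : Fin n →₀ ℕ) :
    monom (t • y) i = t ^ i.degree * monom y i := by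
  simp only [monom, Pi.smul_apply, smul_eq_mul, mul_pow, Finset.prod_mul_distrib]
  rw [Finset.prod_pow_eq_pow_sum, Finsupp.degree_eq_sum]

theorem tendsto_degree_cofinite : Tendsto (fun i : Fin n →₀ ℕ => i.degree) cofinite atTop := by
  rw [tendsto_atTop]
  intro b
  have h : {i : Fin n →₀ ℕ | ¬ b ≤ i.degree}.Finite :=
    (Finsupp.finite_of_degree_lt b).subset fun i hi => not_le.1 hi
  exact h

namespace PowSer

variable {r s : Fin n → ℝ≥0} {E : Type w} [NormedAddCommGroup E] [NormedSpace K E]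
  {F : Type*} [SeminormedAddCommGroup F] [NormedSpace K F]

/-- The power series with given coefficients. -/
def mk (a : (Fin n →₀ ℕ) → E) (h : Tendsto (fun i => weight r i * ‖a i‖) cofinite (𝓝 0)) :
    PowSer K r E := ⟨a, h⟩

@[ext]
theorem ext {g h : PowSer K r E} (H : ∀ i, g.coeff i = h.coeff i) : g = h :=
  Subtype.ext (funext H)

theorem coeff_add (g h : PowSer K r E) (i : Fin n →₀ ℕ) :
    (g + h).coeff i = g.coeff i + h.coeff i := rfl

theorem coeff_sub (g h : PowSer K r E) (i : Fin n →₀ ℕ) :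
    (g - h).coeff i = g.coeff i - h.coeff i := rfl

theorem coeff_smul (c : K) (g : PowSer K r E) (i : Fin n →₀ ℕ) :
    (c • g).coeff i = c • g.coeff i := rfl

theorem norm_le_of_forall {g : PowSer K r E} {C : ℝ}
    (h : ∀ i, weight r i * ‖g.coeff i‖ ≤ C) : ‖g‖ ≤ C := ciSup_le h

theorem coeff_sum {ι : Type*} (s : Finset ι) (g : ι → PowSer K r E) (i : Fin n →₀ ℕ) :
    (∑ k ∈ s, g k).coeff i = ∑ k ∈ s, (g k).coeff i := by
  let c : PowSer K r E →+ E :=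
    { toFun := fun g => g.coeff i, map_zero' := rfl, map_add' := fun _ _ => rfl }
  exact map_sum c g s

instance [IsUltrametricDist E] : IsUltrametricDist (PowSer K r E) :=
  IsUltrametricDist.isUltrametricDist_of_forall_norm_add_le_max_norm fun g h =>
    norm_le_of_forall fun i => by
      refine (mul_le_mul_of_nonneg_left (IsUltrametricDist.norm_add_le_max _ _)
        (weight_nonneg r i)).trans ?_
      rw [mul_max_of_nonneg _ _ (weight_nonneg r i)]
      exact max_le_max (g.le_norm i) (h.le_norm i)

section Fact

variable [hr : Fact (∀ j, 0 < r j)]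

theorem norm_coeff_le (g : PowSer K r E) (i : Fin n →₀ ℕ) :
    ‖g.coeff i‖ ≤ (weight r i)⁻¹ * ‖g‖ := by
  rw [inv_mul_eq_div, le_div_iff₀' (weight_pos r i)]
  exact g.le_norm i

instance : T0Space (PowSer K r E) := ⟨fun g h hgh => by
  rw [Metric.inseparable_iff, dist_eq_norm] at hgh
  ext i
  have := (g - h).norm_coeff_le i
  rw [hgh, mul_zero] at this
  exact sub_eq_zero.1 (norm_le_zero_iff.1 this)⟩

/-- The coefficient of index `i`, as a continuous linear map. -/
def coeffL (r : Fin n → ℝ≥0) [Fact (∀ j, 0 < r j)] (E : Type w) [NormedAddCommGroup E]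
    [NormedSpace K E] (i : Fin n →₀ ℕ) : PowSer K r E →L[K] E :=
  LinearMap.mkContinuous
    { toFun := fun g => g.coeff i, map_add' := fun _ _ => rfl, map_smul' := fun _ _ => rfl }
    (weight r i)⁻¹ fun g => g.norm_coeff_le i

theorem coeffL_apply (g : PowSer K r E) (i : Fin n →₀ ℕ) : coeffL r E i g = g.coeff i := rfl

instance [CompleteSpace E] : CompleteSpace (PowSer K r E) := by
  refine Metric.complete_of_cauchySeq_tendsto fun u hu => ?_
  have hc : ∀ i, ∃ a, Tendsto (fun k => (u k).coeff i) atTop (𝓝 a) := fun i =>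
    cauchySeq_tendsto_of_complete (hu.map (coeffL (K := K) r E i).uniformContinuous)
  choose a ha using hc
  have key : ∀ ε > 0, ∃ N, ∀ k ≥ N, ∀ i, weight r i * ‖(u k).coeff i - a i‖ ≤ ε := by
    intro ε hε
    obtain ⟨N, hN⟩ := Metric.cauchySeq_iff.1 hu ε hε
    refine ⟨N, fun k hk i => ?_⟩
    have h1 : Tendsto (fun l => weight r i * ‖(u k).coeff i - (u l).coeff i‖) atTop
        (𝓝 (weight r i * ‖(u k).coeff i - a i‖)) :=
      ((tendsto_const_nhds.sub (ha i)).norm).const_mul _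
    refine le_of_tendsto h1 ?_
    filter_upwards [eventually_ge_atTop N] with l hl
    have := hN k hk l hl
    rw [dist_eq_norm] at this
    exact ((u k - u l).le_norm i).trans this.le
  have hstrict : Tendsto (fun i => weight r i * ‖a i‖) cofinite (𝓝 0) := by
    rw [Metric.tendsto_nhds]
    intro ε hε
    obtain ⟨N, hN⟩ := key (ε / 2) (half_pos hε)
    have h2 := (u N).tendsto_coeff.eventually (gt_mem_nhds (half_pos hε))
    filter_upwards [h2] with i hi
    rw [Real.dist_0_eq_abs, abs_of_nonneg (mul_nonneg (weight_nonneg r i) (norm_nonneg _))]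
    have h3 : ‖a i‖ ≤ ‖(u N).coeff i‖ + ‖(u N).coeff i - a i‖ := by
      have := norm_sub_le ((u N).coeff i) ((u N).coeff i - a i)
      rwa [sub_sub_cancel] at this
    calc weight r i * ‖a i‖ ≤ weight r i * (‖(u N).coeff i‖ + ‖(u N).coeff i - a i‖) :=
          mul_le_mul_of_nonneg_left h3 (weight_nonneg r i)
      _ < ε := by rw [mul_add]; linarith [hN N le_rfl i]
  refine ⟨mk a hstrict, ?_⟩
  rw [Metric.tendsto_atTop]
  intro ε hε
  obtain ⟨N, hN⟩ := key (ε / 2) (half_pos hε)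
  refine ⟨N, fun k hk => ?_⟩
  rw [dist_eq_norm]
  exact (norm_le_of_forall (hN k hk)).trans_lt (half_lt_self hε)

end Fact

/-- The power series `v Xⁱ`, as a continuous linear map of `v`. -/
def monomial (r : Fin n → ℝ≥0) (i : Fin n →₀ ℕ) : E →L[K] PowSer K r E :=
  LinearMap.mkContinuous
    { toFun := fun v => mk (fun j => if j = i then v else 0) <| by
        refine tendsto_nhds_of_eventually_eq ?_
        refine (Set.finite_singleton i).subset fun j hj => ?_
        by_contra h
        exact hj (by simp [show j ≠ i from h])
      map_add' := fun v v' => PowSer.ext fun j => by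
        change (if j = i then v + v' else 0) = (if j = i then v else 0) + if j = i then v' else 0
        by_cases h : j = i <;> simp [h]
      map_smul' := fun c v => PowSer.ext fun j => by
        change (if j = i then c • v else 0) = c • if j = i then v else 0
        by_cases h : j = i <;> simp [h] }
    (weight r i) fun v => norm_le_of_forall fun j => by
      change weight r j * ‖if j = i then v else 0‖ ≤ _
      by_cases h : j = i
      · simp [h]
      · simpa [h] using mul_nonneg (weight_nonneg r i) (norm_nonneg v)

theorem coeff_monomial (i j : Fin n →₀ ℕ) (v : E) :
    (monomial (K := K) r i v).coeff j = if j = i then v else 0 := rfl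

theorem norm_monomial_le (i : Fin n →₀ ℕ) (v : E) :
    ‖monomial (K := K) r i v‖ ≤ weight r i * ‖v‖ := norm_le_of_forall fun j => by
  by_cases h : j = i
  · simp [coeff_monomial, h]
  · simpa [coeff_monomial, h] using mul_nonneg (weight_nonneg r i) (norm_nonneg v)

theorem hasSum_monomial (g : PowSer K r E) : HasSum (fun i => monomial r i (g.coeff i)) g := by
  rw [HasSum, SummationFilter.unconditional_filter, tendsto_iff_norm_sub_tendsto_zero,
    Metric.tendsto_nhds]
  intro ε hε
  have h := g.tendsto_coeff.eventually (gt_mem_nhds (half_pos hε))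
  have hf : {i | ¬ weight r i * ‖g.coeff i‖ < ε / 2}.Finite := h
  filter_upwards [eventually_ge_atTop hf.toFinset] with s hs
  rw [Real.dist_0_eq_abs, abs_of_nonneg (norm_nonneg _)]
  refine lt_of_le_of_lt (norm_le_of_forall fun i => ?_) (half_lt_self hε)
  rw [coeff_sub, coeff_sum]
  simp only [coeff_monomial, Finset.sum_ite_eq]
  by_cases hi : i ∈ s
  · simpa [hi] using (half_pos hε).le
  · have : weight r i * ‖g.coeff i‖ < ε / 2 := by
      by_contra hcon
      exact hi (hs (hf.mem_toFinset.2 hcon))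
    simpa [hi] using this.le

/-- Continuous linear maps on a space of power series are determined by their values on the series
with a single term. -/
theorem ext_monomial {W : Type*} [AddCommGroup W] [Module K W] [TopologicalSpace W] [T2Space W]
    {S T : PowSer K r E →L[K] W} (h : ∀ i v, S (monomial r i v) = T (monomial r i v)) : S = T := by
  ext g
  have h1 := g.hasSum_monomial.mapL S
  have h2 := g.hasSum_monomial.mapL T
  simp only [h] at h1
  exact h1.unique h2

section Lift

variable [IsUltrametricDist F] [CompleteSpace F] [T0Space F]

theorem summable_lift (T : (Fin n →₀ ℕ) → E →L[K] F) {C : ℝ}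
    (hT : ∀ i v, ‖T i v‖ ≤ C * (weight r i * ‖v‖)) (g : PowSer K r E) :
    Summable fun i => T i (g.coeff i) := by
  refine NonarchimedeanAddGroup.summable_of_tendsto_cofinite_zero ?_
  have := g.tendsto_coeff.const_mul C
  rw [mul_zero] at this
  exact squeeze_zero_norm (fun i => hT i _) this

/-- The continuous linear map on power series which sends `v Xⁱ` to `Tᵢ v`. -/
def lift (T : (Fin n →₀ ℕ) → E →L[K] F) (C : ℝ) (hC : 0 ≤ C)
    (hT : ∀ i v, ‖T i v‖ ≤ C * (weight r i * ‖v‖)) : PowSer K r E →L[K] F :=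
  LinearMap.mkContinuous
    { toFun := fun g => ∑' i, T i (g.coeff i)
      map_add' := fun g h => by
        rw [← (summable_lift T hT g).tsum_add (summable_lift T hT h)]
        exact tsum_congr fun i => by rw [coeff_add, map_add]
      map_smul' := fun c g => by
        rw [RingHom.id_apply, ← (summable_lift T hT g).tsum_const_smul]
        exact tsum_congr fun i => by rw [coeff_smul, map_smul] }
    C fun g => IsUltrametricDist.norm_tsum_le_of_forall_le_of_nonneg
      (mul_nonneg hC (norm_nonneg _)) fun i =>
        (hT i _).trans (mul_le_mul_of_nonneg_left (g.le_norm i) hC)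

variable (T : (Fin n →₀ ℕ) → E →L[K] F) (C : ℝ) (hC : 0 ≤ C)
    (hT : ∀ i v, ‖T i v‖ ≤ C * (weight r i * ‖v‖))

theorem hasSum_lift (g : PowSer K r E) : HasSum (fun i => T i (g.coeff i)) (lift T C hC hT g) :=
  (summable_lift T hT g).hasSum

theorem lift_monomial (i : Fin n →₀ ℕ) (v : E) : lift T C hC hT (monomial r i v) = T i v := by
  refine (hasSum_lift T C hC hT _).unique ?_
  have h := hasSum_single (f := fun j => T j ((monomial (K := K) r i v).coeff j)) i
    fun j hj => by simp [coeff_monomial, hj]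
  simpa [coeff_monomial] using h

theorem norm_lift_le {g : PowSer K r E} {ε : ℝ} (hε : 0 ≤ ε) (h : ∀ i, ‖T i (g.coeff i)‖ ≤ ε) :
    ‖lift T C hC hT g‖ ≤ ε :=
  IsUltrametricDist.norm_tsum_le_of_forall_le_of_nonneg hε h

end Lift

section Maps

variable {F : Type*} [NormedAddCommGroup F] [NormedSpace K F]

/-- Applying a continuous linear map to all coefficients is continuous and linear. -/
def mapL (r : Fin n → ℝ≥0) (T : E →L[K] F) : PowSer K r E →L[K] PowSer K r F :=
  LinearMap.mkContinuous
    { toFun := fun g => g.map T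
      map_add' := fun g h => PowSer.ext fun i => map_add T (g.coeff i) (h.coeff i)
      map_smul' := fun c g => PowSer.ext fun i => map_smul T c (g.coeff i) }
    ‖T‖ fun g => norm_le_of_forall fun i => by
      change weight r i * ‖T (g.coeff i)‖ ≤ _
      calc weight r i * ‖T (g.coeff i)‖ ≤ weight r i * (‖T‖ * ‖g.coeff i‖) :=
            mul_le_mul_of_nonneg_left (T.le_opNorm _) (weight_nonneg r i)
        _ = ‖T‖ * (weight r i * ‖g.coeff i‖) := by ring
        _ ≤ _ := mul_le_mul_of_nonneg_left (g.le_norm i) (norm_nonneg T)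

theorem map_monomial (T : E →L[K] F) (i : Fin n →₀ ℕ) (v : E) :
    (monomial (K := K) r i v).map T = monomial r i (T v) := PowSer.ext fun j => by
  change T ((monomial (K := K) r i v).coeff j) = _
  by_cases h : j = i <;> simp [coeff_monomial, h]

/-- Coefficients bounded by `C r⁻ⁱ` define a power series on every smaller polydisc. -/
theorem exists_of_bounded {ρ σ : ℝ≥0} (hρ : 0 < ρ) (hρσ : ρ < σ) (a : (Fin n →₀ ℕ) → E) {C : ℝ}
    (h : ∀ i, (σ : ℝ) ^ i.degree * ‖a i‖ ≤ C) :
    ∃ g : PowSer K (fun _ : Fin n => ρ) E, g.coeff = a ∧ ‖g‖ ≤ C := by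
  have hσ : (0 : ℝ) < σ := by exact_mod_cast hρ.trans hρσ
  have hC : 0 ≤ C := le_trans (mul_nonneg (pow_nonneg hσ.le _) (norm_nonneg _)) (h 0)
  have hle : ∀ i, weight (fun _ : Fin n => ρ) i * ‖a i‖ ≤ (ρ / σ : ℝ) ^ i.degree * C := by
    intro i
    rw [weight_const, div_pow, div_mul_eq_mul_div, le_div_iff₀ (pow_pos hσ _), mul_assoc,
      mul_comm ‖a i‖]
    exact mul_le_mul_of_nonneg_left (h i) (by positivity)
  have hq : (ρ / σ : ℝ) < 1 := (div_lt_one hσ).2 (by exact_mod_cast hρσ)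
  have hlim : Tendsto (fun i : Fin n →₀ ℕ => (ρ / σ : ℝ) ^ i.degree * C) cofinite (𝓝 0) := by
    have := ((tendsto_pow_atTop_nhds_zero_of_lt_one (by positivity) hq).comp
      (tendsto_degree_cofinite (n := n))).mul_const C
    rwa [zero_mul] at this
  refine ⟨⟨a, squeeze_zero (fun i => mul_nonneg (weight_nonneg _ i) (norm_nonneg _)) hle hlim⟩,
    rfl, norm_le_of_forall fun i => (hle i).trans ?_⟩
  exact mul_le_of_le_one_left hC (pow_le_one₀ (by positivity) hq.le)

variable [IsUltrametricDist E] [CompleteSpace E]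

/-- Evaluation at a point of the polydisc, as a continuous linear map. -/
def evalL (E : Type w) [NormedAddCommGroup E] [NormedSpace K E] [IsUltrametricDist E]
    [CompleteSpace E] (y : Fin n → L) (hy : ∀ j, ‖y j‖ ≤ r j) : PowSer K r E →L[K] E :=
  LinearMap.mkContinuous
    { toFun := fun g => g.eval y
      map_add' := fun g h => eval_add g h hy
      map_smul' := fun c g => eval_smul c g hy }
    1 fun g => by
      rw [one_mul]
      exact g.norm_eval_le hy

theorem evalL_apply {y : Fin n → L} (hy : ∀ j, ‖y j‖ ≤ r j) (g : PowSer K r E) :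
    evalL E y hy g = g.eval y := rfl

theorem eval_monomial (i : Fin n →₀ ℕ) (v : E) (y : Fin n → L) :
    (monomial (K := K) r i v).eval y = algebraMap L K (monom y i) • v := by
  rw [eval, tsum_eq_single i]
  · simp [coeff_monomial]
  · intro j hj
    simp [coeff_monomial, hj]

theorem eval_zero_eq (g : PowSer K r E) : g.eval (0 : Fin n → L) = g.coeff 0 := by
  rw [eval, tsum_eq_single 0]
  · simp [monom_zero]
  · intro j hj
    have : ∃ k, j k ≠ 0 := by
      by_contra h
      push Not at h
      exact hj (Finsupp.ext h)
    obtain ⟨k, hk⟩ := this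
    have : monom (0 : Fin n → L) j = 0 := Finset.prod_eq_zero (Finset.mem_univ k) (by simp [hk])
    simp [this]

end Maps

section Pair

variable [IsUltrametricDist K] [CompleteSpace K] [IsUltrametricDist E] [CompleteSpace E]

theorem norm_apply_monomial_le (μ : PowSer K r K →L[K] K) (i : Fin n →₀ ℕ) :
    ‖μ (monomial r i 1)‖ ≤ ‖μ‖ * weight r i := by
  refine (μ.le_opNorm _).trans (mul_le_mul_of_nonneg_left ?_ (norm_nonneg _))
  simpa using norm_monomial_le (K := K) (r := r) i (1 : K)

theorem apply_monomial (μ : PowSer K r K →L[K] K) (i : Fin n →₀ ℕ) (c : K) :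
    μ (monomial r i c) = c * μ (monomial r i 1) := by
  rw [← smul_eq_mul c, ← map_smul, ← map_smul, smul_eq_mul, mul_one]

/-- The extension of a functional `μ` on scalar power series to vector-valued ones,
`∑ vᵢ Xⁱ ↦ ∑ μ(Xⁱ) vᵢ`. -/
def pair (E : Type w) [NormedAddCommGroup E] [NormedSpace K E] [IsUltrametricDist E]
    [CompleteSpace E] (μ : PowSer K r K →L[K] K) : PowSer K r E →L[K] E :=
  lift (fun i => μ (monomial r i 1) • ContinuousLinearMap.id K E) ‖μ‖ (norm_nonneg _) fun i v => by
    change ‖μ (monomial r i 1) • v‖ ≤ _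
    rw [norm_smul, ← mul_assoc]
    exact mul_le_mul_of_nonneg_right (norm_apply_monomial_le μ i) (norm_nonneg v)

theorem pair_monomial (μ : PowSer K r K →L[K] K) (i : Fin n →₀ ℕ) (v : E) :
    pair E μ (monomial r i v) = μ (monomial r i 1) • v := lift_monomial _ _ _ _ _ _

theorem norm_pair_le (μ : PowSer K r K →L[K] K) {g : PowSer K r E} {ε : ℝ} (hε : 0 ≤ ε)
    (h : ∀ i, ‖μ (monomial r i 1)‖ * ‖g.coeff i‖ ≤ ε) : ‖pair E μ g‖ ≤ ε :=
  norm_lift_le _ _ _ _ hε fun i => (norm_smul_le _ _).trans (h i)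

theorem norm_pair_le_mul (μ : PowSer K r K →L[K] K) (g : PowSer K r E) :
    ‖pair E μ g‖ ≤ ‖μ‖ * ‖g‖ :=
  norm_pair_le μ (mul_nonneg (norm_nonneg _) (norm_nonneg _)) fun i => by
    calc _ ≤ ‖μ‖ * weight r i * ‖g.coeff i‖ :=
          mul_le_mul_of_nonneg_right (norm_apply_monomial_le μ i) (norm_nonneg _)
      _ = ‖μ‖ * (weight r i * ‖g.coeff i‖) := by ring
      _ ≤ _ := mul_le_mul_of_nonneg_left (g.le_norm i) (norm_nonneg _)

theorem pair_self (μ : PowSer K r K →L[K] K) : pair K μ = μ :=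
  ext_monomial fun i v => by rw [pair_monomial, apply_monomial μ i v, smul_eq_mul, mul_comm]

theorem pair_add (μ ν : PowSer K r K →L[K] K) : pair E (μ + ν) = pair E μ + pair E ν :=
  ext_monomial fun i v => by
    rw [add_apply, pair_monomial, pair_monomial, pair_monomial, add_apply, add_smul]

theorem pair_smul (c : K) (μ : PowSer K r K →L[K] K) : pair E (c • μ) = c • pair E μ :=
  ext_monomial fun i v => by
    rw [smul_apply, pair_monomial, pair_monomial, smul_apply, smul_assoc]

theorem pair_evalL {y : Fin n → L} (hy : ∀ j, ‖y j‖ ≤ r j) :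
    pair E (evalL K y hy) = evalL E y hy :=
  ext_monomial fun i v => by
    rw [pair_monomial, evalL_apply, evalL_apply, eval_monomial, eval_monomial, smul_eq_mul, mul_one]

end Pair

end PowSer

end PowSerBasic

/-! ### Power series in two groups of variables -/

section Slice

variable {L : Type*} [NontriviallyNormedField L] {K : Type*} [NontriviallyNormedField K]
  [NormedAlgebra L K] {m n : ℕ}

/-- The part of a multi-index belonging to the first group of variables. -/
def leftIndex (i : Fin (m + n) →₀ ℕ) : Fin m →₀ ℕ :=
  Finsupp.equivFunOnFinite.symm fun j => i (Fin.castAdd n j)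

/-- The part of a multi-index belonging to the second group of variables. -/
def rightIndex (i : Fin (m + n) →₀ ℕ) : Fin n →₀ ℕ :=
  Finsupp.equivFunOnFinite.symm fun j => i (Fin.natAdd m j)

theorem weight_append (r : Fin m → ℝ≥0) (s : Fin n → ℝ≥0) (i : Fin (m + n) →₀ ℕ) :
    weight (Fin.append r s) i = weight r (leftIndex i) * weight s (rightIndex i) := by
  simp [weight, Fin.prod_univ_add, leftIndex, rightIndex]

theorem monom_append (x : Fin m → L) (y : Fin n → L) (i : Fin (m + n) →₀ ℕ) :
    monom (Fin.append x y) i = monom x (leftIndex i) * monom y (rightIndex i) := by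
  simp [monom, Fin.prod_univ_add, leftIndex, rightIndex]

theorem degree_leftIndex_add (i : Fin (m + n) →₀ ℕ) :
    (leftIndex i).degree + (rightIndex i).degree = i.degree := by
  simp [Finsupp.degree_eq_sum, Fin.sum_univ_add, leftIndex, rightIndex]

theorem append_le {x : Fin m → L} {y : Fin n → L} {r : Fin m → ℝ≥0} {s : Fin n → ℝ≥0}
    (hx : ∀ j, ‖x j‖ ≤ r j) (hy : ∀ j, ‖y j‖ ≤ s j) (j : Fin (m + n)) :
    ‖Fin.append x y j‖ ≤ Fin.append r s j := by
  induction j using Fin.addCases with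
  | left j => simpa using hx j
  | right j => simpa using hy j

namespace PowSer

variable {r : Fin m → ℝ≥0} {s : Fin n → ℝ≥0} [Fact (∀ j, 0 < r j)] [Fact (∀ j, 0 < s j)]
  [IsUltrametricDist K] [CompleteSpace K]

/-- Applying a functional in the second group of variables. -/
def sliceLeft (r : Fin m → ℝ≥0) [Fact (∀ j, 0 < r j)] (ν : PowSer K s K →L[K] K) :
    PowSer K (Fin.append r s) K →L[K] PowSer K r K :=
  lift (fun i => ν (monomial s (rightIndex i) 1) • monomial r (leftIndex i)) ‖ν‖ (norm_nonneg _)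
    fun i v => by
      change ‖ν (monomial s (rightIndex i) 1) • monomial r (leftIndex i) v‖ ≤ _
      rw [norm_smul, weight_append, mul_comm (weight r _), mul_assoc, ← mul_assoc ‖ν‖]
      exact mul_le_mul (norm_apply_monomial_le ν _) (norm_monomial_le _ _) (norm_nonneg _)
        (mul_nonneg (norm_nonneg _) (weight_nonneg _ _))

/-- Applying a functional in the first group of variables. -/
def sliceRight (s : Fin n → ℝ≥0) [Fact (∀ j, 0 < s j)] (μ : PowSer K r K →L[K] K) :
    PowSer K (Fin.append r s) K →L[K] PowSer K s K :=
  lift (fun i => μ (monomial r (leftIndex i) 1) • monomial s (rightIndex i)) ‖μ‖ (norm_nonneg _)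
    fun i v => by
      change ‖μ (monomial r (leftIndex i) 1) • monomial s (rightIndex i) v‖ ≤ _
      rw [norm_smul, weight_append, mul_assoc, ← mul_assoc ‖μ‖]
      exact mul_le_mul (norm_apply_monomial_le μ _) (norm_monomial_le _ _) (norm_nonneg _)
        (mul_nonneg (norm_nonneg _) (weight_nonneg _ _))

theorem sliceLeft_monomial (ν : PowSer K s K →L[K] K) (i : Fin (m + n) →₀ ℕ) (c : K) :
    sliceLeft r ν (monomial _ i c) =
      ν (monomial s (rightIndex i) 1) • monomial r (leftIndex i) c := lift_monomial _ _ _ _ _ _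

theorem sliceRight_monomial (μ : PowSer K r K →L[K] K) (i : Fin (m + n) →₀ ℕ) (c : K) :
    sliceRight s μ (monomial _ i c) =
      μ (monomial r (leftIndex i) 1) • monomial s (rightIndex i) c := lift_monomial _ _ _ _ _ _

/-- Fubini's theorem for functionals on two groups of variables. -/
theorem apply_sliceLeft (μ : PowSer K r K →L[K] K) (ν : PowSer K s K →L[K] K)
    (g : PowSer K (Fin.append r s) K) : μ (sliceLeft r ν g) = ν (sliceRight s μ g) := by
  have : μ.comp (sliceLeft r ν) = ν.comp (sliceRight s μ) := ext_monomial fun i v => by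
    rw [ContinuousLinearMap.comp_apply, ContinuousLinearMap.comp_apply, sliceLeft_monomial,
      sliceRight_monomial, map_smul, map_smul, apply_monomial μ _ v, apply_monomial ν _ v,
      smul_eq_mul, smul_eq_mul]
    ring
  exact DFunLike.congr_fun this g

theorem eval_sliceRight_eval {x : Fin m → L} {y : Fin n → L} (hx : ∀ j, ‖x j‖ ≤ r j)
    (hy : ∀ j, ‖y j‖ ≤ s j) (g : PowSer K (Fin.append r s) K) :
    (sliceRight s (evalL K x hx) g).eval y = g.eval (Fin.append x y) := by
  have : (evalL K y hy).comp (sliceRight s (evalL K x hx)) =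
      evalL K (Fin.append x y) (append_le hx hy) := ext_monomial fun i v => by
    rw [ContinuousLinearMap.comp_apply, sliceRight_monomial, map_smul, evalL_apply, evalL_apply,
      evalL_apply, eval_monomial, eval_monomial, eval_monomial, monom_append, map_mul]
    simp only [smul_eq_mul]
    ring
  exact DFunLike.congr_fun this g

theorem eval_sliceLeft_eval {x : Fin m → L} {y : Fin n → L} (hx : ∀ j, ‖x j‖ ≤ r j)
    (hy : ∀ j, ‖y j‖ ≤ s j) (g : PowSer K (Fin.append r s) K) :
    (sliceLeft r (evalL K y hy) g).eval x = g.eval (Fin.append x y) := by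
  rw [← eval_sliceRight_eval hx hy, ← evalL_apply hx, ← evalL_apply hy, apply_sliceLeft]

theorem coeff_lift_eq_zero {E F : Type*} [NormedAddCommGroup E] [NormedSpace K E]
    [NormedAddCommGroup F] [NormedSpace K F] [IsUltrametricDist F] [CompleteSpace F]
    (T : (Fin m →₀ ℕ) → E →L[K] PowSer K s F) (C : ℝ) (hC : 0 ≤ C) {r : Fin m → ℝ≥0}
    (hT : ∀ i v, ‖T i v‖ ≤ C * (weight r i * ‖v‖)) {g : PowSer K r E} {i : Fin n →₀ ℕ}
    (h : ∀ j, (T j (g.coeff j)).coeff i = 0) : (lift T C hC hT g).coeff i = 0 := by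
  have h1 := (hasSum_lift T C hC hT g).mapL (coeffL s F i)
  simp only [coeffL_apply, h] at h1
  exact h1.unique hasSum_zero

/-- If `ν` kills all monomials of degree `> l` and `g` has only terms of degree `> k + l`, then the
terms of degree `≤ k` vanish after applying `ν` in the second group of variables. -/
theorem coeff_sliceLeft_eq_zero {ν : PowSer K s K →L[K] K} {k l : ℕ}
    (hν : ∀ i, l < i.degree → ν (monomial s i 1) = 0) {g : PowSer K (Fin.append r s) K}
    (hg : ∀ i, i.degree < k + l + 1 → g.coeff i = 0) {i : Fin m →₀ ℕ} (hi : i.degree < k + 1) :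
    (sliceLeft r ν g).coeff i = 0 := by
  refine coeff_lift_eq_zero _ _ _ _ fun j => ?_
  change (ν (monomial s (rightIndex j) 1) • monomial r (leftIndex j) (g.coeff j)).coeff i = 0
  rw [coeff_smul, coeff_monomial]
  split_ifs with hij
  · by_cases hl : l < (rightIndex j).degree
    · rw [hν _ hl, zero_smul]
    · rw [hg j, smul_zero]
      rw [← degree_leftIndex_add, ← hij]
      omega
  · rw [smul_zero]

end PowSer

end Slice

/-! ### Composition of power series -/

section Comp

variable {L : Type*} [NontriviallyNormedField L] {K : Type*} [NontriviallyNormedField K]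
  [NormedAlgebra L K] [IsUltrametricDist K] [CompleteSpace K] {m n : ℕ}

namespace PowSer

variable {r : Fin m → ℝ≥0} {s : Fin n → ℝ≥0}
  {E : Type w} [NormedAddCommGroup E] [NormedSpace K E]

theorem norm_mul_le (g h : PowSer K s K) : ‖g.mul h‖ ≤ ‖g‖ * ‖h‖ :=
  norm_le_of_forall fun i => by
    obtain ⟨p, hp, hpn⟩ := IsUltrametricDist.exists_norm_finsetSum_le_of_nonempty
      (t := Finset.HasAntidiagonal.antidiagonal i)
      ⟨(0, i), Finset.HasAntidiagonal.mem_antidiagonal.2 (zero_add i)⟩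
      (fun p => g.coeff p.1 * h.coeff p.2)
    rw [Finset.HasAntidiagonal.mem_antidiagonal] at hp
    calc weight s i * ‖(g.mul h).coeff i‖ ≤ weight s i * ‖g.coeff p.1 * h.coeff p.2‖ :=
          mul_le_mul_of_nonneg_left hpn (weight_nonneg s i)
      _ = (weight s p.1 * ‖g.coeff p.1‖) * (weight s p.2 * ‖h.coeff p.2‖) := by
          rw [← hp, weight_add, norm_mul]; ring
      _ ≤ _ := mul_le_mul (g.le_norm _) (h.le_norm _)
          (mul_nonneg (weight_nonneg _ _) (norm_nonneg _)) (norm_nonneg _)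

theorem coeff_mul_eq_zero {g h : PowSer K s K} {a b : ℕ}
    (hg : ∀ i, i.degree < a → g.coeff i = 0) (hh : ∀ i, i.degree < b → h.coeff i = 0)
    {i : Fin n →₀ ℕ} (hi : i.degree < a + b) : (g.mul h).coeff i = 0 := by
  refine Finset.sum_eq_zero fun p hp => ?_
  rw [Finset.HasAntidiagonal.mem_antidiagonal] at hp
  have : p.1.degree + p.2.degree = i.degree := by rw [← hp, map_add]
  by_cases h1 : p.1.degree < a
  · rw [hg _ h1, zero_mul]
  · rw [hh p.2 (by omega), mul_zero]

/-- The monomial `η₁ ^ i₁ ⋯ ηₘ ^ iₘ` in power series `ηⱼ`, with its norm, its values, and its order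
in the case that the `ηⱼ` have no constant term. -/
theorem exists_prod_pow (η : Fin m → PowSer K s K) (hη : ∀ j, ‖η j‖ ≤ r j) (i : Fin m →₀ ℕ) :
    ∃ h : PowSer K s K, ‖h‖ ≤ weight r i ∧
      (∀ y : Fin n → L, (∀ j, ‖y j‖ ≤ s j) → h.eval y = ∏ j, (η j).eval y ^ i j) ∧
      ((∀ j, (η j).coeff 0 = 0) → ∀ k, k.degree < i.degree → h.coeff k = 0) := by
  -- `P C v d`: some series has norm at most `C`, values `v`, and order at least `d` if the `ηⱼ`
  -- have no constant term; a product of series multiplies `C` and `v` and adds `d`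
  let P : ℝ → ((Fin n → L) → K) → ℕ → Prop := fun C v d => ∃ h : PowSer K s K, ‖h‖ ≤ C ∧
      (∀ y : Fin n → L, (∀ j, ‖y j‖ ≤ s j) → h.eval y = v y) ∧
      ((∀ j, (η j).coeff 0 = 0) → ∀ k, k.degree < d → h.coeff k = 0)
  have h1 : P 1 1 0 := by
    refine ⟨PowSer.const s 1, norm_le_of_forall fun i => ?_,
      fun y _ => PowSer.eval_const 1 y, fun _ k hk => absurd hk (Nat.not_lt_zero _)⟩
    change weight s i * ‖if i = 0 then (1 : K) else 0‖ ≤ 1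
    split_ifs with h
    · simp [h, weight_zero]
    · simp
  have hmul : ∀ {C C' v v' d d'}, 0 ≤ C → P C v d → P C' v' d' → P (C * C') (v * v') (d + d') := by
    rintro C C' v v' d d' hC ⟨g, hg1, hg2, hg3⟩ ⟨h, hh1, hh2, hh3⟩
    refine ⟨g.mul h, (norm_mul_le g h).trans (mul_le_mul hg1 hh1 (norm_nonneg _) hC),
      fun y hy => ?_, fun H k hk => coeff_mul_eq_zero (hg3 H) (hh3 H) hk⟩
    rw [PowSer.eval_mul g h hy, hg2 y hy, hh2 y hy, Pi.mul_apply]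
  have hη1 : ∀ j, P (r j) (fun y => (η j).eval y) 1 := fun j =>
    ⟨η j, hη j, fun _ _ => rfl, fun H k hk => by
      rw [(Finsupp.degree_eq_zero_iff k).1 (Nat.lt_one_iff.1 hk)]
      exact H j⟩
  have hpow : ∀ j k, P ((r j : ℝ) ^ k) ((fun y => (η j).eval y) ^ k) k := by
    intro j k
    induction k with
    | zero => simpa using h1
    | succ k ih =>
      rw [pow_succ, pow_succ]
      exact hmul (pow_nonneg (NNReal.coe_nonneg _) _) ih (hη1 j)
  have hprod : ∀ t : Finset (Fin m), P (∏ j ∈ t, (r j : ℝ) ^ i j)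
      (∏ j ∈ t, (fun y => (η j).eval y) ^ i j) (∑ j ∈ t, i j) := by
    intro t
    induction t using Finset.induction_on with
    | empty => simpa using h1
    | insert a t ha ih =>
      rw [Finset.prod_insert ha, Finset.prod_insert ha, Finset.sum_insert ha]
      exact hmul (pow_nonneg (NNReal.coe_nonneg _) _) (hpow _ _) ih
  obtain ⟨h, ha, hb, hc⟩ := hprod Finset.univ
  refine ⟨h, ha, fun y hy => ?_, fun H k hk => hc H k ?_⟩
  · rw [hb y hy, Finset.prod_apply]
    rfl
  · rwa [← Finsupp.degree_eq_sum]

/-- The power series `h v` with coefficients `hᵢ v`, for a scalar power series `h`. -/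
def smulSeries (h : PowSer K s K) : E →L[K] PowSer K s E :=
  LinearMap.mkContinuous
    { toFun := fun v => h.map (ContinuousLinearMap.toSpanSingleton K v)
      map_add' := fun v w => PowSer.ext fun i => smul_add (h.coeff i) v w
      map_smul' := fun c v => PowSer.ext fun i => smul_comm (h.coeff i) c v }
    ‖h‖ fun v => norm_le_of_forall fun i => by
      change weight s i * ‖h.coeff i • v‖ ≤ _
      rw [norm_smul, ← mul_assoc]
      exact mul_le_mul_of_nonneg_right (h.le_norm i) (norm_nonneg v)

theorem coeff_smulSeries (h : PowSer K s K) (v : E) (i : Fin n →₀ ℕ) :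
    (smulSeries h v).coeff i = h.coeff i • v := rfl

theorem norm_smulSeries_le (h : PowSer K s K) (v : E) : ‖smulSeries h v‖ ≤ ‖h‖ * ‖v‖ :=
  LinearMap.mkContinuous_norm_le _ (norm_nonneg h) _ |> fun H =>
    ((smulSeries h).le_opNorm v).trans (mul_le_mul_of_nonneg_right H (norm_nonneg v))

variable [IsUltrametricDist E] [CompleteSpace E]

theorem eval_smulSeries (h : PowSer K s K) (v : E) {y : Fin n → L} (hy : ∀ j, ‖y j‖ ≤ s j) :
    (smulSeries h v).eval y = h.eval y • v :=
  PowSer.map_eval (ContinuousLinearMap.toSpanSingleton K v) h hy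

variable [Fact (∀ j, 0 < s j)]

/-- Every power series can be substituted by power series `η₁, …, ηₘ` with `‖ηⱼ‖ ≤ rⱼ`. The
third property says that substituting series without constant term does not lower the order. -/
theorem exists_comp (E : Type w) [NormedAddCommGroup E] [NormedSpace K E] [IsUltrametricDist E]
    [CompleteSpace E] (η : Fin m → PowSer K s K) (hη : ∀ j, ‖η j‖ ≤ r j) :
    ∃ Θ : PowSer K r E →L[K] PowSer K s E,
      (∀ (y : Fin n → L) (z : Fin m → L), (∀ j, ‖y j‖ ≤ s j) → (∀ j, ‖z j‖ ≤ r j) →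
        (∀ j, (η j).eval y = algebraMap L K (z j)) → ∀ g, (Θ g).eval y = g.eval z) ∧
      ((∀ j, (η j).coeff 0 = 0) → ∀ (k : ℕ) (g : PowSer K r E),
        (∀ i, i.degree < k → g.coeff i = 0) → ∀ i, i.degree < k → (Θ g).coeff i = 0) := by
  choose h hnorm heval hcoeff using exists_prod_pow (L := L) η hη
  have hT : ∀ i (v : E), ‖smulSeries (h i) v‖ ≤ 1 * (weight r i * ‖v‖) := fun i v => by
    rw [one_mul]
    exact (norm_smulSeries_le _ _).trans (mul_le_mul_of_nonneg_right (hnorm i) (norm_nonneg v))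
  refine ⟨lift (fun i => smulSeries (h i)) 1 zero_le_one hT, fun y z hy hz hyz g => ?_,
    fun H k g hg i hi => ?_⟩
  · have h1 := (hasSum_lift _ 1 zero_le_one hT g).mapL (evalL E y hy)
    simp only [evalL_apply, eval_smulSeries _ _ hy] at h1
    refine h1.unique ?_
    have h2 := (g.summable hz).hasSum
    refine h2.congr_fun fun i => ?_
    rw [heval i y hy, monom, map_prod]
    congr 1
    exact Finset.prod_congr rfl fun j _ => by rw [hyz, map_pow]
  · refine coeff_lift_eq_zero _ _ _ _ fun j => ?_
    rw [coeff_smulSeries]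
    by_cases hj : j.degree < k
    · rw [hg j hj, smul_zero]
    · rw [hcoeff j H i (by omega), zero_smul]

end PowSer

end Comp

/-! ### Recovering coefficients from values -/

section Interp

variable (L : Type*) [NontriviallyNormedField L] {K : Type*} [NontriviallyNormedField K]
  [NormedAlgebra L K] {n : ℕ}

/-- The functionals `P ↦ P(y)` on polynomials of bounded degree span the dual space: the functional
"coefficient at `i`" on the polynomials of degree `≤ |i|` is a combination of evaluations. -/
theorem exists_interp (i : Fin n →₀ ℕ) : ∃ c : (Fin n → L) →₀ L, ∀ k : Fin n →₀ ℕ,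
    k.degree ≤ i.degree → (c.sum fun y a => a * monom y k) = if k = i then 1 else 0 := by
  classical
  let S : Finset (Fin n →₀ ℕ) := (Finsupp.finite_of_degree_le (σ := Fin n) i.degree).toFinset
  have hS : ∀ k, k ∈ S ↔ k.degree ≤ i.degree := fun k => by simp [S]
  let w : (Fin n → L) → (S → L) := fun y k => monom y k.1
  have hspan : Submodule.span L (Set.range w) = ⊤ := by
    by_contra hne
    obtain ⟨f, hf0, hf⟩ := Submodule.exists_dual_map_eq_bot_of_lt_top (lt_top_iff_ne_top.2 hne)
      inferInstance
    refine hf0 ?_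
    have hfw : ∀ y, f (w y) = 0 := fun y => by
      have : f (w y) ∈ Submodule.map f (Submodule.span L (Set.range w)) :=
        Submodule.mem_map_of_mem (Submodule.subset_span ⟨y, rfl⟩)
      rwa [hf, Submodule.mem_bot] at this
    -- a functional killing all evaluations gives a polynomial that vanishes identically, and the
    -- field `L` is infinite
    let p : MvPolynomial (Fin n) L :=
      ∑ k : S, MvPolynomial.monomial k.1 (f (Pi.single k 1))
    have hp : p = 0 := MvPolynomial.funext fun y => by
      rw [map_zero, ← hfw y, map_sum, LinearMap.pi_apply_eq_sum_univ f (w y)]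
      refine Finset.sum_congr rfl fun k _ => ?_
      rw [MvPolynomial.eval_monomial, smul_eq_mul, mul_comm, Finsupp.prod_fintype _ _ (by simp)]
      congr 2
      ext l
      simp [Pi.single_apply, eq_comm]
    refine LinearMap.pi_ext' fun k => LinearMap.ext_ring ?_
    have hk := congrArg (MvPolynomial.coeff k.1) hp
    rw [MvPolynomial.coeff_sum] at hk
    simp only [MvPolynomial.coeff_monomial, MvPolynomial.coeff_zero, Subtype.coe_inj,
      Finset.sum_ite_eq', Finset.mem_univ, if_true] at hk
    simpa using hk
  have hi : (Pi.single (⟨i, (hS i).2 le_rfl⟩ : S) 1 : S → L) ∈ Submodule.span L (Set.range w) := by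
    rw [hspan]; trivial
  obtain ⟨c, hc⟩ := (Finsupp.mem_span_range_iff_exists_finsupp).1 hi
  refine ⟨c, fun k hk => ?_⟩
  have := congrFun hc ⟨k, (hS k).2 hk⟩
  rw [Finsupp.sum, Finset.sum_apply] at this
  simp only [Pi.smul_apply, smul_eq_mul, Pi.single_apply, Subtype.mk.injEq] at this
  exact this

/-- The coefficients of a combination of evaluations which agrees with "coefficient at `i`" on
polynomials of degree `≤ |i|`. -/
def interp (i : Fin n →₀ ℕ) : (Fin n → L) →₀ L := (exists_interp L i).choose

variable {L}

theorem sum_interp {i k : Fin n →₀ ℕ} (h : k.degree ≤ i.degree) :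
    ((interp L i).sum fun y a => a * monom y k) = if k = i then 1 else 0 :=
  (exists_interp L i).choose_spec k h

/-- The combination of values of `F` at the points `t y`, for `y` an interpolation point, which
approximates the coefficient at `i` of `F` for `t → 0`. -/
def interpSum {V : Type*} [AddCommGroup V] [Module K V] (i : Fin n →₀ ℕ) (t : L)
    (F : (Fin n → L) → V) : V :=
  ∑ y ∈ (interp L i).support, algebraMap L K (t⁻¹ ^ i.degree * interp L i y) • F (t • y)

namespace PowSer

variable {E : Type w} [NormedAddCommGroup E] [NormedSpace K E]
  {F : Type*} [SeminormedAddCommGroup F] [NormedSpace K F] [IsUltrametricDist F]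

theorem norm_le_of_monomial {r : Fin n → ℝ≥0} {T : PowSer K r E →L[K] F} {D : ℝ} (hD : 0 ≤ D)
    (h : ∀ i v, ‖T (monomial r i v)‖ ≤ D * (weight r i * ‖v‖)) (g : PowSer K r E) :
    ‖T g‖ ≤ D * ‖g‖ := by
  have h1 := (g.hasSum_monomial.mapL T).norm
  have h2 : ∀ s : Finset (Fin n →₀ ℕ), ‖∑ i ∈ s, T (monomial r i (g.coeff i))‖ ≤ D * ‖g‖ := fun s =>
    IsUltrametricDist.norm_sum_le_of_forall_le_of_nonneg (mul_nonneg hD (norm_nonneg _))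
      fun i _ => (h i _).trans (mul_le_mul_of_nonneg_left (g.le_norm i) hD)
  exact le_of_tendsto h1 (Eventually.of_forall h2)

variable [IsUltrametricDist K] [IsUltrametricDist E] [CompleteSpace E] (E)

/-- The coefficients of a power series are limits of combinations of its values; the estimate is
uniform on bounded sets of power series. -/
theorem exists_norm_coeff_sub_interpSum_le (r : Fin n → ℝ≥0) [hr : Fact (∀ j, 0 < r j)]
    (i : Fin n →₀ ℕ) : ∃ t₀ > 0, ∃ C ≥ 0,
      (∀ t : L, ‖t‖ ≤ t₀ → ∀ y ∈ (interp L i).support, ∀ j, ‖(t • y) j‖ ≤ r j) ∧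
      ∀ t : L, t ≠ 0 → ‖t‖ ≤ t₀ → ∀ g : PowSer K r E,
        ‖g.coeff i - interpSum (K := K) i t g.eval‖ ≤ ‖t‖ * C * ‖g‖ := by
  obtain ⟨t₁, ht₁, hmem⟩ : ∃ t₁ : L, t₁ ≠ 0 ∧
      ∀ y ∈ (interp L i).support, ∀ j, ‖(t₁ • y) j‖ ≤ r j := by
    have h1 : ∀ᶠ t in 𝓝 (0 : L), ∀ y ∈ (interp L i).support, ∀ j, ‖(t • y) j‖ ≤ r j := by
      rw [Finset.eventually_all]
      intro y _
      rw [eventually_all]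
      intro j
      have : Tendsto (fun t : L => ‖(t • y) j‖) (𝓝 0) (𝓝 ‖((0 : L) • y) j‖) := by
        refine Continuous.tendsto ?_ 0
        simp only [Pi.smul_apply, smul_eq_mul]
        fun_prop
      refine this.eventually (ge_mem_nhds ?_)
      simpa using hr.out j
    obtain ⟨t, ht, ht0⟩ :=
      ((h1.filter_mono (nhdsWithin_le_nhds (s := {0}ᶜ))).and self_mem_nhdsWithin).exists
    exact ⟨t, ht0, ht⟩
  have ht₁' : 0 < ‖t₁‖ := norm_pos_iff.2 ht₁
  have hmem' : ∀ t : L, ‖t‖ ≤ ‖t₁‖ → ∀ y ∈ (interp L i).support, ∀ j, ‖(t • y) j‖ ≤ r j := by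
    intro t ht y hy j
    refine le_trans ?_ (hmem y hy j)
    simp only [Pi.smul_apply, smul_eq_mul, norm_mul]
    exact mul_le_mul_of_nonneg_right ht (norm_nonneg _)
  let A : ℝ := ∑ y ∈ (interp L i).support, ‖interp L i y‖
  have hA : 0 ≤ A := Finset.sum_nonneg fun _ _ => norm_nonneg _
  refine ⟨‖t₁‖, ht₁', A * ‖t₁‖⁻¹ ^ (i.degree + 1), by positivity, hmem', fun t ht htle g => ?_⟩
  let Λ : PowSer K r E →L[K] E := ∑ y ∈ (interp L i).support.attach,
    algebraMap L K (t⁻¹ ^ i.degree * interp L i y) • evalL E (t • y.1) (hmem' t htle y.1 y.2)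
  have hΛ : ∀ g : PowSer K r E, Λ g = interpSum (K := K) i t g.eval := fun g => by
    rw [interpSum, ← Finset.sum_attach]
    simp only [Λ, sum_apply, smul_apply, evalL_apply]
  rw [← hΛ, ← coeffL_apply, ← sub_apply]
  refine norm_le_of_monomial (by positivity) (fun k v => ?_) g
  rw [sub_apply, hΛ, coeffL_apply, coeff_monomial, interpSum]
  have h2 : (∑ y ∈ (interp L i).support, algebraMap L K (t⁻¹ ^ i.degree * interp L i y) •
      (monomial (K := K) r k v).eval (t • y)) = algebraMap L K (t⁻¹ ^ i.degree * t ^ k.degree *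
        ∑ y ∈ (interp L i).support, interp L i y * monom y k) • v := by
    rw [Finset.mul_sum, map_sum, Finset.sum_smul]
    refine Finset.sum_congr rfl fun y _ => ?_
    rw [eval_monomial, smul_smul, ← map_mul, monom_smul]
    congr 2
    ring
  rw [h2]
  -- the combination reproduces the terms of degree `≤ |i|`, and a term of higher degree contributes
  -- at least one factor `t`
  rcases le_or_gt k.degree i.degree with hk | hk
  · have h3 := sum_interp (L := L) hk
    rw [Finsupp.sum] at h3
    rw [h3]
    have h4 : (if i = k then v else 0) - algebraMap L K (t⁻¹ ^ i.degree * t ^ k.degree *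
        if k = i then 1 else 0) • v = 0 := by
      by_cases hik : i = k
      · subst hik
        rw [← mul_pow, inv_mul_cancel₀ ht]
        simp
      · simp [hik, Ne.symm hik]
    rw [h4, norm_zero]
    have := weight_nonneg r k
    positivity
  · have hik : i ≠ k := fun h => by subst h; exact lt_irrefl _ hk
    rw [if_neg hik, zero_sub, norm_neg, norm_smul, norm_algebraMap', norm_mul, norm_mul, norm_pow,
      norm_pow, norm_inv]
    have h5 : ‖∑ y ∈ (interp L i).support, interp L i y * monom y k‖ ≤
        A * (‖t₁‖⁻¹ ^ k.degree * weight r k) := by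
      refine (norm_sum_le _ _).trans ?_
      rw [Finset.sum_mul]
      refine Finset.sum_le_sum fun y hy => ?_
      rw [norm_mul]
      refine mul_le_mul_of_nonneg_left ?_ (norm_nonneg _)
      have := norm_monom_le (hmem y hy) k
      rw [monom_smul, norm_mul, norm_pow] at this
      rw [inv_pow, inv_mul_eq_div, le_div_iff₀' (pow_pos ht₁' _)]
      exact this
    obtain ⟨d, hd⟩ := Nat.exists_eq_add_of_lt hk
    have ht' : 0 < ‖t‖ := norm_pos_iff.2 ht
    have h6 : ‖t‖⁻¹ ^ i.degree * ‖t‖ ^ k.degree = ‖t‖ ^ (d + 1) := by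
      rw [hd, add_assoc, pow_add, ← mul_assoc, ← mul_pow, inv_mul_cancel₀ ht'.ne', one_pow, one_mul]
    have h7 : ‖t‖ ^ (d + 1) * ‖t₁‖⁻¹ ^ k.degree ≤ ‖t‖ * ‖t₁‖⁻¹ ^ (i.degree + 1) := by
      have : ‖t‖ ^ (d + 1) * ‖t₁‖⁻¹ ^ k.degree =
          (‖t‖ * ‖t₁‖⁻¹) ^ d * (‖t‖ * ‖t₁‖⁻¹ ^ (i.degree + 1)) := by
        rw [hd]; ring
      rw [this]
      refine mul_le_of_le_one_left (by positivity) (pow_le_one₀ (by positivity) ?_)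
      rw [← div_eq_mul_inv]
      exact (div_le_one ht₁').2 htle
    rw [h6]
    calc ‖t‖ ^ (d + 1) * ‖∑ y ∈ (interp L i).support, interp L i y * monom y k‖ * ‖v‖
        ≤ ‖t‖ ^ (d + 1) * (A * (‖t₁‖⁻¹ ^ k.degree * weight r k)) * ‖v‖ := by gcongr
      _ = (‖t‖ ^ (d + 1) * ‖t₁‖⁻¹ ^ k.degree) * (A * (weight r k * ‖v‖)) := by ring
      _ ≤ (‖t‖ * ‖t₁‖⁻¹ ^ (i.degree + 1)) * (A * (weight r k * ‖v‖)) := by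
          have := weight_nonneg r k
          gcongr
      _ = _ := by ring

variable {E}

theorem tendsto_interpSum {r : Fin n → ℝ≥0} [Fact (∀ j, 0 < r j)] (i : Fin n →₀ ℕ)
    (g : PowSer K r E) :
    Tendsto (fun t : L => interpSum (K := K) i t g.eval) (𝓝[≠] 0) (𝓝 (g.coeff i)) := by
  obtain ⟨t₀, ht₀, C, hC, -, h⟩ := exists_norm_coeff_sub_interpSum_le (L := L) (K := K) E r i
  rw [tendsto_iff_norm_sub_tendsto_zero]
  have h1 : Tendsto (fun t : L => ‖t‖ * C * ‖g‖) (𝓝[≠] 0) (𝓝 0) := by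
    have : Tendsto (fun t : L => ‖t‖ * C * ‖g‖) (𝓝 0) (𝓝 (‖(0 : L)‖ * C * ‖g‖)) :=
      Continuous.tendsto (by fun_prop) 0
    rw [norm_zero, zero_mul, zero_mul] at this
    exact this.mono_left nhdsWithin_le_nhds
  refine squeeze_zero' (Eventually.of_forall fun _ => norm_nonneg _) ?_ h1
  have h2 : ∀ᶠ t in 𝓝[≠] (0 : L), ‖t‖ ≤ t₀ := by
    refine Filter.Eventually.filter_mono nhdsWithin_le_nhds ?_
    have := Metric.closedBall_mem_nhds (0 : L) ht₀
    filter_upwards [this] with t ht using by simpa using ht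
  filter_upwards [h2, self_mem_nhdsWithin] with t ht ht0
  rw [norm_sub_rev]
  exact h t ht0 ht g

end PowSer

end Interp

/-! ### Analytic functions as power series in several variables -/

section Analytic

variable {L : Type*} [NontriviallyNormedField L] [IsUltrametricDist L]
  {K : Type*} [NontriviallyNormedField K] [IsUltrametricDist K] [CompleteSpace K]
  [NormedAlgebra L K] {n : ℕ}

/-- The number of occurrences of each variable in a list of variables. -/
def countIndex {k : ℕ} (σ : Fin k → Fin n) : Fin n →₀ ℕ := ∑ l, Finsupp.single (σ l) 1

theorem degree_countIndex {k : ℕ} (σ : Fin k → Fin n) : (countIndex σ).degree = k := by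
  simp [countIndex, map_sum]

theorem monom_countIndex {k : ℕ} (σ : Fin k → Fin n) (y : Fin n → L) :
    monom y (countIndex σ) = ∏ l, y (σ l) := by
  have h : ∀ t : Finset (Fin k), monom y (∑ l ∈ t, Finsupp.single (σ l) 1) = ∏ l ∈ t, y (σ l) := by
    intro t
    induction t using Finset.induction_on with
    | empty => simp [monom_zero]
    | insert a t ha ih =>
      rw [Finset.sum_insert ha, Finset.prod_insert ha, monom_add, ih]
      congr 1
      rw [monom, Finset.prod_eq_single (σ a)]
      · simp
      · intro b _ hb
        simp [Ne.symm hb]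
      · simp
  exact h _

/-- An analytic function of `n` variables is given by a convergent power series in monomials. -/
theorem exists_powSer_of_analyticAt {f : (Fin n → L) → L} {x : Fin n → L}
    (hf : AnalyticAt L f x) : ∃ ρ : ℝ≥0, 0 < ρ ∧ ∃ g : PowSer K (fun _ : Fin n => ρ) K,
      ∀ y : Fin n → L, (∀ j, ‖y j‖ ≤ ρ) → g.eval y = algebraMap L K (f (x + y)) := by
  classical
  obtain ⟨p, R, hp⟩ := hf
  obtain ⟨σ, hσ0, hσR⟩ := ENNReal.lt_iff_exists_nnreal_btwn.1 hp.r_pos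
  have hσ0' : 0 < σ := by exact_mod_cast hσ0
  obtain ⟨ρ, hρ0, hρσ⟩ := exists_between hσ0'
  obtain ⟨C, hC, hpC⟩ := p.norm_mul_pow_le_of_lt_radius (hσR.trans_le hp.r_le)
  let e : Fin n → (Fin n → L) := fun j => Pi.single j 1
  let c : ℕ → (Fin n →₀ ℕ) → L := fun k i =>
    ∑ τ : Fin k → Fin n with countIndex τ = i, p k fun l => e (τ l)
  have he : ∀ j, ‖e j‖ ≤ 1 := fun j => by simp [e, Pi.norm_single]
  have hc : ∀ k i, ‖c k i‖ ≤ ‖p k‖ := fun k i =>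
    IsUltrametricDist.norm_sum_le_of_forall_le_of_nonneg (norm_nonneg _) fun τ _ => by
      refine ((p k).le_opNorm _).trans (mul_le_of_le_one_right (norm_nonneg _) ?_)
      exact Finset.prod_le_one (fun _ _ => norm_nonneg _) fun l _ => he _
  obtain ⟨g, hg, -⟩ := PowSer.exists_of_bounded (K := K) hρ0 hρσ
    (fun i => algebraMap L K (c i.degree i)) (C := C) fun i => by
      rw [norm_algebraMap', mul_comm]
      exact (mul_le_mul_of_nonneg_right (hc _ _) (by positivity)).trans (hpC i.degree)
  refine ⟨ρ, hρ0, g, fun y hy => ?_⟩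
  -- the homogeneous part of degree `k`, expanded in monomials
  have hhom : ∀ k, (p k fun _ => y) =
      ∑ i ∈ (Finsupp.finite_of_degree_eq (σ := Fin n) k).toFinset, monom y i * c k i := by
    intro k
    have hy' : y = ∑ j, y j • e j := by
      ext l
      simp [e, Finset.sum_apply, Pi.single_apply]
    have h1 : (p k fun _ => y) = ∑ τ : Fin k → Fin n,
        monom y (countIndex τ) * p k fun l => e (τ l) := by
      conv_lhs => rw [hy']
      rw [ContinuousMultilinearMap.map_sum]
      refine Finset.sum_congr rfl fun τ _ => ?_
      rw [ContinuousMultilinearMap.map_smul_univ, monom_countIndex, smul_eq_mul]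
    rw [h1, ← Finset.sum_fiberwise_of_maps_to (t :=
      (Finsupp.finite_of_degree_eq (σ := Fin n) k).toFinset) (g := countIndex)
      fun τ _ => by simp [degree_countIndex]]
    refine Finset.sum_congr rfl fun i _ => ?_
    rw [Finset.mul_sum]
    refine Finset.sum_congr rfl fun τ hτ => ?_
    rw [(Finset.mem_filter.1 hτ).2]
  have hsum := (g.summable (y := y) hy).hasSum
  rw [← (Equiv.sigmaFiberEquiv fun i : Fin n →₀ ℕ => i.degree).hasSum_iff] at hsum
  have hfib := hsum.sigma (g := fun k => algebraMap L K (p k fun _ => y)) fun k => by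
    have : Fintype {i : Fin n →₀ ℕ // i.degree = k} :=
      (Finsupp.finite_of_degree_eq (σ := Fin n) k).fintype
    refine (congrArg (HasSum _) ?_).mp (hasSum_fintype _)
    rw [hhom, map_sum, Finset.sum_subtype (p := fun i : Fin n →₀ ℕ => i.degree = k) _
      (by simp)]
    refine Finset.sum_congr rfl fun i _ => ?_
    have : g.coeff i.1 = algebraMap L K (c k i.1) := by
      simp only [hg, i.2]
    change algebraMap L K (monom y i.1) • g.coeff i.1 = _
    rw [this, map_mul, smul_eq_mul]
  have hyR : y ∈ Metric.eball (0 : Fin n → L) R := by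
    refine Metric.eball_subset_eball hσR.le ?_
    rw [Metric.mem_eball, edist_zero_right]
    refine lt_of_le_of_lt ?_ (ENNReal.coe_lt_coe.2 hρσ)
    rw [enorm_eq_nnnorm, ENNReal.coe_le_coe]
    exact (pi_norm_le_iff_of_nonneg ρ.2).2 hy
  have h3 := (hp.hasSum hyR).map (algebraMap L K) (algebraMapCLM L K).continuous
  exact hfib.unique h3

end Analytic

/-! ### Charts onto polydiscs -/

section Substitution

variable {L : Type*} [NontriviallyNormedField L] [IsUltrametricDist L]
  {K : Type*} [NontriviallyNormedField K] [IsUltrametricDist K] [CompleteSpace K]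
  [NormedAlgebra L K] {m n : ℕ}

/-- Power series on a polydisc can be pulled back along analytic maps, on all sufficiently small
polydiscs in the source. If the base point is mapped to the centre, the order does not drop. -/
theorem exists_substitution (E : Type w) [NormedAddCommGroup E] [NormedSpace K E]
    [IsUltrametricDist E] [CompleteSpace E] {F : (Fin n → L) → (Fin m → L)} {x : Fin n → L}
    (hF : AnalyticAt L F x) {a : Fin m → L} {r : Fin m → ℝ≥0} (hr : ∀ j, 0 < r j)
    (hx : F x ∈ polyBall a r) : ∃ ρ₀ : ℝ≥0, 0 < ρ₀ ∧ ∀ s : Fin n → ℝ≥0, (∀ j, 0 < s j) →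
      (∀ j, s j ≤ ρ₀) → ∃ Θ : PowSer K r E →L[K] PowSer K s E,
        (∀ y : Fin n → L, (∀ j, ‖y j‖ ≤ s j) → F (x + y) ∈ polyBall a r ∧
          ∀ g, (Θ g).eval y = g.eval (F (x + y) - a)) ∧
        (F x = a → ∀ (k : ℕ) (g : PowSer K r E),
          (∀ i, i.degree < k → g.coeff i = 0) → ∀ i, i.degree < k → (Θ g).coeff i = 0) := by
  have hFj : ∀ j, AnalyticAt L (fun y => F y j) x := fun j =>
    (ContinuousLinearMap.proj (R := L) (φ := fun _ : Fin m => L) j).analyticAt _ |>.comp hF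
  choose ρ hρ g hg using fun j => exists_powSer_of_analyticAt (K := K) (hFj j)
  have hδ : ∀ j, ∃ δ : ℝ≥0, 0 < δ ∧ δ ≤ ρ j ∧ (δ / ρ j : ℝ) * ‖g j‖ ≤ r j := by
    intro j
    have h1 : Tendsto (fun δ : ℝ≥0 => ((δ : ℝ) / ρ j) * ‖g j‖) (𝓝 0)
        (𝓝 (((0 : ℝ≥0) : ℝ) / ρ j * ‖g j‖)) :=
      Continuous.tendsto (by fun_prop) 0
    rw [NNReal.coe_zero, zero_div, zero_mul] at h1
    have h2 := (h1.eventually (ge_mem_nhds (show (0 : ℝ) < r j by exact_mod_cast hr j))).and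
      (ge_mem_nhds (hρ j))
    obtain ⟨δ, ⟨h3, h4⟩, h5⟩ := ((h2.filter_mono (nhdsWithin_le_nhds (s := Set.Ioi 0))).and
      self_mem_nhdsWithin).exists
    exact ⟨δ, h5, h4, h3⟩
  choose δ hδ0 hδρ hδr using hδ
  obtain ⟨ρ₀, hρ₀, hρ₀δ⟩ : ∃ ρ₀ : ℝ≥0, 0 < ρ₀ ∧ ∀ j, ρ₀ ≤ δ j := by
    have : ∀ᶠ ρ₀ in 𝓝[>] (0 : ℝ≥0), ∀ j, ρ₀ ≤ δ j := by
      rw [eventually_all]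
      exact fun j => (ge_mem_nhds (hδ0 j)).filter_mono nhdsWithin_le_nhds
    obtain ⟨ρ₀, h1, h2⟩ := (this.and self_mem_nhdsWithin).exists
    exact ⟨ρ₀, h2, h1⟩
  refine ⟨ρ₀, hρ₀, fun s hs hsρ => ?_⟩
  have : Fact (∀ j, 0 < s j) := ⟨hs⟩
  have hsle : ∀ j, s ≤ fun _ => ρ j := fun j l => ((hsρ l).trans (hρ₀δ j)).trans (hδρ j)
  let η : Fin m → PowSer K s K := fun j =>
    (g j).restrict (hsle j) - PowSer.const s (algebraMap L K (a j))
  have heval : ∀ (y : Fin n → L), (∀ j, ‖y j‖ ≤ s j) → ∀ j,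
      (η j).eval y = algebraMap L K ((F (x + y) - a) j) := by
    intro y hy j
    have hsub : (η j).eval y = ((g j).restrict (hsle j)).eval y -
        (PowSer.const s (algebraMap L K (a j))).eval y := map_sub (PowSer.evalL K y hy) _ _
    rw [hsub, PowSer.eval_const, PowSer.eval_restrict, hg j y fun l => (hy l).trans (hsle j l),
      Pi.sub_apply, map_sub]
  have hcoeff0 : ∀ j, (η j).coeff 0 = algebraMap L K ((F x - a) j) := by
    intro j
    rw [← PowSer.eval_zero_eq (L := L), heval 0 (by simp) j, add_zero]
  have hnorm : ∀ j, ‖η j‖ ≤ r j := by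
    intro j
    refine PowSer.norm_le_of_forall fun i => ?_
    by_cases hi : i = 0
    · rw [hi, weight_zero, one_mul, hcoeff0, norm_algebraMap']
      exact hx j
    · have h1 : (η j).coeff i = (g j).coeff i := by
        change (g j).coeff i - (if i = 0 then _ else 0) = _
        rw [if_neg hi, sub_zero]
      have hρj : (0 : ℝ) < ρ j := by exact_mod_cast hρ j
      have hδj : (0 : ℝ) ≤ δ j / ρ j := by positivity
      have h2 : weight s i ≤ (δ j / ρ j : ℝ) ^ i.degree * weight (fun _ : Fin n => ρ j) i := by
        rw [weight_const, ← mul_pow, div_mul_cancel₀ _ hρj.ne', ← weight_const]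
        exact weight_mono (fun l => (hsρ l).trans (hρ₀δ j)) i
      have h3 : (δ j / ρ j : ℝ) ^ i.degree ≤ δ j / ρ j := by
        refine pow_le_of_le_one hδj ((div_le_one hρj).2 (by exact_mod_cast hδρ j)) ?_
        rwa [Ne, Finsupp.degree_eq_zero_iff]
      rw [h1]
      calc weight s i * ‖(g j).coeff i‖
          ≤ (δ j / ρ j : ℝ) ^ i.degree * weight (fun _ : Fin n => ρ j) i * ‖(g j).coeff i‖ :=
            mul_le_mul_of_nonneg_right h2 (norm_nonneg _)
        _ = (δ j / ρ j : ℝ) ^ i.degree * (weight (fun _ : Fin n => ρ j) i * ‖(g j).coeff i‖) := by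
            ring
        _ ≤ (δ j / ρ j) * ‖g j‖ := mul_le_mul h3 ((g j).le_norm i)
            (mul_nonneg (weight_nonneg _ _) (norm_nonneg _)) hδj
        _ ≤ r j := hδr j
  obtain ⟨Θ, hΘ, hΘ'⟩ := PowSer.exists_comp (L := L) E η hnorm
  have hball : ∀ y : Fin n → L, (∀ j, ‖y j‖ ≤ s j) → F (x + y) ∈ polyBall a r := fun y hy j => by
    have := ((η j).norm_eval_le hy).trans (hnorm j)
    rwa [heval y hy, norm_algebraMap'] at this
  refine ⟨Θ, fun y hy => ⟨hball y hy, hΘ y _ hy (hball y hy) (heval y hy)⟩,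
    fun h => hΘ' fun j => ?_⟩
  rw [hcoeff0, h, sub_self]
  exact map_zero _

end Substitution

section PolyChart

variable (L : Type*) [NontriviallyNormedField L] (n : ℕ)

/-- A chart of `X` onto a closed polydisc. -/
structure PolyChart (X : Type*) [TopologicalSpace X] [ChartedSpace (Fin n → L) X] where
  chart : OpenPartialHomeomorph X (Fin n → L)
  mem : chart ∈ charts L n X
  center : Fin n → L
  radius : Fin n → ℝ≥0
  radius_pos : ∀ j, 0 < radius j
  target_eq : chart.target = polyBall center radius

variable {L n} {X : Type*} [TopologicalSpace X] [ChartedSpace (Fin n → L) X]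

instance (D : PolyChart L n X) : Fact (∀ j, 0 < D.radius j) := ⟨D.radius_pos⟩

theorem mem_polyBall_self (a : Fin n → L) (r : Fin n → ℝ≥0) : a ∈ polyBall a r := fun j => by simp

theorem polyBall_eq_pi (a : Fin n → L) (r : Fin n → ℝ≥0) :
    polyBall a r = Set.pi Set.univ fun j => Metric.closedBall (a j) (r j) := by
  ext y
  simp [polyBall, dist_eq_norm]

theorem polyBall_const (a : Fin n → L) (ρ : ℝ≥0) :
    polyBall a (fun _ => ρ) = Metric.closedBall a ρ := by
  ext y
  rw [mem_closedBall_iff_norm, pi_norm_le_iff_of_nonneg (NNReal.coe_nonneg ρ)]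
  rfl

theorem isOpen_polyBall [IsUltrametricDist L] (a : Fin n → L) {r : Fin n → ℝ≥0}
    (hr : ∀ j, 0 < r j) : IsOpen (polyBall a r) := by
  rw [polyBall_eq_pi]
  exact isOpen_set_pi Set.finite_univ fun j _ =>
    IsUltrametricDist.isOpen_closedBall _ (by exact_mod_cast (hr j).ne')

theorem isCompact_polyBall [LocallyCompactSpace L] (a : Fin n → L) (r : Fin n → ℝ≥0) :
    IsCompact (polyBall a r) := by
  have : ProperSpace L := ProperSpace.of_locallyCompactSpace L
  rw [polyBall_eq_pi]
  exact isCompact_univ_pi fun j => isCompact_closedBall _ _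

namespace PolyChart

/-- The domain of a chart onto a polydisc. -/
def source (D : PolyChart L n X) : Set X := D.chart.source

/-- The coordinates of a point with respect to the centre of the polydisc. -/
def coord (D : PolyChart L n X) (x : X) : Fin n → L := D.chart x - D.center

theorem isOpen_source (D : PolyChart L n X) : IsOpen D.source := D.chart.open_source

theorem coord_le (D : PolyChart L n X) {x : X} (hx : x ∈ D.source) (j : Fin n) :
    ‖D.coord x j‖ ≤ D.radius j := by
  have := D.chart.map_source hx
  rw [D.target_eq] at this
  exact this j

theorem exists_coord_eq (D : PolyChart L n X) {y : Fin n → L} (hy : ∀ j, ‖y j‖ ≤ D.radius j) :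
    ∃ x ∈ D.source, D.coord x = y := by
  have h : D.center + y ∈ D.chart.target := by
    rw [D.target_eq]
    intro j
    simpa using hy j
  exact ⟨D.chart.symm (D.center + y), D.chart.map_target h, by
    rw [coord, D.chart.right_inv h, add_sub_cancel_left]⟩

theorem isCompact_source [LocallyCompactSpace L] (D : PolyChart L n X) : IsCompact D.source := by
  have h := (isCompact_polyBall D.center D.radius)
  rw [← D.target_eq] at h
  rw [source, ← D.chart.symm_image_target_eq_source]
  exact h.image_of_continuousOn D.chart.continuousOn_symm

variable [IsUltrametricDist L]

/-- The restriction of a chart to the preimage of a polydisc with all radii equal. -/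
abbrev ball (φ : OpenPartialHomeomorph X (Fin n → L)) (hφ : φ ∈ charts L n X) (a : Fin n → L)
    (ρ : ℝ≥0) (hρ : 0 < ρ) (hsub : polyBall a (fun _ => ρ) ⊆ φ.target) : PolyChart L n X where
  chart := φ.restr (φ.source ∩ φ ⁻¹' polyBall a fun _ => ρ)
  mem := restr_mem_maximalAtlas _ hφ
    (φ.isOpen_inter_preimage (isOpen_polyBall a fun _ => hρ))
  center := a
  radius := fun _ => ρ
  radius_pos := fun _ => hρ
  target_eq := by
    have ho := φ.isOpen_inter_preimage (isOpen_polyBall a fun _ : Fin n => hρ)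
    rw [OpenPartialHomeomorph.restr_toPartialEquiv' _ _ ho, PartialEquiv.restr_target]
    ext y
    constructor
    · rintro ⟨h1, -, h2⟩
      exact Eq.mp (congrArg (· ∈ polyBall a fun _ => ρ) (φ.right_inv h1)) h2
    · intro hy
      exact ⟨hsub hy, φ.map_target (hsub hy),
        Eq.mpr (congrArg (· ∈ polyBall a fun _ => ρ) (φ.right_inv (hsub hy))) hy⟩

variable {φ : OpenPartialHomeomorph X (Fin n → L)} {hφ : φ ∈ charts L n X} {a : Fin n → L}
  {ρ : ℝ≥0} {hρ : 0 < ρ} {hsub : polyBall a (fun _ => ρ) ⊆ φ.target}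

theorem source_ball :
    (ball φ hφ a ρ hρ hsub).source = φ.source ∩ φ ⁻¹' polyBall a fun _ => ρ := by
  have ho := φ.isOpen_inter_preimage (isOpen_polyBall a fun _ : Fin n => hρ)
  change (φ.restr (φ.source ∩ φ ⁻¹' polyBall a fun _ => ρ)).source = _
  rw [OpenPartialHomeomorph.restr_toPartialEquiv' _ _ ho, PartialEquiv.restr_source,
    ← Set.inter_assoc, Set.inter_self]

theorem coord_ball (x : X) : (ball φ hφ a ρ hρ hsub).coord x = φ x - a := rfl

/-- Sufficiently small polydiscs around `φ x` lie in the target of `φ`, and their preimages form a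
basis of neighbourhoods of `x`. -/
theorem eventually_ball (hφ : φ ∈ charts L n X) {x : X} (hx : x ∈ φ.source) {N : Set X}
    (hN : N ∈ 𝓝 x) : ∃ ρ₀ : ℝ≥0, 0 < ρ₀ ∧ ∀ (ρ : ℝ≥0) (hρ : 0 < ρ), ρ ≤ ρ₀ →
      ∃ hsub : polyBall (φ x) (fun _ => ρ) ⊆ φ.target,
        x ∈ (ball φ hφ (φ x) ρ hρ hsub).source ∧ (ball φ hφ (φ x) ρ hρ hsub).source ⊆ N := by
  have h1 : φ.target ∩ φ.symm ⁻¹' N ∈ 𝓝 (φ x) := by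
    refine inter_mem (φ.open_target.mem_nhds (φ.map_source hx)) ?_
    refine (φ.continuousAt_symm (φ.map_source hx)).preimage_mem_nhds ?_
    rwa [φ.left_inv hx]
  obtain ⟨ε, hε, hεN⟩ := Metric.nhds_basis_closedBall.mem_iff.1 h1
  refine ⟨⟨ε, hε.le⟩, hε, fun ρ hρ hle => ?_⟩
  have h2 : polyBall (φ x) (fun _ => ρ) ⊆ φ.target ∩ φ.symm ⁻¹' N := by
    rw [polyBall_const]
    exact (Metric.closedBall_subset_closedBall hle).trans hεN
  refine ⟨h2.trans Set.inter_subset_left, ?_, ?_⟩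
  · rw [source_ball]
    exact ⟨hx, mem_polyBall_self _ _⟩
  · rw [source_ball]
    rintro y ⟨hy, hy'⟩
    have := (h2 hy').2
    rwa [Set.mem_preimage, φ.left_inv hy] at this

end PolyChart

end PolyChart

/-! ### Pulling back power series along analytic maps -/

section Pullback

variable {L : Type*} [NontriviallyNormedField L] [IsUltrametricDist L]
  {K : Type*} [NontriviallyNormedField K] [IsUltrametricDist K] [CompleteSpace K]
  [NormedAlgebra L K] {m n : ℕ}
  {X : Type*} [TopologicalSpace X] [ChartedSpace (Fin n → L) X]
  {Y : Type*} [TopologicalSpace Y] [ChartedSpace (Fin m → L) Y]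

/-- `f` is analytic at `x` in all charts at `x`. -/
theorem analyticAt_chart {𝓧 : Type*} [NormedAddCommGroup 𝓧] [NormedSpace L 𝓧]
    {H : Type*} [TopologicalSpace H] {I : ModelWithCorners L 𝓧 H}
    {X : Type*} [TopologicalSpace X] [ChartedSpace H X] [I.Boundaryless] {f : X → Y} {x : X}
    (hf : ContMDiffAt I 𝓘(L, Fin m → L) ω f x) {φ : OpenPartialHomeomorph X H}
    (hφ : φ ∈ IsManifold.maximalAtlas I ω X) (hx : x ∈ φ.source)
    {ψ : OpenPartialHomeomorph Y (Fin m → L)} (hψ : ψ ∈ charts L m Y) (hy : f x ∈ ψ.source)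
    [IsManifold I ω X] [IsManifold 𝓘(L, Fin m → L) ω Y] :
    AnalyticAt L (ψ ∘ f ∘ φ.symm ∘ I.symm) (I (φ x)) := by
  have h := ((contMDiffAt_iff_of_mem_maximalAtlas hφ hψ hx hy).1 hf).2
  rw [I.range_eq_univ, contDiffWithinAt_univ] at h
  exact h.analyticAt

/-- Power series on a polydisc can be pulled back along an analytic map between manifolds, on all
sufficiently small balls around `x` in a given chart. If `f x` is the centre of the polydisc, the
order does not drop. -/
theorem exists_pullback (E : Type w) [NormedAddCommGroup E] [NormedSpace K E]
    [IsUltrametricDist E] [CompleteSpace E] [IsManifold 𝓘(L, Fin n → L) ω X]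
    [IsManifold 𝓘(L, Fin m → L) ω Y] {f : X → Y} {x : X}
    (hf : ContMDiffAt 𝓘(L, Fin n → L) 𝓘(L, Fin m → L) ω f x) (D : PolyChart L m Y)
    (hx : f x ∈ D.source) {φ : OpenPartialHomeomorph X (Fin n → L)} (hφ : φ ∈ charts L n X)
    (hxφ : x ∈ φ.source) {N : Set X} (hN : N ∈ 𝓝 x) :
    ∃ ρ₀ : ℝ≥0, 0 < ρ₀ ∧ ∀ (ρ : ℝ≥0) (hρ : 0 < ρ), ρ ≤ ρ₀ →
      ∃ hsub : polyBall (φ x) (fun _ => ρ) ⊆ φ.target,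
        x ∈ (PolyChart.ball φ hφ (φ x) ρ hρ hsub).source ∧
        (PolyChart.ball φ hφ (φ x) ρ hρ hsub).source ⊆ N ∩ f ⁻¹' D.source ∧
        ∃ Θ : PowSer K D.radius E →L[K] PowSer K (fun _ : Fin n => ρ) E,
          (∀ y ∈ (PolyChart.ball φ hφ (φ x) ρ hρ hsub).source, ∀ g,
            (Θ g).eval (φ y - φ x) = g.eval (D.coord (f y))) ∧
          (D.chart (f x) = D.center → ∀ (k : ℕ) (g : PowSer K D.radius E),
            (∀ i, i.degree < k → g.coeff i = 0) → ∀ i, i.degree < k → (Θ g).coeff i = 0) := by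
  have han : AnalyticAt L (D.chart ∘ f ∘ φ.symm) (φ x) := analyticAt_chart hf hφ hxφ D.mem hx
  have hmem : (D.chart ∘ f ∘ φ.symm) (φ x) ∈ polyBall D.center D.radius := by
    rw [← D.target_eq]
    simpa [φ.left_inv hxφ] using D.chart.map_source hx
  obtain ⟨ρ₁, hρ₁, h1⟩ := exists_substitution (K := K) E han D.radius_pos hmem
  obtain ⟨ρ₂, hρ₂, h2⟩ := PolyChart.eventually_ball hφ hxφ
    (inter_mem hN (hf.continuousAt.preimage_mem_nhds (D.isOpen_source.mem_nhds hx)))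
  refine ⟨min ρ₁ ρ₂, lt_min hρ₁ hρ₂, fun ρ hρ hle => ?_⟩
  obtain ⟨hsub, hxs, hs⟩ := h2 ρ hρ (hle.trans (min_le_right _ _))
  obtain ⟨Θ, hΘ, hΘ'⟩ := h1 (fun _ => ρ) (fun _ => hρ) fun _ => hle.trans (min_le_left _ _)
  refine ⟨hsub, hxs, hs, Θ, fun y hy g => ?_, fun h => hΘ' ?_⟩
  · have h3 := (hΘ _ ((PolyChart.ball φ hφ (φ x) ρ hρ hsub).coord_le hy)).2 g
    rw [PolyChart.coord_ball, add_sub_cancel] at h3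
    rw [PolyChart.source_ball] at hy
    rw [h3]
    simp [φ.left_inv hy.1, PolyChart.coord]
  · simpa [φ.left_inv hxφ] using h

/-- Pulling back scalar power series along a map of two variables; the result is a power series in
two groups of variables. -/
theorem exists_pullback_two {n' : ℕ} {X' : Type*} [TopologicalSpace X']
    [ChartedSpace (Fin n' → L) X'] [IsManifold 𝓘(L, Fin n → L) ω X]
    [IsManifold 𝓘(L, Fin n' → L) ω X'] [IsManifold 𝓘(L, Fin m → L) ω Y] {f : X × X' → Y}
    {x : X} {x' : X'} (hf : ContMDiffAt (𝓘(L, Fin n → L).prod 𝓘(L, Fin n' → L))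
      𝓘(L, Fin m → L) ω f (x, x')) (D : PolyChart L m Y) (hx : f (x, x') ∈ D.source)
    {φ : OpenPartialHomeomorph X (Fin n → L)} (hφ : φ ∈ charts L n X) (hxφ : x ∈ φ.source)
    {φ' : OpenPartialHomeomorph X' (Fin n' → L)} (hφ' : φ' ∈ charts L n' X')
    (hxφ' : x' ∈ φ'.source) :
    ∃ ρ₀ : ℝ≥0, 0 < ρ₀ ∧ ∀ (ρ : ℝ≥0) (hρ : 0 < ρ), ρ ≤ ρ₀ → ∀ (ρ' : ℝ≥0) (hρ' : 0 < ρ'),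
      ρ' ≤ ρ₀ → ∃ (hsub : polyBall (φ x) (fun _ => ρ) ⊆ φ.target)
        (hsub' : polyBall (φ' x') (fun _ => ρ') ⊆ φ'.target),
        x ∈ (PolyChart.ball φ hφ (φ x) ρ hρ hsub).source ∧
        x' ∈ (PolyChart.ball φ' hφ' (φ' x') ρ' hρ' hsub').source ∧
        ∃ Θ : PowSer K D.radius K →L[K]
            PowSer K (Fin.append (fun _ : Fin n => ρ) fun _ : Fin n' => ρ') K,
          (∀ y ∈ (PolyChart.ball φ hφ (φ x) ρ hρ hsub).source,
            ∀ y' ∈ (PolyChart.ball φ' hφ' (φ' x') ρ' hρ' hsub').source,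
            f (y, y') ∈ D.source ∧ ∀ g, (Θ g).eval (Fin.append (φ y - φ x) (φ' y' - φ' x')) =
              g.eval (D.coord (f (y, y')))) ∧
          (D.chart (f (x, x')) = D.center → ∀ (k : ℕ) (g : PowSer K D.radius K),
            (∀ i, i.degree < k → g.coeff i = 0) → ∀ i, i.degree < k → (Θ g).coeff i = 0) := by
  let e : (Fin (n + n') → L) →L[L] (Fin n → L) × (Fin n' → L) :=
    (ContinuousLinearMap.pi fun j =>
      ContinuousLinearMap.proj (R := L) (φ := fun _ : Fin (n + n') => L) (Fin.castAdd n' j)).prod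
    (ContinuousLinearMap.pi fun j =>
      ContinuousLinearMap.proj (R := L) (φ := fun _ : Fin (n + n') => L) (Fin.natAdd n j))
  have he : ∀ y y', e (Fin.append y y') = (y, y') := fun y y' => by
    ext j <;> simp [e]
  let G : (Fin (n + n') → L) → (Fin m → L) := fun z =>
    D.chart (f (φ.symm (e z).1, φ'.symm (e z).2))
  have happ : ∀ y y' z z', Fin.append y y' + Fin.append z z' =
      (Fin.append (y + z) (y' + z') : Fin (n + n') → L) := fun y y' z z' => by
    ext j
    induction j using Fin.addCases <;> simp
  have han : AnalyticAt L G (Fin.append (φ x) (φ' x')) := by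
    have h1 := analyticAt_chart hf (IsManifold.mem_maximalAtlas_prod hφ hφ')
      (show (x, x') ∈ (φ.prod φ').source from ⟨hxφ, hxφ'⟩) D.mem hx
    have h2 : AnalyticAt L e (Fin.append (φ x) (φ' x')) := e.analyticAt _
    have h3 : (𝓘(L, Fin n → L).prod 𝓘(L, Fin n' → L)) (φ.prod φ' (x, x')) =
        e (Fin.append (φ x) (φ' x')) := (he _ _).symm
    rw [h3] at h1
    exact h1.comp h2
  have hval : ∀ y ∈ φ.source, ∀ y' ∈ φ'.source,
      G (Fin.append (φ y) (φ' y')) = D.chart (f (y, y')) := fun y hy y' hy' => by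
    simp only [G, he, φ.left_inv hy, φ'.left_inv hy']
  have hmem : G (Fin.append (φ x) (φ' x')) ∈ polyBall D.center D.radius := by
    rw [hval _ hxφ _ hxφ', ← D.target_eq]
    exact D.chart.map_source hx
  obtain ⟨ρ₁, hρ₁, h1⟩ := exists_substitution (K := K) K han D.radius_pos hmem
  have hfc := hf.continuousAt.preimage_mem_nhds (D.isOpen_source.mem_nhds hx)
  rw [nhds_prod_eq] at hfc
  obtain ⟨N, hN, N', hN', hNN⟩ := mem_prod_iff.1 hfc
  obtain ⟨ρ₂, hρ₂, h2⟩ := PolyChart.eventually_ball hφ hxφ hN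
  obtain ⟨ρ₃, hρ₃, h3⟩ := PolyChart.eventually_ball hφ' hxφ' hN'
  refine ⟨min ρ₁ (min ρ₂ ρ₃), lt_min hρ₁ (lt_min hρ₂ hρ₃), fun ρ hρ hle ρ' hρ' hle' => ?_⟩
  simp only [le_min_iff] at hle hle'
  obtain ⟨hsub, hxs, hs⟩ := h2 ρ hρ hle.2.1
  obtain ⟨hsub', hxs', hs'⟩ := h3 ρ' hρ' hle'.2.2
  obtain ⟨Θ, hΘ, hΘ'⟩ := h1 (Fin.append (fun _ => ρ) fun _ => ρ')
    (fun j => by induction j using Fin.addCases <;> simpa)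
    (fun j => by induction j using Fin.addCases <;> simp [hle.1, hle'.1])
  refine ⟨hsub, hsub', hxs, hxs', Θ, fun y hy y' hy' => ⟨hNN ⟨hs hy, hs' hy'⟩, fun g => ?_⟩,
    fun h => hΘ' ?_⟩
  · have h4 := append_le ((PolyChart.ball φ hφ (φ x) ρ hρ hsub).coord_le hy)
      ((PolyChart.ball φ' hφ' (φ' x') ρ' hρ' hsub').coord_le hy')
    have h5 := (hΘ _ h4).2 g
    rw [PolyChart.coord_ball, PolyChart.coord_ball, happ, add_sub_cancel, add_sub_cancel] at h5
    rw [PolyChart.source_ball] at hy hy'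
    rw [hval _ hy.1 _ hy'.1] at h5
    exact h5
  · rwa [hval _ hxφ _ hxφ']

end Pullback

/-! ### Disjoint coverings by polydiscs -/

section Partition

variable {L : Type*} [NontriviallyNormedField L] [IsUltrametricDist L] {n : ℕ}
  {X : Type uG} [TopologicalSpace X] [ChartedSpace (Fin n → L) X]

namespace PolyChart

/-- `D'` is a restriction of the chart `D` to a smaller polydisc, possibly with another centre. -/
def IsSub (D' D : PolyChart L n X) : Prop :=
  D'.source ⊆ D.source ∧ (∀ y, D'.chart y = D.chart y) ∧ ∀ j, D'.radius j ≤ D.radius j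

/-- Re-expansion is the substitution of `X + b`, where `b` is the difference of the centres; since
`b` lies in the larger polydisc, this has the right norm by the ultrametric inequality. -/
theorem exists_recenter {K : Type*} [NontriviallyNormedField K] [IsUltrametricDist K]
    [CompleteSpace K] [NormedAlgebra L K] (E : Type w) [NormedAddCommGroup E] [NormedSpace K E]
    [IsUltrametricDist E] [CompleteSpace E] {D' D : PolyChart L n X} (h : D'.IsSub D) :
    ∃ Θ : PowSer K D.radius E →L[K] PowSer K D'.radius E,
      ∀ y ∈ D'.source, ∀ g, (Θ g).eval (D'.coord y) = g.eval (D.coord y) := by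
  obtain ⟨hs, hc, hr⟩ := h
  let b : Fin n → L := D'.center - D.center
  have hb : ∀ j, ‖b j‖ ≤ D.radius j := by
    obtain ⟨z, hz, hz0⟩ := D'.exists_coord_eq (y := 0) fun j => by simp
    have h1 : D'.center = D.chart z := by
      rw [← hc, eq_comm, ← sub_eq_zero]
      exact hz0
    have h2 : b = D.coord z := by rw [coord, ← h1]
    rw [h2]
    exact D.coord_le (hs hz)
  let η : Fin n → PowSer K D'.radius K := fun j =>
    PowSer.monomial D'.radius (Finsupp.single j 1) 1 + PowSer.monomial D'.radius 0
      (algebraMap L K (b j))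
  have hη : ∀ j, ‖η j‖ ≤ D.radius j := fun j => by
    refine (IsUltrametricDist.norm_add_le_max _ _).trans (max_le ?_ ?_)
    · refine (PowSer.norm_monomial_le _ _).trans ?_
      rw [norm_one, mul_one, weight, Finset.prod_eq_single j]
      · simpa using hr j
      · intro k _ hk
        simp [Ne.symm hk]
      · simp
    · refine (PowSer.norm_monomial_le _ _).trans ?_
      rw [weight_zero, one_mul, norm_algebraMap']
      exact hb j
  obtain ⟨Θ, hΘ, -⟩ := PowSer.exists_comp (L := L) E η hη
  refine ⟨Θ, fun y hy g => hΘ _ _ (D'.coord_le hy) (D.coord_le (hs hy)) (fun j => ?_) g⟩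
  rw [PowSer.eval_add _ _ (D'.coord_le hy), PowSer.eval_monomial, PowSer.eval_monomial, monom_zero,
    map_one, one_smul, smul_eq_mul, mul_one, ← map_add]
  congr 1
  rw [monom, Finset.prod_eq_single j]
  · simp [coord, b, hc]
  · intro k _ hk
    simp [Ne.symm hk]
  · simp

/-- Re-expansion of a power series on a smaller polydisc. -/
def recenter {K : Type*} [NontriviallyNormedField K] [IsUltrametricDist K]
    [CompleteSpace K] [NormedAlgebra L K] (E : Type w) [NormedAddCommGroup E] [NormedSpace K E]
    [IsUltrametricDist E] [CompleteSpace E] {D' D : PolyChart L n X} (h : D'.IsSub D) :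
    PowSer K D.radius E →L[K] PowSer K D'.radius E :=
  (exists_recenter E h).choose

theorem eval_recenter {K : Type*} [NontriviallyNormedField K] [IsUltrametricDist K]
    [CompleteSpace K] [NormedAlgebra L K] {E : Type w} [NormedAddCommGroup E] [NormedSpace K E]
    [IsUltrametricDist E] [CompleteSpace E] {D' D : PolyChart L n X} (h : D'.IsSub D) {y : X}
    (hy : y ∈ D'.source) (g : PowSer K D.radius E) :
    (recenter E h g).eval (D'.coord y) = g.eval (D.coord y) :=
  (exists_recenter E h).choose_spec y hy g

end PolyChart

variable [LocallyCompactSpace L] [T2Space X] [SecondCountableTopology X]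

/-- Every covering of an open set by polydiscs can be refined to a disjoint covering: a countable
subcovering by compact open sets is made disjoint, and each of the resulting compact open sets is
the disjoint union of small balls of equal radius. -/
theorem exists_partition (U : Opens X) (D : X → PolyChart L n X)
    (hD : ∀ x ∈ U, x ∈ (D x).source) (hDU : ∀ x ∈ U, (D x).source ⊆ U) :
    ∃ (I : Type uG) (D' : I → PolyChart L n X) (ξ : I → X),
      (Pairwise fun i j => Disjoint (D' i).source (D' j).source) ∧
      ⋃ i, (D' i).source = (U : Set X) ∧ ∀ i, ξ i ∈ U ∧ (D' i).IsSub (D (ξ i)) := by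
  classical
  obtain ⟨t, htU, htc, htcov⟩ := TopologicalSpace.countable_cover_nhdsWithin
    (s := (U : Set X)) (f := fun x => (D x).source)
    fun x hx => mem_nhdsWithin_of_mem_nhds ((D x).isOpen_source.mem_nhds (hD x hx))
  rcases t.eq_empty_or_nonempty with rfl | hne
  · have hU : (U : Set X) = ∅ := by simpa using htcov
    exact ⟨PEmpty, fun i => i.elim, fun i => i.elim, fun i => i.elim, by simp [hU],
      fun i => i.elim⟩
  obtain ⟨f, rfl⟩ := htc.exists_eq_range hne
  have hfU : ∀ k, f k ∈ U := fun k => htU ⟨k, rfl⟩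
  let S : ℕ → Set X := fun k => (D (f k)).source
  -- the compact open sets `W k` are disjoint and cover `U`
  let W : ℕ → Set X := fun k => S k \ ⋃ l < k, S l
  have hclosed : ∀ k, IsClosed (S k) := fun k => (D (f k)).isCompact_source.isClosed
  have hWo : ∀ k, IsOpen (W k) := fun k => (D (f k)).isOpen_source.sdiff
    ((Set.finite_lt_nat k).isClosed_biUnion fun l _ => hclosed l)
  have hWc : ∀ k, IsCompact (W k) := fun k => (D (f k)).isCompact_source.diff
    (isOpen_biUnion fun l _ => (D (f l)).isOpen_source)
  let A : ℕ → Set (Fin n → L) := fun k => (D (f k)).chart '' W k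
  have hAo : ∀ k, IsOpen (A k) := fun k =>
    (D (f k)).chart.isOpen_image_of_subset_source (hWo k) Set.sdiff_subset
  have hAc : ∀ k, IsCompact (A k) := fun k =>
    (hWc k).image_of_continuousOn ((D (f k)).chart.continuousOn.mono Set.sdiff_subset)
  -- by compactness, the balls of a common radius `ε` around the points of `A k` lie in `A k`
  have hε : ∀ k, ∃ ε : ℝ≥0, 0 < ε ∧ (∀ b ∈ A k, polyBall b (fun _ => ε) ⊆ A k) ∧
      ∀ j, ε ≤ (D (f k)).radius j := by
    intro k
    obtain ⟨δ, hδ, hδA⟩ := (hAc k).exists_cthickening_subset_open (hAo k) subset_rfl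
    have : ∀ᶠ ε in 𝓝[>] (0 : ℝ≥0), ε ≤ ⟨δ, hδ.le⟩ ∧ ∀ j, ε ≤ (D (f k)).radius j := by
      refine Eventually.and ((ge_mem_nhds (show (0 : ℝ≥0) < ⟨δ, hδ.le⟩ from hδ)).filter_mono
        nhdsWithin_le_nhds) ?_
      rw [eventually_all]
      exact fun j => (ge_mem_nhds ((D (f k)).radius_pos j)).filter_mono nhdsWithin_le_nhds
    obtain ⟨ε, ⟨h1, h2⟩, h3⟩ := (this.and self_mem_nhdsWithin).exists
    refine ⟨ε, h3, fun b hb => ?_, h2⟩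
    rw [polyBall_const]
    exact (Metric.closedBall_subset_closedBall h1).trans
      ((Metric.closedBall_subset_cthickening hb _).trans hδA)
  choose ε hε0 hεA hεr using hε
  have hAt : ∀ k, A k ⊆ (D (f k)).chart.target := by
    rintro k _ ⟨x, hx, rfl⟩
    exact (D (f k)).chart.map_source hx.1
  let P : ∀ k, A k → PolyChart L n X := fun k b =>
    PolyChart.ball (D (f k)).chart (D (f k)).mem b.1 (ε k) (hε0 k) ((hεA k b.1 b.2).trans (hAt k))
  have hPs : ∀ k b, (P k b).source = S k ∩ (D (f k)).chart ⁻¹' polyBall b.1 fun _ => ε k :=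
    fun k b => PolyChart.source_ball
  have hPW : ∀ k b, (P k b).source ⊆ W k := by
    intro k b y hy
    rw [hPs] at hy
    obtain ⟨x, hx, hxy⟩ := hεA k b.1 b.2 hy.2
    rwa [← (D (f k)).chart.injOn hx.1 hy.1 hxy]
  have hWdisj : ∀ k l, k < l → Disjoint (W k) (W l) := by
    intro k l hkl
    rw [Set.disjoint_left]
    intro x hx hx'
    exact hx'.2 (Set.mem_biUnion hkl hx.1)
  -- two balls of equal radius are equal or disjoint; indexing by the set, and not by the centre,
  -- identifies those which are equal
  let I : Type uG := {T : Set X // ∃ k b, (P k b).source = T}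
  choose κ β hκβ using fun i : I => i.2
  refine ⟨I, fun i => P (κ i) (β i), fun i => f (κ i), fun i j hij => ?_, ?_, fun i => ⟨hfU _, ?_⟩⟩
  · rcases lt_trichotomy (κ i) (κ j) with h | h | h
    · exact (hWdisj _ _ h).mono (hPW _ _) (hPW _ _)
    · rw [Set.disjoint_left]
      intro y hy hy'
      refine hij (Subtype.ext ?_)
      rw [← hκβ i, ← hκβ j]
      have key : ∀ k (b b' : A k), y ∈ (P k b).source → y ∈ (P k b').source →
          (P k b).source = (P k b').source := by
        intro k b b' hy hy'
        rw [hPs] at hy hy'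
        rw [hPs, hPs]
        have h1 := hy.2
        have h2 := hy'.2
        rw [Set.mem_preimage, polyBall_const] at h1 h2
        rw [polyBall_const, polyBall_const, IsUltrametricDist.closedBall_eq_of_mem h1,
          IsUltrametricDist.closedBall_eq_of_mem h2]
      have key' : ∀ k k' (b : A k) (b' : A k'), k = k' → y ∈ (P k b).source →
          y ∈ (P k' b').source → (P k b).source = (P k' b').source := by
        rintro k _ b b' rfl
        exact key k b b'
      exact key' _ _ _ _ h hy hy'
    · exact ((hWdisj _ _ h).mono (hPW _ _) (hPW _ _)).symm
  · refine Set.Subset.antisymm (Set.iUnion_subset fun i => ?_) fun x hx => ?_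
    · exact ((hPW _ _).trans Set.sdiff_subset).trans (hDU _ (hfU _))
    · have hex : ∃ k, x ∈ S k := by
        have := htcov hx
        simpa using this
      let k := Nat.find hex
      have hxW : x ∈ W k := by
        refine ⟨Nat.find_spec hex, fun h => ?_⟩
        simp only [Set.mem_iUnion] at h
        obtain ⟨l, hl, hxl⟩ := h
        exact Nat.find_min hex hl hxl
      let b : A k := ⟨(D (f k)).chart x, x, hxW, rfl⟩
      have hxP : x ∈ (P k b).source := by
        rw [hPs]
        exact ⟨hxW.1, mem_polyBall_self _ _⟩
      refine Set.mem_iUnion.2 ⟨⟨(P k b).source, k, b, rfl⟩, ?_⟩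
      rw [hκβ]
      exact hxP
  · refine ⟨?_, fun y => rfl, fun j => hεr _ j⟩
    rw [hPs]
    exact Set.inter_subset_left

end Partition

/-! ### Locally analytic functions and their topology -/

section Cla

variable {L : Type uL} [NontriviallyNormedField L] [IsUltrametricDist L] {n : ℕ}
  {K : Type uK} [NontriviallyNormedField K] [IsUltrametricDist K] [CompleteSpace K]
  [NormedAlgebra L K]
  {X : Type uG} [TopologicalSpace X] [ChartedSpace (Fin n → L) X]
  [IsManifold 𝓘(L, Fin n → L) ω X]
  {V : Type uV} [AddCommGroup V] [Module K V] [TopologicalSpace V]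

/-- Analyticity at a point can be verified in any one chart: changes of charts are analytic. -/
theorem isLocAnAt_of_polyChart {f : X → V} {x : X} (D : PolyChart L n X) (hx : x ∈ D.source)
    (B : BHSubspace K V) (g : PowSer K D.radius B.E)
    (hf : ∀ᶠ y in 𝓝 x, f y = B.ι (g.eval (D.coord y))) : IsLocAnAt L n K f x := by
  intro φ hφ hxφ
  obtain ⟨ρ, hρ, h⟩ := exists_pullback (K := K) B.E (contMDiffAt_id (x := x)) D hx hφ hxφ univ_mem
  obtain ⟨hsub, hxs, -, Θ, hΘ, -⟩ := h ρ hρ le_rfl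
  refine ⟨B, fun _ => ρ, fun _ => hρ, Θ g, ?_⟩
  filter_upwards [hf, (PolyChart.isOpen_source _).mem_nhds hxs] with y h1 h2
  rw [h1, hΘ y h2]
  rfl

/-- The power series of a function analytic at `x` can be taken on all sufficiently small balls
around `x` in a given chart. -/
theorem IsLocAnAt.exists_ball {f : X → V} {x : X} (hf : IsLocAnAt L n K f x)
    {φ : OpenPartialHomeomorph X (Fin n → L)} (hφ : φ ∈ charts L n X) (hx : x ∈ φ.source)
    {N : Set X} (hN : N ∈ 𝓝 x) : ∃ (B : BHSubspace K V) (ρ₀ : ℝ≥0), 0 < ρ₀ ∧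
      ∀ (ρ : ℝ≥0) (hρ : 0 < ρ), ρ ≤ ρ₀ → ∃ hsub : polyBall (φ x) (fun _ => ρ) ⊆ φ.target,
        x ∈ (PolyChart.ball φ hφ (φ x) ρ hρ hsub).source ∧
        (PolyChart.ball φ hφ (φ x) ρ hρ hsub).source ⊆ N ∧
        ∃ g : PowSer K (fun _ : Fin n => ρ) B.E,
          ∀ y ∈ (PolyChart.ball φ hφ (φ x) ρ hρ hsub).source, f y = B.ι (g.eval (φ y - φ x)) := by
  obtain ⟨B, r, hr, g, hg⟩ := hf φ hφ hx
  obtain ⟨ρ₁, hρ₁, h1⟩ := PolyChart.eventually_ball hφ hx (inter_mem hN hg)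
  obtain ⟨ρ₂, hρ₂, h2⟩ : ∃ ρ₂ : ℝ≥0, 0 < ρ₂ ∧ ∀ j, ρ₂ ≤ r j := by
    have : ∀ᶠ ρ in 𝓝[>] (0 : ℝ≥0), ∀ j, ρ ≤ r j := by
      rw [eventually_all]
      exact fun j => (ge_mem_nhds (hr j)).filter_mono nhdsWithin_le_nhds
    obtain ⟨ρ, h1, h2⟩ := (this.and self_mem_nhdsWithin).exists
    exact ⟨ρ, h2, h1⟩
  refine ⟨B, min ρ₁ ρ₂, lt_min hρ₁ hρ₂, fun ρ hρ hle => ?_⟩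
  obtain ⟨hsub, hxs, hs⟩ := h1 ρ hρ (hle.trans (min_le_left _ _))
  refine ⟨hsub, hxs, fun y hy => (hs hy).1,
    g.restrict fun j => (hle.trans (min_le_right _ _)).trans (h2 j), fun y hy => ?_⟩
  rw [PowSer.eval_restrict]
  exact (hs hy).2

variable [IsTopologicalAddGroup V] [ContinuousSMul K V] [T2Space V]

namespace VIndex

/-- The charts of a `V`-index. -/
abbrev polyChart {U : Opens X} (J : VIndex L n K V U) (i : J.I) : PolyChart L n X where
  chart := J.chart i
  mem := J.chart_mem i
  center := J.center i
  radius := J.radius i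
  radius_pos := J.radius_pos i
  target_eq := J.target_eq i

/-- The `V`-index given by a disjoint covering by polydiscs. -/
abbrev ofPolyChart {U : Opens X} {I : Type uG} (D : I → PolyChart L n X)
    (hd : Pairwise fun i j => Disjoint (D i).source (D j).source)
    (hc : ⋃ i, (D i).source = (U : Set X)) (B : I → BHSubspace K V) : VIndex L n K V U where
  I := I
  chart i := (D i).chart
  chart_mem i := (D i).mem
  center i := (D i).center
  radius i := (D i).radius
  radius_pos i := (D i).radius_pos
  target_eq i := (D i).target_eq
  disjoint := hd
  cover := hc
  B := B

/-- The product of the Banach spaces `C^rig(φᵢ, Eᵢ)` of a `V`-index. -/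
abbrev Series {U : Opens X} (J : VIndex L n K V U) : Type _ :=
  ∀ i, PowSer K (J.polyChart i).radius (J.B i).E

variable {U : Opens X} (J : VIndex L n K V U)

theorem exists_mem (x : U) : ∃ i, (x : X) ∈ (J.polyChart i).source := by
  have := x.2
  rw [← SetLike.mem_coe, ← J.cover] at this
  exact Set.mem_iUnion.1 this

/-- The polydisc containing a point. -/
def index (x : U) : J.I := (J.exists_mem x).choose

theorem mem_index (x : U) : (x : X) ∈ (J.polyChart (J.index x)).source :=
  (J.exists_mem x).choose_spec

theorem eq_of_mem {i j : J.I} {x : X} (hi : x ∈ (J.polyChart i).source)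
    (hj : x ∈ (J.polyChart j).source) : i = j := by
  by_contra h
  exact Set.disjoint_left.1 (J.disjoint h) hi hj

/-- The function on `U` given by a family of power series. -/
def toFun (p : J.Series) (x : U) : V :=
  (J.B (J.index x)).ι ((p (J.index x)).eval ((J.polyChart (J.index x)).coord x))

theorem toFun_eq (p : J.Series) {x : U} {i : J.I} (hi : (x : X) ∈ (J.polyChart i).source) :
    J.toFun p x = (J.B i).ι ((p i).eval ((J.polyChart i).coord x)) := by
  obtain rfl := J.eq_of_mem hi (J.mem_index x)
  rfl

/-- The locally analytic function given by a family of power series. -/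
def toClaₗ : J.Series →ₗ[K] Cla L n K V U where
  toFun p := ⟨J.toFun p, fun x hx => by
    have hi := J.mem_index ⟨x, hx⟩
    refine isLocAnAt_of_polyChart (J.polyChart (J.index ⟨x, hx⟩)) hi _
      (p (J.index ⟨x, hx⟩)) ?_
    filter_upwards [U.isOpen.mem_nhds hx, (PolyChart.isOpen_source _).mem_nhds hi] with y hy hyi
    rw [show y = ((⟨y, hy⟩ : U) : X) from rfl, extendZero_apply, J.toFun_eq p hyi]⟩
  map_add' p q := Subtype.ext <| funext fun x => by
    change J.toFun (p + q) x = J.toFun p x + J.toFun q x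
    rw [toFun, toFun, toFun, Pi.add_apply,
      PowSer.eval_add _ _ ((J.polyChart _).coord_le (J.mem_index x)), map_add]
  map_smul' c p := Subtype.ext <| funext fun x => by
    change J.toFun (c • p) x = c • J.toFun p x
    rw [toFun, toFun, Pi.smul_apply,
      PowSer.eval_smul _ _ ((J.polyChart _).coord_le (J.mem_index x)), map_smul]

/-- The continuous linear map from families of power series to locally analytic functions. -/
def toCla : J.Series →L[K] Cla L n K V U where
  toLinearMap := J.toClaₗ
  cont := by
    let σ : J.Series → J.Subordinate := fun p => ⟨(p, J.toClaₗ p), fun i x hx => J.toFun_eq p hx⟩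
    have hσ : Continuous σ := continuous_induced_rng.2 continuous_id
    have h : Continuous fun q : J.Subordinate => q.1.2 :=
      continuous_iff_coinduced_le.2 ((le_iSup (fun J : VIndex L n K V U =>
        TopologicalSpace.coinduced (fun p : J.Subordinate => p.1.2) inferInstance) J).trans
          (le_lcFinal _))
    exact h.comp hσ

theorem toCla_apply (p : J.Series) {x : U} {i : J.I} (hi : (x : X) ∈ (J.polyChart i).source) :
    J.toCla p x = (J.B i).ι ((p i).eval ((J.polyChart i).coord x)) := J.toFun_eq p hi

end VIndex

theorem Cla.ext {U : Opens X} {f g : Cla L n K V U} (h : ∀ x : U, f x = g x) : f = g :=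
  Subtype.ext (funext h)

/-- A linear map from `C^la(U, V)` to a locally convex space is continuous if it is so on all
products of spaces of power series. -/
theorem Cla.continuous_of_toCla {U : Opens X} {W : Type*} [AddCommGroup W] [Module K W]
    [t : TopologicalSpace W] (hW : IsLocConvex K t) (T : Cla L n K V U →ₗ[K] W)
    (h : ∀ J : VIndex L n K V U, Continuous (T ∘ J.toCla)) : Continuous T := by
  rw [continuous_iff_le_induced]
  refine lcFinal_le (iSup_le fun J => ?_) (hW.induced T)
  rw [← continuous_iff_coinduced_le, continuous_induced_rng]
  have h1 : Continuous fun q : J.Subordinate => (q.1.1 : J.Series) := continuous_induced_dom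
  have h2 : (T ∘ fun q : J.Subordinate => q.1.2) = (T ∘ J.toCla) ∘ fun q => q.1.1 := by
    funext q
    simp only [Function.comp_apply]
    congr 1
    exact Cla.ext fun x => (q.2 _ x (J.mem_index x)).trans rfl
  rw [h2]
  exact (h J).comp h1

/-- A locally analytic function on all of `X`. -/
def Cla.mkTop (f : X → V) (hf : ∀ x, IsLocAnAt L n K f x) : Cla L n K V (⊤ : Opens X) :=
  ⟨fun x => f x, fun x _ => (hf x).congr <| Eventually.of_forall fun y =>
    (extendZero_apply (U := (⊤ : Opens X)) (fun x => f x) ⟨y, trivial⟩).symm⟩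

theorem Cla.isLocAnAt_top (f : Cla L n K V (⊤ : Opens X)) (x : X) :
    IsLocAnAt L n K (fun y => f ⟨y, trivial⟩) x :=
  (f.2 x trivial).congr <| Eventually.of_forall fun y =>
    extendZero_apply (U := (⊤ : Opens X)) f.1 ⟨y, trivial⟩

theorem ClaGerm.ext {x : X} {F G : ClaGerm L n K V x} (h : F.germ = G.germ) : F = G :=
  Subtype.ext h

theorem Cla.germ_toGerm_top {x : X} (f : Cla L n K V (⊤ : Opens X)) :
    (Cla.toGerm L n K V (Opens.mem_top x) f).germ =
      ((fun y => f ⟨y, trivial⟩ : X → V) : Germ (𝓝 x) V) :=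
  Germ.coe_eq.2 <| Eventually.of_forall fun y =>
    extendZero_apply (U := (⊤ : Opens X)) f.1 ⟨y, trivial⟩

/-- The continuous linear map from power series on a polydisc to germs at a point of it. -/
def rigGerm {x : X} (D : PolyChart L n X) (hx : x ∈ D.source) (B : BHSubspace K V) :
    PowSer K D.radius B.E →L[K] ClaGerm L n K V x :=
  let J : VIndex L n K V (⟨D.source, D.isOpen_source⟩ : Opens X) :=
    VIndex.ofPolyChart (fun _ : PUnit => D) (fun _ _ h => absurd rfl h) (Set.iUnion_const _)
      fun _ => B
  ((Cla.toGerm L n K V (U := ⟨D.source, D.isOpen_source⟩) hx).comp J.toCla).comp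
    (ContinuousLinearMap.pi fun _ => ContinuousLinearMap.id K _)

theorem germ_rigGerm {x : X} (D : PolyChart L n X) (hx : x ∈ D.source) (B : BHSubspace K V)
    (g : PowSer K D.radius B.E) : (rigGerm D hx B g).germ =
      ((fun y => B.ι (g.eval (D.coord y)) : X → V) : Germ (𝓝 x) V) := by
  refine Germ.coe_eq.2 ?_
  filter_upwards [D.isOpen_source.mem_nhds hx] with y hy
  exact extendZero_apply (U := ⟨D.source, D.isOpen_source⟩) _ ⟨y, hy⟩

/-- A linear map from `C^la_x(X, V)` to a locally convex space is continuous if it is so on all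
spaces of power series. -/
theorem ClaGerm.continuous_of_rigGerm {x : X} {W : Type*} [AddCommGroup W] [Module K W]
    [t : TopologicalSpace W] (hW : IsLocConvex K t) (T : ClaGerm L n K V x →ₗ[K] W)
    (h : ∀ (D : PolyChart L n X) (hx : x ∈ D.source) (B : BHSubspace K V),
      Continuous (T ∘ rigGerm D hx B)) : Continuous T := by
  rw [continuous_iff_le_induced]
  refine lcFinal_le (iSup₂_le fun U hx => ?_) (hW.induced T)
  rw [← continuous_iff_coinduced_le, continuous_induced_rng]
  refine Cla.continuous_of_toCla hW (T ∘ₗ Cla.toGermₗ L n K V hx) fun J => ?_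
  have hi := J.mem_index ⟨x, hx⟩
  have h2 : ((T ∘ₗ Cla.toGermₗ L n K V hx) ∘ J.toCla) =
      (T ∘ rigGerm (J.polyChart (J.index ⟨x, hx⟩)) hi (J.B (J.index ⟨x, hx⟩))) ∘
        fun p : J.Series => p (J.index ⟨x, hx⟩) := by
    funext p
    simp only [Function.comp_apply, LinearMap.comp_apply]
    congr 1
    refine ClaGerm.ext ?_
    rw [germ_rigGerm]
    refine Germ.coe_eq.2 ?_
    filter_upwards [U.isOpen.mem_nhds hx, (PolyChart.isOpen_source _).mem_nhds hi] with y hy hyi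
    rw [← J.toCla_apply p (x := ⟨y, hy⟩) hyi]
    exact extendZero_apply _ (⟨y, hy⟩ : U)
  rw [h2]
  exact (h _ _ _).comp (continuous_apply _)

section Global

variable [LocallyCompactSpace L] [T2Space X] [SecondCountableTopology X]

/-- Any assignment of polydiscs and BH-subspaces to the points of `X` can be refined by a
`V`-index. -/
theorem exists_refinement (D : X → PolyChart L n X) (B : X → BHSubspace K V)
    (hD : ∀ x, x ∈ (D x).source) : ∃ (J : VIndex L n K V (⊤ : Opens X)) (ξ : J.I → X)
      (c : ∀ i, PowSer K (D (ξ i)).radius (B (ξ i)).E →L[K]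
        PowSer K (J.polyChart i).radius (J.B i).E),
      ∀ i, ∀ y ∈ (J.polyChart i).source, y ∈ (D (ξ i)).source ∧ ∀ g,
        (J.B i).ι ((c i g).eval ((J.polyChart i).coord y)) =
          (B (ξ i)).ι (g.eval ((D (ξ i)).coord y)) := by
  obtain ⟨I, D', ξ, hd, hc, hξ⟩ := exists_partition (⊤ : Opens X) D (fun x _ => hD x)
    fun x _ => Set.subset_univ _
  refine ⟨VIndex.ofPolyChart D' hd hc fun i => B (ξ i), ξ,
    fun i => PolyChart.recenter (B (ξ i)).E (hξ i).2, fun i y hy => ⟨(hξ i).2.1 hy, fun g => ?_⟩⟩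
  exact congrArg _ (PolyChart.eval_recenter (hξ i).2 hy g)

/-- A linear map to `C^la(X, V)` which locally on `X` comes from continuous linear maps to spaces
of power series is continuous. -/
theorem Cla.continuous_of_local {A : Type*} [AddCommGroup A] [Module K A] [TopologicalSpace A]
    (T : A →ₗ[K] Cla L n K V (⊤ : Opens X))
    (h : ∀ x, ∃ (D : PolyChart L n X) (B : BHSubspace K V) (Λ : A →L[K] PowSer K D.radius B.E),
      x ∈ D.source ∧ ∀ a, ∀ y ∈ D.source, T a ⟨y, trivial⟩ = B.ι ((Λ a).eval (D.coord y))) :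
    Continuous T := by
  choose D B Λ hD hΛ using h
  obtain ⟨J, ξ, c, hc⟩ := exists_refinement D B hD
  let M : A →L[K] J.Series := ContinuousLinearMap.pi fun i => (c i).comp (Λ (ξ i))
  have : (T : A → Cla L n K V (⊤ : Opens X)) = J.toCla ∘ M := by
    funext a
    refine Cla.ext fun x => ?_
    have hx := J.mem_index x
    rw [Function.comp_apply, J.toCla_apply _ hx, hΛ (ξ (J.index x)) a x (hc _ _ hx).1]
    exact ((hc _ _ hx).2 _).symm
  rw [this]
  exact J.toCla.continuous.comp M.continuous

/-- Every locally analytic function is given by a family of power series. -/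
theorem Cla.exists_toCla (f : Cla L n K V (⊤ : Opens X)) :
    ∃ (J : VIndex L n K V (⊤ : Opens X)) (p : J.Series), J.toCla p = f := by
  have h : ∀ x, ∃ (D : PolyChart L n X) (B : BHSubspace K V) (g : PowSer K D.radius B.E),
      x ∈ D.source ∧ ∀ y ∈ D.source, f ⟨y, trivial⟩ = B.ι (g.eval (D.coord y)) := by
    intro x
    obtain ⟨B, ρ, hρ, h⟩ := (f.isLocAnAt_top x).exists_ball
      (IsManifold.chart_mem_maximalAtlas (I := 𝓘(L, Fin n → L)) x) (mem_chart_source _ x) univ_mem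
    obtain ⟨hsub, hx, -, g, hg⟩ := h ρ hρ le_rfl
    exact ⟨PolyChart.ball _ _ _ ρ hρ hsub, B, g, hx, hg⟩
  choose D B g hD hg using h
  obtain ⟨J, ξ, c, hc⟩ := exists_refinement D B hD
  refine ⟨J, fun i => c i (g (ξ i)), Cla.ext fun x => ?_⟩
  have hx := J.mem_index x
  rw [J.toCla_apply _ hx, hg (ξ (J.index x)) x (hc _ _ hx).1]
  exact (hc _ _ hx).2 _

/-- Every polydisc is a member of some disjoint covering. -/
theorem exists_vIndex_of_polyChart (D : PolyChart L n X) (B : BHSubspace K V) :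
    ∃ (J : VIndex L n K V (⊤ : Opens X)) (i : J.I), J.polyChart i = D ∧ J.B i = B := by
  classical
  let U : Opens X := ⟨D.sourceᶜ, D.isCompact_source.isClosed.isOpen_compl⟩
  have h : ∀ x : X, ∃ D₁ : PolyChart L n X, x ∈ U → x ∈ D₁.source ∧ D₁.source ⊆ U := by
    intro x
    by_cases hx : x ∈ U
    · obtain ⟨ρ, hρ, h⟩ := PolyChart.eventually_ball
        (IsManifold.chart_mem_maximalAtlas (I := 𝓘(L, Fin n → L)) x) (mem_chart_source _ x)
        (U.isOpen.mem_nhds hx)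
      obtain ⟨hsub, h1, h2⟩ := h ρ hρ le_rfl
      exact ⟨_, fun _ => ⟨h1, h2⟩⟩
    · exact ⟨D, fun h => absurd h hx⟩
  choose D₁ hD₁ using h
  obtain ⟨I, D', ξ, hd, hc, hξ⟩ := exists_partition U D₁ (fun x hx => (hD₁ x hx).1)
    fun x hx => (hD₁ x hx).2
  let D'' : Option I → PolyChart L n X := fun i => i.elim D D'
  have hI : ∀ i, (D' i).source ⊆ D.sourceᶜ := fun i => by
    have := Set.subset_iUnion (fun i => (D' i).source) i
    rwa [hc] at this
  have hd'' : Pairwise fun i j => Disjoint (D'' i).source (D'' j).source := by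
    rintro (_ | i) (_ | j) hij
    · exact absurd rfl hij
    · exact Set.disjoint_left.2 fun x hx hx' => hI j hx' hx
    · exact Set.disjoint_left.2 fun x hx hx' => hI i hx hx'
    · exact hd fun h => hij (congrArg some h)
  have hc'' : ⋃ i, (D'' i).source = ((⊤ : Opens X) : Set X) := by
    rw [Set.iUnion_option]
    change D.source ∪ ⋃ i, (D' i).source = Set.univ
    rw [hc]
    exact Set.union_compl_self _
  exact ⟨VIndex.ofPolyChart D'' hd'' hc'' fun _ => B, none, rfl, rfl⟩

theorem exists_rigCla (D : PolyChart L n X) (B : BHSubspace K V) :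
    ∃ T : PowSer K D.radius B.E →L[K] Cla L n K V (⊤ : Opens X), ∀ g (y : X),
      (y ∈ D.source → T g ⟨y, trivial⟩ = B.ι (g.eval (D.coord y))) ∧
      (y ∉ D.source → T g ⟨y, trivial⟩ = 0) := by
  classical
  obtain ⟨J, i, rfl, rfl⟩ := exists_vIndex_of_polyChart D B
  refine ⟨J.toCla.comp (ContinuousLinearMap.single K
    (fun i => PowSer K (J.polyChart i).radius (J.B i).E) i),
      fun g y => ⟨fun hy => ?_, fun hy => ?_⟩⟩
  · rw [ContinuousLinearMap.comp_apply, J.toCla_apply _ hy, ContinuousLinearMap.single_apply,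
      Pi.single_eq_same]
  · have hyi := J.mem_index ⟨y, trivial⟩
    rw [ContinuousLinearMap.comp_apply, J.toCla_apply _ hyi, ContinuousLinearMap.single_apply,
      Pi.single_eq_of_ne, ← PowSer.evalL_apply ((J.polyChart _).coord_le hyi), map_zero, map_zero]
    rintro h
    rw [h] at hyi
    exact hy hyi

/-- The extension by zero of a function given by a power series on a polydisc. -/
def rigCla (D : PolyChart L n X) (B : BHSubspace K V) :
    PowSer K D.radius B.E →L[K] Cla L n K V (⊤ : Opens X) := (exists_rigCla D B).choose

theorem rigCla_apply (D : PolyChart L n X) (B : BHSubspace K V) (g : PowSer K D.radius B.E) {y : X}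
    (hy : y ∈ D.source) : rigCla D B g ⟨y, trivial⟩ = B.ι (g.eval (D.coord y)) :=
  ((exists_rigCla D B).choose_spec g y).1 hy

theorem rigCla_apply_of_notMem (D : PolyChart L n X) (B : BHSubspace K V)
    (g : PowSer K D.radius B.E) {y : X} (hy : y ∉ D.source) : rigCla D B g ⟨y, trivial⟩ = 0 :=
  ((exists_rigCla D B).choose_spec g y).2 hy

theorem toGerm_rigCla {x : X} (D : PolyChart L n X) (hx : x ∈ D.source) (B : BHSubspace K V)
    (g : PowSer K D.radius B.E) :
    Cla.toGerm L n K V (Opens.mem_top x) (rigCla D B g) = rigGerm D hx B g := by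
  refine ClaGerm.ext ?_
  rw [germ_rigGerm, Cla.germ_toGerm_top]
  refine Germ.coe_eq.2 ?_
  filter_upwards [D.isOpen_source.mem_nhds hx] with y hy
  exact rigCla_apply D B g hy

end Global

/-- Every germ comes from a power series on an arbitrarily small polydisc. -/
theorem ClaGerm.exists_rigGerm {x : X} (F : ClaGerm L n K V x)
    {φ : OpenPartialHomeomorph X (Fin n → L)} (hφ : φ ∈ charts L n X) (hx : x ∈ φ.source) :
    ∃ (B : BHSubspace K V) (ρ₀ : ℝ≥0), 0 < ρ₀ ∧
      ∀ (ρ : ℝ≥0) (hρ : 0 < ρ), ρ ≤ ρ₀ → ∃ (hsub : polyBall (φ x) (fun _ => ρ) ⊆ φ.target)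
        (hxs : x ∈ (PolyChart.ball φ hφ (φ x) ρ hρ hsub).source)
        (g : PowSer K (fun _ : Fin n => ρ) B.E),
        rigGerm (PolyChart.ball φ hφ (φ x) ρ hρ hsub) hxs B g = F := by
  obtain ⟨f, hfF, hf⟩ := F.2
  obtain ⟨B, ρ₀, hρ₀, h⟩ := hf.exists_ball hφ hx univ_mem
  refine ⟨B, ρ₀, hρ₀, fun ρ hρ hle => ?_⟩
  obtain ⟨hsub, hxs, -, g, hg⟩ := h ρ hρ hle
  refine ⟨hsub, hxs, g, ClaGerm.ext ?_⟩
  rw [germ_rigGerm, ClaGerm.germ, ← hfF]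
  refine Germ.coe_eq.2 ?_
  filter_upwards [(PolyChart.isOpen_source _).mem_nhds hxs] with y hy
  rw [hg y hy]
  rfl

end Cla

/-! ### Taylor coefficients of germs -/

section Interp

variable {L : Type*} [NontriviallyNormedField L] {K : Type*} [NontriviallyNormedField K]
  [NormedAlgebra L K] {n : ℕ} {V : Type*} [AddCommGroup V] [Module K V]

theorem interpSum_add (i : Fin n →₀ ℕ) (t : L) (F G : (Fin n → L) → V) :
    interpSum (K := K) i t (fun y => F y + G y) =
      interpSum (K := K) i t F + interpSum (K := K) i t G := by
  simp only [interpSum, smul_add, Finset.sum_add_distrib]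

theorem interpSum_smul (i : Fin n →₀ ℕ) (t : L) (c : K) (F : (Fin n → L) → V) :
    interpSum (K := K) i t (fun y => c • F y) = c • interpSum (K := K) i t F := by
  simp only [interpSum, Finset.smul_sum]
  exact Finset.sum_congr rfl fun y _ => smul_comm _ _ _

theorem map_interpSum {W : Type*} [AddCommGroup W] [Module K W] (T : V →ₗ[K] W) (i : Fin n →₀ ℕ)
    (t : L) (F : (Fin n → L) → V) :
    T (interpSum (K := K) i t F) = interpSum (K := K) i t fun y => T (F y) := by
  simp only [interpSum, map_sum, map_smul]

theorem interpSum_congr {F G : (Fin n → L) → V} (h : F =ᶠ[𝓝 0] G) (i : Fin n →₀ ℕ) :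
    ∀ᶠ t : L in 𝓝[≠] 0, interpSum (K := K) i t F = interpSum (K := K) i t G := by
  have h1 : ∀ y ∈ (interp L i).support, ∀ᶠ t : L in 𝓝[≠] 0, F (t • y) = G (t • y) := by
    intro y _
    have : Tendsto (fun t : L => t • y) (𝓝[≠] 0) (𝓝 0) := by
      have h2 : Tendsto (fun t : L => t • y) (𝓝 0) (𝓝 ((0 : L) • y)) :=
        (continuous_id.smul continuous_const).tendsto _
      rw [zero_smul] at h2
      exact h2.mono_left nhdsWithin_le_nhds
    exact this.eventually h
  filter_upwards [(Finset.eventually_all _).2 h1] with t ht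
  exact Finset.sum_congr rfl fun y hy => by rw [ht y hy]

theorem PowSer.eq_zero_of_eval [IsUltrametricDist K] {E : Type w} [NormedAddCommGroup E]
    [NormedSpace K E] [IsUltrametricDist E] [CompleteSpace E] {r : Fin n → ℝ≥0}
    [Fact (∀ j, 0 < r j)] {g : PowSer K r E} (h : ∀ᶠ y : Fin n → L in 𝓝 0, g.eval y = 0) :
    g = 0 := by
  refine PowSer.ext fun i => tendsto_nhds_unique (tendsto_interpSum (L := L) i g) ?_
  refine tendsto_const_nhds.congr' ?_
  filter_upwards [interpSum_congr (K := K) (G := fun _ => (0 : E)) h i] with t ht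
  rw [ht]
  simp only [interpSum, smul_zero, Finset.sum_const_zero]
  rfl

end Interp

section Taylor

variable {L : Type uL} [NontriviallyNormedField L] [IsUltrametricDist L] {n : ℕ}
  {K : Type uK} [NontriviallyNormedField K] [IsUltrametricDist K] [CompleteSpace K]
  [NormedAlgebra L K]
  {X : Type uG} [TopologicalSpace X] [ChartedSpace (Fin n → L) X]
  [IsManifold 𝓘(L, Fin n → L) ω X]
  {V : Type uV} [AddCommGroup V] [Module K V] [TopologicalSpace V]
  [IsTopologicalAddGroup V] [ContinuousSMul K V] [T2Space V]

theorem tendsto_const_add_zero {A : Type*} [AddMonoid A] [TopologicalSpace A] [ContinuousAdd A]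
    (a : A) : Tendsto (fun z => a + z) (𝓝 0) (𝓝 a) := by
  have h : Tendsto (fun z => a + z) (𝓝 0) (𝓝 (a + 0)) :=
    tendsto_const_nhds.add tendsto_id
  rwa [add_zero] at h

theorem tendsto_chart_symm {φ : OpenPartialHomeomorph X (Fin n → L)} {x : X} (hx : x ∈ φ.source) :
    Tendsto (fun z => φ.symm (φ x + z)) (𝓝 0) (𝓝 x) := by
  have h2 := (φ.continuousAt_symm (φ.map_source hx)).tendsto.comp (tendsto_const_add_zero (φ x))
  rwa [φ.left_inv hx] at h2

/-- By the identity theorem for power series, `C^rig(U, E)` is contained in the space of germs. -/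
theorem rigGerm_injective {x : X} (D : PolyChart L n X) (hx : x ∈ D.source) (B : BHSubspace K V) :
    Function.Injective (rigGerm D hx B) := by
  -- re-expand at `x`, where the vanishing of the germ can be used
  have hb : polyBall (D.chart x) D.radius = polyBall D.center D.radius := by
    have hx' : D.chart x ∈ polyBall D.center D.radius := D.target_eq ▸ D.chart.map_source hx
    rw [polyBall_eq_pi, polyBall_eq_pi]
    congr 1
    funext j
    exact (IsUltrametricDist.closedBall_eq_of_mem (by
      rw [mem_closedBall_iff_norm]; exact hx' j)).symm
  let D' : PolyChart L n X := ⟨D.chart, D.mem, D.chart x, D.radius, D.radius_pos,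
    D.target_eq.trans hb.symm⟩
  have hsub : D'.IsSub D := ⟨subset_rfl, fun _ => rfl, fun _ => le_rfl⟩
  rw [injective_iff_map_eq_zero]
  intro g hg
  have h1 : ∀ᶠ y in 𝓝 x, g.eval (D.coord y) = 0 := by
    have h2 := congrArg ClaGerm.germ hg
    rw [germ_rigGerm] at h2
    have h3 : (fun y => B.ι (g.eval (D.coord y))) =ᶠ[𝓝 x] fun _ => 0 := Germ.coe_eq.1 h2
    filter_upwards [h3] with y hy
    exact B.injective (hy.trans (map_zero _).symm)
  have h2 : PolyChart.recenter B.E hsub g = 0 := by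
    refine PowSer.eq_zero_of_eval (L := L) ?_
    have h3 := tendsto_chart_symm (φ := D.chart) hx
    have h4 : ∀ᶠ z in 𝓝 (0 : Fin n → L), D.chart x + z ∈ D.chart.target :=
      (tendsto_const_add_zero (D.chart x)).eventually
        (D.chart.open_target.mem_nhds (D.chart.map_source hx))
    filter_upwards [h3.eventually h1, h3.eventually (D.isOpen_source.mem_nhds hx), h4]
      with z hz1 hz2 hz3
    have := PolyChart.eval_recenter hsub (y := D.chart.symm (D.chart x + z)) hz2 g
    rw [hz1] at this
    rw [← this]
    congr 1
    change z = D.chart _ - D.chart x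
    rw [D.chart.right_inv hz3, add_sub_cancel_left]
  refine PowSer.eq_zero_of_eval (L := L) ?_
  have h5 : polyBall (0 : Fin n → L) D.radius ∈ 𝓝 0 :=
    (isOpen_polyBall 0 D.radius_pos).mem_nhds (mem_polyBall_self _ _)
  filter_upwards [h5] with z hz
  obtain ⟨y, hy, rfl⟩ := D.exists_coord_eq (y := z) (by simpa [polyBall] using hz)
  rw [← PolyChart.eval_recenter hsub hy g, h2]
  exact map_zero (PowSer.evalL B.E (D'.coord y) (D'.coord_le hy))

theorem rigGerm_congr {x : X} {D D' : PolyChart L n X} {hx : x ∈ D.source} {hx' : x ∈ D'.source}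
    {B : BHSubspace K V} {g : PowSer K D.radius B.E} {g' : PowSer K D'.radius B.E}
    (h : ∀ᶠ y in 𝓝 x, g.eval (D.coord y) = g'.eval (D'.coord y)) :
    rigGerm D hx B g = rigGerm D' hx' B g' := by
  refine ClaGerm.ext ?_
  rw [germ_rigGerm, germ_rigGerm]
  refine Germ.coe_eq.2 ?_
  filter_upwards [h] with y hy
  rw [hy]

theorem exists_rigGerm_ball {x : X} (D : PolyChart L n X) (hx : x ∈ D.source) (B : BHSubspace K V)
    {φ : OpenPartialHomeomorph X (Fin n → L)} (hφ : φ ∈ charts L n X) (hxφ : x ∈ φ.source) :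
    ∃ ρ₀ : ℝ≥0, 0 < ρ₀ ∧ ∀ (ρ : ℝ≥0) (hρ : 0 < ρ), ρ ≤ ρ₀ →
      ∃ (hsub : polyBall (φ x) (fun _ => ρ) ⊆ φ.target)
        (hxs : x ∈ (PolyChart.ball φ hφ (φ x) ρ hρ hsub).source)
        (Θ : PowSer K D.radius B.E →L[K] PowSer K (fun _ : Fin n => ρ) B.E),
        ∀ g, rigGerm D hx B g = rigGerm (PolyChart.ball φ hφ (φ x) ρ hρ hsub) hxs B (Θ g) := by
  obtain ⟨ρ₀, hρ₀, h⟩ := exists_pullback (K := K) B.E (contMDiffAt_id (x := x)) D hx hφ hxφ univ_mem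
  refine ⟨ρ₀, hρ₀, fun ρ hρ hle => ?_⟩
  obtain ⟨hsub, hxs, -, Θ, hΘ, -⟩ := h ρ hρ hle
  refine ⟨hsub, hxs, Θ, fun g => rigGerm_congr ?_⟩
  filter_upwards [(PolyChart.isOpen_source _).mem_nhds hxs] with y hy
  exact (hΘ y hy g).symm

/-- The chart at `x` belongs to the maximal atlas. -/
theorem chartAt_mem (x : X) : chartAt (Fin n → L) x ∈ charts L n X :=
  IsManifold.chart_mem_maximalAtlas (I := 𝓘(L, Fin n → L)) x

variable (L n) in
/-- The closed ball of radius `ρ` around `x` in the preferred chart at `x`. -/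
abbrev ballAt (x : X) (ρ : ℝ≥0) (hρ : 0 < ρ)
    (hsub : polyBall (chartAt (Fin n → L) x x) (fun _ => ρ) ⊆ (chartAt (Fin n → L) x).target) :
    PolyChart L n X :=
  PolyChart.ball (chartAt (Fin n → L) x) (chartAt_mem x) (chartAt (Fin n → L) x x) ρ hρ hsub

theorem mem_ballAt (x : X) (ρ : ℝ≥0) (hρ : 0 < ρ)
    (hsub : polyBall (chartAt (Fin n → L) x x) (fun _ => ρ) ⊆ (chartAt (Fin n → L) x).target) :
    x ∈ (ballAt L n x ρ hρ hsub).source := by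
  rw [PolyChart.source_ball]
  exact ⟨mem_chart_source _ x, mem_polyBall_self _ _⟩

/-- `v` is the coefficient at `i` of the germ `F` in the preferred chart at `x`. -/
def HasTaylor {x : X} (F : ClaGerm L n K V x) (i : Fin n →₀ ℕ) (v : V) : Prop :=
  ∀ f : X → V, F.germ = (f : Germ (𝓝 x) V) →
    Tendsto (fun t : L => interpSum (K := K) i t fun z =>
      f ((chartAt (Fin n → L) x).symm (chartAt (Fin n → L) x x + z))) (𝓝[≠] 0) (𝓝 v)

theorem ClaGerm.exists_germ_eq {x : X} (F : ClaGerm L n K V x) :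
    ∃ f : X → V, F.germ = (f : Germ (𝓝 x) V) := by
  obtain ⟨f, hf, -⟩ := F.2
  exact ⟨f, hf.symm⟩

theorem HasTaylor.unique {x : X} {F : ClaGerm L n K V x} {i : Fin n →₀ ℕ} {v v' : V}
    (h : HasTaylor F i v) (h' : HasTaylor F i v') : v = v' := by
  obtain ⟨f, hf⟩ := F.exists_germ_eq
  exact tendsto_nhds_unique (h f hf) (h' f hf)

theorem HasTaylor.of_tendsto {x : X} {F : ClaGerm L n K V x} {i : Fin n →₀ ℕ} {v : V} (f : X → V)
    (hf : F.germ = (f : Germ (𝓝 x) V)) (h : Tendsto (fun t : L => interpSum (K := K) i t fun z =>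
      f ((chartAt (Fin n → L) x).symm (chartAt (Fin n → L) x x + z))) (𝓝[≠] 0) (𝓝 v)) :
    HasTaylor F i v := by
  intro f' hf'
  have h1 : ∀ᶠ y in 𝓝 x, f y = f' y := Germ.coe_eq.1 (hf.symm.trans hf')
  have h2 := (tendsto_chart_symm (mem_chart_source (Fin n → L) x)).eventually h1
  exact h.congr' (interpSum_congr h2 i)

theorem hasTaylor_rigGerm {x : X} {ρ : ℝ≥0} (hρ : 0 < ρ)
    (hsub : polyBall (chartAt (Fin n → L) x x) (fun _ => ρ) ⊆ (chartAt (Fin n → L) x).target)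
    (B : BHSubspace K V) (g : PowSer K (fun _ : Fin n => ρ) B.E) (i : Fin n →₀ ℕ) :
    HasTaylor (rigGerm (ballAt L n x ρ hρ hsub) (mem_ballAt x ρ hρ hsub) B g) i
      (B.ι (g.coeff i)) := by
  have : Fact (∀ _ : Fin n, 0 < ρ) := ⟨fun _ => hρ⟩
  refine HasTaylor.of_tendsto _ (germ_rigGerm _ _ _ _) ?_
  refine ((B.ι.continuous.tendsto _).comp (PowSer.tendsto_interpSum (L := L) i g)).congr' ?_
  have h4 : ∀ᶠ z in 𝓝 (0 : Fin n → L),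
      chartAt (Fin n → L) x x + z ∈ (chartAt (Fin n → L) x).target :=
    (tendsto_const_add_zero _).eventually
      ((chartAt _ x).open_target.mem_nhds (mem_chart_target _ x))
  have h5 : (fun z => B.ι (g.eval z)) =ᶠ[𝓝 0] fun z => B.ι (g.eval ((ballAt L n x ρ hρ hsub).coord
      ((chartAt (Fin n → L) x).symm (chartAt (Fin n → L) x x + z)))) := by
    filter_upwards [h4] with z hz
    congr 2
    rw [PolyChart.coord_ball, (chartAt (Fin n → L) x).right_inv hz, add_sub_cancel_left]
  filter_upwards [interpSum_congr (K := K) h5 i] with t ht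
  rw [← ht, Function.comp_apply]
  exact map_interpSum B.ι.toLinearMap i t _

theorem ClaGerm.exists_ballAt {x : X} (F : ClaGerm L n K V x) :
    ∃ (B : BHSubspace K V) (ρ₀ : ℝ≥0), 0 < ρ₀ ∧ ∀ (ρ : ℝ≥0) (hρ : 0 < ρ), ρ ≤ ρ₀ →
      ∃ (hsub : polyBall (chartAt (Fin n → L) x x) (fun _ => ρ) ⊆ (chartAt (Fin n → L) x).target)
        (g : PowSer K (fun _ : Fin n => ρ) B.E),
        rigGerm (ballAt L n x ρ hρ hsub) (mem_ballAt x ρ hρ hsub) B g = F := by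
  obtain ⟨B, ρ₀, hρ₀, h⟩ := F.exists_rigGerm (chartAt_mem x) (mem_chart_source _ x)
  refine ⟨B, ρ₀, hρ₀, fun ρ hρ hle => ?_⟩
  obtain ⟨hsub, _, g, hg⟩ := h ρ hρ hle
  exact ⟨hsub, g, hg⟩

theorem ClaGerm.exists_hasTaylor {x : X} (F : ClaGerm L n K V x) (i : Fin n →₀ ℕ) :
    ∃ v, HasTaylor F i v := by
  obtain ⟨B, ρ₀, hρ₀, h⟩ := F.exists_ballAt
  obtain ⟨hsub, g, rfl⟩ := h ρ₀ hρ₀ le_rfl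
  exact ⟨_, hasTaylor_rigGerm hρ₀ hsub B g i⟩

/-- The Taylor coefficients of germs at `x` in the preferred chart, as a linear map. -/
def taylorₗ (x : X) (i : Fin n →₀ ℕ) : ClaGerm L n K V x →ₗ[K] V where
  toFun F := (F.exists_hasTaylor i).choose
  map_add' F G := by
    obtain ⟨f, hf⟩ := F.exists_germ_eq
    obtain ⟨g, hg⟩ := G.exists_germ_eq
    refine ((F + G).exists_hasTaylor i).choose_spec.unique (HasTaylor.of_tendsto (f + g) ?_ ?_)
    · rw [Germ.coe_add, ← hf, ← hg]
      rfl
    · refine (((F.exists_hasTaylor i).choose_spec f hf).add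
        ((G.exists_hasTaylor i).choose_spec g hg)).congr fun t => ?_
      rw [← interpSum_add]
      rfl
  map_smul' c F := by
    obtain ⟨f, hf⟩ := F.exists_germ_eq
    refine ((c • F).exists_hasTaylor i).choose_spec.unique (HasTaylor.of_tendsto (c • f) ?_ ?_)
    · rw [Germ.coe_smul, ← hf]
      rfl
    · refine (((F.exists_hasTaylor i).choose_spec f hf).const_smul c).congr fun t => ?_
      rw [← interpSum_smul]
      rfl

theorem taylorₗ_rigGerm {x : X} {ρ : ℝ≥0} (hρ : 0 < ρ)
    (hsub : polyBall (chartAt (Fin n → L) x x) (fun _ => ρ) ⊆ (chartAt (Fin n → L) x).target)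
    (hxs : x ∈ (ballAt L n x ρ hρ hsub).source)
    (B : BHSubspace K V) (g : PowSer K (fun _ : Fin n => ρ) B.E) (i : Fin n →₀ ℕ) :
    taylorₗ x i (rigGerm (ballAt L n x ρ hρ hsub) hxs B g) = B.ι (g.coeff i) :=
  (ClaGerm.exists_hasTaylor _ i).choose_spec.unique (hasTaylor_rigGerm hρ hsub B g i)

/-- The Taylor coefficients of germs at `x`, as a continuous linear map. -/
def taylor (hV : IsLocConvex K (inferInstance : TopologicalSpace V)) (x : X) (i : Fin n →₀ ℕ) :
    ClaGerm L n K V x →L[K] V where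
  toLinearMap := taylorₗ x i
  cont := by
    refine ClaGerm.continuous_of_rigGerm hV _ fun D hx B => ?_
    obtain ⟨ρ, hρ, h⟩ := exists_rigGerm_ball D hx B (chartAt_mem x) (mem_chart_source _ x)
    obtain ⟨hsub, hxs, Θ, hΘ⟩ := h ρ hρ le_rfl
    have : Fact (∀ _ : Fin n, 0 < ρ) := ⟨fun _ => hρ⟩
    have h2 : taylorₗ x i ∘ rigGerm D hx B =
        fun g => B.ι (PowSer.coeffL (fun _ => ρ) B.E i (Θ g)) := by
      funext g
      rw [Function.comp_apply, hΘ, taylorₗ_rigGerm]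
      rfl
    rw [h2]
    exact B.ι.continuous.comp ((PowSer.coeffL _ _ i).continuous.comp Θ.continuous)

theorem taylor_rigGerm (hV : IsLocConvex K (inferInstance : TopologicalSpace V)) {x : X} {ρ : ℝ≥0}
    (hρ : 0 < ρ)
    (hsub : polyBall (chartAt (Fin n → L) x x) (fun _ => ρ) ⊆ (chartAt (Fin n → L) x).target)
    (hxs : x ∈ (ballAt L n x ρ hρ hsub).source)
    (B : BHSubspace K V) (g : PowSer K (fun _ : Fin n => ρ) B.E) (i : Fin n →₀ ℕ) :
    taylor hV x i (rigGerm (ballAt L n x ρ hρ hsub) hxs B g) = B.ι (g.coeff i) :=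
  taylorₗ_rigGerm hρ hsub hxs B g i

theorem ClaGerm.eq_zero_of_taylor (hV : IsLocConvex K (inferInstance : TopologicalSpace V)) {x : X}
    {F : ClaGerm L n K V x} (h : ∀ i, taylor hV x i F = 0) : F = 0 := by
  obtain ⟨B, ρ, hρ, hF⟩ := F.exists_ballAt
  obtain ⟨hsub, g, rfl⟩ := hF ρ hρ le_rfl
  have : g = 0 := PowSer.ext fun i => B.injective <| by
    rw [← taylor_rigGerm hV hρ hsub (mem_ballAt x ρ hρ hsub) B g i, h i]
    exact (map_zero _).symm
  rw [this, map_zero]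

end Taylor

/-! ### Bounded sets in locally convex inductive limits -/

section Bounded

variable {K : Type*} [NontriviallyNormedField K] [IsUltrametricDist K]

theorem isLocConvex_of_isUltrametricDist (F : Type*) [NormedAddCommGroup F] [NormedSpace K F]
    [IsUltrametricDist F] : IsLocConvex K (inferInstance : TopologicalSpace F) := by
  refine ⟨inferInstance, inferInstance, ⟨?_⟩⟩
  refine Metric.nhds_basis_ball.to_hasBasis (fun ε hε => ?_) fun N hN => Metric.mem_nhds_iff.1 hN
  let N : Submodule (IntegerRing K) F :=
    { carrier := Metric.ball 0 ε
      zero_mem' := Metric.mem_ball_self hε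
      add_mem' := by
        intro a b ha hb
        rw [mem_ball_zero_iff] at *
        exact (IsUltrametricDist.norm_add_le_max a b).trans_lt (max_lt ha hb)
      smul_mem' := by
        rintro ⟨c, hc⟩ a ha
        rw [mem_ball_zero_iff] at *
        have hc' : ‖c‖ ≤ 1 := by
          rw [Valuation.mem_integer_iff, NormedField.valuation_apply] at hc
          exact_mod_cast hc
        rw [Subring.smul_def, norm_smul]
        exact (mul_le_of_le_one_left (norm_nonneg _) hc').trans_lt ha }
  exact ⟨N, Metric.ball_mem_nhds 0 hε, subset_rfl⟩

instance {α : Type*} [TopologicalSpace α] {F : Type*} [SeminormedAddCommGroup F]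
    [IsUltrametricDist F] : IsUltrametricDist (BoundedContinuousFunction α F) := by
  refine IsUltrametricDist.isUltrametricDist_of_forall_norm_add_le_max_norm fun f g => ?_
  refine (BoundedContinuousFunction.norm_le (le_max_of_le_left (norm_nonneg f))).2 fun x => ?_
  exact (IsUltrametricDist.norm_add_le_max _ _).trans
    (max_le_max (f.norm_coe_le_norm x) (g.norm_coe_le_norm x))

/-- A neighbourhood of zero absorbs every point, in terms of scalars. -/
theorem exists_smul_mem {S : Type*} [AddCommGroup S] [Module K S] [TopologicalSpace S]
    [ContinuousSMul K S] {N : Set S} (hN : N ∈ 𝓝 0) (s : S) : ∃ c : K, c ≠ 0 ∧ c • s ∈ N := by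
  have h1 : Tendsto (fun c : K => c • s) (𝓝[≠] 0) (𝓝 0) := by
    have h2 : Tendsto (fun c : K => c • s) (𝓝 0) (𝓝 ((0 : K) • s)) :=
      (continuous_id.smul continuous_const).tendsto _
    rw [zero_smul] at h2
    exact h2.mono_left nhdsWithin_le_nhds
  obtain ⟨c, h, hc⟩ := ((h1.eventually hN).and self_mem_nhdsWithin).exists
  exact ⟨c, hc, h⟩

/-- A sequence of functionals on a locally convex inductive limit which is eventually bounded on
some neighbourhood of zero in every step is uniformly bounded on bounded sets: it defines a
continuous linear map to the space of bounded sequences. -/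
theorem exists_bound_of_steps {A : Type*} [AddCommGroup A] [Module K A] [TopologicalSpace A]
    {ι : Type*} {S : ι → Type*} [∀ i, AddCommGroup (S i)] [∀ i, Module K (S i)]
    [∀ i, TopologicalSpace (S i)] [∀ i, IsTopologicalAddGroup (S i)]
    [∀ i, ContinuousSMul K (S i)] (σ : ∀ i, S i →L[K] A)
    (hcont : ∀ T : A →ₗ[K] BoundedContinuousFunction ℕ K,
      (∀ i, Continuous (T ∘ σ i)) → Continuous T)
    (hsurj : ∀ a, ∃ i s, σ i s = a) (ℓ : ℕ → A →L[K] K)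
    (h : ∀ i, ∃ N ∈ 𝓝 (0 : S i), ∃ k₀, ∀ k ≥ k₀, ∀ s ∈ N, ‖ℓ k (σ i s)‖ ≤ 1)
    {B : Set A} (hB : Bornology.IsVonNBounded K B) : ∃ C, ∀ a ∈ B, ∀ k, ‖ℓ k a‖ ≤ C := by
  have h' : ∀ i, ∃ N ∈ 𝓝 (0 : S i), ∀ k, ∀ s ∈ N, ‖ℓ k (σ i s)‖ ≤ 1 := by
    intro i
    obtain ⟨N, hN, k₀, hk⟩ := h i
    have h1 : ∀ k < k₀, {s : S i | ‖ℓ k (σ i s)‖ ≤ 1} ∈ 𝓝 (0 : S i) := by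
      intro k _
      have h2 : Tendsto (fun s => ‖ℓ k (σ i s)‖) (𝓝 (0 : S i)) (𝓝 ‖ℓ k (σ i 0)‖) :=
        (((ℓ k).comp (σ i)).continuous.norm).tendsto 0
      rw [map_zero, map_zero, norm_zero] at h2
      exact h2.eventually (ge_mem_nhds zero_lt_one)
    refine ⟨N ∩ ⋂ k ∈ Set.Iio k₀, {s : S i | ‖ℓ k (σ i s)‖ ≤ 1},
      inter_mem hN ((biInter_mem (Set.finite_Iio k₀)).2 h1), fun k s hs => ?_⟩
    rcases lt_or_ge k k₀ with hlt | hge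
    · exact Set.mem_iInter₂.1 hs.2 k hlt
    · exact hk k hge s hs.1
  have hbd : ∀ a, ∃ C, ∀ k, ‖ℓ k a‖ ≤ C := by
    intro a
    obtain ⟨i, s, rfl⟩ := hsurj a
    obtain ⟨N, hN, hk⟩ := h' i
    obtain ⟨c, hc, hcs⟩ := exists_smul_mem (K := K) hN s
    refine ⟨‖c‖⁻¹, fun k => ?_⟩
    have := hk k _ hcs
    rw [map_smul, map_smul, norm_smul] at this
    rwa [← one_div, le_div_iff₀ (norm_pos_iff.2 hc), mul_comm]
  choose C hC using hbd
  let Λ : A →ₗ[K] BoundedContinuousFunction ℕ K :=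
    { toFun := fun a => BoundedContinuousFunction.ofNormedAddCommGroupDiscrete
        (fun k => ℓ k a) (C a) (hC a)
      map_add' := fun a b => BoundedContinuousFunction.ext fun k => map_add (ℓ k) a b
      map_smul' := fun c a => BoundedContinuousFunction.ext fun k => map_smul (ℓ k) c a }
  have hΛ : Continuous Λ := by
    refine hcont Λ fun i => ?_
    let M : S i →ₗ[K] BoundedContinuousFunction ℕ K := Λ ∘ₗ (σ i).toLinearMap
    change Continuous M
    refine continuous_of_continuousAt_zero M ?_
    rw [ContinuousAt, map_zero, Metric.tendsto_nhds]
    intro ε hε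
    obtain ⟨N, hN, hk⟩ := h' i
    obtain ⟨c, hc0, hcε⟩ := NormedField.exists_norm_lt K hε
    have hc : c ≠ 0 := norm_pos_iff.1 hc0
    have hcN : (fun s : S i => c⁻¹ • s) ⁻¹' N ∈ 𝓝 (0 : S i) := by
      refine (continuous_const_smul c⁻¹).continuousAt.preimage_mem_nhds ?_
      rwa [smul_zero]
    filter_upwards [hcN] with s hs
    rw [dist_zero_right]
    refine lt_of_le_of_lt ((BoundedContinuousFunction.norm_le (norm_nonneg c)).2 fun k => ?_) hcε
    have := hk k _ hs
    rw [map_smul, map_smul, norm_smul, norm_inv] at this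
    rwa [← div_eq_inv_mul, div_le_one hc0] at this
  obtain ⟨R, hR⟩ := (NormedSpace.isVonNBounded_iff K).1
    (hB.image (⟨Λ, hΛ⟩ : A →L[K] BoundedContinuousFunction ℕ K)) |>.exists_norm_le
  exact ⟨R, fun a ha k => (BoundedContinuousFunction.norm_coe_le_norm (Λ a) k).trans
    (hR _ ⟨a, ha, rfl⟩)⟩

/-- A continuous functional on a product depends on finitely many coordinates only. -/
theorem exists_finset_eq_zero {ι : Type*} {S : ι → Type*} [∀ i, AddCommGroup (S i)]
    [∀ i, Module K (S i)] [∀ i, TopologicalSpace (S i)] (ℓ : (∀ i, S i) →L[K] K) :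
    ∃ t : Finset ι, ∀ p, (∀ i ∈ t, p i = 0) → ℓ p = 0 := by
  have h : ℓ ⁻¹' Metric.ball 0 1 ∈ 𝓝 (0 : ∀ i, S i) :=
    ℓ.continuous.continuousAt.preimage_mem_nhds (by
      rw [map_zero]; exact Metric.ball_mem_nhds 0 one_pos)
  rw [nhds_pi, Filter.mem_pi] at h
  obtain ⟨I, hI, u, hu, hsub⟩ := h
  refine ⟨hI.toFinset, fun p hp => ?_⟩
  by_contra hne
  obtain ⟨c, hc⟩ := NormedField.exists_lt_norm K ‖ℓ p‖⁻¹
  have : c • p ∈ ℓ ⁻¹' Metric.ball 0 1 := hsub fun i hi => by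
    rw [Pi.smul_apply, hp i (hI.mem_toFinset.2 hi), smul_zero]
    exact mem_of_mem_nhds (hu i)
  rw [Set.mem_preimage, mem_ball_zero_iff, map_smul, norm_smul] at this
  have h0 := norm_pos_iff.2 hne
  rw [inv_lt_iff_one_lt_mul₀ h0] at hc
  linarith

theorem exists_finset_eq_sum {ι : Type*} [DecidableEq ι] {S : ι → Type*}
    [∀ i, AddCommGroup (S i)] [∀ i, Module K (S i)] [∀ i, TopologicalSpace (S i)]
    (ℓ : (∀ i, S i) →L[K] K) :
    ∃ t : Finset ι, ∀ p, ℓ p = ∑ i ∈ t, ℓ (Pi.single i (p i)) := by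
  obtain ⟨t, ht⟩ := exists_finset_eq_zero ℓ
  refine ⟨t, fun p => ?_⟩
  rw [← sub_eq_zero, ← map_sum, ← map_sub]
  refine ht _ fun i hi => ?_
  rw [Pi.sub_apply, Finset.sum_apply, Finset.sum_eq_single i, Pi.single_eq_same, sub_self]
  · intro j _ hj
    rw [Pi.single_eq_of_ne hj.symm]
  · exact fun h => absurd hi h

end Bounded

/-! ### Approximation in strong duals -/

section Approx

variable {K : Type*} [NontriviallyNormedField K] {A : Type*} [AddCommGroup A] [Module K A]
  [TopologicalSpace A]

/-- The function `θ` on `A` is uniformly approximated by elements of `𝒮` on the set `B`. -/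
def Approximable (𝒮 : Submodule K (A →L[K] K)) (B : Set A) (θ : A → K) : Prop :=
  ∀ ε > 0, ∃ d ∈ 𝒮, ∀ a ∈ B, ‖θ a - d a‖ ≤ ε

variable {𝒮 : Submodule K (A →L[K] K)} {B : Set A}

theorem approximable_of_mem {d : A →L[K] K} (hd : d ∈ 𝒮) : Approximable 𝒮 B d :=
  fun ε hε => ⟨d, hd, fun a _ => by rw [sub_self, norm_zero]; exact hε.le⟩

theorem Approximable.congr {θ θ' : A → K} (h : Approximable 𝒮 B θ) (hθ : ∀ a ∈ B, θ a = θ' a) :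
    Approximable 𝒮 B θ' := fun ε hε => by
  obtain ⟨d, hd, h⟩ := h ε hε
  exact ⟨d, hd, fun a ha => hθ a ha ▸ h a ha⟩

theorem Approximable.const_mul {θ : A → K} (h : Approximable 𝒮 B θ) (c : K) :
    Approximable 𝒮 B fun a => c * θ a := fun ε hε => by
  obtain ⟨d, hd, h⟩ := h (ε / (‖c‖ + 1)) (by positivity)
  refine ⟨c • d, 𝒮.smul_mem c hd, fun a ha => ?_⟩
  rw [smul_apply, smul_eq_mul, ← mul_sub, norm_mul]
  calc ‖c‖ * ‖θ a - d a‖ ≤ (‖c‖ + 1) * (ε / (‖c‖ + 1)) := by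
        gcongr
        · linarith
        · exact h a ha
    _ = ε := by field_simp

theorem Approximable.sum {ι : Type*} (t : Finset ι) {θ : ι → A → K}
    (h : ∀ i ∈ t, Approximable 𝒮 B (θ i)) : Approximable 𝒮 B fun a => ∑ i ∈ t, θ i a := by
  classical
  induction t using Finset.induction_on with
  | empty => exact fun ε hε => ⟨0, 𝒮.zero_mem, fun a _ => by simpa using hε.le⟩
  | insert i t hi ih =>
    intro ε hε
    obtain ⟨d, hd, h1⟩ := h i (Finset.mem_insert_self _ _) (ε / 2) (half_pos hε)
    obtain ⟨d', hd', h2⟩ := ih (fun j hj => h j (Finset.mem_insert_of_mem hj)) (ε / 2) (half_pos hε)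
    refine ⟨d + d', 𝒮.add_mem hd hd', fun a ha => ?_⟩
    simp only [Finset.sum_insert hi, add_apply]
    rw [add_sub_add_comm]
    exact (norm_add_le _ _).trans (by linarith [h1 a ha, h2 a ha])

theorem Approximable.of_uniform {θ : A → K}
    (h : ∀ ε > 0, ∃ θ', Approximable 𝒮 B θ' ∧ ∀ a ∈ B, ‖θ a - θ' a‖ ≤ ε) :
    Approximable 𝒮 B θ := fun ε hε => by
  obtain ⟨θ', h1, h2⟩ := h (ε / 2) (half_pos hε)
  obtain ⟨d, hd, h3⟩ := h1 (ε / 2) (half_pos hε)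
  refine ⟨d, hd, fun a ha => ?_⟩
  rw [← sub_add_sub_cancel]
  exact (norm_add_le _ _).trans (by linarith [h2 a ha, h3 a ha])

/-- Closures in the strong dual are determined by uniform approximation on bounded sets. -/
theorem mem_closure_of_approximable {μ : A →L[K] K}
    (h : ∀ B : Set A, Bornology.IsVonNBounded K B → Approximable 𝒮 B μ) :
    μ ∈ closure (𝒮 : Set (A →L[K] K)) := by
  rw [mem_closure_iff_nhds]
  intro N hN
  have h1 : (fun ν => μ + ν) ⁻¹' N ∈ 𝓝 0 := tendsto_const_add_zero μ hN
  obtain ⟨⟨B, ε⟩, ⟨hB, hε⟩, hsub⟩ := (ContinuousLinearMap.hasBasis_nhds_zero_of_basis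
    Metric.nhds_basis_closedBall).mem_iff.1 h1
  obtain ⟨d, hd, hBd⟩ := h B hB ε hε
  refine ⟨d, ?_, hd⟩
  have h2 : d - μ ∈ (fun ν => μ + ν) ⁻¹' N := hsub fun a ha => by
    rw [mem_closedBall_zero_iff, sub_apply, norm_sub_rev]
    exact hBd a ha
  rwa [Set.mem_preimage, add_sub_cancel] at h2

end Approx

/-! ### Truncation of power series -/

section Truncation

variable {L : Type*} [NontriviallyNormedField L] {K : Type*} [NontriviallyNormedField K]
  [NormedAlgebra L K] {n : ℕ}

/-- The multi-indices of degree at most `m`. -/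
def degreeLE (n m : ℕ) : Finset (Fin n →₀ ℕ) :=
  Set.Finite.toFinset (s := {i : Fin n →₀ ℕ | i.degree ≤ m}) <| by
    have h := tendsto_degree_cofinite (n := n) (Ioi_mem_atTop m)
    refine Set.Finite.subset (s := {i : Fin n →₀ ℕ | m < i.degree}ᶜ) h fun i hi => ?_
    exact not_lt.2 (show i.degree ≤ m from hi)

theorem mem_degreeLE {m : ℕ} {i : Fin n →₀ ℕ} : i ∈ degreeLE n m ↔ i.degree ≤ m := by
  simp [degreeLE]

namespace PowSer

variable {E : Type w} [NormedAddCommGroup E] [NormedSpace K E]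

theorem coeff_restrict {r s : Fin n → ℝ≥0} (h : s ≤ r) (g : PowSer K r E) (i : Fin n →₀ ℕ) :
    (g.restrict h).coeff i = g.coeff i := by
  -- passing through `mk` avoids a comparison of power series on different polydiscs
  have h1 : ∀ (a : (Fin n →₀ ℕ) → E) (ha : Tendsto (fun i => weight s i * ‖a i‖) cofinite (𝓝 0)),
      (mk (K := K) a ha).coeff = a := fun _ _ => rfl
  exact congrFun (h1 g.coeff (squeeze_zero
    (fun i => mul_nonneg (weight_nonneg s i) (norm_nonneg _))
    (fun i => mul_le_mul_of_nonneg_right (weight_mono h i) (norm_nonneg _)) g.tendsto_coeff)) i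

theorem norm_restrict_le {r s : Fin n → ℝ≥0} (h : s ≤ r) (g : PowSer K r E) :
    ‖g.restrict h‖ ≤ ‖g‖ :=
  norm_le_of_forall fun i => by
    rw [coeff_restrict]
    exact (mul_le_mul_of_nonneg_right (weight_mono h i) (norm_nonneg _)).trans (g.le_norm i)

/-- On a smaller polydisc, the Taylor polynomials converge at a geometric rate. -/
theorem norm_restrict_sub_le {ρ σ : ℝ≥0} (hσ : 0 < σ) (h : ρ ≤ σ) (m : ℕ)
    (g : PowSer K (fun _ : Fin n => σ) E) :
    ‖g.restrict (fun _ => h) - ∑ i ∈ degreeLE n m, monomial (fun _ => ρ) i (g.coeff i)‖ ≤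
      (ρ / σ : ℝ) ^ m * ‖g‖ := by
  have hσ' : (0 : ℝ) < σ := by exact_mod_cast hσ
  refine norm_le_of_forall fun k => ?_
  rw [coeff_sub, coeff_sum, coeff_restrict]
  by_cases hk : k.degree ≤ m
  · rw [Finset.sum_eq_single k]
    · rw [coeff_monomial, if_pos rfl]
      rw [sub_self, norm_zero, mul_zero]
      positivity
    · intro i _ hik
      rw [coeff_monomial, if_neg hik.symm]
    · exact fun hk' => absurd (mem_degreeLE.2 hk) hk'
  · rw [Finset.sum_eq_zero, sub_zero]
    · have h1 := g.le_norm k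
      rw [weight_const] at h1 ⊢
      have h2 : (ρ / σ : ℝ) ^ k.degree ≤ (ρ / σ : ℝ) ^ m :=
        pow_le_pow_of_le_one (by positivity) ((div_le_one hσ').2 (by exact_mod_cast h))
          (not_le.1 hk).le
      calc (ρ : ℝ) ^ k.degree * ‖g.coeff k‖
          = (ρ / σ : ℝ) ^ k.degree * ((σ : ℝ) ^ k.degree * ‖g.coeff k‖) := by
            rw [div_pow]; field_simp
        _ ≤ _ := mul_le_mul h2 h1 (by positivity) (by positivity)
    · intro i hi
      rw [coeff_monomial, if_neg]
      rintro rfl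
      exact hk (mem_degreeLE.1 hi)

theorem norm_eval_sub_le [IsUltrametricDist E] [CompleteSpace E] {ρ σ : ℝ≥0} (hρ : 0 < ρ)
    (h : ρ ≤ σ) (m : ℕ) (g : PowSer K (fun _ : Fin n => σ) E) {z : Fin n → L}
    (hz : ∀ j, ‖z j‖ ≤ ρ) :
    ‖g.eval z - ∑ i ∈ degreeLE n m, algebraMap L K (monom z i) • g.coeff i‖ ≤
      (ρ / σ : ℝ) ^ m * ‖g‖ := by
  have : Fact (∀ _ : Fin n, 0 < ρ) := ⟨fun _ => hρ⟩
  have h1 := (norm_eval_le _ hz).trans (norm_restrict_sub_le (hρ.trans_le h) h m g)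
  rw [← evalL_apply (E := E) hz, map_sub, map_sum, evalL_apply,
    eval_restrict] at h1
  simpa only [evalL_apply, eval_monomial] using h1

end PowSer

/-- If power series `G a` are bounded on a larger polydisc and their coefficients can be
approximated, then so can the values of a functional on the smaller polydisc at them: up to small
error, only the terms of bounded degree contribute. -/
theorem Approximable.of_coeff {A : Type*} [AddCommGroup A] [Module K A]
    [TopologicalSpace A] {𝒮 : Submodule K (A →L[K] K)} {B : Set A} {ρ σ : ℝ≥0} (hρσ : ρ < σ)
    {G : A → PowSer K (fun _ : Fin n => σ) K} {C : ℝ} (hC : ∀ a ∈ B, ‖G a‖ ≤ C)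
    (h : ∀ i, Approximable 𝒮 B fun a => (G a).coeff i)
    (ν : PowSer K (fun _ : Fin n => ρ) K →L[K] K) :
    Approximable 𝒮 B fun a => ν ((G a).restrict fun _ => hρσ.le) := by
  have hσ : (0 : ℝ) < σ := lt_of_le_of_lt ρ.coe_nonneg (by exact_mod_cast hρσ)
  have hq : (ρ / σ : ℝ) < 1 := (div_lt_one hσ).2 (by exact_mod_cast hρσ)
  refine Approximable.of_uniform fun ε hε => ?_
  have hlim : Tendsto (fun m : ℕ => ‖ν‖ * ((ρ / σ : ℝ) ^ m * C)) atTop (𝓝 0) := by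
    have := ((tendsto_pow_atTop_nhds_zero_of_lt_one (by positivity) hq).mul_const C).const_mul ‖ν‖
    rwa [zero_mul, mul_zero] at this
  obtain ⟨m, hm⟩ := (hlim.eventually (ge_mem_nhds hε)).exists
  refine ⟨fun a => ∑ i ∈ degreeLE n m, ν (PowSer.monomial _ i 1) * (G a).coeff i,
    Approximable.sum _ fun i _ => (h i).const_mul _, fun a ha => ?_⟩
  have h1 : ∑ i ∈ degreeLE n m, ν (PowSer.monomial _ i 1) * (G a).coeff i =
      ν (∑ i ∈ degreeLE n m, PowSer.monomial _ i ((G a).coeff i)) := by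
    rw [map_sum]
    refine Finset.sum_congr rfl fun i _ => ?_
    rw [mul_comm, ← smul_eq_mul, ← map_smul, ← map_smul, smul_eq_mul, mul_one]
  change ‖_ - ∑ i ∈ degreeLE n m, _‖ ≤ ε
  rw [h1, ← map_sub]
  refine (ν.le_opNorm _).trans (le_trans ?_ hm)
  refine mul_le_mul_of_nonneg_left ?_ (norm_nonneg _)
  refine (PowSer.norm_restrict_sub_le (by exact_mod_cast hσ) hρσ.le m (G a)).trans ?_
  exact mul_le_mul_of_nonneg_left (hC a ha) (by positivity)

end Truncation

/-! ### Bounded sets of germs and of locally analytic functions -/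

section Regular

variable {L : Type uL} [NontriviallyNormedField L] [IsUltrametricDist L] {n : ℕ}
  {K : Type uK} [NontriviallyNormedField K] [IsUltrametricDist K] [CompleteSpace K]
  [NormedAlgebra L K]
  {X : Type uG} [TopologicalSpace X] [ChartedSpace (Fin n → L) X]
  [IsManifold 𝓘(L, Fin n → L) ω X]

/-- The map from scalar power series on a polydisc to germs at a point of it. -/
def rigGermK {x : X} (D : PolyChart L n X) (hx : x ∈ D.source) :
    PowSer K D.radius K →L[K] ClaGerm L n K K x := rigGerm D hx (BHSubspace.self K)

theorem germ_rigGermK {x : X} (D : PolyChart L n X) (hx : x ∈ D.source)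
    (g : PowSer K D.radius K) : (rigGermK D hx g).germ =
      ((fun y => g.eval (D.coord y) : X → K) : Germ (𝓝 x) K) :=
  germ_rigGerm D hx (BHSubspace.self K) g

/-- The Taylor coefficients of germs with values in `K`, as functionals. -/
def taylorK (x : X) (i : Fin n →₀ ℕ) : ClaGerm L n K K x →L[K] K := taylor isLocConvex_self x i

theorem taylorK_rigGermK {x : X} {ρ : ℝ≥0} (hρ : 0 < ρ)
    (hsub : polyBall (chartAt (Fin n → L) x x) (fun _ => ρ) ⊆ (chartAt (Fin n → L) x).target)
    (hxs : x ∈ (ballAt L n x ρ hρ hsub).source)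
    (g : PowSer K (fun _ : Fin n => ρ) K) (i : Fin n →₀ ℕ) :
    taylorK x i (rigGermK (ballAt L n x ρ hρ hsub) hxs g) = g.coeff i :=
  taylor_rigGerm isLocConvex_self hρ hsub hxs (BHSubspace.self K) g i

theorem eventually_ballAt (x : X) {N : Set X} (hN : N ∈ 𝓝 x) : ∃ ρ₀ : ℝ≥0, 0 < ρ₀ ∧
    ∀ (ρ : ℝ≥0) (hρ : 0 < ρ), ρ ≤ ρ₀ → ∃ hsub : polyBall (chartAt (Fin n → L) x x) (fun _ => ρ) ⊆
      (chartAt (Fin n → L) x).target, (ballAt L n x ρ hρ hsub).source ⊆ N := by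
  obtain ⟨ρ₀, hρ₀, h⟩ := PolyChart.eventually_ball (chartAt_mem (L := L) (n := n) x)
    (mem_chart_source _ x) hN
  refine ⟨ρ₀, hρ₀, fun ρ hρ hle => ?_⟩
  obtain ⟨hsub, -, hs⟩ := h ρ hρ hle
  exact ⟨hsub, hs⟩

theorem mem_ballAt_iff {x y : X} {ρ : ℝ≥0} {hρ : 0 < ρ}
    {hsub : polyBall (chartAt (Fin n → L) x x) (fun _ => ρ) ⊆ (chartAt (Fin n → L) x).target} :
    y ∈ (ballAt L n x ρ hρ hsub).source ↔ y ∈ (chartAt (Fin n → L) x).source ∧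
      ∀ j, ‖(chartAt (Fin n → L) x y - chartAt (Fin n → L) x x) j‖ ≤ ρ := by
  rw [ballAt, PolyChart.source_ball]
  rfl

/-- The Taylor coefficients of a bounded set of germs are bounded on a common polydisc: otherwise
suitably scaled Taylor coefficients form a sequence of functionals contradicting
`exists_bound_of_steps`. -/
theorem exists_taylorK_le {x : X} {B : Set (ClaGerm L n K K x)}
    (hB : Bornology.IsVonNBounded K B) : ∃ ρ : ℝ≥0, 0 < ρ ∧ ∃ C : ℝ,
      ∀ F ∈ B, ∀ i, (ρ : ℝ) ^ i.degree * ‖taylorK x i F‖ ≤ C := by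
  by_contra hcon
  push Not at hcon
  obtain ⟨π, hπ0, hπ1⟩ := NormedField.exists_norm_lt_one K
  have hπ : 0 < ‖π‖₊ := hπ0
  choose F hF i hi using fun k : ℕ => hcon (‖π‖₊ ^ k) (pow_pos hπ k) k
  -- as soon as `‖π ^ k‖ ≤ ρ`, the functional `ℓ k` is bounded by the norm of power series on the
  -- polydisc of radius `ρ`; on the other hand, `‖ℓ k (F k)‖ > k`
  let ℓ : ℕ → ClaGerm L n K K x →L[K] K := fun k => (π ^ k) ^ (i k).degree • taylorK x (i k)
  let ι := {p : PolyChart L n X × BHSubspace K K // x ∈ p.1.source}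
  obtain ⟨C, hC⟩ := exists_bound_of_steps (ι := ι) (S := fun p => PowSer K p.1.1.radius p.1.2.E)
    (fun p => rigGerm p.1.1 p.2 p.1.2)
    (fun T h => ClaGerm.continuous_of_rigGerm (isLocConvex_of_isUltrametricDist _) T
      fun D hx B => h ⟨(D, B), hx⟩) (fun F => by
        obtain ⟨B, ρ, hρ, h⟩ := F.exists_ballAt
        obtain ⟨hsub, g, hg⟩ := h ρ hρ le_rfl
        exact ⟨⟨(_, B), mem_ballAt x ρ hρ hsub⟩, g, hg⟩) ℓ (by
      rintro ⟨⟨D, B⟩, hx⟩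
      obtain ⟨ρ, hρ, h⟩ := exists_rigGerm_ball D hx B (chartAt_mem x) (mem_chart_source _ x)
      obtain ⟨hsub, hxs, Θ, hΘ⟩ := h ρ hρ le_rfl
      obtain ⟨k₀, hk₀⟩ := exists_pow_lt_of_lt_one (show (0 : ℝ) < ρ from hρ) hπ1
      refine ⟨{g | ‖B.ι‖ * ‖Θ g‖ ≤ 1}, ?_, k₀, fun k hk g hg => ?_⟩
      · have h2 : Tendsto (fun g => ‖B.ι‖ * ‖Θ g‖) (𝓝 0) (𝓝 (‖B.ι‖ * ‖Θ 0‖)) :=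
          (continuous_const.mul Θ.continuous.norm).tendsto 0
        rw [map_zero, norm_zero, mul_zero] at h2
        exact h2.eventually (ge_mem_nhds zero_lt_one)
      · refine le_trans ?_ hg
        change ‖(π ^ k) ^ (i k).degree • taylorK x (i k) (rigGerm D hx B g)‖ ≤ _
        rw [hΘ, norm_smul, taylorK, taylor_rigGerm, norm_pow, norm_pow]
        have h3 : ‖π‖ ^ k ≤ ρ := (pow_le_pow_of_le_one hπ0.le hπ1.le hk).trans hk₀.le
        calc (‖π‖ ^ k) ^ (i k).degree * ‖B.ι ((Θ g).coeff (i k))‖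
            ≤ (ρ : ℝ) ^ (i k).degree * (‖B.ι‖ * ‖(Θ g).coeff (i k)‖) := by
              gcongr
              exact B.ι.le_opNorm _
          _ = ‖B.ι‖ * (weight (fun _ => ρ) (i k) * ‖(Θ g).coeff (i k)‖) := by
              rw [weight_const]; ring
          _ ≤ _ := by gcongr; exact PowSer.le_norm _ _) hB
  obtain ⟨k, hk⟩ := exists_nat_gt C
  have h1 := hC _ (hF k) k
  have h2 : ‖ℓ k (F k)‖ = ((‖π‖₊ ^ k : ℝ≥0) : ℝ) ^ (i k).degree * ‖taylorK x (i k) (F k)‖ := by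
    change ‖(π ^ k) ^ (i k).degree • taylorK x (i k) (F k)‖ = _
    rw [norm_smul, norm_pow, norm_pow]
    simp
  rw [h2] at h1
  linarith [hi k]

/-- A bounded set of germs consists of power series on a common polydisc, with bounded norms. -/
theorem ClaGerm.exists_rigGermK_of_bounded {x : X} {B : Set (ClaGerm L n K K x)}
    (hB : Bornology.IsVonNBounded K B) : ∃ ρ₀ : ℝ≥0, 0 < ρ₀ ∧ ∃ C : ℝ, ∀ (ρ : ℝ≥0) (hρ : 0 < ρ),
      ρ ≤ ρ₀ → ∃ hsub : polyBall (chartAt (Fin n → L) x x) (fun _ => ρ) ⊆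
        (chartAt (Fin n → L) x).target, ∀ F ∈ B, ∃ g : PowSer K (fun _ : Fin n => ρ) K,
          ‖g‖ ≤ C ∧ rigGermK (ballAt L n x ρ hρ hsub) (mem_ballAt x ρ hρ hsub) g = F := by
  obtain ⟨ρ₁, hρ₁, C, hC⟩ := exists_taylorK_le hB
  obtain ⟨ρ₂, hρ₂, h2⟩ := eventually_ballAt (L := L) (n := n) x univ_mem
  refine ⟨min (ρ₁ / 2) ρ₂, lt_min (half_pos hρ₁) hρ₂, C, fun ρ hρ hle => ?_⟩
  obtain ⟨hsub, -⟩ := h2 ρ hρ (hle.trans (min_le_right _ _))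
  have hlt : ρ < ρ₁ := (hle.trans (min_le_left _ _)).trans_lt (half_lt_self hρ₁)
  refine ⟨hsub, fun F hF => ?_⟩
  obtain ⟨g, hg, hgC⟩ := PowSer.exists_of_bounded (K := K) hρ hlt (fun i => taylorK x i F) (hC F hF)
  refine ⟨g, hgC, sub_eq_zero.1 (ClaGerm.eq_zero_of_taylor isLocConvex_self fun i => ?_)⟩
  change taylorK x i _ = 0
  rw [map_sub, taylorK_rigGermK, hg, sub_self]

section Global

variable [LocallyCompactSpace L] [T2Space X] [SecondCountableTopology X]

theorem dirac_apply (x : X) (f : Cla L n K K (⊤ : Opens X)) : dirac L n K x f = f ⟨x, trivial⟩ :=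
  rfl

/-- Around a given point, the functions subordinate to a `V`-index are given by power series in the
preferred chart, depending continuously on the family of power series. -/
theorem VIndex.exists_ballAt {V : Type uV} [AddCommGroup V] [Module K V] [TopologicalSpace V]
    [IsTopologicalAddGroup V] [ContinuousSMul K V] [T2Space V] (J : VIndex L n K V (⊤ : Opens X))
    (x : X) : ∃ ρ₀ : ℝ≥0, 0 < ρ₀ ∧ ∀ (ρ : ℝ≥0) (hρ : 0 < ρ), ρ ≤ ρ₀ →
      ∃ (hsub : polyBall (chartAt (Fin n → L) x x) (fun _ => ρ) ⊆ (chartAt (Fin n → L) x).target)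
        (B : BHSubspace K V) (Θ : J.Series →L[K] PowSer K (fun _ : Fin n => ρ) B.E),
        (∀ p, Cla.toGerm L n K V (Opens.mem_top x) (J.toCla p) =
          rigGerm (ballAt L n x ρ hρ hsub) (mem_ballAt x ρ hρ hsub) B (Θ p)) ∧
        ∀ y ∈ (ballAt L n x ρ hρ hsub).source, ∀ p, J.toCla p ⟨y, trivial⟩ =
          B.ι ((Θ p).eval (chartAt (Fin n → L) x y - chartAt (Fin n → L) x x)) := by
  obtain ⟨i, hi⟩ := J.exists_mem ⟨x, trivial⟩
  obtain ⟨ρ₀, hρ₀, h⟩ := exists_pullback (K := K) (J.B i).E (contMDiffAt_id (x := x))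
    (J.polyChart i) hi (chartAt_mem x) (mem_chart_source _ x) univ_mem
  refine ⟨ρ₀, hρ₀, fun ρ hρ hle => ?_⟩
  obtain ⟨hsub, hxs, hs, Θ, hΘ, -⟩ := h ρ hρ hle
  have hy : ∀ y ∈ (ballAt L n x ρ hρ hsub).source, ∀ p : J.Series, J.toCla p ⟨y, trivial⟩ =
      (J.B i).ι ((Θ (p i)).eval (chartAt (Fin n → L) x y - chartAt (Fin n → L) x x)) := by
    intro y hy p
    rw [J.toCla_apply p (x := ⟨y, trivial⟩) (hs hy).2]
    exact congrArg _ (hΘ y hy _).symm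
  refine ⟨hsub, J.B i, Θ.comp (ContinuousLinearMap.proj i), fun p => ClaGerm.ext ?_, hy⟩
  rw [germ_rigGerm, Cla.germ_toGerm_top]
  refine Germ.coe_eq.2 ?_
  filter_upwards [(PolyChart.isOpen_source _).mem_nhds hxs] with y hys
  exact hy y hys p

/-- If the elements `f` of a bounded set have Taylor series `G f` with bounded norms on a polydisc
around `x`, then they agree with them on a common neighbourhood of `x`: otherwise suitable multiples
of differences `f(yₖ) - ∑ (yₖ - x)ⁱ aᵢ(f)`, for `yₖ → x` and `|i| ≤ mₖ`, form a sequence of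
functionals contradicting `exists_bound_of_steps`. -/
theorem exists_eq_eval_of_bounded {B : Set (Cla L n K K (⊤ : Opens X))}
    (hB : Bornology.IsVonNBounded K B) (x : X) {σ : ℝ≥0} (hσ : 0 < σ)
    (hsub : polyBall (chartAt (Fin n → L) x x) (fun _ => σ) ⊆ (chartAt (Fin n → L) x).target)
    {C : ℝ} (G : Cla L n K K (⊤ : Opens X) → PowSer K (fun _ : Fin n => σ) K)
    (hC : ∀ f ∈ B, ‖G f‖ ≤ C) (hG : ∀ f ∈ B, rigGermK (ballAt L n x σ hσ hsub)
      (mem_ballAt x σ hσ hsub) (G f) = Cla.toGerm L n K K (Opens.mem_top x) f) :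
    ∃ k : ℕ, ∀ y ∈ (chartAt (Fin n → L) x).source,
      (∀ j, ‖(chartAt (Fin n → L) x y - chartAt (Fin n → L) x x) j‖ ≤ σ * (1 / 2) ^ (k + 1)) →
        ∀ f ∈ B, f ⟨y, trivial⟩ =
          (G f).eval (chartAt (Fin n → L) x y - chartAt (Fin n → L) x x) := by
  by_contra hcon
  push Not at hcon
  choose y hys hyq f hf hne using hcon
  let z : ℕ → Fin n → L := fun k => chartAt (Fin n → L) x (y k) - chartAt (Fin n → L) x x
  let d : ℕ → K := fun k => f k ⟨y k, trivial⟩ - (G (f k)).eval (z k)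
  have hd : ∀ k, 0 < ‖d k‖ := fun k => norm_pos_iff.2 (sub_ne_zero.2 (hne k))
  -- `c k` is chosen such that `‖c k * d k‖ > k`; the degree `m k` is so large that the tail of the
  -- series `G (f k)` is smaller than `d k`, and that the geometric rate of convergence of Taylor
  -- polynomials compensates for the factor `c k`
  choose c hc using fun k : ℕ => NormedField.exists_lt_norm K (k / ‖d k‖)
  have hm : ∀ k, ∃ m : ℕ, (1 / 2 : ℝ) ^ m * C < ‖d k‖ ∧ ‖c k‖ * (1 / 2 : ℝ) ^ m ≤ 1 := by
    intro k
    have h0 : Tendsto (fun m : ℕ => (1 / 2 : ℝ) ^ m) atTop (𝓝 0) :=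
      tendsto_pow_atTop_nhds_zero_of_lt_one (by norm_num) (by norm_num)
    have h1 := h0.mul_const C
    have h2 := h0.const_mul ‖c k‖
    rw [zero_mul] at h1
    rw [mul_zero] at h2
    exact ((h1.eventually (gt_mem_nhds (hd k))).and
      (h2.eventually (ge_mem_nhds zero_lt_one))).exists
  choose m hm1 hm2 using hm
  let τ : (Fin n →₀ ℕ) → Cla L n K K (⊤ : Opens X) →L[K] K := fun i =>
    (taylorK x i).comp (Cla.toGerm L n K K (Opens.mem_top x))
  let ℓ : ℕ → Cla L n K K (⊤ : Opens X) →L[K] K := fun k =>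
    c k • (dirac L n K (y k) - ∑ i ∈ degreeLE n (m k), algebraMap L K (monom (z k) i) • τ i)
  have hℓ : ∀ k a, ℓ k a = c k * (a ⟨y k, trivial⟩ -
      ∑ i ∈ degreeLE n (m k), algebraMap L K (monom (z k) i) • τ i a) := by
    intro k a
    simp only [ℓ, smul_apply, sub_apply, sum_apply, dirac_apply, smul_eq_mul]
  obtain ⟨R, hR⟩ := exists_bound_of_steps (ι := VIndex L n K K (⊤ : Opens X))
    (S := fun J => J.Series) (fun J => J.toCla)
    (fun T h => Cla.continuous_of_toCla (isLocConvex_of_isUltrametricDist _) T h)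
    (fun a => by
      obtain ⟨J, p, h⟩ := a.exists_toCla
      exact ⟨J, p, h⟩) ℓ (by
      intro J
      obtain ⟨ρ, hρ, h⟩ := J.exists_ballAt x
      obtain ⟨hsub', D, Θ, hΘ, hy⟩ := h ρ hρ le_rfl
      have hρ' : (0 : ℝ) < ρ := hρ
      have hτ : ∀ (p : J.Series) i, τ i (J.toCla p) = D.ι ((Θ p).coeff i) := by
        intro p i
        rw [← taylor_rigGerm isLocConvex_self hρ hsub' (mem_ballAt x ρ hρ hsub'), ← hΘ]
        rfl
      obtain ⟨k₀, hk₀⟩ := exists_pow_lt_of_lt_one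
        (show (0 : ℝ) < ρ / 2 / σ from div_pos (half_pos hρ') hσ) (show (1 / 2 : ℝ) < 1 by norm_num)
      refine ⟨{p | ‖D.ι‖ * ‖Θ p‖ ≤ 1}, ?_, k₀, fun k hk p hp => ?_⟩
      · have h2 : Tendsto (fun p : J.Series => ‖D.ι‖ * ‖Θ p‖) (𝓝 0)
            (𝓝 (‖D.ι‖ * ‖Θ 0‖)) :=
          (continuous_const.mul Θ.continuous.norm).tendsto 0
        rw [map_zero, norm_zero, mul_zero] at h2
        exact h2.eventually (ge_mem_nhds zero_lt_one)
      · refine le_trans ?_ (show ‖D.ι‖ * ‖Θ p‖ ≤ 1 from hp)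
        have hq : ((ρ / 2 : ℝ≥0) : ℝ) = ρ / 2 := by simp
        have hz : ∀ j, ‖z k j‖ ≤ (ρ / 2 : ℝ≥0) := fun j => by
          rw [hq]
          refine (hyq k j).trans ?_
          have h3 : (1 / 2 : ℝ) ^ (k + 1) ≤ ρ / 2 / σ :=
            (pow_le_pow_of_le_one (by norm_num) (by norm_num) (hk.le.trans k.le_succ)).trans hk₀.le
          have h4 := (le_div_iff₀ (show (0 : ℝ) < σ from hσ)).1 h3
          linarith
        have hyb : y k ∈ (ballAt L n x ρ hρ hsub').source := by
          rw [PolyChart.source_ball]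
          refine ⟨hys k, fun j => (hz j).trans ?_⟩
          rw [hq]
          linarith
        have h5 : (J.toCla p) ⟨y k, trivial⟩ = D.ι ((Θ p).eval (z k)) := by
          exact hy (y k) hyb p
        have h6 : ∑ i ∈ degreeLE n (m k), algebraMap L K (monom (z k) i) • τ i (J.toCla p) =
            D.ι (∑ i ∈ degreeLE n (m k),
              algebraMap L K (monom (z k) i) • (Θ p).coeff i) := by
          rw [map_sum]
          refine Finset.sum_congr rfl fun i _ => ?_
          rw [hτ, map_smul]
        rw [hℓ, h5, h6, ← map_sub, norm_mul]
        have h7 := PowSer.norm_eval_sub_le (half_pos hρ) (half_le_self hρ.le) (m k) (Θ p) hz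
        have h8 : ((ρ / 2 : ℝ≥0) : ℝ) / ρ = 1 / 2 := by
          rw [hq]; field_simp
        rw [h8] at h7
        calc ‖c k‖ * ‖D.ι ((Θ p).eval (z k) - ∑ i ∈ degreeLE n (m k),
              algebraMap L K (monom (z k) i) • (Θ p).coeff i)‖
            ≤ ‖c k‖ * (‖D.ι‖ * ((1 / 2 : ℝ) ^ m k * ‖Θ p‖)) := by
              gcongr
              exact (D.ι.le_opNorm _).trans (by gcongr)
          _ = ‖c k‖ * (1 / 2 : ℝ) ^ m k * (‖D.ι‖ * ‖Θ p‖) := by ring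
          _ ≤ 1 * (‖D.ι‖ * ‖Θ p‖) := by gcongr; exact hm2 k
          _ = _ := one_mul _) hB
  obtain ⟨k, hk⟩ := exists_nat_gt R
  have hb := hR _ (hf k) k
  have hτ : ∀ i, τ i (f k) = (G (f k)).coeff i := fun i => by
    rw [← taylorK_rigGermK hσ hsub (mem_ballAt x σ hσ hsub), hG _ (hf k)]
    rfl
  have hs : f k ⟨y k, trivial⟩ - ∑ i ∈ degreeLE n (m k),
      algebraMap L K (monom (z k) i) • τ i (f k) = d k + ((G (f k)).eval (z k) -
        ∑ i ∈ degreeLE n (m k), algebraMap L K (monom (z k) i) • (G (f k)).coeff i) := by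
    simp only [hτ, d]
    ring
  have ht : ‖(G (f k)).eval (z k) - ∑ i ∈ degreeLE n (m k),
      algebraMap L K (monom (z k) i) • (G (f k)).coeff i‖ < ‖d k‖ := by
    have hq : ((σ / 2 : ℝ≥0) : ℝ) = σ / 2 := by simp
    have hσ' : (0 : ℝ) < σ := hσ
    have hz : ∀ j, ‖z k j‖ ≤ (σ / 2 : ℝ≥0) := fun j => by
      have h1 : (1 / 2 : ℝ) ^ (k + 1) ≤ (1 / 2) ^ 1 :=
        pow_le_pow_of_le_one (by norm_num) (by norm_num) (by omega)
      rw [hq]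
      have h2 := mul_le_mul_of_nonneg_left h1 hσ'.le
      have h3 := hyq k j
      change ‖z k j‖ ≤ _ at h3
      linarith
    have h7 := PowSer.norm_eval_sub_le (half_pos hσ) (half_le_self hσ.le) (m k) (G (f k)) hz
    have h8 : ((σ / 2 : ℝ≥0) : ℝ) / σ = 1 / 2 := by
      rw [hq]; field_simp
    rw [h8] at h7
    refine (h7.trans ?_).trans_lt (hm1 k)
    exact mul_le_mul_of_nonneg_left (hC _ (hf k)) (by positivity)
  have hn : ‖d k‖ ≤ ‖f k ⟨y k, trivial⟩ -
      ∑ i ∈ degreeLE n (m k), algebraMap L K (monom (z k) i) • τ i (f k)‖ := by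
    rw [hs, IsUltrametricDist.norm_add_eq_max_of_norm_ne_norm ht.ne']
    exact le_max_left _ _
  have h9 : (k : ℝ) < ‖c k‖ * ‖d k‖ := (div_lt_iff₀ (hd k)).1 (hc k)
  rw [hℓ, norm_mul] at hb
  have h10 := mul_le_mul_of_nonneg_left hn (norm_nonneg (c k))
  linarith

/-- Around a given point, the functions in a bounded set are given by power series on a common
polydisc, with bounded norms. -/
theorem Cla.exists_ballAt_of_bounded {B : Set (Cla L n K K (⊤ : Opens X))}
    (hB : Bornology.IsVonNBounded K B) (x : X) : ∃ ρ₀ : ℝ≥0, 0 < ρ₀ ∧ ∃ C : ℝ,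
      ∀ (ρ : ℝ≥0) (hρ : 0 < ρ), ρ ≤ ρ₀ → ∃ hsub : polyBall (chartAt (Fin n → L) x x) (fun _ => ρ) ⊆
        (chartAt (Fin n → L) x).target, ∀ f ∈ B, ∃ g : PowSer K (fun _ : Fin n => ρ) K, ‖g‖ ≤ C ∧
          ∀ y ∈ (ballAt L n x ρ hρ hsub).source, f ⟨y, trivial⟩ =
            g.eval (chartAt (Fin n → L) x y - chartAt (Fin n → L) x x) := by
  classical
  obtain ⟨σ, hσ, C, h⟩ := ClaGerm.exists_rigGermK_of_bounded
    (hB.image (Cla.toGerm L n K K (Opens.mem_top x)))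
  obtain ⟨hsub, hF⟩ := h σ hσ le_rfl
  have h1 : ∀ f : Cla L n K K (⊤ : Opens X), ∃ g : PowSer K (fun _ : Fin n => σ) K, f ∈ B →
      ‖g‖ ≤ C ∧ rigGermK (ballAt L n x σ hσ hsub) (mem_ballAt x σ hσ hsub) g =
        Cla.toGerm L n K K (Opens.mem_top x) f := by
    intro f
    by_cases hf : f ∈ B
    · obtain ⟨g, hg⟩ := hF _ ⟨f, hf, rfl⟩
      exact ⟨g, fun _ => hg⟩
    · exact ⟨0, fun h => absurd h hf⟩
  choose G hG using h1
  obtain ⟨k, hk⟩ := exists_eq_eval_of_bounded hB x hσ hsub G (fun f hf => (hG f hf).1)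
    fun f hf => (hG f hf).2
  have hpow : (1 / 2 : ℝ≥0) ^ (k + 1) ≤ 1 := pow_le_one₀ (zero_le) (by norm_num)
  refine ⟨σ * (1 / 2) ^ (k + 1), by positivity, C, fun ρ hρ hle => ?_⟩
  have hρσ : ρ ≤ σ := hle.trans (mul_le_of_le_one_right' hpow)
  refine ⟨fun y hy => hsub fun j => (hy j).trans (by exact_mod_cast hρσ), fun f hf =>
    ⟨(G f).restrict fun _ => hρσ, (PowSer.norm_restrict_le _ _).trans (hG f hf).1,
      fun y hy => ?_⟩⟩
  have hy' := mem_ballAt_iff.1 hy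
  rw [PowSer.eval_restrict]
  refine hk y hy'.1 (fun j => (hy'.2 j).trans ?_) f hf
  exact_mod_cast hle

/-- On functions given by bounded power series on a common polydisc, the coefficients are uniform
limits of linear combinations of Dirac distributions. -/
theorem approximable_coeff {B : Set (Cla L n K K (⊤ : Opens X))} {x : X} {σ : ℝ≥0} (hσ : 0 < σ)
    (hsub : polyBall (chartAt (Fin n → L) x x) (fun _ => σ) ⊆ (chartAt (Fin n → L) x).target)
    {C : ℝ} {G : Cla L n K K (⊤ : Opens X) → PowSer K (fun _ : Fin n => σ) K}
    (hC : ∀ f ∈ B, ‖G f‖ ≤ C) (hG : ∀ f ∈ B, ∀ y ∈ (ballAt L n x σ hσ hsub).source,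
      f ⟨y, trivial⟩ = (G f).eval (chartAt (Fin n → L) x y - chartAt (Fin n → L) x x))
    (i : Fin n →₀ ℕ) :
    Approximable (Submodule.span K (Set.range (dirac L n K))) B fun f => (G f).coeff i := by
  have : Fact (∀ _ : Fin n, 0 < σ) := ⟨fun _ => hσ⟩
  obtain ⟨t₀, ht₀, D, hD, ht, hcoeff⟩ :=
    PowSer.exists_norm_coeff_sub_interpSum_le (L := L) (K := K) K (fun _ : Fin n => σ) i
  refine Approximable.of_uniform fun ε hε => ?_
  have hlim : Tendsto (fun t : L => ‖t‖ * D * C) (𝓝[≠] 0) (𝓝 0) := by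
    have h1 : Tendsto (fun t : L => ‖t‖ * D * C) (𝓝 0) (𝓝 (‖(0 : L)‖ * D * C)) :=
      ((continuous_norm.mul continuous_const).mul continuous_const).tendsto 0
    rw [norm_zero, zero_mul, zero_mul] at h1
    exact h1.mono_left nhdsWithin_le_nhds
  have hlim' : Tendsto (fun t : L => ‖t‖) (𝓝[≠] 0) (𝓝 0) := by
    have h1 : Tendsto (fun t : L => ‖t‖) (𝓝 0) (𝓝 ‖(0 : L)‖) := continuous_norm.tendsto 0
    rw [norm_zero] at h1
    exact h1.mono_left nhdsWithin_le_nhds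
  obtain ⟨t, ⟨ht1, ht2⟩, ht3⟩ := (((hlim.eventually (ge_mem_nhds hε)).and
    (hlim'.eventually (ge_mem_nhds ht₀))).and self_mem_nhdsWithin).exists
  refine ⟨fun f => interpSum (K := K) i t (G f).eval, ?_, fun f hf => ?_⟩
  · refine Approximable.sum _ fun y hy => Approximable.const_mul ?_ _
    obtain ⟨p, hp, hpy⟩ := (ballAt L n x σ hσ hsub).exists_coord_eq (ht t ht2 y hy)
    refine (approximable_of_mem (Submodule.subset_span (Set.mem_range_self p))).congr fun f hf => ?_
    rw [dirac_apply, hG f hf p hp, ← hpy]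
    rfl
  · refine (hcoeff t ht3 ht2 (G f)).trans (le_trans ?_ ht1)
    exact mul_le_mul_of_nonneg_left (hC f hf) (by positivity)

/-- The Dirac distributions span a dense subspace of `D(X)`: on a bounded set of functions, a
distribution involves only finitely many of the Taylor coefficients up to small error, and Taylor
coefficients are uniform limits of linear combinations of values. -/
theorem dense_span_dirac :
    closure (Submodule.span K (Set.range (dirac L n K (X := X))) : Set (LaDistribution L n K X)) =
      Set.univ := by
  classical
  refine Set.eq_univ_of_forall fun μ => mem_closure_of_approximable fun B hB => ?_
  choose σ hσ C h using Cla.exists_ballAt_of_bounded hB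
  choose hsub hg using fun x => h x (σ x) (hσ x) le_rfl
  have h1 : ∀ x (f : Cla L n K K (⊤ : Opens X)), ∃ g : PowSer K (fun _ : Fin n => σ x) K, f ∈ B →
      ‖g‖ ≤ C x ∧ ∀ y ∈ (ballAt L n x (σ x) (hσ x) (hsub x)).source, f ⟨y, trivial⟩ =
        g.eval (chartAt (Fin n → L) x y - chartAt (Fin n → L) x x) := by
    intro x f
    by_cases hf : f ∈ B
    · obtain ⟨g, hg⟩ := hg x f hf
      exact ⟨g, fun _ => hg⟩
    · exact ⟨0, fun h => absurd h hf⟩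
  choose G hG using h1
  have hlt : ∀ x, σ x / 2 < σ x := fun x => half_lt_self (hσ x)
  let D : X → PolyChart L n X := fun x => ballAt L n x (σ x / 2) (half_pos (hσ x))
    fun y hy => hsub x fun j => (hy j).trans (by exact_mod_cast (hlt x).le)
  have hDs : ∀ x, (D x).source ⊆ (ballAt L n x (σ x) (hσ x) (hsub x)).source := by
    intro x y hy
    have hy' := mem_ballAt_iff.1 hy
    exact mem_ballAt_iff.2 ⟨hy'.1, fun j => (hy'.2 j).trans (by exact_mod_cast (hlt x).le)⟩
  obtain ⟨J, ξ, c, hc⟩ := exists_refinement D (fun _ => BHSubspace.self K)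
    fun x => mem_ballAt x _ _ _
  let R : ∀ i, Cla L n K K (⊤ : Opens X) → PowSer K (fun _ : Fin n => σ (ξ i) / 2) K :=
    fun i f => (G (ξ i) f).restrict fun _ => (hlt (ξ i)).le
  have hR : ∀ f ∈ B, J.toCla (fun i => c i (R i f)) = f := by
    intro f hf
    refine Cla.ext fun x => ?_
    have hx := J.mem_index x
    rw [J.toCla_apply _ hx]
    refine ((hc _ _ hx).2 _).trans ?_
    have h2 := (hG (ξ (J.index x)) f hf).2 x (hDs _ (hc _ _ hx).1)
    change PowSer.eval (R (J.index x) f) ((D (ξ (J.index x))).coord x) = f x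
    exact (PowSer.eval_restrict (E := K) (fun _ => (hlt (ξ (J.index x))).le)
      (G (ξ (J.index x)) f) _).trans h2.symm
  obtain ⟨t, ht⟩ := exists_finset_eq_sum (μ.comp J.toCla)
  have h2 : ∀ f ∈ B, ∑ i ∈ t, μ (J.toCla (Pi.single i (c i (R i f)))) = μ f := by
    intro f hf
    conv_rhs => rw [← hR f hf]
    exact (ht _).symm
  refine Approximable.congr (Approximable.sum t fun i _ => ?_) h2
  let ν : PowSer K (fun _ : Fin n => σ (ξ i) / 2) K →L[K] K := ((μ.comp J.toCla).comp
    (ContinuousLinearMap.single K (fun i => PowSer K (J.polyChart i).radius (J.B i).E)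
      i)).comp (c i)
  exact Approximable.of_coeff (hlt (ξ i)) (fun f hf => (hG (ξ i) f hf).1)
    (approximable_coeff (hσ (ξ i)) (hsub (ξ i)) (fun f hf => (hG (ξ i) f hf).1)
      fun f hf => (hG (ξ i) f hf).2) ν

/-- A continuous linear map on `D(X)` is determined by its values on Dirac distributions. -/
theorem dirac_ext {W : Type*} [AddCommGroup W] [Module K W] [TopologicalSpace W] [T2Space W]
    {S T : LaDistribution L n K X →L[K] W} (h : ∀ x, S (dirac L n K x) = T (dirac L n K x)) :
    S = T := by
  refine ContinuousLinearMap.ext fun μ => ?_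
  have h1 : Set.EqOn S T (Submodule.span K (Set.range (dirac L n K (X := X)))) := by
    refine LinearMap.eqOn_span (f := S.toLinearMap) (g := T.toLinearMap) ?_
    rintro _ ⟨x, rfl⟩
    exact h x
  exact h1.closure S.continuous T.continuous (by
    rw [dense_span_dirac]
    exact Set.mem_univ μ)

end Global

end Regular

/-! ### Integration of vector-valued functions -/

section LocConvex

variable {K : Type*} [NontriviallyNormedField K] [IsUltrametricDist K]

/-- Every positive real number is approximated by the norm of a scalar up to a constant factor. -/
theorem exists_norm_between (K : Type*) [NontriviallyNormedField K] :
    ∃ M : ℝ, 0 < M ∧ ∀ a : ℝ, 0 < a → ∃ c : K, a ≤ ‖c‖ ∧ ‖c‖ ≤ M * a := by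
  obtain ⟨π, hπ⟩ := NormedField.exists_one_lt_norm K
  have h0 : 0 < ‖π‖ := zero_lt_one.trans hπ
  refine ⟨‖π‖, h0, fun a ha => ?_⟩
  obtain ⟨k, -, h1, h2, -⟩ := rescale_to_shell_zpow hπ (mul_pos h0 ha) (one_ne_zero (α := K))
  refine ⟨π ^ k, ?_, ?_⟩
  · rwa [mul_div_cancel_left₀ _ h0.ne', smul_eq_mul, mul_one] at h2
  · rw [smul_eq_mul, mul_one] at h1
    exact h1.le

/-- `ℒ_b(A, V)` is locally convex if `V` is. -/
theorem IsLocConvex.continuousLinearMap {A : Type*} [AddCommGroup A] [Module K A]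
    [TopologicalSpace A] {V : Type*} [AddCommGroup V] [Module K V] [TopologicalSpace V]
    [IsTopologicalAddGroup V] [ContinuousSMul K V] [IsLinearTopology (IntegerRing K) V] :
    IsLocConvex K (inferInstance : TopologicalSpace (A →L[K] V)) := by
  have hb := ContinuousLinearMap.hasBasis_nhds_zero_of_basis (σ := RingHom.id K) (E := A) (F := V)
    (IsLinearTopology.hasBasis_submodule (M := V) (IntegerRing K))
  refine ⟨inferInstance, inferInstance, ⟨hb.to_hasBasis ?_ fun N hN => ?_⟩⟩
  · rintro ⟨S, N⟩ ⟨hS, hN⟩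
    let M : Submodule (IntegerRing K) (A →L[K] V) :=
      { carrier := {Φ | ∀ x ∈ S, Φ x ∈ N}
        zero_mem' := fun x _ => N.zero_mem
        add_mem' := fun {a b} ha hb x hx => N.add_mem (ha x hx) (hb x hx)
        smul_mem' := fun c a ha x hx => N.smul_mem c (ha x hx) }
    exact ⟨M, hb.mem_of_mem (i := ⟨S, N⟩) ⟨hS, hN⟩, subset_rfl⟩
  · obtain ⟨⟨S, W⟩, hSW, hsub⟩ := hb.mem_iff.1 hN
    exact ⟨⟨S, W⟩, hSW, hsub⟩

end LocConvex

section Integration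

variable {L : Type uL} [NontriviallyNormedField L] [IsUltrametricDist L] {n : ℕ}
  {K : Type uK} [NontriviallyNormedField K] [IsUltrametricDist K] [CompleteSpace K]
  [NormedAlgebra L K]
  {X : Type uG} [TopologicalSpace X] [ChartedSpace (Fin n → L) X]
  [IsManifold 𝓘(L, Fin n → L) ω X]
  {V : Type uV} [AddCommGroup V] [Module K V] [TopologicalSpace V]
  [IsTopologicalAddGroup V] [ContinuousSMul K V] [T2Space V]

namespace VIndex

variable (J : VIndex L n K V (⊤ : Opens X))

/-- Families of scalar power series on the polydiscs of a `V`-index. -/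
abbrev ScalarSeries : Type _ := ∀ i, PowSer K (J.polyChart i).radius K

/-- The scalar function given by a family of scalar power series. -/
def toScalarCla : J.ScalarSeries →L[K] Cla L n K K (⊤ : Opens X) :=
  (ofPolyChart J.polyChart J.disjoint J.cover fun _ => BHSubspace.self K).toCla

theorem toScalarCla_apply (p : J.ScalarSeries) {x : X} {i : J.I}
    (hi : x ∈ (J.polyChart i).source) :
    J.toScalarCla p ⟨x, trivial⟩ = (p i).eval ((J.polyChart i).coord x) :=
  (ofPolyChart J.polyChart J.disjoint J.cover fun _ => BHSubspace.self K).toCla_apply p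
    (x := ⟨x, trivial⟩) (i := i) hi

open scoped Classical in
/-- The extension by zero of a scalar power series on one of the polydiscs. -/
def single (i : J.I) : PowSer K (J.polyChart i).radius K →L[K] Cla L n K K (⊤ : Opens X) :=
  J.toScalarCla.comp (ContinuousLinearMap.single K (fun i => PowSer K (J.polyChart i).radius K) i)

open scoped Classical in
theorem toScalarCla_single (i : J.I) (g : PowSer K (J.polyChart i).radius K) :
    J.toScalarCla (Pi.single i g) = J.single i g := rfl

theorem single_apply {i : J.I} (g : PowSer K (J.polyChart i).radius K) {x : X}
    (hx : x ∈ (J.polyChart i).source) :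
    J.single i g ⟨x, trivial⟩ = g.eval ((J.polyChart i).coord x) := by
  classical
  rw [← toScalarCla_single, J.toScalarCla_apply _ hx, Pi.single_eq_same]

theorem single_apply_of_notMem {i : J.I} (g : PowSer K (J.polyChart i).radius K) {x : X}
    (hx : x ∉ (J.polyChart i).source) : J.single i g ⟨x, trivial⟩ = 0 := by
  classical
  obtain ⟨j, hj⟩ := J.exists_mem ⟨x, trivial⟩
  rw [← toScalarCla_single, J.toScalarCla_apply _ hj, Pi.single_eq_of_ne,
    ← PowSer.evalL_apply ((J.polyChart j).coord_le hj), map_zero]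
  rintro rfl
  exact hx hj

/-- The restriction of a distribution to one of the polydiscs. -/
def component (μ : LaDistribution L n K X) (i : J.I) : PowSer K (J.polyChart i).radius K →L[K] K :=
  μ.comp (J.single i)

/-- A distribution is non-zero on finitely many of the polydiscs only, being continuous on the
product of the spaces of power series. -/
theorem finite_component (μ : LaDistribution L n K X) : {i | J.component μ i ≠ 0}.Finite := by
  classical
  obtain ⟨t, ht⟩ := exists_finset_eq_zero (μ.comp J.toScalarCla)
  refine t.finite_toSet.subset fun i hi => ?_
  by_contra hit
  refine hi (ContinuousLinearMap.ext fun g => ?_)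
  refine (congrArg μ (J.toScalarCla_single i g)).symm.trans (ht (Pi.single i g) fun j hj => ?_)
  rw [Pi.single_eq_of_ne]
  rintro rfl
  exact hit hj

/-- The integral of the function given by the family `p` of power series. -/
def integralₗ (p : J.Series) : LaDistribution L n K X →ₗ[K] V where
  toFun μ := ∑ᶠ i, (J.B i).ι (PowSer.pair (J.B i).E (J.component μ i) (p i))
  map_add' μ ν := by
    have h : ∀ μ : LaDistribution L n K X, (Function.support fun i =>
        (J.B i).ι (PowSer.pair (J.B i).E (J.component μ i) (p i))).Finite := by
      intro μ
      refine (J.finite_component μ).subset fun i hi h0 => hi ?_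
      have : PowSer.pair (J.B i).E (0 : PowSer K (J.polyChart i).radius K →L[K] K) = 0 := by
        rw [← zero_smul K (0 : PowSer K (J.polyChart i).radius K →L[K] K), PowSer.pair_smul,
          zero_smul]
      change (J.B i).ι (PowSer.pair (J.B i).E (J.component μ i) (p i)) = 0
      rw [h0, this, zero_apply, map_zero]
    rw [← finsum_add_distrib (h μ) (h ν)]
    refine finsum_congr fun i => ?_
    rw [← map_add, ← add_apply, ← PowSer.pair_add]
    rfl
  map_smul' c μ := by
    rw [RingHom.id_apply, smul_finsum]
    refine finsum_congr fun i => ?_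
    rw [← map_smul, ← smul_apply, ← PowSer.pair_smul]
    rfl

theorem integralₗ_dirac (p : J.Series) (x : X) :
    J.integralₗ p (dirac L n K x) = J.toCla p ⟨x, trivial⟩ := by
  obtain ⟨i, hi⟩ := J.exists_mem ⟨x, trivial⟩
  have h1 : J.component (dirac L n K x) i = PowSer.evalL K _ ((J.polyChart i).coord_le hi) :=
    ContinuousLinearMap.ext fun g => J.single_apply g hi
  have h2 : ∀ j, j ≠ i → J.component (dirac L n K x) j =
      (0 : K) • (0 : PowSer K (J.polyChart j).radius K →L[K] K) := by
    intro j hj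
    rw [zero_smul K (0 : PowSer K (J.polyChart j).radius K →L[K] K)]
    refine ContinuousLinearMap.ext fun g => J.single_apply_of_notMem g fun hx => hj ?_
    exact J.eq_of_mem hx hi
  rw [J.toCla_apply p hi]
  refine (finsum_eq_single _ i fun j hj => ?_).trans ?_
  · rw [h2 j hj, PowSer.pair_smul, zero_smul, zero_apply, map_zero]
  · rw [h1, PowSer.pair_evalL]
    rfl

variable [IsLinearTopology (IntegerRing K) V]

theorem exists_norm_le_imp_mem (B : BHSubspace K V) {N : Set V} (hN : N ∈ 𝓝 0) :
    ∃ δ : ℝ, 0 < δ ∧ ∀ v, ‖v‖ ≤ δ → B.ι v ∈ N := by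
  have h : B.ι ⁻¹' N ∈ 𝓝 0 := B.ι.continuous.continuousAt.preimage_mem_nhds (by rwa [map_zero])
  obtain ⟨δ, hδ, h⟩ := Metric.nhds_basis_closedBall.mem_iff.1 h
  exact ⟨δ, hδ, fun v hv => h (mem_closedBall_zero_iff.2 hv)⟩

theorem integralₗ_mem (p : J.Series) {N : Submodule (IntegerRing K) V} {δ : J.I → ℝ}
    (hδN : ∀ i v, ‖v‖ ≤ δ i → (J.B i).ι v ∈ N) (μ : LaDistribution L n K X)
    (h : ∀ i, ‖PowSer.pair (J.B i).E (J.component μ i) (p i)‖ ≤ δ i) : J.integralₗ p μ ∈ N :=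
  finsum_induction (fun v => v ∈ N) N.zero_mem (fun _ _ => N.add_mem) fun i => hδN i _ (h i)

/-- For a single function, the integrals against the distributions in a neighbourhood of zero are
small: the terms of its power series, scaled to the size of a neighbourhood in `V`, form a bounded
set of scalar functions. -/
theorem continuous_integralₗ (p : J.Series) : Continuous (J.integralₗ p) := by
  classical
  refine continuous_of_continuousAt_zero (J.integralₗ p) ?_
  rw [ContinuousAt, map_zero,
    (IsLinearTopology.hasBasis_submodule (IntegerRing K)).tendsto_right_iff]
  intro N hN
  choose δ hδ hδN using fun i => exists_norm_le_imp_mem (J.B i) hN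
  obtain ⟨M, hM, hMc⟩ := exists_norm_between K
  -- `c Xᵅ` on the `i`-th polydisc, with `c` of the size of the coefficient of `p i`
  let S : Set J.ScalarSeries := {q | ∃ (i : J.I) (α : Fin n →₀ ℕ) (c : K),
    ‖c‖ ≤ M * (‖(p i).coeff α‖ / δ i) ∧
      q = Pi.single (M := fun i => PowSer K (J.polyChart i).radius K) i (PowSer.monomial _ α c)}
  have hS : Bornology.IsVonNBounded K S := by
    refine Bornology.isVonNBounded_pi_iff.2 fun i => ?_
    refine Bornology.IsVonNBounded.subset ?_
      (NormedSpace.isVonNBounded_closedBall K (PowSer K (J.polyChart i).radius K)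
        (M * (‖p i‖ / δ i)))
    rintro _ ⟨_, ⟨j, α, c, hc, rfl⟩, rfl⟩
    rw [mem_closedBall_zero_iff]
    by_cases hji : i = j
    · subst hji
      rw [Function.eval, Pi.single_eq_same]
      refine (PowSer.norm_monomial_le _ _).trans ?_
      calc weight (J.polyChart i).radius α * ‖c‖
          ≤ weight (J.polyChart i).radius α * (M * (‖(p i).coeff α‖ / δ i)) := by
            gcongr
            exact weight_nonneg _ _
        _ = M * ((weight (J.polyChart i).radius α * ‖(p i).coeff α‖) / δ i) := by ring
        _ ≤ _ := by
            gcongr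
            · exact (hδ i).le
            · exact (p i).le_norm α
    · rw [Function.eval, Pi.single_eq_of_ne hji, norm_zero]
      have := hδ i
      positivity
  have h1 : {μ : LaDistribution L n K X | ∀ f ∈ J.toScalarCla '' S, μ f ∈ Metric.closedBall 0 1} ∈
      𝓝 0 := (ContinuousLinearMap.hasBasis_nhds_zero_of_basis
        (Metric.nhds_basis_closedBall (x := (0 : K)))).mem_of_mem (i := (_, 1))
          ⟨hS.image J.toScalarCla, one_pos⟩
  filter_upwards [h1] with μ hμ
  refine J.integralₗ_mem p hδN μ fun i => PowSer.norm_pair_le _ (hδ i).le fun α => ?_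
  rcases eq_or_ne ((p i).coeff α) 0 with h0 | h0
  · rw [h0, norm_zero, mul_zero]
    exact (hδ i).le
  · have hp := norm_pos_iff.2 h0
    obtain ⟨c, hc1, hc2⟩ := hMc _ (div_pos hp (hδ i))
    have h2 := hμ _ ⟨_, ⟨i, α, c, hc2, rfl⟩, rfl⟩
    rw [mem_closedBall_zero_iff] at h2
    have h3 : ‖J.component μ i (PowSer.monomial _ α c)‖ ≤ 1 := by
      rwa [toScalarCla_single] at h2
    rw [PowSer.apply_monomial, norm_mul] at h3
    have h4 := (mul_le_mul_of_nonneg_right hc1 (norm_nonneg _)).trans h3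
    rw [div_mul_eq_mul_div, div_le_one (hδ i)] at h4
    rwa [mul_comm]

/-- The integral of the function given by the family `p` of power series, as a continuous linear
map. -/
def integral (p : J.Series) : LaDistribution L n K X →L[K] V :=
  ⟨J.integralₗ p, J.continuous_integralₗ p⟩

/-- A bounded set of distributions is supported on finitely many of the polydiscs. -/
theorem finite_component_of_bounded {S : Set (LaDistribution L n K X)}
    (hS : Bornology.IsVonNBounded K S) : {i | ∃ μ ∈ S, J.component μ i ≠ 0}.Finite := by
  classical
  by_contra hinf
  have hinf' : Set.Infinite {i | ∃ μ ∈ S, J.component μ i ≠ 0} := hinf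
  let e := hinf'.natEmbedding
  have hg : ∀ k : ℕ, ∃ μ ∈ S, ∃ g, (k : ℝ) < ‖J.component μ (e k) g‖ := by
    intro k
    obtain ⟨μ, hμ, hne⟩ := (e k).2
    obtain ⟨g, hg⟩ : ∃ g, J.component μ (e k) g ≠ 0 := by
      by_contra h
      push Not at h
      exact hne (ContinuousLinearMap.ext h)
    obtain ⟨c, hc⟩ := NormedField.exists_lt_norm K (k / ‖J.component μ (e k) g‖)
    refine ⟨μ, hμ, c • g, ?_⟩
    rwa [map_smul, norm_smul, ← div_lt_iff₀ (norm_pos_iff.2 hg)]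
  choose μ hμ g hg using hg
  -- the functions `g k` live on distinct polydiscs, hence form a bounded set in the product
  let A : Set J.ScalarSeries := Set.range fun k : ℕ =>
    Pi.single (M := fun i => PowSer K (J.polyChart i).radius K) (e k : J.I) (g k)
  have hA : Bornology.IsVonNBounded K A := by
    refine Bornology.isVonNBounded_pi_iff.2 fun i => ?_
    by_cases hi : ∃ k, (e k : J.I) = i
    · obtain ⟨k, rfl⟩ := hi
      refine Bornology.IsVonNBounded.subset ?_
        (NormedSpace.isVonNBounded_closedBall K (PowSer K (J.polyChart (e k)).radius K) ‖g k‖)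
      rintro _ ⟨_, ⟨l, rfl⟩, rfl⟩
      rw [mem_closedBall_zero_iff]
      by_cases hkl : k = l
      · subst hkl
        change ‖(Pi.single (M := fun i => PowSer K (J.polyChart i).radius K) (e k : J.I) (g k) :
          J.ScalarSeries) (e k)‖ ≤ _
        rw [Pi.single_eq_same]
      · change ‖(Pi.single (M := fun i => PowSer K (J.polyChart i).radius K) (e l : J.I) (g l) :
          J.ScalarSeries) (e k)‖ ≤ _
        rw [Pi.single_eq_of_ne, norm_zero]
        · exact norm_nonneg _
        · exact fun h => hkl (e.injective (Subtype.ext h))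
    · refine Bornology.IsVonNBounded.subset ?_
        (NormedSpace.isVonNBounded_closedBall K (PowSer K (J.polyChart i).radius K) 0)
      rintro _ ⟨_, ⟨l, rfl⟩, rfl⟩
      rw [mem_closedBall_zero_iff]
      change ‖(Pi.single (M := fun i => PowSer K (J.polyChart i).radius K) (e l : J.I) (g l) :
        J.ScalarSeries) i‖ ≤ _
      rw [Pi.single_eq_of_ne, norm_zero]
      exact fun h => hi ⟨l, h.symm⟩
  have hb := ContinuousLinearMap.isVonNBounded_image2_apply hS (hA.image J.toScalarCla)
  obtain ⟨R, hR⟩ := ((NormedSpace.isVonNBounded_iff K).1 hb).exists_norm_le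
  obtain ⟨k, hk⟩ := exists_nat_gt R
  have := hR _ ⟨μ k, hμ k, _, ⟨_, ⟨k, rfl⟩, rfl⟩, rfl⟩
  have h2 : (k : ℝ) < R := by
    exact (hg k).trans_le this
  linarith

/-- The distributions in a bounded set have bounded norms on each polydisc. -/
theorem exists_norm_component_le {S : Set (LaDistribution L n K X)}
    (hS : Bornology.IsVonNBounded K S) (i : J.I) : ∃ C : ℝ, ∀ μ ∈ S, ‖J.component μ i‖ ≤ C := by
  have h := hS.image (ContinuousLinearMap.precomp K (J.single i))
  obtain ⟨C, hC⟩ := ((NormedSpace.isVonNBounded_iff K).1 h).exists_norm_le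
  exact ⟨C, fun μ hμ => hC _ ⟨μ, hμ, rfl⟩⟩

variable [LocallyCompactSpace L] [T2Space X] [SecondCountableTopology X]

theorem integral_dirac (p : J.Series) (x : X) :
    J.integral p (dirac L n K x) = J.toCla p ⟨x, trivial⟩ := J.integralₗ_dirac p x

/-- Integration is continuous for the topology of bounded convergence: on a bounded set of
distributions only finitely many of the polydiscs matter, and on each of them the distributions have
bounded norms. -/
theorem continuous_integral : Continuous J.integral := by
  classical
  let T : J.Series →ₗ[K] (LaDistribution L n K X →L[K] V) :=
    { toFun := J.integral
      map_add' := fun p q => dirac_ext fun x => by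
        rw [add_apply, integral_dirac, integral_dirac, integral_dirac, map_add]
        rfl
      map_smul' := fun c p => dirac_ext fun x => by
        rw [smul_apply, integral_dirac, integral_dirac, map_smul]
        rfl }
  suffices h : ContinuousAt T 0 by
    have hgrp : IsTopologicalAddGroup (LaDistribution L n K X →L[K] V) := inferInstance
    have := hgrp.toContinuousAdd
    exact continuous_of_continuousAt_zero T h
  rw [ContinuousAt, map_zero, (ContinuousLinearMap.hasBasis_nhds_zero_of_basis
    (σ := RingHom.id K) (E := LaDistribution L n K X) (F := V)
    (IsLinearTopology.hasBasis_submodule (M := V) (IntegerRing K))).tendsto_right_iff]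
  rintro ⟨S, N⟩ ⟨hS, hN⟩
  choose δ hδ hδN using fun i => exists_norm_le_imp_mem (J.B i) hN
  choose C hC using J.exists_norm_component_le hS
  have hfin := J.finite_component_of_bounded hS
  have h1 : ∀ i ∈ {i | ∃ μ ∈ S, J.component μ i ≠ 0},
      {p : J.Series | ‖C i‖ * ‖p i‖ ≤ δ i} ∈ 𝓝 (0 : J.Series) := by
    intro i _
    have h2 : Tendsto (fun p : J.Series => ‖C i‖ * ‖p i‖) (𝓝 0)
        (𝓝 (‖C i‖ * ‖(0 : J.Series) i‖)) :=
      (continuous_const.mul (continuous_apply i).norm).tendsto 0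
    rw [Pi.zero_apply, norm_zero, mul_zero] at h2
    exact h2.eventually (ge_mem_nhds (hδ i))
  filter_upwards [(biInter_mem hfin).2 h1] with p hp μ hμ
  refine J.integralₗ_mem p hδN μ fun i => ?_
  refine (PowSer.norm_pair_le_mul _ _).trans ?_
  by_cases hi : J.component μ i = 0
  · rw [hi, norm_zero, zero_mul]
    exact (hδ i).le
  · refine le_trans ?_ (Set.mem_iInter₂.1 hp i ⟨μ, hμ, hi⟩)
    exact mul_le_mul_of_nonneg_right ((hC i μ hμ).trans (le_abs_self _)) (norm_nonneg _)

end VIndex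

section Global

variable [LocallyCompactSpace L] [T2Space X] [SecondCountableTopology X]
  [IsLinearTopology (IntegerRing K) V]

theorem exists_integral (f : Cla L n K V (⊤ : Opens X)) :
    ∃ Φ : LaDistribution L n K X →L[K] V, ∀ x, Φ (dirac L n K x) = f ⟨x, trivial⟩ := by
  obtain ⟨J, p, rfl⟩ := f.exists_toCla
  exact ⟨J.integral p, J.integral_dirac p⟩

/-- Integration of a locally analytic function against distributions. -/
def integrationₗ : Cla L n K V (⊤ : Opens X) →ₗ[K] (LaDistribution L n K X →L[K] V) where
  toFun f := (exists_integral f).choose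
  map_add' f g := dirac_ext fun x => by
    rw [add_apply, (exists_integral _).choose_spec, (exists_integral _).choose_spec,
      (exists_integral _).choose_spec]
    rfl
  map_smul' c f := dirac_ext fun x => by
    rw [smul_apply, (exists_integral _).choose_spec, (exists_integral _).choose_spec]
    rfl

theorem integrationₗ_dirac (f : Cla L n K V (⊤ : Opens X)) (x : X) :
    integrationₗ f (dirac L n K x) = f ⟨x, trivial⟩ := (exists_integral f).choose_spec x

theorem integrationₗ_toCla (J : VIndex L n K V (⊤ : Opens X)) (p : J.Series) :
    integrationₗ (J.toCla p) = J.integral p :=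
  dirac_ext fun x => by rw [integrationₗ_dirac, J.integral_dirac]

variable (L n K X V) in
/-- The integration map `C^la(X, V) → ℒ_b(D(X), V)`. -/
def integration : Cla L n K V (⊤ : Opens X) →L[K] (LaDistribution L n K X →L[K] V) where
  toLinearMap := integrationₗ
  cont := Cla.continuous_of_toCla IsLocConvex.continuousLinearMap _ fun J => by
    refine J.continuous_integral.congr fun p => ?_
    exact (integrationₗ_toCla J p).symm

theorem isIntegrationMap_integration : IsIntegrationMap L n (integration L n K X V) :=
  fun f x => integrationₗ_dirac f x

theorem IsIntegrationMap.eq_integration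
    {I : Cla L n K V (⊤ : Opens X) →L[K] (LaDistribution L n K X →L[K] V)}
    (hI : IsIntegrationMap L n I) : I = integration L n K X V :=
  ContinuousLinearMap.ext fun f => dirac_ext fun x => by
    rw [hI f x, isIntegrationMap_integration f x]

end Global

end Integration

section Apply

variable {K : Type*} [NontriviallyNormedField K] {A : Type*} [AddCommGroup A] [Module K A]
  [TopologicalSpace A] [ContinuousSMul K A]

/-- Evaluation at `a`, as a continuous linear map on `ℒ_b(A, V)`. -/
def applyCLM (V : Type*) [AddCommGroup V] [Module K V] [TopologicalSpace V]
    [IsTopologicalAddGroup V] [ContinuousSMul K V] (a : A) : (A →L[K] V) →L[K] V where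
  toFun S := S a
  map_add' _ _ := rfl
  map_smul' _ _ := rfl
  cont := continuous_eval_const a

end Apply

/-! ### BH-subspaces from continuous linear maps -/

section Range

variable {K : Type uK} [NontriviallyNormedField K]
  {E : Type*} [NormedAddCommGroup E] [NormedSpace K E]
  {V : Type uV} [AddCommGroup V] [Module K V] [TopologicalSpace V] [T2Space V]

/-- The range of a continuous linear map on a Banach space, to be equipped with the quotient
norm. -/
def RangeType (T : E →L[K] V) : Type uV := LinearMap.range T.toLinearMap

namespace RangeType

variable (T : E →L[K] V)

instance : AddCommGroup (RangeType T) :=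
  inferInstanceAs (AddCommGroup (LinearMap.range T.toLinearMap))

instance : Module K (RangeType T) := inferInstanceAs (Module K (LinearMap.range T.toLinearMap))

instance : IsClosed (LinearMap.ker T.toLinearMap : Set E) := T.isClosed_ker

/-- The range of `T` is the quotient by the kernel of `T`. -/
def equiv : (E ⧸ LinearMap.ker T.toLinearMap) ≃ₗ[K] RangeType T := T.toLinearMap.quotKerEquivRange

instance : NormedAddCommGroup (RangeType T) :=
  NormedAddCommGroup.induced _ (E ⧸ LinearMap.ker T.toLinearMap) (equiv T).symm
    (equiv T).symm.injective

instance : NormedSpace K (RangeType T) :=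
  NormedSpace.induced K (RangeType T) (E ⧸ LinearMap.ker T.toLinearMap) (equiv T).symm

theorem norm_def (x : RangeType T) : ‖x‖ = ‖(equiv T).symm x‖ := rfl

/-- The identification of the quotient by the kernel with the range is isometric. -/
def isometry : (E ⧸ LinearMap.ker T.toLinearMap) ≃ₗᵢ[K] RangeType T where
  toLinearEquiv := equiv T
  norm_map' x := by rw [norm_def, LinearEquiv.symm_apply_apply]

instance [CompleteSpace E] : CompleteSpace (RangeType T) :=
  (isometry T).toIsometryEquiv.completeSpace_iff.1 inferInstance

instance [IsUltrametricDist E] : IsUltrametricDist (RangeType T) := by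
  apply IsUltrametricDist.isUltrametricDist_of_forall_norm_add_le_max_norm
  intro x y
  obtain ⟨x, rfl⟩ := (isometry T).surjective x
  obtain ⟨y, rfl⟩ := (isometry T).surjective y
  rw [← map_add, (isometry T).norm_map, (isometry T).norm_map, (isometry T).norm_map]
  refine le_of_forall_pos_lt_add fun ε hε => ?_
  obtain ⟨a, rfl, ha⟩ := Submodule.Quotient.norm_mk_lt x hε
  obtain ⟨b, rfl, hb⟩ := Submodule.Quotient.norm_mk_lt y hε
  rw [← Submodule.Quotient.mk_add, ← max_add_add_right]
  exact (Submodule.Quotient.norm_mk_le _ (a + b)).trans_lt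
    ((IsUltrametricDist.norm_add_le_max _ _).trans_lt (max_lt_max ha hb))

end RangeType

/-- The range of a continuous linear map from a Banach space is a BH-subspace. -/
theorem exists_bhSubspace_range [IsUltrametricDist E] [CompleteSpace E] (T : E →L[K] V) :
    ∃ (B : BHSubspace K V) (q : E →L[K] B.E), ∀ e, B.ι (q e) = T e := by
  let ι : RangeType T →L[K] V :=
    { toLinearMap := (LinearMap.range T.toLinearMap).subtype
      cont := by
        have h : Continuous ((LinearMap.ker T.toLinearMap).liftQ T.toLinearMap le_rfl) :=
          T.continuous.quotient_lift _
        refine (h.comp (RangeType.isometry T).symm.continuous).congr fun x => ?_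
        obtain ⟨x, rfl⟩ := (RangeType.isometry T).surjective x
        obtain ⟨e, rfl⟩ := Submodule.Quotient.mk_surjective _ x
        exact congrArg _ ((RangeType.isometry T).symm_apply_apply _) }
  let q : E →L[K] RangeType T :=
    { toLinearMap := (RangeType.equiv T).toLinearMap ∘ₗ (LinearMap.ker T.toLinearMap).mkQ
      cont := (RangeType.isometry T).continuous.comp continuous_quot_mk }
  exact ⟨{ E := RangeType T, ι := ι, injective := Subtype.val_injective }, q, fun e => rfl⟩

end Range

/-! ### The pairing of distributions and germs at a point -/

section PairMap

variable {K : Type*} [NontriviallyNormedField K] [IsUltrametricDist K] [CompleteSpace K] {n : ℕ}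
  {r : Fin n → ℝ≥0} [Fact (∀ j, 0 < r j)]
  {E : Type*} [NormedAddCommGroup E] [NormedSpace K E] [IsUltrametricDist E] [CompleteSpace E]
  {F : Type*} [NormedAddCommGroup F] [NormedSpace K F] [IsUltrametricDist F] [CompleteSpace F]

namespace PowSer

theorem pair_map (μ : PowSer K r K →L[K] K) (T : E →L[K] F) (g : PowSer K r E) :
    pair F μ (g.map T) = T (pair E μ g) := by
  have h : (pair F μ).comp (mapL r T) = T.comp (pair E μ) := ext_monomial fun i v => by
    change pair F μ ((monomial r i v).map T) = T (pair E μ (monomial r i v))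
    rw [map_monomial, pair_monomial, pair_monomial, map_smul]
  exact congrArg (fun S => S g) h

theorem pair_coeffL (i : Fin n →₀ ℕ) : pair E (coeffL r K i) = coeffL r E i :=
  ext_monomial fun j v => by
    rw [pair_monomial, coeffL_apply, coeffL_apply, coeff_monomial, coeff_monomial]
    split_ifs <;> simp

end PowSer

end PairMap

section Pairing

variable {L : Type uL} [NontriviallyNormedField L] [IsUltrametricDist L] {n : ℕ}
  {K : Type uK} [NontriviallyNormedField K] [IsUltrametricDist K] [CompleteSpace K]
  [NormedAlgebra L K]
  {X : Type uG} [TopologicalSpace X] [ChartedSpace (Fin n → L) X]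
  [IsManifold 𝓘(L, Fin n → L) ω X]
  {V : Type uV} [AddCommGroup V] [Module K V] [TopologicalSpace V]
  [IsTopologicalAddGroup V] [ContinuousSMul K V] [T2Space V]
  [LocallyCompactSpace L] [T2Space X] [SecondCountableTopology X]

/-- Every germ extends to a function on `X`, by zero outside a small polydisc. -/
theorem Cla.toGerm_surjective (x : X) :
    Function.Surjective (Cla.toGerm L n K V (Opens.mem_top x)) := by
  intro F
  obtain ⟨B, ρ₀, hρ₀, h⟩ := F.exists_ballAt
  obtain ⟨hsub, g, rfl⟩ := h ρ₀ hρ₀ le_rfl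
  exact ⟨rigCla (ballAt L n x ρ₀ hρ₀ hsub) B g,
    toGerm_rigCla (ballAt L n x ρ₀ hρ₀ hsub) (mem_ballAt x ρ₀ hρ₀ hsub) B g⟩

theorem incl_injective (x : X) : Function.Injective (DistributionAt.incl L n K x) := by
  intro μ ν h
  refine ContinuousLinearMap.ext fun F => ?_
  obtain ⟨f, rfl⟩ := Cla.toGerm_surjective x F
  exact congrArg (fun θ => θ f) h

theorem ClaGerm.exists_rigGermK {x : X} (F : ClaGerm L n K K x) : ∃ ρ₀ : ℝ≥0, 0 < ρ₀ ∧
    ∀ (ρ : ℝ≥0) (hρ : 0 < ρ), ρ ≤ ρ₀ → ∃ (hsub : polyBall (chartAt (Fin n → L) x x) (fun _ => ρ) ⊆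
      (chartAt (Fin n → L) x).target) (g : PowSer K (fun _ : Fin n => ρ) K),
        rigGermK (ballAt L n x ρ hρ hsub) (mem_ballAt x ρ hρ hsub) g = F := by
  obtain ⟨ρ₀, hρ₀, C, h⟩ := ClaGerm.exists_rigGermK_of_bounded
    (Bornology.isVonNBounded_singleton (𝕜 := K) F)
  refine ⟨ρ₀, hρ₀, fun ρ hρ hle => ?_⟩
  obtain ⟨hsub, h⟩ := h ρ hρ hle
  obtain ⟨g, -, hg⟩ := h F rfl
  exact ⟨hsub, g, hg⟩

/-- The extension by zero of a scalar power series on a polydisc. -/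
def rigClaK (D : PolyChart L n X) : PowSer K D.radius K →L[K] Cla L n K K (⊤ : Opens X) :=
  rigCla D (BHSubspace.self K)

theorem rigClaK_apply (D : PolyChart L n X) (g : PowSer K D.radius K) {y : X}
    (hy : y ∈ D.source) : rigClaK D g ⟨y, trivial⟩ = g.eval (D.coord y) :=
  rigCla_apply D (BHSubspace.self K) g hy

theorem rigClaK_apply_of_notMem (D : PolyChart L n X) (g : PowSer K D.radius K) {y : X}
    (hy : y ∉ D.source) : rigClaK D g ⟨y, trivial⟩ = 0 :=
  rigCla_apply_of_notMem D (BHSubspace.self K) g hy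

theorem toGerm_rigClaK {x : X} (D : PolyChart L n X) (hx : x ∈ D.source)
    (g : PowSer K D.radius K) :
    Cla.toGerm L n K K (Opens.mem_top x) (rigClaK D g) = rigGermK D hx g :=
  toGerm_rigCla D hx (BHSubspace.self K) g

variable [IsLinearTopology (IntegerRing K) V]

/-- The integral of a function that vanishes near `x` against a distribution supported at `x` is
zero. -/
theorem integration_incl_eq_zero {x : X} {f : Cla L n K V (⊤ : Opens X)}
    (hf : Cla.toGerm L n K V (Opens.mem_top x) f = 0) (μ : DistributionAt L n K x) :
    integration L n K X V f (DistributionAt.incl L n K x μ) = 0 := by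
  obtain ⟨J, p, rfl⟩ := f.exists_toCla
  obtain ⟨i, hi⟩ := J.exists_mem ⟨x, trivial⟩
  change integrationₗ (J.toCla p) _ = 0
  rw [integrationₗ_toCla]
  refine (finsum_congr fun j => ?_).trans (finsum_zero (α := J.I))
  by_cases hj : j = i
  · subst hj
    have h0 : p j = 0 := by
      refine rigGerm_injective (J.polyChart j) hi (J.B j) ?_
      rw [map_zero, ← hf]
      refine ClaGerm.ext ?_
      rw [germ_rigGerm, Cla.germ_toGerm_top]
      refine Germ.coe_eq.2 ?_
      filter_upwards [(J.polyChart j).isOpen_source.mem_nhds hi] with y hy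
      exact (J.toCla_apply (x := ⟨y, trivial⟩) p hy).symm
    rw [h0, map_zero, map_zero]
  · have h0 : J.component (DistributionAt.incl L n K x μ) j =
        (0 : K) • (0 : PowSer K (J.polyChart j).radius K →L[K] K) := by
      rw [zero_smul K (0 : PowSer K (J.polyChart j).radius K →L[K] K)]
      refine ContinuousLinearMap.ext fun g => ?_
      refine (congrArg μ (?_ : Cla.toGerm L n K K (Opens.mem_top x) (J.single j g) = 0)).trans
        (map_zero μ)
      refine ClaGerm.ext ?_
      rw [Cla.germ_toGerm_top]
      refine Germ.coe_eq.2 ?_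
      filter_upwards [(J.polyChart i).isOpen_source.mem_nhds hi] with y hy
      exact J.single_apply_of_notMem g fun hyj => hj (J.eq_of_mem hyj hy)
    rw [h0, PowSer.pair_smul, zero_smul, zero_apply, map_zero]

theorem integration_incl_congr {x : X} {f g : Cla L n K V (⊤ : Opens X)}
    (h : Cla.toGerm L n K V (Opens.mem_top x) f = Cla.toGerm L n K V (Opens.mem_top x) g)
    (μ : DistributionAt L n K x) :
    integration L n K X V f (DistributionAt.incl L n K x μ) =
      integration L n K X V g (DistributionAt.incl L n K x μ) := by
  have h0 := integration_incl_eq_zero (f := f - g) (by rw [map_sub, h, sub_self]) μ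
  rw [map_sub] at h0
  exact sub_eq_zero.1 h0

/-- The pairing `D_x(X) × C^la_x(X, V) → V`. -/
def germPairing (x : X) : DistributionAt L n K x →ₗ[K] ClaGerm L n K V x →ₗ[K] V :=
  have hs (F : ClaGerm L n K V x) := Function.surjInv_eq (Cla.toGerm_surjective x) F
  LinearMap.mk₂ K (fun μ F => integration L n K X V
      (Function.surjInv (Cla.toGerm_surjective x) F) (DistributionAt.incl L n K x μ))
    (fun μ ν F => by rw [map_add, map_add])
    (fun c μ F => by rw [map_smul, map_smul])
    (fun μ F G => (integration_incl_congr (by rw [map_add, hs, hs, hs]) μ).trans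
      (congrArg (fun S => S (DistributionAt.incl L n K x μ)) (map_add (integration L n K X V) _ _)))
    (fun c μ F => (integration_incl_congr (by rw [map_smul, hs, hs]) μ).trans
      (congrArg (fun S => S (DistributionAt.incl L n K x μ))
        (map_smul (integration L n K X V) _ _)))

theorem germPairing_toGerm {x : X} (μ : DistributionAt L n K x) (f : Cla L n K V (⊤ : Opens X)) :
    germPairing x μ (Cla.toGerm L n K V (Opens.mem_top x) f) =
      integration L n K X V f (DistributionAt.incl L n K x μ) :=
  integration_incl_congr (Function.surjInv_eq (Cla.toGerm_surjective x) _) μ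

theorem isGermPairing_germPairing (x : X) :
    IsGermPairing L n x (germPairing (L := L) (n := n) (K := K) (V := V) x) :=
  ⟨_, isIntegrationMap_integration, germPairing_toGerm⟩

theorem IsGermPairing.eq_germPairing {x : X}
    {P : DistributionAt L n K x →ₗ[K] ClaGerm L n K V x →ₗ[K] V} (hP : IsGermPairing L n x P) :
    P = germPairing x := by
  obtain ⟨I, hI, h⟩ := hP
  refine LinearMap.ext fun μ => LinearMap.ext fun F => ?_
  obtain ⟨f, rfl⟩ := Cla.toGerm_surjective x F
  rw [h, germPairing_toGerm, hI.eq_integration]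

/-- On functions `h(·) v` with a scalar function `h`, integration is integration of `h`. -/
theorem integration_of_smul {f : Cla L n K V (⊤ : Opens X)} {h : Cla L n K K (⊤ : Opens X)} {v : V}
    (hf : ∀ y : X, f ⟨y, trivial⟩ = h ⟨y, trivial⟩ • v) (μ : LaDistribution L n K X) :
    integration L n K X V f μ = μ h • v := by
  let S : LaDistribution L n K X →L[K] V :=
    (ContinuousLinearMap.toSpanSingleton K v).comp (applyCLM K h)
  have hS : integration L n K X V f = S := dirac_ext fun y =>
    (isIntegrationMap_integration f y).trans (hf y)
  rw [hS]
  rfl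

theorem isLocConvex_of_isLinearTopology : IsLocConvex K (inferInstance : TopologicalSpace V) :=
  ⟨inferInstance, inferInstance, inferInstance⟩

/-- The pairing on germs given by power series on a polydisc. -/
theorem germPairing_rigGerm {x : X} (D : PolyChart L n X) (hx : x ∈ D.source) (B : BHSubspace K V)
    (μ : DistributionAt L n K x) (g : PowSer K D.radius B.E) :
    germPairing x μ (rigGerm D hx B g) = B.ι (PowSer.pair B.E (μ.comp (rigGermK D hx)) g) := by
  have h : (applyCLM V (DistributionAt.incl L n K x μ)).comp
      ((integration L n K X V).comp (rigCla D B)) =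
        B.ι.comp (PowSer.pair B.E (μ.comp (rigGermK D hx))) :=
    PowSer.ext_monomial fun i v => by
      change integration L n K X V (rigCla D B (PowSer.monomial D.radius i v))
        (DistributionAt.incl L n K x μ) =
          B.ι (PowSer.pair B.E (μ.comp (rigGermK D hx)) (PowSer.monomial D.radius i v))
      rw [PowSer.pair_monomial, map_smul, integration_of_smul
        (h := rigClaK D (PowSer.monomial D.radius i 1)) (v := B.ι v)]
      · exact congrArg (fun c : K => c • B.ι v) (congrArg μ (toGerm_rigClaK D hx _))
      · intro y
        by_cases hy : y ∈ D.source
        · rw [rigCla_apply D B _ hy, rigClaK_apply D _ hy, PowSer.eval_monomial, map_smul,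
            PowSer.eval_monomial, smul_eq_mul, mul_one]
        · rw [rigCla_apply_of_notMem D B _ hy, rigClaK_apply_of_notMem D _ hy, zero_smul]
  rw [← toGerm_rigCla D hx B g, germPairing_toGerm]
  exact congrArg (fun S => S g) h

theorem separatelyContinuous_germPairing (x : X) :
    SeparatelyContinuous (germPairing (L := L) (n := n) (K := K) (V := V) x) := by
  refine ⟨fun μ => ?_, fun F => ?_⟩
  · refine ClaGerm.continuous_of_rigGerm isLocConvex_of_isLinearTopology (germPairing x μ)
      fun D hx B => ?_
    refine (B.ι.comp (PowSer.pair B.E (μ.comp (rigGermK D hx)))).continuous.congr fun g => ?_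
    exact (germPairing_rigGerm D hx B μ g).symm
  · obtain ⟨f, rfl⟩ := Cla.toGerm_surjective x F
    refine ((integration L n K X V f).comp (ContinuousLinearMap.precomp K
      (Cla.toGerm L n K K (Opens.mem_top x)))).continuous.congr fun μ => ?_
    exact (germPairing_toGerm μ f).symm

/-- On germs `F(·) v` with a scalar germ `F`, the pairing is evaluation at `F`. -/
theorem germPairing_of_smul {x : X} (μ : DistributionAt L n K x) {F : ClaGerm L n K K x}
    {G : ClaGerm L n K V x} {v : V} (h : G.germ = F.germ.map (· • v)) :
    germPairing x μ G = μ F • v := by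
  obtain ⟨ρ₀, hρ₀, hF⟩ := F.exists_rigGermK
  obtain ⟨hsub, g, rfl⟩ := hF ρ₀ hρ₀ le_rfl
  obtain ⟨B, q, hq⟩ := exists_bhSubspace_range (ContinuousLinearMap.toSpanSingleton K v)
  have hG : G = rigGerm (ballAt L n x ρ₀ hρ₀ hsub) (mem_ballAt x ρ₀ hρ₀ hsub) B (g.map q) := by
    refine ClaGerm.ext ?_
    rw [h, germ_rigGerm, germ_rigGermK, Germ.map_coe]
    refine Germ.coe_eq.2 ?_
    filter_upwards [(ballAt L n x ρ₀ hρ₀ hsub).isOpen_source.mem_nhds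
      (mem_ballAt x ρ₀ hρ₀ hsub)] with y hy
    rw [PowSer.map_eval _ _ ((ballAt L n x ρ₀ hρ₀ hsub).coord_le hy), hq,
      ContinuousLinearMap.toSpanSingleton_apply, Function.comp_apply]
  rw [hG, germPairing_rigGerm, PowSer.pair_map, hq, PowSer.pair_self,
    ContinuousLinearMap.toSpanSingleton_apply]
  rfl

/-- For every scalar germ `F` and every vector `v`, there is the germ `F(·) v`. -/
theorem ClaGerm.exists_smul {x : X} (F : ClaGerm L n K K x) (v : V) :
    ∃ G : ClaGerm L n K V x, G.germ = F.germ.map (· • v) := by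
  obtain ⟨ρ₀, hρ₀, hF⟩ := F.exists_rigGermK
  obtain ⟨hsub, g, rfl⟩ := hF ρ₀ hρ₀ le_rfl
  obtain ⟨B, q, hq⟩ := exists_bhSubspace_range (ContinuousLinearMap.toSpanSingleton K v)
  refine ⟨rigGerm (ballAt L n x ρ₀ hρ₀ hsub) (mem_ballAt x ρ₀ hρ₀ hsub) B (g.map q), ?_⟩
  rw [germ_rigGerm, germ_rigGermK, Germ.map_coe]
  refine Germ.coe_eq.2 ?_
  filter_upwards [(ballAt L n x ρ₀ hρ₀ hsub).isOpen_source.mem_nhds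
    (mem_ballAt x ρ₀ hρ₀ hsub)] with y hy
  rw [PowSer.map_eval _ _ ((ballAt L n x ρ₀ hρ₀ hsub).coord_le hy), hq,
    ContinuousLinearMap.toSpanSingleton_apply, Function.comp_apply]

theorem germPairing_taylorK {x : X} (i : Fin n →₀ ℕ) (F : ClaGerm L n K V x) :
    germPairing x (taylorK x i) F = taylor isLocConvex_of_isLinearTopology x i F := by
  obtain ⟨B, ρ₀, hρ₀, h⟩ := F.exists_ballAt
  obtain ⟨hsub, g, rfl⟩ := h ρ₀ hρ₀ le_rfl
  have hT : (taylorK x i).comp (rigGermK (ballAt L n x ρ₀ hρ₀ hsub) (mem_ballAt x ρ₀ hρ₀ hsub)) =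
      PowSer.coeffL (ballAt L n x ρ₀ hρ₀ hsub).radius K i :=
    ContinuousLinearMap.ext fun g => taylorK_rigGermK hρ₀ hsub _ g i
  rw [germPairing_rigGerm, taylor_rigGerm, hT, PowSer.pair_coeffL]
  rfl

/-- The pairing is non-degenerate on every space of distributions at `x` which contains the Taylor
coefficients. -/
theorem nondegenerate_germPairing_domRestrict [Nontrivial V] {x : X}
    {S : Submodule K (DistributionAt L n K x)} (hS : ∀ i, taylorK x i ∈ S) :
    ((germPairing (L := L) (n := n) (K := K) (V := V) x).domRestrict S).Nondegenerate := by
  refine ⟨fun μ hμ => ?_, fun F hF => ?_⟩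
  · obtain ⟨v, hv⟩ := exists_ne (0 : V)
    refine Subtype.ext (ContinuousLinearMap.ext fun F => ?_)
    obtain ⟨G, hG⟩ := F.exists_smul v
    have h := hμ G
    rw [LinearMap.domRestrict_apply, germPairing_of_smul _ hG] at h
    exact (smul_eq_zero.1 h).resolve_right hv
  · refine ClaGerm.eq_zero_of_taylor isLocConvex_of_isLinearTopology fun i => ?_
    rw [← germPairing_taylorK]
    exact hF ⟨_, hS i⟩

theorem nondegenerate_germPairing [Nontrivial V] (x : X) :
    (germPairing (L := L) (n := n) (K := K) (V := V) x).Nondegenerate := by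
  have h := nondegenerate_germPairing_domRestrict (V := V) (x := x)
    (S := (⊤ : Submodule K (DistributionAt L n K x))) fun _ => trivial
  exact ⟨fun μ hμ => congrArg Subtype.val (h.1 ⟨μ, trivial⟩ hμ), fun F hF => h.2 F fun μ => hF μ⟩

end Pairing

/-! ### The hyperalgebra -/

section Hyperalgebra

variable {L : Type uL} [NontriviallyNormedField L] [IsUltrametricDist L] {n : ℕ}
  {K : Type uK} [NontriviallyNormedField K] [IsUltrametricDist K] [CompleteSpace K]
  [NormedAlgebra L K]
  {X : Type uG} [TopologicalSpace X] [ChartedSpace (Fin n → L) X]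
  [IsManifold 𝓘(L, Fin n → L) ω X]
  [LocallyCompactSpace L] [T2Space X] [SecondCountableTopology X]

theorem germ_value_coe {x : X} (f : X → K) : (f : Germ (𝓝 x) K).value = f x := rfl

/-- A germ as an element of the ring of germs. -/
def ClaGerm.toRing {x : X} (F : ClaGerm L n K K x) : claGermSubring L n K x := ⟨F.1, F.2⟩

/-- An element of the ring of germs as a germ. -/
def ClaGerm.ofRing {x : X} (f : claGermSubring L n K x) : ClaGerm L n K K x := ⟨f.1, f.2⟩

/-- The germs whose Taylor coefficients of degree less than `k` vanish. -/
def VanishTo {x : X} (k : ℕ) (F : ClaGerm L n K K x) : Prop :=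
  ∀ i : Fin n →₀ ℕ, i.degree < k → taylorK x i F = 0

theorem toRing_rigGermK_mul {x : X} (D : PolyChart L n X) (hx : x ∈ D.source)
    (g h : PowSer K D.radius K) :
    (rigGermK D hx (g.mul h)).toRing = (rigGermK D hx g).toRing * (rigGermK D hx h).toRing := by
  refine Subtype.ext ?_
  change (rigGermK D hx (g.mul h)).germ = (rigGermK D hx g).germ * (rigGermK D hx h).germ
  rw [germ_rigGermK, germ_rigGermK, germ_rigGermK, ← Germ.coe_mul]
  refine Germ.coe_eq.2 ?_
  filter_upwards [D.isOpen_source.mem_nhds hx] with y hy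
  rw [PowSer.eval_mul _ _ (D.coord_le hy), Pi.mul_apply]

/-- Orders of vanishing add up; `H` is the product of `F` and `G` in the ring of germs. -/
theorem VanishTo.mul {x : X} {a b : ℕ} {F G H : ClaGerm L n K K x} (hF : VanishTo a F)
    (hG : VanishTo b G) (h : H.toRing = F.toRing * G.toRing) : VanishTo (a + b) H := by
  obtain ⟨ρ₁, hρ₁, h1⟩ := F.exists_rigGermK
  obtain ⟨ρ₂, hρ₂, h2⟩ := G.exists_rigGermK
  have hρ := lt_min hρ₁ hρ₂
  obtain ⟨hsub, g₁, rfl⟩ := h1 _ hρ (min_le_left _ _)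
  obtain ⟨_, g₂, rfl⟩ := h2 _ hρ (min_le_right _ _)
  rw [← toRing_rigGermK_mul] at h
  have hH : H = rigGermK (ballAt L n x _ hρ hsub) (mem_ballAt x _ hρ hsub) (g₁.mul g₂) :=
    Subtype.ext (congrArg Subtype.val h)
  intro i hi
  rw [hH, taylorK_rigGermK]
  refine PowSer.coeff_mul_eq_zero (a := a) (b := b) (fun k hk => ?_) (fun k hk => ?_) hi
  · rw [← hF k hk, taylorK_rigGermK]
  · rw [← hG k hk, taylorK_rigGermK]

/-- The constant Taylor coefficient is the value. -/
theorem taylorK_zero {x : X} (F : ClaGerm L n K K x) : taylorK x 0 F = F.germ.value := by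
  obtain ⟨ρ₀, hρ₀, h⟩ := F.exists_rigGermK
  obtain ⟨hsub, g, rfl⟩ := h ρ₀ hρ₀ le_rfl
  rw [taylorK_rigGermK, germ_rigGermK, germ_value_coe, ← PowSer.eval_zero_eq (L := L)]
  refine congrArg g.eval ?_
  exact (sub_self _).symm

theorem ClaGerm.toRing_mem_maxIdeal {x : X} {F : ClaGerm L n K K x} :
    F.toRing ∈ maxIdeal L n K x ↔ F.germ.value = 0 := Iff.rfl

/-- The elements of `𝔪_x ^ k` vanish to order `k`. -/
theorem vanishTo_of_mem {x : X} {k : ℕ} {F : ClaGerm L n K K x}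
    (hF : F.toRing ∈ maxIdeal L n K x ^ k) : VanishTo k F := by
  suffices h : ∀ (k : ℕ), ∀ f ∈ maxIdeal L n K x ^ k,
      VanishTo k (ClaGerm.ofRing f) from h k _ hF
  clear hF
  intro k
  induction k with
  | zero => exact fun f _ i hi => absurd hi (Nat.not_lt_zero _)
  | succ k ih =>
    intro f hf
    rw [pow_succ] at hf
    refine Submodule.mul_induction_on hf (fun a ha b hb => ?_) fun a b ha hb i hi => ?_
    · refine (ih a ha).mul (b := 1) (G := ClaGerm.ofRing b) (fun i hi => ?_) rfl
      have hi0 : i = 0 := by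
        rw [Nat.lt_one_iff] at hi
        exact (Finsupp.degree_eq_zero_iff i).1 hi
      rw [hi0, taylorK_zero]
      exact hb
    · refine (map_add (taylorK x i) (ClaGerm.ofRing a) (ClaGerm.ofRing b)).trans ?_
      rw [ha i hi, hb i hi, add_zero]

/-- The monomials in the coordinates of a polydisc with centre `x` lie in powers of `𝔪_x`. -/
theorem toRing_monomial_mem {x : X} (D : PolyChart L n X) (hx : x ∈ D.source)
    (hD : D.chart x = D.center) (i : Fin n →₀ ℕ) :
    (rigGermK D hx (PowSer.monomial D.radius i 1)).toRing ∈ maxIdeal L n K x ^ i.degree := by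
  have hmul : ∀ i j : Fin n →₀ ℕ,
      (rigGermK D hx (PowSer.monomial D.radius (i + j) (1 : K))).toRing =
      (rigGermK D hx (PowSer.monomial D.radius i 1)).toRing *
        (rigGermK D hx (PowSer.monomial D.radius j 1)).toRing := by
    intro i j
    refine Subtype.ext ?_
    change (rigGermK D hx _).germ = (rigGermK D hx _).germ * (rigGermK D hx _).germ
    rw [germ_rigGermK, germ_rigGermK, germ_rigGermK, ← Germ.coe_mul]
    refine congrArg _ (funext fun y => ?_)
    rw [Pi.mul_apply, PowSer.eval_monomial, PowSer.eval_monomial, PowSer.eval_monomial,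
      monom_add, map_mul, smul_eq_mul, mul_one, smul_eq_mul, mul_one, smul_eq_mul, mul_one]
  have hadd : ∀ i j : Fin n →₀ ℕ,
      (rigGermK D hx (PowSer.monomial D.radius i (1 : K))).toRing ∈ maxIdeal L n K x ^ i.degree →
      (rigGermK D hx (PowSer.monomial D.radius j (1 : K))).toRing ∈ maxIdeal L n K x ^ j.degree →
      (rigGermK D hx (PowSer.monomial D.radius (i + j) (1 : K))).toRing ∈
        maxIdeal L n K x ^ (i + j).degree := by
    intro i j hi hj
    rw [hmul, map_add, pow_add]
    exact Ideal.mul_mem_mul hi hj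
  have h0 : (rigGermK D hx (PowSer.monomial D.radius 0 (1 : K))).toRing ∈
      maxIdeal L n K x ^ (0 : Fin n →₀ ℕ).degree := by
    rw [map_zero, pow_zero, Ideal.one_eq_top]
    exact Submodule.mem_top
  induction i using Finsupp.induction_linear with
  | zero => exact h0
  | add i j hi hj => exact hadd i j hi hj
  | single j a =>
    induction a with
    | zero =>
      rw [Finsupp.single_zero]
      exact h0
    | succ a ih =>
      rw [Finsupp.single_add]
      refine hadd _ _ ih ?_
      rw [Finsupp.degree_single, pow_one, ClaGerm.toRing_mem_maxIdeal, germ_rigGermK,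
        germ_value_coe, PowSer.eval_monomial]
      have hc : D.coord x j = 0 := by
        change (D.chart x - D.center) j = 0
        rw [hD, sub_self, Pi.zero_apply]
      rw [monom, Finset.prod_eq_zero (Finset.mem_univ j), map_zero, zero_smul]
      rw [hc, Finsupp.single_eq_same, pow_one]

theorem taylorK_mem_hyFil (x : X) (i : Fin n →₀ ℕ) : taylorK x i ∈ hyFil L n K x i.degree :=
  fun F hF => vanishTo_of_mem (F := F) hF i (Nat.lt_succ_self _)

theorem taylorK_mem_hy (x : X) (i : Fin n →₀ ℕ) : taylorK x i ∈ hy L n K x :=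
  ⟨_, taylorK_mem_hyFil x i⟩

theorem mem_hyFil_monomial {x : X} (D : PolyChart L n X) (hx : x ∈ D.source)
    (hD : D.chart x = D.center) {k : ℕ} {μ : DistributionAt L n K x} (hμ : μ ∈ hyFil L n K x k)
    {i : Fin n →₀ ℕ} (hi : k < i.degree) :
    μ.comp (rigGermK D hx) (PowSer.monomial D.radius i 1) = 0 :=
  hμ _ (Ideal.pow_le_pow_right hi (toRing_monomial_mem D hx hD i))

/-- An element of the `k`-th step of the filtration kills the power series without terms of degree
at most `k`. -/
theorem mem_hyFil_apply_eq_zero {x : X} (D : PolyChart L n X) (hx : x ∈ D.source)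
    (hD : D.chart x = D.center) {k : ℕ} {μ : DistributionAt L n K x} (hμ : μ ∈ hyFil L n K x k)
    {g : PowSer K D.radius K} (hg : ∀ i, i.degree < k + 1 → g.coeff i = 0) :
    μ (rigGermK D hx g) = 0 := by
  have h := (g.hasSum_monomial).mapL (μ.comp (rigGermK D hx))
  refine h.unique ?_
  have h0 : (fun i => μ.comp (rigGermK D hx) (PowSer.monomial D.radius i (g.coeff i))) = 0 := by
    funext i
    rw [PowSer.apply_monomial]
    rcases Nat.lt_or_ge k i.degree with hi | hi
    · rw [mem_hyFil_monomial D hx hD hμ hi, mul_zero, Pi.zero_apply]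
    · rw [hg i (Nat.lt_succ_of_le hi), zero_mul, Pi.zero_apply]
  rw [h0]
  exact hasSum_zero

/-- The hyperalgebra is dense: on a bounded set of germs, given by power series on a common
polydisc, the Taylor expansion converges uniformly. -/
theorem dense_hy (x : X) :
    Dense (hy L n K x : Set (DistributionAt L n K x)) := by
  intro μ
  refine mem_closure_of_approximable fun B hB => ?_
  obtain ⟨σ, hσ, C, h⟩ := ClaGerm.exists_rigGermK_of_bounded hB
  obtain ⟨ρ, hρ, hρσ⟩ := exists_between hσ
  obtain ⟨hsubσ, hG⟩ := h σ hσ le_rfl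
  obtain ⟨hsubρ, -⟩ := h ρ hρ hρσ.le
  classical
  let G : ClaGerm L n K K x → PowSer K (fun _ : Fin n => σ) K := fun F =>
    if hF : F ∈ B then (hG F hF).choose else 0
  have hGB : ∀ F ∈ B, ‖G F‖ ≤ C ∧
      rigGermK (ballAt L n x σ hσ hsubσ) (mem_ballAt x σ hσ hsubσ) (G F) = F := by
    intro F hF
    simp only [G, dif_pos hF]
    exact (hG F hF).choose_spec
  refine (Approximable.of_coeff hρσ (fun F hF => (hGB F hF).1) (fun i => ?_)
    (μ.comp (rigGermK (ballAt L n x ρ hρ hsubρ) (mem_ballAt x ρ hρ hsubρ)))).congr fun F hF => ?_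
  · refine (approximable_of_mem (taylorK_mem_hy x i)).congr fun F hF => ?_
    conv_lhs => rw [← (hGB F hF).2]
    rw [taylorK_rigGermK]
  · refine congrArg μ ?_
    conv_rhs => rw [← (hGB F hF).2]
    refine rigGerm_congr (Eventually.of_forall fun y => ?_)
    exact PowSer.eval_restrict _ _ _

end Hyperalgebra

/-! ### Functoriality of germs -/

section LcFinal

variable {K : Type*} [NontriviallyNormedField K] [IsUltrametricDist K]

/-- The locally convex final topology is locally convex. -/
theorem isLocConvex_lcFinal {F : Type*} [AddCommGroup F] [Module K F] (t₀ : TopologicalSpace F) :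
    IsLocConvex K (lcFinal K t₀) := by
  refine ⟨lcFinal_isTopologicalAddGroup t₀, lcFinal_continuousSMul t₀, ?_⟩
  let := lcFinal K t₀
  refine ⟨⟨fun s => ⟨fun hs => ?_, fun ⟨N, hN, hNs⟩ => mem_of_superset hN hNs⟩⟩⟩
  have hs' : s ∈ ⨅ t : {t : TopologicalSpace F | t₀ ≤ t ∧ IsLocConvex K t}, @nhds F t.1 0 := by
    rw [iInf_subtype, ← nhds_sInf]
    exact hs
  refine iInf_sets_induct hs' (p := fun s => ∃ N : Submodule (IntegerRing K) F,
    (N : Set F) ∈ 𝓝 0 ∧ (N : Set F) ⊆ s) ⟨⊤, univ_mem, fun _ _ => trivial⟩ ?_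
  rintro ⟨t, ht⟩ s₁ s₂ h₁ ⟨N₂, hN₂, hNs₂⟩
  have := ht.2.isLinearTopology
  obtain ⟨N₁, hN₁, hNs₁⟩ :=
    ((@IsLinearTopology.hasBasis_submodule (IntegerRing K) F _ _ _ t _).mem_iff).1 h₁
  refine ⟨N₁ ⊓ N₂, inter_mem ?_ hN₂, fun v hv => ⟨hNs₁ hv.1, hNs₂ hv.2⟩⟩
  exact nhds_mono (sInf_le ht) hN₁

end LcFinal

section Functoriality

variable {L : Type uL} [NontriviallyNormedField L] [IsUltrametricDist L] [LocallyCompactSpace L]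
  {n : ℕ} {K : Type uK} [NontriviallyNormedField K] [IsUltrametricDist K] [CompleteSpace K]
  [NormedAlgebra L K]
  {X : Type uG} [TopologicalSpace X] [ChartedSpace (Fin n → L) X]
  [IsManifold 𝓘(L, Fin n → L) ω X] [T2Space X] [SecondCountableTopology X]
  {V : Type uV} [AddCommGroup V] [Module K V] [TopologicalSpace V]
  [IsTopologicalAddGroup V] [ContinuousSMul K V] [T2Space V] [IsLinearTopology (IntegerRing K) V]

/-- Postcomposition with a continuous linear map is a continuous linear map on germs, compatible
with the pairing. -/
theorem ClaGerm.exists_postcomp {W : Type uW} [AddCommGroup W] [Module K W] [TopologicalSpace W]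
    [IsTopologicalAddGroup W] [ContinuousSMul K W] [T2Space W] [IsLinearTopology (IntegerRing K) W]
    (l : V →L[K] W) (x : X) : ∃ T : ClaGerm L n K V x →L[K] ClaGerm L n K W x,
      (∀ F, (T F).germ = F.germ.map l) ∧ ∀ μ F, germPairing x μ (T F) = l (germPairing x μ F) := by
  choose B q hq using fun B : BHSubspace K V => exists_bhSubspace_range (l.comp B.ι)
  have hrig : ∀ (D : PolyChart L n X) (hx : x ∈ D.source) (C : BHSubspace K V)
      (g : PowSer K D.radius C.E),
      (rigGerm D hx (B C) (g.map (q C))).germ = (rigGerm D hx C g).germ.map l := by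
    intro D hx C g
    rw [germ_rigGerm, germ_rigGerm, Germ.map_coe]
    refine Germ.coe_eq.2 ?_
    filter_upwards [D.isOpen_source.mem_nhds hx] with y hy
    rw [PowSer.map_eval _ _ (D.coord_le hy), hq]
    rfl
  have hmem : ∀ F : ClaGerm L n K V x, F.germ.map l ∈ claGermSubmodule L n K W x := by
    intro F
    obtain ⟨C, ρ₀, hρ₀, h⟩ := F.exists_ballAt
    obtain ⟨hsub, g, rfl⟩ := h ρ₀ hρ₀ le_rfl
    rw [← hrig]
    exact (rigGerm (ballAt L n x ρ₀ hρ₀ hsub) (mem_ballAt x ρ₀ hρ₀ hsub) (B C) (g.map (q C))).2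
  let T : ClaGerm L n K V x →ₗ[K] ClaGerm L n K W x :=
    { toFun := fun F => ⟨F.germ.map l, hmem F⟩
      map_add' := fun F G => by
        refine ClaGerm.ext ?_
        change (F.germ + G.germ).map l = F.germ.map l + G.germ.map l
        obtain ⟨f, hf⟩ := F.exists_germ_eq
        obtain ⟨g, hg⟩ := G.exists_germ_eq
        rw [hf, hg, ← Germ.coe_add, Germ.map_coe, Germ.map_coe, Germ.map_coe, ← Germ.coe_add]
        exact congrArg _ (funext fun y => map_add l _ _)
      map_smul' := fun c F => by
        refine ClaGerm.ext ?_
        change (c • F.germ).map l = c • F.germ.map l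
        obtain ⟨f, hf⟩ := F.exists_germ_eq
        rw [hf, ← Germ.coe_smul, Germ.map_coe, Germ.map_coe, ← Germ.coe_smul]
        exact congrArg _ (funext fun y => map_smul l _ _) }
  have hT : ∀ (D : PolyChart L n X) (hx : x ∈ D.source) (C : BHSubspace K V)
      (g : PowSer K D.radius C.E), T (rigGerm D hx C g) = rigGerm D hx (B C) (g.map (q C)) :=
    fun D hx C g => ClaGerm.ext (hrig D hx C g).symm
  refine ⟨⟨T, ClaGerm.continuous_of_rigGerm (isLocConvex_lcFinal _) T
    fun D hx C => ?_⟩, fun F => rfl, fun μ F => ?_⟩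
  · exact ((rigGerm D hx (B C)).comp (PowSer.mapL D.radius (q C))).continuous.congr
      fun g => (hT D hx C g).symm
  · obtain ⟨C, ρ₀, hρ₀, h⟩ := F.exists_ballAt
    obtain ⟨hsub, g, rfl⟩ := h ρ₀ hρ₀ le_rfl
    refine (congrArg (germPairing x μ)
      (hT (ballAt L n x ρ₀ hρ₀ hsub) (mem_ballAt x ρ₀ hρ₀ hsub) C g)).trans ?_
    rw [germPairing_rigGerm, germPairing_rigGerm, PowSer.pair_map, hq]
    rfl

variable {m : ℕ} {Y : Type uH} [TopologicalSpace Y] [ChartedSpace (Fin m → L) Y]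
  [IsManifold 𝓘(L, Fin m → L) ω Y] [T2Space Y] [SecondCountableTopology Y]

/-- Pullback along an analytic map is a continuous linear map on germs. -/
theorem ClaGerm.exists_precomp {f : X → Y} {x : X} {y : Y}
    (hf : ContMDiffAt 𝓘(L, Fin n → L) 𝓘(L, Fin m → L) ω f x) (hxy : f x = y) :
    ∃ T : ClaGerm L m K V y →L[K] ClaGerm L n K V x,
      ∀ (F : ClaGerm L m K V y) (g : Y → V), F.germ = (g : Germ (𝓝 y) V) →
        (T F).germ = ((g ∘ f : X → V) : Germ (𝓝 x) V) := by
  subst hxy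
  have hc : Tendsto f (𝓝 x) (𝓝 (f x)) := hf.continuousAt
  have hrig : ∀ (D : PolyChart L m Y) (hy : f x ∈ D.source) (C : BHSubspace K V),
      ∃ (D' : PolyChart L n X) (hx : x ∈ D'.source)
        (Θ : PowSer K D.radius C.E →L[K] PowSer K D'.radius C.E), ∀ g,
        (rigGerm D' hx C (Θ g)).germ =
          (rigGerm D hy C g).germ.compTendsto f hc := by
    intro D hy C
    obtain ⟨ρ₀, hρ₀, h⟩ := exists_pullback (K := K) C.E hf D hy (chartAt_mem x)
      (mem_chart_source (Fin n → L) x) univ_mem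
    obtain ⟨hsub, hx, -, Θ, hΘ, -⟩ := h ρ₀ hρ₀ le_rfl
    refine ⟨ballAt L n x ρ₀ hρ₀ hsub, hx, Θ, fun g => ?_⟩
    rw [germ_rigGerm, germ_rigGerm, Germ.coe_compTendsto]
    refine Germ.coe_eq.2 ?_
    filter_upwards [(ballAt L n x ρ₀ hρ₀ hsub).isOpen_source.mem_nhds hx] with z hz
    exact congrArg C.ι (hΘ z hz g)
  have hmem : ∀ F : ClaGerm L m K V (f x),
      F.germ.compTendsto f hc ∈ claGermSubmodule L n K V x := by
    intro F
    obtain ⟨C, ρ₀, hρ₀, h⟩ := F.exists_ballAt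
    obtain ⟨hsub, g, rfl⟩ := h ρ₀ hρ₀ le_rfl
    obtain ⟨D', hx, Θ, hΘ⟩ := hrig _ (mem_ballAt (f x) ρ₀ hρ₀ hsub) C
    rw [← hΘ]
    exact (rigGerm D' hx C (Θ g)).2
  let T : ClaGerm L m K V (f x) →ₗ[K] ClaGerm L n K V x :=
    { toFun := fun F => ⟨F.germ.compTendsto f hc, hmem F⟩
      map_add' := fun F G => by
        refine ClaGerm.ext ?_
        change (F.germ + G.germ).compTendsto f hc = F.germ.compTendsto f hc
          + G.germ.compTendsto f hc
        obtain ⟨a, ha⟩ := F.exists_germ_eq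
        obtain ⟨b, hb⟩ := G.exists_germ_eq
        rw [ha, hb]
        rfl
      map_smul' := fun c F => by
        refine ClaGerm.ext ?_
        change (c • F.germ).compTendsto f hc =
          c • F.germ.compTendsto f hc
        obtain ⟨a, ha⟩ := F.exists_germ_eq
        rw [ha]
        rfl }
  refine ⟨⟨T, ClaGerm.continuous_of_rigGerm (isLocConvex_lcFinal _) T
    fun D hy C => ?_⟩, fun F g hg => ?_⟩
  · obtain ⟨D', hx, Θ, hΘ⟩ := hrig D hy C
    refine ((rigGerm D' hx C).comp Θ).continuous.congr fun g => ?_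
    exact ClaGerm.ext (hΘ g)
  · change F.germ.compTendsto f hc = _
    rw [hg]
    rfl

theorem germ_rigGerm_monomial {x : X} (D : PolyChart L n X) (hx : x ∈ D.source)
    (B : BHSubspace K V) (i : Fin n →₀ ℕ) (v : B.E) :
    (rigGerm D hx B (PowSer.monomial D.radius i v)).germ =
      (rigGermK D hx (PowSer.monomial D.radius i (1 : K))).germ.map (· • B.ι v) := by
  rw [germ_rigGerm, germ_rigGermK, Germ.map_coe]
  refine congrArg _ (funext fun y => ?_)
  rw [Function.comp_apply, PowSer.eval_monomial, PowSer.eval_monomial, map_smul, smul_eq_mul,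
    mul_one]

/-- The pairing is compatible with pullback. -/
theorem germPairing_precomp {f : X → Y} {x : X} {y : Y}
    {T : ClaGerm L m K V y →L[K] ClaGerm L n K V x} {S : ClaGerm L m K K y →L[K] ClaGerm L n K K x}
    (hT : ∀ (F : ClaGerm L m K V y) (g : Y → V), F.germ = (g : Germ (𝓝 y) V) →
      (T F).germ = ((g ∘ f : X → V) : Germ (𝓝 x) V))
    (hS : ∀ (F : ClaGerm L m K K y) (g : Y → K), F.germ = (g : Germ (𝓝 y) K) →
      (S F).germ = ((g ∘ f : X → K) : Germ (𝓝 x) K))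
    (μ : DistributionAt L n K x) (F : ClaGerm L m K V y) :
    germPairing x μ (T F) = germPairing y (μ.comp S) F := by
  obtain ⟨B, ρ₀, hρ₀, h⟩ := F.exists_ballAt
  obtain ⟨hsub, g, rfl⟩ := h ρ₀ hρ₀ le_rfl
  let D := ballAt L m y ρ₀ hρ₀ hsub
  have hy : y ∈ D.source := mem_ballAt y ρ₀ hρ₀ hsub
  let S₁ : ClaGerm L n K V x →L[K] V :=
    ⟨germPairing x μ, (separatelyContinuous_germPairing x).1 μ⟩
  let S₂ : ClaGerm L m K V y →L[K] V :=
    ⟨germPairing y (μ.comp S), (separatelyContinuous_germPairing y).1 _⟩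
  have key : (S₁.comp T).comp (rigGerm D hy B) = S₂.comp (rigGerm D hy B) := by
    refine PowSer.ext_monomial fun i v => ?_
    have h2 := germ_rigGerm_monomial D hy B i v
    obtain ⟨a, ha⟩ := (rigGermK D hy (PowSer.monomial D.radius i (1 : K))).exists_germ_eq
    rw [ha] at h2
    have h1 : (T (rigGerm D hy B (PowSer.monomial D.radius i v))).germ =
        (S (rigGermK D hy (PowSer.monomial D.radius i (1 : K)))).germ.map (· • B.ι v) := by
      rw [hT _ _ h2, hS _ _ ha]
      rfl
    rw [← ha] at h2
    exact (germPairing_of_smul μ h1).trans (germPairing_of_smul (μ.comp S) h2).symm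
  exact congrArg (fun R => R g) key

end Functoriality

/-! ### The completed tensor product -/

section CompletedTensor

variable {K : Type*} [NontriviallyNormedField K] [IsUltrametricDist K]
  {A : Type*} [AddCommGroup A] [Module K A] [TopologicalSpace A]
  {E : Type*} [NormedAddCommGroup E] [NormedSpace K E]

instance : NonarchimedeanAddGroup (ProjTensor K A E) where
  is_nonarchimedean U hU := by
    have : IsLinearTopology (IntegerRing K) (ProjTensor K A E) :=
      (isLocConvex_lcFinal _).isLinearTopology
    obtain ⟨N, hN, hNU⟩ :=
      (IsLinearTopology.hasBasis_submodule (M := ProjTensor K A E) (IntegerRing K)).mem_iff.1 hU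
    exact ⟨⟨N.toAddSubgroup, N.toAddSubgroup.isOpen_of_mem_nhds hN⟩, hNU⟩

theorem continuous_ctmul : Continuous fun p : A × E => ctmul K p.1 p.2 := by
  have h : Continuous fun p : A × E => (show ProjTensor K A E from p.1 ⊗ₜ[K] p.2) :=
    continuous_iff_coinduced_le.2 (le_lcFinal _)
  exact (UniformSpace.Completion.continuous_coe (ProjTensor K A E)).comp h

/-- The map `(a, e) ↦ a ⊗ e` to the completed tensor product, as a bilinear map. -/
def ctmulₗ : A →ₗ[K] E →ₗ[K] CompletedTensor K A E :=
  let t (a : A) (e : E) : ProjTensor K A E := a ⊗ₜ[K] e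
  LinearMap.mk₂ K (ctmul K)
    (fun a a' e => (congrArg ((↑) : ProjTensor K A E → CompletedTensor K A E)
      (TensorProduct.add_tmul a a' e)).trans (UniformSpace.Completion.coe_add (t a e) (t a' e)))
    (fun c a e => (congrArg ((↑) : ProjTensor K A E → CompletedTensor K A E)
      (TensorProduct.smul_tmul' c a e).symm).trans (UniformSpace.Completion.coe_smul c (t a e)))
    (fun a e e' => (congrArg ((↑) : ProjTensor K A E → CompletedTensor K A E)
      (TensorProduct.tmul_add a e e')).trans (UniformSpace.Completion.coe_add (t a e) (t a e')))
    (fun c a e => (congrArg ((↑) : ProjTensor K A E → CompletedTensor K A E)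
      (TensorProduct.tmul_smul c a e)).trans (UniformSpace.Completion.coe_smul c (t a e)))

theorem ctmulₗ_apply (a : A) (e : E) : ctmulₗ a e = ctmul K a e := rfl

/-- `(g, e) ↦ c(g) ⊗ e` is small as soon as `‖g‖ ‖e‖` is: a scalar can be moved from one factor to
the other in order to make both of them small. -/
theorem exists_ctmul_mem {P : Type*} [SeminormedAddCommGroup P] [NormedSpace K P] (c : P →L[K] A)
    {U : Set (CompletedTensor K A E)} (hU : U ∈ 𝓝 0) :
    ∃ ε : ℝ, 0 < ε ∧ ∀ g e, ‖g‖ * ‖e‖ ≤ ε → ctmul K (c g) e ∈ U := by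
  have hcont : Continuous fun p : P × E => ctmul K (c p.1) p.2 :=
    continuous_ctmul.comp ((c.continuous.comp continuous_fst).prodMk continuous_snd)
  have h0 : ctmul K (c (0 : P)) (0 : E) = 0 := map_zero (ctmulₗ _)
  have h1 : ∀ᶠ p : P × E in 𝓝 (0, 0), ctmul K (c p.1) p.2 ∈ U :=
    hcont.continuousAt.preimage_mem_nhds (by rwa [h0])
  rw [nhds_prod_eq] at h1
  obtain ⟨⟨δ, δ'⟩, ⟨hδ, hδ'⟩, h1⟩ :=
    ((Metric.nhds_basis_closedBall (x := (0 : P))).prod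
      (Metric.nhds_basis_closedBall (x := (0 : E)))).mem_iff.1 h1
  obtain ⟨M, hM, hMc⟩ := exists_norm_between K
  refine ⟨δ * δ' / M, by positivity, fun g e hge => ?_⟩
  rcases eq_or_ne e 0 with rfl | he
  · have : ctmul K (c g) (0 : E) = 0 := map_zero (ctmulₗ _)
    rw [this]
    exact mem_of_mem_nhds hU
  have hep := norm_pos_iff.2 he
  -- move a scalar of the size of `e` to the first factor
  obtain ⟨a, ha1, ha2⟩ := hMc (‖e‖ / δ') (by positivity)
  have ha : a ≠ 0 := norm_pos_iff.1 ((by positivity : 0 < ‖e‖ / δ').trans_le ha1)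
  have heq : ctmul K (c g) e = ctmul K (c (a • g)) (a⁻¹ • e) := by
    rw [← ctmulₗ_apply, ← ctmulₗ_apply, map_smul, map_smul, map_smul, LinearMap.smul_apply,
      smul_smul, inv_mul_cancel₀ ha, one_smul]
  rw [heq]
  refine @h1 (a • g, a⁻¹ • e) ⟨?_, ?_⟩
  · rw [mem_closedBall_zero_iff, norm_smul]
    calc ‖a‖ * ‖g‖ ≤ M * (‖e‖ / δ') * ‖g‖ := by gcongr
      _ = M / δ' * (‖g‖ * ‖e‖) := by ring
      _ ≤ M / δ' * (δ * δ' / M) := by gcongr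
      _ = δ := by field_simp
  · rw [mem_closedBall_zero_iff, norm_smul, norm_inv, inv_mul_le_iff₀ (norm_pos_iff.2 ha)]
    rwa [div_le_iff₀ hδ'] at ha1

variable {n : ℕ} {r : Fin n → ℝ≥0}

/-- A continuous linear map `c` on scalar power series induces a continuous linear map
`f(·) v ↦ c(f) ⊗ v` from vector-valued power series to the completed tensor product: a power series
is mapped to the sum of the images of its terms. -/
theorem exists_powSer_completedTensor (c : PowSer K r K →L[K] A) :
    ∃ j : PowSer K r E →L[K] CompletedTensor K A E, ∀ g v,
      j (g.map (ContinuousLinearMap.toSpanSingleton K v)) = ctmul K (c g) v := by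
  let t : PowSer K r E → (Fin n →₀ ℕ) → CompletedTensor K A E :=
    fun g i => ctmul K (c (PowSer.monomial r i 1)) (g.coeff i)
  have hle : ∀ (g : PowSer K r E) (i : Fin n →₀ ℕ),
      ‖(PowSer.monomial r i (1 : K) : PowSer K r K)‖ * ‖g.coeff i‖ ≤ weight r i * ‖g.coeff i‖ := by
    intro g i
    refine mul_le_mul_of_nonneg_right ?_ (norm_nonneg _)
    refine (PowSer.norm_monomial_le i _).trans ?_
    rw [norm_one, mul_one]
  have hsum : ∀ g, Summable (t g) := by
    intro g
    refine NonarchimedeanAddGroup.summable_of_tendsto_cofinite_zero fun U hU => ?_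
    obtain ⟨ε, hε, h⟩ := exists_ctmul_mem c hU
    rw [mem_map]
    filter_upwards [g.tendsto_coeff.eventually (ge_mem_nhds hε)] with i hi
    exact h _ _ ((hle g i).trans hi)
  let jₗ : PowSer K r E →ₗ[K] CompletedTensor K A E :=
    { toFun := fun g => ∑' i, t g i
      map_add' := fun g h => by
        rw [← (hsum g).tsum_add (hsum h)]
        exact tsum_congr fun i => map_add (ctmulₗ (c (PowSer.monomial r i 1))) _ _
      map_smul' := fun a g => by
        rw [RingHom.id_apply, ← (hsum g).tsum_const_smul]
        exact tsum_congr fun i => map_smul (ctmulₗ (c (PowSer.monomial r i 1))) _ _ }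
  have hj : Continuous jₗ := by
    refine continuous_of_continuousAt_zero jₗ ?_
    rw [ContinuousAt, map_zero]
    intro U hU
    obtain ⟨N, hN⟩ := NonarchimedeanAddGroup.is_nonarchimedean U hU
    obtain ⟨ε, hε, h⟩ := exists_ctmul_mem c (N.mem_nhds_zero)
    rw [mem_map]
    filter_upwards [Metric.closedBall_mem_nhds (0 : PowSer K r E) hε] with g hg
    rw [mem_closedBall_zero_iff] at hg
    refine hN ?_
    refine N.isClosed.mem_of_tendsto (hsum g).hasSum (Eventually.of_forall fun s => ?_)
    exact N.toAddSubgroup.sum_mem fun i _ => h _ _ ((hle g i).trans ((g.le_norm i).trans hg))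
  let j : PowSer K r E →L[K] CompletedTensor K A E := ⟨jₗ, hj⟩
  refine ⟨j, fun g v => ?_⟩
  let S : PowSer K r K →L[K] CompletedTensor K A E :=
    { toFun := fun g => ctmul K (c g) v
      map_add' := fun g h => by rw [← ctmulₗ_apply, map_add, map_add]; rfl
      map_smul' := fun a g => by rw [← ctmulₗ_apply, map_smul, map_smul]; rfl
      cont := continuous_ctmul.comp (c.continuous.prodMk continuous_const) }
  have key : j.comp (PowSer.mapL r (ContinuousLinearMap.toSpanSingleton K v)) = S := by
    refine PowSer.ext_monomial fun i a => ?_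
    change jₗ ((PowSer.monomial r i a).map (ContinuousLinearMap.toSpanSingleton K v)) =
      ctmul K (c (PowSer.monomial r i a)) v
    have ha : (PowSer.monomial r i a : PowSer K r K) = a • PowSer.monomial r i 1 := by
      rw [← map_smul, smul_eq_mul, mul_one]
    rw [PowSer.map_monomial, ContinuousLinearMap.toSpanSingleton_apply, ha]
    refine (tsum_eq_single i fun k hk => ?_).trans ?_
    · change ctmul K _ ((PowSer.monomial r i (a • v)).coeff k) = 0
      rw [PowSer.coeff_monomial, if_neg hk, ← ctmulₗ_apply, map_zero]
    · change ctmul K _ ((PowSer.monomial r i (a • v)).coeff i) = _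
      rw [PowSer.coeff_monomial, if_pos rfl, ← ctmulₗ_apply, ← ctmulₗ_apply, map_smul, map_smul,
        map_smul]
      rfl
  exact congrArg (fun R => R g) key

/-- A functional `μ` on `A` induces the continuous linear map `a ⊗ e ↦ μ(a) e`. -/
theorem exists_completedTensor_lift [IsUltrametricDist E] [CompleteSpace E] (μ : A →L[K] K) :
    ∃ T : CompletedTensor K A E →L[K] E, ∀ a e, T (ctmul K a e) = μ a • e := by
  let T₀ : ProjTensor K A E →ₗ[K] E :=
    TensorProduct.lift ((LinearMap.lsmul K E).comp μ.toLinearMap)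
  have hT₀ : Continuous T₀ := by
    rw [continuous_iff_le_induced]
    refine lcFinal_le ?_ ((isLocConvex_of_isUltrametricDist E).induced T₀)
    refine continuous_iff_coinduced_le.1 (continuous_induced_rng.2 ?_)
    exact (μ.continuous.comp continuous_fst).smul continuous_snd
  refine ⟨ContinuousLinearMap.fromCompletion ⟨T₀, hT₀⟩, fun a e => ?_⟩
  exact ContinuousLinearMap.fromCompletion_apply_coe _ _

end CompletedTensor

section RigidPairing

variable {L : Type uL} [NontriviallyNormedField L] [IsUltrametricDist L] [LocallyCompactSpace L]
  {n : ℕ} {K : Type uK} [NontriviallyNormedField K] [IsUltrametricDist K] [CompleteSpace K]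
  [NormedAlgebra L K]
  {X : Type uG} [TopologicalSpace X] [ChartedSpace (Fin n → L) X]
  [IsManifold 𝓘(L, Fin n → L) ω X] [T2Space X] [SecondCountableTopology X]
  {V : Type uV} [AddCommGroup V] [Module K V] [TopologicalSpace V]
  [IsTopologicalAddGroup V] [ContinuousSMul K V] [T2Space V] [IsLinearTopology (IntegerRing K) V]

/-- The restriction of the pairing to the power series on a polydisc factors through the completed
tensor product. -/
theorem germPairing_rigGerm_eq {x : X} (D : PolyChart L n X) (hx : x ∈ D.source)
    (B : BHSubspace K V) {j : PowSer K D.radius B.E →L[K] CompletedTensor K (ClaGerm L n K K x) B.E}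
    (hj : ∀ g v, j (g.map (ContinuousLinearMap.toSpanSingleton K v)) =
      ctmul K (rigGermK D hx g) v) (μ : DistributionAt L n K x)
    {T : CompletedTensor K (ClaGerm L n K K x) B.E →L[K] B.E}
    (hT : ∀ F v, T (ctmul K F v) = μ F • v) (g : PowSer K D.radius B.E) :
    germPairing x μ (rigGerm D hx B g) = B.ι (T (j g)) := by
  rw [germPairing_rigGerm]
  have key : PowSer.pair B.E (μ.comp (rigGermK D hx)) = T.comp j := by
    refine PowSer.ext_monomial fun i v => ?_
    have h := hj (PowSer.monomial D.radius i 1) v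
    rw [PowSer.map_monomial, ContinuousLinearMap.toSpanSingleton_apply, one_smul] at h
    rw [PowSer.pair_monomial]
    change _ = T (j _)
    rw [h, hT]
    rfl
  rw [key]
  rfl

end RigidPairing

/-! ### Operators on scalar functions -/

section Operators

variable {L : Type uL} [NontriviallyNormedField L] [IsUltrametricDist L] [LocallyCompactSpace L]
  {n : ℕ} {K : Type uK} [NontriviallyNormedField K] [IsUltrametricDist K] [CompleteSpace K]
  [NormedAlgebra L K]
  {X : Type uG} [TopologicalSpace X] [ChartedSpace (Fin n → L) X]
  [IsManifold 𝓘(L, Fin n → L) ω X] [T2Space X] [SecondCountableTopology X]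
  {m : ℕ} {Y : Type uH} [TopologicalSpace Y] [ChartedSpace (Fin m → L) Y]
  [IsManifold 𝓘(L, Fin m → L) ω Y] [T2Space Y] [SecondCountableTopology Y]

/-- A family of functions that depends linearly on a parameter and is locally given by power series
depending continuously on the parameter is a continuous linear map to the locally analytic
functions. -/
theorem exists_clm_of_local {A : Type*} [AddCommGroup A] [Module K A] [TopologicalSpace A]
    (T : X → A →ₗ[K] K) (h : ∀ x, ∃ (D : PolyChart L n X) (Λ : A →L[K] PowSer K D.radius K),
      x ∈ D.source ∧ ∀ a, ∀ y ∈ D.source, T y a = (Λ a).eval (D.coord y)) :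
    ∃ S : A →L[K] Cla L n K K (⊤ : Opens X), ∀ a y, S a ⟨y, trivial⟩ = T y a := by
  have hla : ∀ a x, IsLocAnAt L n K (fun y => T y a) x := by
    intro a x
    obtain ⟨D, Λ, hx, hΛ⟩ := h x
    refine isLocAnAt_of_polyChart D hx (BHSubspace.self K) (Λ a) ?_
    filter_upwards [D.isOpen_source.mem_nhds hx] with y hy
    exact hΛ a y hy
  let S : A →ₗ[K] Cla L n K K (⊤ : Opens X) :=
    { toFun := fun a => Cla.mkTop (fun y => T y a) (hla a)
      map_add' := fun a b => Cla.ext fun y => map_add (T y) a b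
      map_smul' := fun c a => Cla.ext fun y => map_smul (T y) c a }
  refine ⟨⟨S, Cla.continuous_of_local S fun x => ?_⟩, fun a y => rfl⟩
  obtain ⟨D, Λ, hx, hΛ⟩ := h x
  exact ⟨D, BHSubspace.self K, Λ, hx, hΛ⟩

/-- An operator on scalar locally analytic functions is continuous if it is so locally on each
step of the inductive limit. -/
theorem exists_clm_of_toCla (T : X → Cla L m K K (⊤ : Opens Y) →ₗ[K] K)
    (h : ∀ (J : VIndex L m K K (⊤ : Opens Y)) (x : X),
      ∃ (D : PolyChart L n X) (Λ : J.Series →L[K] PowSer K D.radius K),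
        x ∈ D.source ∧ ∀ p, ∀ y ∈ D.source, T y (J.toCla p) = (Λ p).eval (D.coord y)) :
    ∃ S : Cla L m K K (⊤ : Opens Y) →L[K] Cla L n K K (⊤ : Opens X),
      ∀ f y, S f ⟨y, trivial⟩ = T y f := by
  choose S hS using fun J : VIndex L m K K (⊤ : Opens Y) =>
    exists_clm_of_local (fun x => T x ∘ₗ (J.toCla : J.Series →ₗ[K] _)) (h J)
  have hla : ∀ f x, IsLocAnAt L n K (fun y => T y f) x := by
    intro f x
    obtain ⟨J, p, rfl⟩ := f.exists_toCla
    refine ((S J p).isLocAnAt_top x).congr (Eventually.of_forall fun y => ?_)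
    exact hS J p y
  let S' : Cla L m K K (⊤ : Opens Y) →ₗ[K] Cla L n K K (⊤ : Opens X) :=
    { toFun := fun f => Cla.mkTop (fun y => T y f) (hla f)
      map_add' := fun a b => Cla.ext fun y => map_add (T y) a b
      map_smul' := fun c a => Cla.ext fun y => map_smul (T y) c a }
  refine ⟨⟨S', Cla.continuous_of_toCla (isLocConvex_lcFinal _) S' fun J => ?_⟩, fun f y => rfl⟩
  refine (S J).continuous.congr fun p => Cla.ext fun y => ?_
  exact hS J p y

/-- Evaluation of scalar functions at a point. -/
def evalPt (y : Y) : Cla L m K K (⊤ : Opens Y) →ₗ[K] K := (dirac L m K y).toLinearMap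

theorem evalPt_apply (y : Y) (f : Cla L m K K (⊤ : Opens Y)) : evalPt y f = f ⟨y, trivial⟩ := rfl

theorem exists_pullbackCla (f : X → Y) (hf : ContMDiff 𝓘(L, Fin n → L) 𝓘(L, Fin m → L) ω f) :
    ∃ S : Cla L m K K (⊤ : Opens Y) →L[K] Cla L n K K (⊤ : Opens X),
      ∀ g x, S g ⟨x, trivial⟩ = g ⟨f x, trivial⟩ := by
  refine exists_clm_of_toCla (fun x => evalPt (f x)) fun J x => ?_
  obtain ⟨i, hi⟩ := J.exists_mem ⟨f x, trivial⟩
  obtain ⟨ρ, hρ, h⟩ := exists_pullback (K := K) K (hf x) (J.polyChart i) hi (chartAt_mem x)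
    (mem_chart_source (Fin n → L) x) univ_mem
  obtain ⟨hsub, hx, hsource, Θ, hΘ, -⟩ := h ρ hρ le_rfl
  refine ⟨ballAt L n x ρ hρ hsub, (Θ.comp (PowSer.mapL _ (J.B i).ι)).comp
    (ContinuousLinearMap.proj i), hx, fun p y hy => ?_⟩
  have hfy : f y ∈ (J.polyChart i).source := (hsource hy).2
  rw [evalPt_apply, J.toCla_apply (x := ⟨f y, trivial⟩) p hfy,
    ← PowSer.map_eval _ _ ((J.polyChart i).coord_le hfy)]
  exact (hΘ y hy _).symm

/-- Pullback of scalar locally analytic functions along an analytic map. -/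
def pullbackCla (f : X → Y) (hf : ContMDiff 𝓘(L, Fin n → L) 𝓘(L, Fin m → L) ω f) :
    Cla L m K K (⊤ : Opens Y) →L[K] Cla L n K K (⊤ : Opens X) := (exists_pullbackCla f hf).choose

theorem pullbackCla_apply (f : X → Y) (hf : ContMDiff 𝓘(L, Fin n → L) 𝓘(L, Fin m → L) ω f)
    (g : Cla L m K K (⊤ : Opens Y)) (x : X) :
    pullbackCla f hf g ⟨x, trivial⟩ = g ⟨f x, trivial⟩ := (exists_pullbackCla f hf).choose_spec g x

theorem PolyChart.isClosed_source (D : PolyChart L n X) : IsClosed D.source :=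
  D.isCompact_source.isClosed

open scoped Classical in
/-- Polydiscs are open and closed, so that their characteristic functions are locally constant. -/
theorem exists_indicatorCla (D : PolyChart L n X) :
    ∃ S : Cla L n K K (⊤ : Opens X) →L[K] Cla L n K K (⊤ : Opens X),
      ∀ g x, S g ⟨x, trivial⟩ = if x ∈ D.source then g ⟨x, trivial⟩ else 0 := by
  refine (exists_clm_of_toCla (fun x => if x ∈ D.source then evalPt x else 0)
    fun J x => ?_).imp fun S hS g x => ?_
  · obtain ⟨ρ₁, hρ₁, h1⟩ := J.exists_ballAt x
    obtain ⟨ρ₂, hρ₂, h2⟩ : ∃ ρ₀ : ℝ≥0, 0 < ρ₀ ∧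
        ∀ (ρ : ℝ≥0) (hρ : 0 < ρ), ρ ≤ ρ₀ →
          ∃ hsub : polyBall (chartAt (Fin n → L) x x) (fun _ => ρ) ⊆ (chartAt (Fin n → L) x).target,
            ∀ y ∈ (ballAt L n x ρ hρ hsub).source, (y ∈ D.source ↔ x ∈ D.source) := by
      by_cases hx : x ∈ D.source
      · obtain ⟨ρ₂, hρ₂, h2⟩ := eventually_ballAt (L := L) (n := n) x (D.isOpen_source.mem_nhds hx)
        refine ⟨ρ₂, hρ₂, fun ρ hρ hle => ?_⟩
        obtain ⟨hsub, h2⟩ := h2 ρ hρ hle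
        exact ⟨hsub, fun y hy => iff_of_true (h2 hy) hx⟩
      · obtain ⟨ρ₂, hρ₂, h2⟩ := eventually_ballAt (L := L) (n := n) x
          (D.isClosed_source.isOpen_compl.mem_nhds hx)
        refine ⟨ρ₂, hρ₂, fun ρ hρ hle => ?_⟩
        obtain ⟨hsub, h2⟩ := h2 ρ hρ hle
        exact ⟨hsub, fun y hy => iff_of_false (h2 hy) hx⟩
    have hρ := lt_min hρ₁ hρ₂
    obtain ⟨hsub, B, Θ, -, hΘ⟩ := h1 _ hρ (min_le_left _ _)
    obtain ⟨_, h2⟩ := h2 _ hρ (min_le_right _ _)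
    refine ⟨ballAt L n x _ hρ hsub,
      if x ∈ D.source then (PowSer.mapL _ B.ι).comp Θ else 0, mem_ballAt x _ hρ hsub,
      fun p y hy => ?_⟩
    by_cases hx : x ∈ D.source
    · rw [if_pos hx, if_pos ((h2 y hy).2 hx), evalPt_apply, hΘ y hy p]
      exact (PowSer.map_eval _ _ ((ballAt L n x _ hρ hsub).coord_le hy)).symm
    · rw [if_neg hx, if_neg fun h => hx ((h2 y hy).1 h)]
      exact (map_zero (PowSer.evalL K _ ((ballAt L n x _ hρ hsub).coord_le hy))).symm
  · rw [hS]
    split_ifs <;> rfl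

/-- Multiplication by the characteristic function of a polydisc. -/
def indicatorCla (D : PolyChart L n X) :
    Cla L n K K (⊤ : Opens X) →L[K] Cla L n K K (⊤ : Opens X) := (exists_indicatorCla D).choose

theorem indicatorCla_apply {D : PolyChart L n X} (g : Cla L n K K (⊤ : Opens X)) {x : X}
    (hx : x ∈ D.source) : indicatorCla D g ⟨x, trivial⟩ = g ⟨x, trivial⟩ := by
  classical
  exact ((exists_indicatorCla D).choose_spec g x).trans (if_pos hx)

theorem indicatorCla_apply_of_notMem {D : PolyChart L n X} (g : Cla L n K K (⊤ : Opens X)) {x : X}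
    (hx : x ∉ D.source) : indicatorCla D g ⟨x, trivial⟩ = 0 := by
  classical
  exact ((exists_indicatorCla D).choose_spec g x).trans (if_neg hx)

theorem indicatorCla_eq_rigClaK {D : PolyChart L n X} {f : Cla L n K K (⊤ : Opens X)}
    {g : PowSer K D.radius K} (h : ∀ x ∈ D.source, f ⟨x, trivial⟩ = g.eval (D.coord x)) :
    indicatorCla D f = rigClaK D g := by
  refine Cla.ext fun ⟨x, _⟩ => ?_
  by_cases hx : x ∈ D.source
  · rw [indicatorCla_apply f hx, rigClaK_apply D g hx, h x hx]
  · rw [indicatorCla_apply_of_notMem f hx, rigClaK_apply_of_notMem D g hx]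

/-! ### Supports of distributions -/

theorem PolyChart.nonempty_source (D : PolyChart L n X) : D.source.Nonempty := by
  obtain ⟨x, hx, -⟩ := D.exists_coord_eq (y := 0) fun j => by
    rw [Pi.zero_apply, norm_zero]
    exact NNReal.coe_nonneg _
  exact ⟨x, hx⟩

/-- Distributions have compact support: for a sequence of functions which are not killed and whose
supports leave every compact set, arbitrary infinite linear combinations would be locally analytic,
in contradiction to continuity on `K ^ ℕ`. -/
theorem exists_finset_support (ν : LaDistribution L n K X) {I : Type*} (D : I → PolyChart L n X)
    (hd : Pairwise fun i j => Disjoint (D i).source (D j).source)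
    (hc : ⋃ i, (D i).source = Set.univ) :
    ∃ t : Finset I, ∀ f : Cla L n K K (⊤ : Opens X),
      (∀ i ∈ t, ∀ x ∈ (D i).source, f ⟨x, trivial⟩ = 0) → ν f = 0 := by
  have : Countable I := Pairwise.countable_of_isOpen_disjoint hd
    (fun i => (D i).isOpen_source) fun i => (D i).nonempty_source
  obtain ⟨e, he⟩ := exists_injective_nat I
  by_contra! hcon
  have hfin : ∀ k : ℕ, {i | e i < k}.Finite := fun k =>
    (Set.finite_Iio k).preimage he.injOn
  choose f hf0 hf using fun k => hcon (hfin k).toFinset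
  replace hf0 : ∀ k i, e i < k → ∀ x ∈ (D i).source, f k ⟨x, trivial⟩ = 0 := fun k i hik =>
    hf0 k i ((hfin k).mem_toFinset.2 hik)
  have hmem : ∀ x, ∃ i, x ∈ (D i).source := fun x => by
    rw [← Set.mem_iUnion, hc]
    trivial
  choose i hi using hmem
  -- the map `a ↦ ∑ aₖ fₖ`, which is a finite sum on each polydisc; it is continuous on `K ^ ℕ`
  obtain ⟨S, hS⟩ := exists_clm_of_local (L := L) (K := K) (A := ℕ → K) (fun x =>
    ∑ k ∈ Finset.range (e (i x) + 1), f k ⟨x, trivial⟩ • LinearMap.proj k) fun x => by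
      obtain ⟨ρ₁, hρ₁, C, h1⟩ := Cla.exists_ballAt_of_bounded
        (((Finset.range (e (i x) + 1)).finite_toSet.image f).isVonNBounded (𝕜 := K)) x
      obtain ⟨ρ₂, hρ₂, h2⟩ := eventually_ballAt (L := L) (n := n) x
        ((D (i x)).isOpen_source.mem_nhds (hi x))
      have hρ := lt_min hρ₁ hρ₂
      obtain ⟨hsub, h1⟩ := h1 _ hρ (min_le_left _ _)
      obtain ⟨_, h2⟩ := h2 _ hρ (min_le_right _ _)
      have h3 : ∀ k : ℕ, ∃ g : PowSer K (ballAt L n x _ hρ hsub).radius K, k < e (i x) + 1 →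
          ∀ y ∈ (ballAt L n x _ hρ hsub).source,
            f k ⟨y, trivial⟩ = g.eval ((ballAt L n x _ hρ hsub).coord y) := by
        intro k
        by_cases hk : k < e (i x) + 1
        · obtain ⟨g, -, hg⟩ := h1 (f k) ⟨k, Finset.mem_coe.2 (Finset.mem_range.2 hk), rfl⟩
          exact ⟨g, fun _ => hg⟩
        · exact ⟨0, fun h => absurd h hk⟩
      choose g hg using h3
      refine ⟨ballAt L n x _ hρ hsub, ∑ k ∈ Finset.range (e (i x) + 1),
        (ContinuousLinearMap.proj (R := K) (φ := fun _ : ℕ => K) k).smulRight (g k),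
        mem_ballAt x _ hρ hsub, fun a y hy => ?_⟩
      have hiy : i y = i x := by
        by_contra hne
        exact Set.disjoint_left.1 (hd hne) (hi y) (h2 hy)
      rw [← PowSer.evalL_apply ((ballAt L n x _ hρ hsub).coord_le hy), hiy, LinearMap.sum_apply,
        sum_apply, map_sum]
      refine Finset.sum_congr rfl fun k hk => ?_
      rw [ContinuousLinearMap.smulRight_apply, map_smul, PowSer.evalL_apply,
        ← hg k (Finset.mem_range.1 hk) y hy, LinearMap.smul_apply, smul_eq_mul, smul_eq_mul,
        mul_comm]
      rfl
  have hSf : ∀ k, S (Pi.single k 1) = f k := by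
    intro k
    refine Cla.ext fun ⟨x, _⟩ => ?_
    rw [hS, LinearMap.sum_apply]
    by_cases hk : k < e (i x) + 1
    · rw [Finset.sum_eq_single_of_mem k (Finset.mem_range.2 hk)]
      · rw [LinearMap.smul_apply, LinearMap.proj_apply, Pi.single_eq_same, smul_eq_mul, mul_one]
      · intro l _ hl
        rw [LinearMap.smul_apply, LinearMap.proj_apply, Pi.single_eq_of_ne hl, smul_zero]
    · rw [Finset.sum_eq_zero, hf0 k (i x) (by omega) x (hi x)]
      intro l hl
      rw [LinearMap.smul_apply, LinearMap.proj_apply, Pi.single_eq_of_ne, smul_zero]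
      rintro rfl
      exact hk (Finset.mem_range.1 hl)
  obtain ⟨t, ht⟩ := exists_finset_eq_zero (ν.comp S)
  obtain ⟨k, hk⟩ := Infinite.exists_notMem_finset t
  refine hf k ?_
  rw [← hSf]
  refine ht _ fun l hl => Pi.single_eq_of_ne ?_ _
  rintro rfl
  exact hk hl

/-- With respect to a partition into polydiscs, a distribution is a finite sum of its
restrictions. -/
theorem exists_finset_sum_indicatorCla (ν : LaDistribution L n K X) {I : Type*}
    (D : I → PolyChart L n X)
    (hd : Pairwise fun i j => Disjoint (D i).source (D j).source)
    (hc : ⋃ i, (D i).source = Set.univ) :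
    ∃ t : Finset I, ∀ f, ν f = ∑ i ∈ t, ν (indicatorCla (D i) f) := by
  obtain ⟨t, ht⟩ := exists_finset_support ν D hd hc
  refine ⟨t, fun f => ?_⟩
  rw [← map_sum, ← sub_eq_zero, ← map_sub]
  refine ht _ fun i hi x hx => ?_
  rw [← evalPt_apply, map_sub, map_sum, Finset.sum_eq_single_of_mem i hi, evalPt_apply,
    evalPt_apply, indicatorCla_apply f hx, sub_self]
  intro j _ hji
  exact indicatorCla_apply_of_notMem f fun h => Set.disjoint_left.1 (hd hji) h hx

end Operators

/-! ### Integration along the fibres and Fubini -/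

section Fubini

variable {L : Type uL} [NontriviallyNormedField L] [IsUltrametricDist L] [LocallyCompactSpace L]
  {K : Type uK} [NontriviallyNormedField K] [IsUltrametricDist K] [CompleteSpace K]
  [NormedAlgebra L K]
  {n : ℕ} {X : Type uG} [TopologicalSpace X] [ChartedSpace (Fin n → L) X]
  [IsManifold 𝓘(L, Fin n → L) ω X] [T2Space X] [SecondCountableTopology X]
  {n' : ℕ} {X' : Type uH} [TopologicalSpace X'] [ChartedSpace (Fin n' → L) X']
  [IsManifold 𝓘(L, Fin n' → L) ω X'] [T2Space X'] [SecondCountableTopology X']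
  {m : ℕ} {Y : Type uV} [TopologicalSpace Y] [ChartedSpace (Fin m → L) Y]
  [IsManifold 𝓘(L, Fin m → L) ω Y] [T2Space Y] [SecondCountableTopology Y]
  {a : X × X' → Y}

/-- For `f` in a step of the inductive limit, the function `x ↦ ν(f(a(x, ·)))` is given on a
polydisc around `x₀` by a power series `Λ f`. The compactness of the support of `ν` allows the
polydisc to be chosen uniformly. Functionals `μ` on power series can be interchanged with the
integration. -/
theorem exists_local_fibreIntegral
    (ha : ContMDiff (𝓘(L, Fin n → L).prod 𝓘(L, Fin n' → L)) 𝓘(L, Fin m → L) ω a)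
    (ν : LaDistribution L n' K X') (J : VIndex L m K K (⊤ : Opens Y)) (x₀ : X) :
    ∃ (D : PolyChart L n X) (Λ : J.Series →L[K] PowSer K D.radius K), x₀ ∈ D.source ∧
      ∀ (μ : PowSer K D.radius K →L[K] K) (p : J.Series) (h : Cla L n' K K (⊤ : Opens X')),
        (∀ (z : X') (g : PowSer K D.radius K), (∀ x ∈ D.source,
          g.eval (D.coord x) = J.toCla p ⟨a (x, z), trivial⟩) → h ⟨z, trivial⟩ = μ g) →
        μ (Λ p) = ν h := by
  classical
  choose k hk using fun z : X' => J.exists_mem ⟨a (x₀, z), trivial⟩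
  choose ρ hρ hpull using fun z : X' => exists_pullback_two (K := K) (ha (x₀, z))
    (J.polyChart (k z)) (hk z) (chartAt_mem x₀) (mem_chart_source (Fin n → L) x₀)
    (chartAt_mem z) (mem_chart_source (Fin n' → L) z)
  -- polydiscs in the second factor, refined to a partition
  have hsub' := fun z : X' =>
    (hpull z (ρ z) (hρ z) le_rfl (ρ z) (hρ z) le_rfl).choose_spec.choose
  obtain ⟨I, D', ξ, hd, hc, hξ⟩ := exists_partition (⊤ : Opens X')
    (fun z => ballAt L n' z (ρ z) (hρ z) (hsub' z)) (fun z _ => mem_ballAt z _ _ _)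
    fun z _ => Set.subset_univ _
  obtain ⟨t, ht⟩ := exists_finset_support ν D' hd hc
  -- finitely many of them suffice, so there is a common radius in the first factor
  obtain ⟨σ, hσ, hσt⟩ : ∃ σ : ℝ≥0, 0 < σ ∧ ∀ i ∈ t, σ ≤ ρ (ξ i) := by
    rcases t.eq_empty_or_nonempty with rfl | hne
    · exact ⟨1, one_pos, fun i hi => absurd hi (Finset.notMem_empty i)⟩
    · refine ⟨t.inf' hne fun i => ρ (ξ i),
        (Finset.lt_inf'_iff hne).2 fun i _ => hρ _, fun i hi => ?_⟩
      exact Finset.inf'_le _ hi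
  obtain ⟨ρ₁, hρ₁, hball⟩ := eventually_ballAt (L := L) (n := n) x₀ univ_mem
  have hτ := lt_min hσ hρ₁
  obtain ⟨hsub, -⟩ := hball _ hτ (min_le_right _ _)
  let D := ballAt L n x₀ _ hτ hsub
  have hΘ : ∀ i : I, ∃ Θ : PowSer K (J.polyChart (k (ξ i))).radius K →L[K]
      PowSer K (Fin.append D.radius fun _ : Fin n' => ρ (ξ i)) K, i ∈ t →
      ∀ x ∈ D.source, ∀ z ∈ (ballAt L n' (ξ i) (ρ (ξ i)) (hρ (ξ i)) (hsub' (ξ i))).source,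
        a (x, z) ∈ (J.polyChart (k (ξ i))).source ∧ ∀ g, (Θ g).eval (Fin.append (D.coord x)
          ((ballAt L n' (ξ i) (ρ (ξ i)) (hρ (ξ i)) (hsub' (ξ i))).coord z)) =
            g.eval ((J.polyChart (k (ξ i))).coord (a (x, z))) := by
    intro i
    by_cases hi : i ∈ t
    · obtain ⟨_, _, -, -, Θ, hΘ, -⟩ := hpull (ξ i) _ hτ ((min_le_left _ _).trans (hσt i hi))
        (ρ (ξ i)) (hρ _) le_rfl
      exact ⟨Θ, fun _ => hΘ⟩
    · exact ⟨0, fun h => absurd h hi⟩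
  choose Θ hΘ using hΘ
  let b (i : I) : PolyChart L n' X' := ballAt L n' (ξ i) (ρ (ξ i)) (hρ (ξ i)) (hsub' (ξ i))
  have hb (i : I) : (D' i).IsSub (b i) := (hξ i).2
  let ν' (i : I) : PowSer K (b i).radius K →L[K] K :=
    ν.comp ((rigClaK (D' i)).comp (PolyChart.recenter K (hb i)))
  let q (p : J.Series) (i : I) : PowSer K (Fin.append D.radius (b i).radius) K :=
    Θ i ((p (k (ξ i))).map (J.B (k (ξ i))).ι)
  let Λ : J.Series →L[K] PowSer K D.radius K := ∑ i ∈ t,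
    (PowSer.sliceLeft D.radius (ν' i)).comp ((Θ i).comp ((PowSer.mapL _ (J.B (k (ξ i))).ι).comp
      (ContinuousLinearMap.proj (k (ξ i)))))
  refine ⟨D, Λ, mem_ballAt x₀ _ hτ hsub, fun μ p h hh => ?_⟩
  have hΛ : Λ p = ∑ i ∈ t, PowSer.sliceLeft D.radius (ν' i) (q p i) := by
    rw [sum_apply]
    rfl
  have h1 : ∀ i, μ (PowSer.sliceLeft D.radius (ν' i) (q p i)) =
      ν (rigClaK (D' i) (PolyChart.recenter K (hb i) (PowSer.sliceRight (b i).radius μ (q p i)))) :=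
    fun i => PowSer.apply_sliceLeft μ (ν' i) (q p i)
  rw [hΛ, map_sum, Finset.sum_congr rfl fun i _ => h1 i, ← map_sum, ← sub_eq_zero, ← map_sub]
  refine ht _ fun i hi z hz => ?_
  have hzb : z ∈ (b i).source := (hb i).1 hz
  rw [← evalPt_apply, map_sub, map_sum, Finset.sum_eq_single_of_mem i hi, evalPt_apply,
    evalPt_apply, rigClaK_apply _ _ hz, PolyChart.eval_recenter (hb i) hz, sub_eq_zero]
  · have h2 := PowSer.apply_sliceLeft μ (PowSer.evalL K _ ((b i).coord_le hzb)) (q p i)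
    rw [PowSer.evalL_apply] at h2
    rw [← h2]
    refine (hh z _ fun x hx => ?_).symm
    obtain ⟨hax, hev⟩ := hΘ i hi x hx z hzb
    rw [PowSer.eval_sliceLeft_eval (D.coord_le hx), J.toCla_apply (x := ⟨a (x, z), trivial⟩) p hax,
      ← PowSer.map_eval _ _ ((J.polyChart (k (ξ i))).coord_le hax)]
    exact hev _
  · intro j _ hji
    exact rigClaK_apply_of_notMem _ _ fun h => Set.disjoint_left.1 (hd hji) h hz

theorem contMDiff_slice
    (ha : ContMDiff (𝓘(L, Fin n → L).prod 𝓘(L, Fin n' → L)) 𝓘(L, Fin m → L) ω a) (x : X) :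
    ContMDiff 𝓘(L, Fin n' → L) 𝓘(L, Fin m → L) ω fun z => a (x, z) :=
  ha.comp (contMDiff_const.prodMk contMDiff_id)

theorem exists_fibreIntegral
    (ha : ContMDiff (𝓘(L, Fin n → L).prod 𝓘(L, Fin n' → L)) 𝓘(L, Fin m → L) ω a)
    (ν : LaDistribution L n' K X') :
    ∃ S : Cla L m K K (⊤ : Opens Y) →L[K] Cla L n K K (⊤ : Opens X), ∀ f x,
      S f ⟨x, trivial⟩ = ν (pullbackCla (fun z => a (x, z)) (contMDiff_slice ha x) f) := by
  refine exists_clm_of_toCla (fun x => (ν.comp (pullbackCla (fun z => a (x, z))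
    (contMDiff_slice ha x))).toLinearMap) fun J x₀ => ?_
  obtain ⟨D, Λ, hx₀, hΛ⟩ := exists_local_fibreIntegral ha ν J x₀
  refine ⟨D, Λ, hx₀, fun p x hx => ?_⟩
  refine (hΛ (PowSer.evalL K _ (D.coord_le hx)) p _ fun z g hg => ?_).symm
  exact (pullbackCla_apply _ _ _ _).trans (hg x hx).symm

/-- The operator `f ↦ (x ↦ ν(f(a(x, ·))))`. -/
def fibreIntegral
    (ha : ContMDiff (𝓘(L, Fin n → L).prod 𝓘(L, Fin n' → L)) 𝓘(L, Fin m → L) ω a)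
    (ν : LaDistribution L n' K X') :
    Cla L m K K (⊤ : Opens Y) →L[K] Cla L n K K (⊤ : Opens X) := (exists_fibreIntegral ha ν).choose

theorem fibreIntegral_apply
    (ha : ContMDiff (𝓘(L, Fin n → L).prod 𝓘(L, Fin n' → L)) 𝓘(L, Fin m → L) ω a)
    (ν : LaDistribution L n' K X') (f : Cla L m K K (⊤ : Opens Y)) (x : X) :
    fibreIntegral ha ν f ⟨x, trivial⟩ =
      ν (pullbackCla (fun z => a (x, z)) (contMDiff_slice ha x) f) :=
  (exists_fibreIntegral ha ν).choose_spec f x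

theorem contMDiff_comp_swap
    (ha : ContMDiff (𝓘(L, Fin n → L).prod 𝓘(L, Fin n' → L)) 𝓘(L, Fin m → L) ω a) :
    ContMDiff (𝓘(L, Fin n' → L).prod 𝓘(L, Fin n → L)) 𝓘(L, Fin m → L) ω (a ∘ Prod.swap) :=
  ha.comp (contMDiff_snd.prodMk contMDiff_fst)

/-- The order of integration can be interchanged. -/
theorem apply_fibreIntegral
    (ha : ContMDiff (𝓘(L, Fin n → L).prod 𝓘(L, Fin n' → L)) 𝓘(L, Fin m → L) ω a)
    (μ : LaDistribution L n K X) (ν : LaDistribution L n' K X') (f : Cla L m K K (⊤ : Opens Y)) :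
    μ (fibreIntegral ha ν f) = ν (fibreIntegral (contMDiff_comp_swap ha) μ f) := by
  obtain ⟨J, p, rfl⟩ := f.exists_toCla
  choose D Λ hD hΛ using exists_local_fibreIntegral ha ν J
  obtain ⟨I, E, ξ, hd, hc, hE⟩ := exists_partition (⊤ : Opens X) D (fun x _ => hD x)
    fun x _ => Set.subset_univ _
  have hE' (j : I) : (E j).IsSub (D (ξ j)) := (hE j).2
  obtain ⟨t, ht⟩ := exists_finset_sum_indicatorCla μ E hd hc
  have hsum : fibreIntegral (contMDiff_comp_swap ha) μ (J.toCla p) = ∑ j ∈ t,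
      fibreIntegral (contMDiff_comp_swap ha) (μ.comp (indicatorCla (E j))) (J.toCla p) := by
    refine Cla.ext fun ⟨z, _⟩ => ?_
    rw [fibreIntegral_apply, ht, ← evalPt_apply, map_sum]
    refine Finset.sum_congr rfl fun j _ => ?_
    rw [evalPt_apply, fibreIntegral_apply]
    rfl
  rw [ht, hsum, map_sum]
  refine Finset.sum_congr rfl fun j _ => ?_
  let μ' : PowSer K (D (ξ j)).radius K →L[K] K :=
    μ.comp ((rigClaK (E j)).comp (PolyChart.recenter K (hE' j)))
  have h1 : indicatorCla (E j) (fibreIntegral ha ν (J.toCla p)) =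
      rigClaK (E j) (PolyChart.recenter K (hE' j) (Λ (ξ j) p)) := by
    refine indicatorCla_eq_rigClaK fun x hx => ?_
    have hxD := (hE' j).1 hx
    rw [PolyChart.eval_recenter (hE' j) hx, fibreIntegral_apply]
    refine (hΛ (ξ j) (PowSer.evalL K _ ((D (ξ j)).coord_le hxD)) p _ fun z g hg => ?_).symm
    rw [pullbackCla_apply, PowSer.evalL_apply, hg x hxD]
  rw [h1]
  refine hΛ (ξ j) μ' p _ fun z g hg => ?_
  rw [fibreIntegral_apply]
  refine congrArg μ (indicatorCla_eq_rigClaK fun x hx => ?_)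
  exact (pullbackCla_apply _ _ _ _).trans
    (((PolyChart.eval_recenter (hE' j) hx g).trans (hg x ((hE' j).1 hx))).symm)

end Fubini

/-! ### Convolution of distributions -/

section Germs

variable {L : Type uL} [NontriviallyNormedField L] [IsUltrametricDist L] [LocallyCompactSpace L]
  {K : Type uK} [NontriviallyNormedField K] [IsUltrametricDist K] [CompleteSpace K]
  [NormedAlgebra L K]
  {n : ℕ} {X : Type uG} [TopologicalSpace X] [ChartedSpace (Fin n → L) X]
  [IsManifold 𝓘(L, Fin n → L) ω X] [T2Space X] [SecondCountableTopology X]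
  {n' : ℕ} {X' : Type uH} [TopologicalSpace X'] [ChartedSpace (Fin n' → L) X']
  [IsManifold 𝓘(L, Fin n' → L) ω X'] [T2Space X'] [SecondCountableTopology X']
  {m : ℕ} {Y : Type uV} [TopologicalSpace Y] [ChartedSpace (Fin m → L) Y]
  [IsManifold 𝓘(L, Fin m → L) ω Y] [T2Space Y] [SecondCountableTopology Y]
  {a : X × X' → Y}

theorem toGerm_eq_zero_iff {x : X} {f : Cla L n K K (⊤ : Opens X)} :
    Cla.toGerm L n K K (Opens.mem_top x) f = 0 ↔ ∀ᶠ y in 𝓝 x, f ⟨y, trivial⟩ = 0 := by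
  have h := Cla.germ_toGerm_top (x := x) f
  constructor
  · intro h0
    rw [h0] at h
    exact Germ.coe_eq.1 h.symm
  · exact fun h0 => ClaGerm.ext (h.trans (Germ.coe_eq.2 h0))

/-- A distribution that kills the functions vanishing near `x` is supported at `x`. -/
theorem exists_incl_eq {x : X} {θ : LaDistribution L n K X}
    (h : ∀ f, Cla.toGerm L n K K (Opens.mem_top x) f = 0 → θ f = 0) :
    ∃ ξ, DistributionAt.incl L n K x ξ = θ := by
  have hs := Cla.toGerm_surjective (L := L) (n := n) (K := K) (V := K) x
  have hc : ∀ f f' : Cla L n K K (⊤ : Opens X), Cla.toGerm L n K K (Opens.mem_top x) f =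
      Cla.toGerm L n K K (Opens.mem_top x) f' → θ f = θ f' := fun f f' hf => by
    rw [← sub_eq_zero, ← map_sub]
    exact h _ (by rw [map_sub, hf, sub_self])
  let ξ : ClaGerm L n K K x →ₗ[K] K :=
    { toFun := fun F => θ (hs F).choose
      map_add' := fun F G => by
        rw [← map_add]
        refine hc _ _ ?_
        rw [map_add, (hs _).choose_spec, (hs _).choose_spec, (hs _).choose_spec]
      map_smul' := fun c F => by
        rw [RingHom.id_apply, ← map_smul]
        refine hc _ _ ?_
        rw [map_smul, (hs _).choose_spec, (hs _).choose_spec] }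
  have hξ : ∀ f, ξ (Cla.toGerm L n K K (Opens.mem_top x) f) = θ f := fun f =>
    hc _ _ (hs _).choose_spec
  refine ⟨⟨ξ, ClaGerm.continuous_of_rigGerm isLocConvex_self ξ fun D hx B => ?_⟩,
    ContinuousLinearMap.ext hξ⟩
  refine (θ.comp (rigCla D B)).continuous.congr fun g => ?_
  exact (hξ _).symm.trans (congrArg ξ (toGerm_rigCla D hx B g))

/-- If `f` vanishes near `a (x, x')`, then its integral along the fibres against a distribution
supported at `x'` vanishes near `x`. -/
theorem toGerm_fibreIntegral_eq_zero
    (ha : ContMDiff (𝓘(L, Fin n → L).prod 𝓘(L, Fin n' → L)) 𝓘(L, Fin m → L) ω a)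
    {x : X} {x' : X'} (ν : DistributionAt L n' K x') {f : Cla L m K K (⊤ : Opens Y)}
    (hf : Cla.toGerm L m K K (Opens.mem_top (a (x, x'))) f = 0) :
    Cla.toGerm L n K K (Opens.mem_top x)
      (fibreIntegral ha (DistributionAt.incl L n' K x' ν) f) = 0 := by
  rw [toGerm_eq_zero_iff] at hf ⊢
  have h := ha.continuous.continuousAt.eventually hf
  rw [nhds_prod_eq] at h
  filter_upwards [h.curry] with y hy
  rw [fibreIntegral_apply]
  refine (congrArg ν (toGerm_eq_zero_iff.2 ?_)).trans (map_zero ν)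
  filter_upwards [hy] with z hz
  exact (pullbackCla_apply _ _ _ _).trans hz

/-- Integrating along the fibres against a distribution supported at `x'`, and then against one
supported at `x`, is a distribution supported at `a (x, x')`. -/
theorem exists_incl_comp_fibreIntegral
    (ha : ContMDiff (𝓘(L, Fin n → L).prod 𝓘(L, Fin n' → L)) 𝓘(L, Fin m → L) ω a)
    {x : X} {x' : X'} (μ : DistributionAt L n K x) (ν : DistributionAt L n' K x') :
    ∃ ξ, DistributionAt.incl L m K (a (x, x')) ξ = (DistributionAt.incl L n K x μ).comp
      (fibreIntegral ha (DistributionAt.incl L n' K x' ν)) :=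
  exists_incl_eq fun _ hf =>
    (congrArg μ (toGerm_fibreIntegral_eq_zero ha ν hf)).trans (map_zero μ)

/-- The orders of point distributions add up: this is the multiplicativity of the filtration by the
powers of the maximal ideals, and holds because pulling back along `a` does not decrease the order
of vanishing. -/
theorem mem_hyFil_of_incl_eq
    (ha : ContMDiff (𝓘(L, Fin n → L).prod 𝓘(L, Fin n' → L)) 𝓘(L, Fin m → L) ω a)
    {x : X} {x' : X'} {μ : DistributionAt L n K x} {ν : DistributionAt L n' K x'} {k l : ℕ}
    (hμ : μ ∈ hyFil L n K x k) (hν : ν ∈ hyFil L n' K x' l)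
    {ξ : DistributionAt L m K (a (x, x'))}
    (hξ : DistributionAt.incl L m K (a (x, x')) ξ = (DistributionAt.incl L n K x μ).comp
      (fibreIntegral ha (DistributionAt.incl L n' K x' ν))) :
    ξ ∈ hyFil L m K (a (x, x')) (k + l) := by
  intro F hF
  have hv : VanishTo (k + l + 1) F := vanishTo_of_mem hF
  obtain ⟨ρ, hρ, h⟩ := F.exists_rigGermK
  obtain ⟨hsub, g, rfl⟩ := h ρ hρ le_rfl
  let D := ballAt L m (a (x, x')) ρ hρ hsub
  have hD : a (x, x') ∈ D.source := mem_ballAt _ ρ hρ hsub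
  have hg : ∀ i, i.degree < k + l + 1 → g.coeff i = 0 := fun i hi => by
    rw [← hv i hi, taylorK_rigGermK]
  obtain ⟨σ, hσ, h⟩ := exists_pullback_two (K := K) (ha (x, x')) D hD (chartAt_mem x)
    (mem_chart_source (Fin n → L) x) (chartAt_mem x') (mem_chart_source (Fin n' → L) x')
  obtain ⟨hs, hs', -, -, Θ, hΘ, hΘ'⟩ := h σ hσ le_rfl σ hσ le_rfl
  let b := ballAt L n x σ hσ hs
  let b' := ballAt L n' x' σ hσ hs'
  have hb : x ∈ b.source := mem_ballAt x σ hσ hs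
  have hb' : x' ∈ b'.source := mem_ballAt x' σ hσ hs'
  let q : PowSer K (Fin.append b.radius b'.radius) K := Θ g
  have hq : ∀ i, i.degree < k + l + 1 → q.coeff i = 0 := hΘ' rfl _ g hg
  let ν' := ν.comp (rigGermK b' hb')
  have key : Cla.toGerm L n K K (Opens.mem_top x)
      (fibreIntegral ha (DistributionAt.incl L n' K x' ν) (rigClaK D g)) =
        rigGermK b hb (PowSer.sliceLeft b.radius ν' q) := by
    rw [← toGerm_rigClaK b hb, ← sub_eq_zero, ← map_sub, toGerm_eq_zero_iff]
    filter_upwards [b.isOpen_source.mem_nhds hb] with y hy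
    rw [← evalPt_apply, map_sub, evalPt_apply, evalPt_apply, fibreIntegral_apply,
      rigClaK_apply _ _ hy, ← PowSer.evalL_apply (b.coord_le hy), PowSer.apply_sliceLeft,
      sub_eq_zero]
    refine congrArg ν (?_ : Cla.toGerm L n' K K (Opens.mem_top x')
      (pullbackCla (fun z => a (y, z)) (contMDiff_slice ha y) (rigClaK D g)) =
        rigGermK b' hb' (PowSer.sliceRight b'.radius (PowSer.evalL K _ (b.coord_le hy)) q))
    rw [← toGerm_rigClaK b' hb', ← sub_eq_zero, ← map_sub, toGerm_eq_zero_iff]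
    filter_upwards [b'.isOpen_source.mem_nhds hb'] with z hz
    rw [← evalPt_apply, map_sub, evalPt_apply, evalPt_apply, pullbackCla_apply,
      rigClaK_apply b' _ hz, PowSer.eval_sliceRight_eval (b.coord_le hy) (b'.coord_le hz),
      rigClaK_apply D _ (hΘ y hy z hz).1, sub_eq_zero]
    exact ((hΘ y hy z hz).2 g).symm
  have h1 : ξ (rigGermK D hD g) = μ (rigGermK b hb (PowSer.sliceLeft b.radius ν' q)) := by
    rw [← key, ← toGerm_rigClaK D hD]
    exact congrArg (fun θ => θ (rigClaK D g)) hξ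
  refine h1.trans (mem_hyFil_apply_eq_zero b hb rfl hμ fun i hi => ?_)
  exact PowSer.coeff_sliceLeft_eq_zero (fun j hj => mem_hyFil_monomial b' hb' rfl hν hj) hq hi

theorem incl_taylorK_zero (x : X) :
    DistributionAt.incl L n K x (taylorK x 0) = dirac L n K x :=
  ContinuousLinearMap.ext fun f => by
    refine (taylorK_zero _).trans ?_
    rw [dirac_apply]
    exact extendZero_apply f.1 ⟨x, trivial⟩

theorem fibreIntegral_add
    (ha : ContMDiff (𝓘(L, Fin n → L).prod 𝓘(L, Fin n' → L)) 𝓘(L, Fin m → L) ω a)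
    (ν ν' : LaDistribution L n' K X') (f : Cla L m K K (⊤ : Opens Y)) :
    fibreIntegral ha (ν + ν') f = fibreIntegral ha ν f + fibreIntegral ha ν' f :=
  Cla.ext fun ⟨x, _⟩ => (fibreIntegral_apply ha (ν + ν') f x).trans
    (congrArg₂ (· + ·) (fibreIntegral_apply ha ν f x) (fibreIntegral_apply ha ν' f x)).symm

theorem fibreIntegral_smul
    (ha : ContMDiff (𝓘(L, Fin n → L).prod 𝓘(L, Fin n' → L)) 𝓘(L, Fin m → L) ω a)
    (c : K) (ν : LaDistribution L n' K X') (f : Cla L m K K (⊤ : Opens Y)) :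
    fibreIntegral ha (c • ν) f = c • fibreIntegral ha ν f :=
  Cla.ext fun ⟨x, _⟩ => (fibreIntegral_apply ha (c • ν) f x).trans
    (congrArg (c • ·) (fibreIntegral_apply ha ν f x)).symm

end Germs

section Group

variable {L : Type uL} [NontriviallyNormedField L] [IsUltrametricDist L] [LocallyCompactSpace L]
  {n : ℕ} {K : Type uK} [NontriviallyNormedField K] [IsUltrametricDist K] [CompleteSpace K]
  [NormedAlgebra L K] {G : Type uG} [TopologicalSpace G] [T2Space G] [SecondCountableTopology G]
  [Group G] [ChartedSpace (Fin n → L) G] [LieGroup 𝓘(L, Fin n → L) ω G]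

variable (L n K G) in
/-- The convolution product `(μ * ν)(f) = ∫ ∫ f(gh) dν(h) dμ(g)`. -/
def convolution :
    LaDistribution L n K G →ₗ[K] LaDistribution L n K G →ₗ[K] LaDistribution L n K G :=
  LinearMap.mk₂ K
    (fun μ ν => μ.comp (fibreIntegral (contMDiff_mul 𝓘(L, Fin n → L) ω) ν))
    (fun _ _ _ => rfl) (fun _ _ _ => rfl)
    (fun μ ν ν' => ContinuousLinearMap.ext fun f =>
      (congrArg μ (fibreIntegral_add _ ν ν' f)).trans (map_add μ _ _))
    (fun c μ ν => ContinuousLinearMap.ext fun f =>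
      (congrArg μ (fibreIntegral_smul _ c ν f)).trans (map_smul μ _ _))

theorem convolution_def (μ ν : LaDistribution L n K G) : convolution L n K G μ ν =
    μ.comp (fibreIntegral (contMDiff_mul 𝓘(L, Fin n → L) ω) ν) := rfl

theorem convolution_eq_comp_swap (μ ν : LaDistribution L n K G) : convolution L n K G μ ν =
    ν.comp (fibreIntegral (contMDiff_comp_swap (contMDiff_mul 𝓘(L, Fin n → L) ω)) μ) :=
  ContinuousLinearMap.ext fun f => apply_fibreIntegral _ μ ν f

theorem convolution_dirac (g h : G) :
    convolution L n K G (dirac L n K g) (dirac L n K h) = dirac L n K (g * h) :=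
  ContinuousLinearMap.ext fun f => by
    rw [convolution_def, ContinuousLinearMap.comp_apply, dirac_apply, fibreIntegral_apply,
      dirac_apply, pullbackCla_apply, dirac_apply]

variable (L n K G) in
theorem isConvolution_convolution : IsConvolution L n (convolution L n K G) := by
  refine ⟨⟨fun μ => ?_, fun ν => ?_⟩, convolution_dirac⟩
  · exact (ContinuousLinearMap.precomp K (fibreIntegral
      (contMDiff_comp_swap (contMDiff_mul 𝓘(L, Fin n → L) ω)) μ)).continuous.congr fun ν =>
        (convolution_eq_comp_swap μ ν).symm
  · exact (ContinuousLinearMap.precomp K (fibreIntegral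
      (contMDiff_mul 𝓘(L, Fin n → L) ω) ν)).continuous

/-- Separately continuous bilinear maps agree as soon as they do so on Dirac distributions. -/
theorem SeparatelyContinuous.eq_of_dirac {W : Type*} [AddCommGroup W] [Module K W]
    [TopologicalSpace W] [T2Space W]
    {m m' : LaDistribution L n K G →ₗ[K] LaDistribution L n K G →ₗ[K] W}
    (hm : SeparatelyContinuous m) (hm' : SeparatelyContinuous m')
    (h : ∀ g h, m (dirac L n K g) (dirac L n K h) = m' (dirac L n K g) (dirac L n K h)) :
    m = m' := by
  have h1 : ∀ g ν, m (dirac L n K g) ν = m' (dirac L n K g) ν := fun g ν =>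
    congrArg (fun S => S ν) (dirac_ext (S := ⟨m (dirac L n K g), hm.1 _⟩)
      (T := ⟨m' (dirac L n K g), hm'.1 _⟩) (h g))
  refine LinearMap.ext₂ fun μ ν => ?_
  exact congrArg (fun S => S μ) (dirac_ext (S := ⟨m.flip ν, hm.2 _⟩)
    (T := ⟨m'.flip ν, hm'.2 _⟩) fun g => h1 g ν)

theorem IsConvolution.eq
    {m m' : LaDistribution L n K G →ₗ[K] LaDistribution L n K G →ₗ[K] LaDistribution L n K G}
    (hm : IsConvolution L n m) (hm' : IsConvolution L n m') : m = m' :=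
  hm.1.eq_of_dirac hm'.1 fun g h => by rw [hm.2, hm'.2]

theorem IsConvolution.dirac_one_mul
    {m : LaDistribution L n K G →ₗ[K] LaDistribution L n K G →ₗ[K] LaDistribution L n K G}
    (hm : IsConvolution L n m) (μ : LaDistribution L n K G) : m (dirac L n K 1) μ = μ :=
  congrArg (fun S => S μ) (dirac_ext (S := ⟨m (dirac L n K 1), hm.1.1 _⟩)
    (T := ContinuousLinearMap.id K _) fun g => (hm.2 1 g).trans (by rw [one_mul]; rfl))

theorem IsConvolution.mul_dirac_one
    {m : LaDistribution L n K G →ₗ[K] LaDistribution L n K G →ₗ[K] LaDistribution L n K G}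
    (hm : IsConvolution L n m) (μ : LaDistribution L n K G) : m μ (dirac L n K 1) = μ :=
  congrArg (fun S => S μ) (dirac_ext (S := ⟨m.flip (dirac L n K 1), hm.1.2 _⟩)
    (T := ContinuousLinearMap.id K _) fun g => (hm.2 g 1).trans (by rw [mul_one]; rfl))

theorem IsConvolution.assoc
    {m : LaDistribution L n K G →ₗ[K] LaDistribution L n K G →ₗ[K] LaDistribution L n K G}
    (hm : IsConvolution L n m) (μ ν ξ : LaDistribution L n K G) : m (m μ ν) ξ = m μ (m ν ξ) := by
  have h1 : ∀ g h ξ, m (m (dirac L n K g) (dirac L n K h)) ξ =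
      m (dirac L n K g) (m (dirac L n K h) ξ) := fun g h ξ =>
    congrArg (fun S => S ξ) (dirac_ext (S := ⟨m (m (dirac L n K g) (dirac L n K h)), hm.1.1 _⟩)
      (T := ⟨m (dirac L n K g) ∘ₗ m (dirac L n K h), (hm.1.1 _).comp (hm.1.1 _)⟩) fun k => by
        change m (m _ _) _ = m _ (m _ _)
        rw [hm.2, hm.2, hm.2, hm.2, mul_assoc])
  have h2 : (m.flip ξ) ∘ₗ m μ = m μ ∘ₗ m.flip ξ := by
    have h3 : m.compr₂ (m.flip ξ) = m.compl₂ (m.flip ξ) :=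
      SeparatelyContinuous.eq_of_dirac
        ⟨fun μ => (hm.1.2 ξ).comp (hm.1.1 μ), fun ν => (hm.1.2 ξ).comp (hm.1.2 ν)⟩
        ⟨fun μ => (hm.1.1 μ).comp (hm.1.2 ξ), fun ν => hm.1.2 (m ν ξ)⟩ fun g h => h1 g h ξ
    exact congrArg (fun S => S μ) h3
  exact congrArg (fun S => S ν) h2

theorem exists_incl_eq_convolution (μ ν : DistributionAt L n K (1 : G)) :
    ∃ ξ : DistributionAt L n K (1 : G), DistributionAt.incl L n K 1 ξ =
      convolution L n K G (DistributionAt.incl L n K 1 μ) (DistributionAt.incl L n K 1 ν) := by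
  have h := exists_incl_comp_fibreIntegral (contMDiff_mul 𝓘(L, Fin n → L) ω (G := G)) μ ν
  have h11 : (1 : G) * 1 = 1 := mul_one 1
  dsimp only at h
  rw [h11] at h
  exact h

theorem exists_mem_hy_incl_eq_convolution {μ ν : DistributionAt L n K (1 : G)}
    (hμ : μ ∈ hy L n K (1 : G)) (hν : ν ∈ hy L n K (1 : G)) :
    ∃ ξ ∈ hy L n K (1 : G), DistributionAt.incl L n K 1 ξ =
      convolution L n K G (DistributionAt.incl L n K 1 μ) (DistributionAt.incl L n K 1 ν) := by
  obtain ⟨k, hk⟩ := hμ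
  obtain ⟨l, hl⟩ := hν
  obtain ⟨ξ, hξ⟩ := exists_incl_comp_fibreIntegral (contMDiff_mul 𝓘(L, Fin n → L) ω (G := G)) μ ν
  have h : ∃ ξ ∈ hy L n K ((1 : G) * 1), DistributionAt.incl L n K _ ξ =
      convolution L n K G (DistributionAt.incl L n K 1 μ) (DistributionAt.incl L n K 1 ν) :=
    ⟨ξ, ⟨k + l, mem_hyFil_of_incl_eq (contMDiff_mul 𝓘(L, Fin n → L) ω) hk hl hξ⟩, hξ⟩
  have h11 : (1 : G) * 1 = 1 := mul_one 1
  rw [h11] at h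
  exact h

end Group

end

end LocAn

theorem mainTheorem5
    {L : Type uL} [NontriviallyNormedField L] [IsUltrametricDist L] [LocallyCompactSpace L]
    {K : Type uK} [NontriviallyNormedField K] [IsUltrametricDist K] [CompleteSpace K]
    (hK : SphericallyComplete K) [NormedAlgebra L K]
    {n : ℕ} {G : Type uG} [TopologicalSpace G] [T2Space G] [SecondCountableTopology G] [Group G]
    [ChartedSpace (Fin n → L) G] [LieGroup 𝓘(L, Fin n → L) ω G]
    {V : Type uV} [AddCommGroup V] [Module K V] [TopologicalSpace V] [IsTopologicalAddGroup V]
    [ContinuousSMul K V] [IsLinearTopology (IntegerRing K) V] [T2Space V] [Nontrivial V] :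
    -- the integration map on `C^la(G, V)` exists and is unique
    (∃! I : Cla L n K V (⊤ : Opens G) →L[K] (LaDistribution L n K G →L[K] V),
      IsIntegrationMap L n I) ∧
    -- the induced pairing `D_e(G) × C^la_e(G, V) → V`
    (∃ P : DistributionAt L n K (1 : G) →ₗ[K] ClaGerm L n K V (1 : G) →ₗ[K] V,
      IsGermPairing L n 1 P ∧ (∀ P', IsGermPairing L n 1 P' → P' = P) ∧
      SeparatelyContinuous P ∧ P.Nondegenerate ∧
      -- naturality in `V`
      (∀ (W : Type uW) [AddCommGroup W] [Module K W] [TopologicalSpace W]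
        [IsTopologicalAddGroup W] [ContinuousSMul K W] [IsLinearTopology (IntegerRing K) W]
        [T2Space W] [Nontrivial W] (l : V →L[K] W),
        ∃ lG : ClaGerm L n K V (1 : G) →L[K] ClaGerm L n K W (1 : G),
          (∀ (F : ClaGerm L n K V (1 : G)) (f : G → V),
            F.germ = (f : Filter.Germ (𝓝 (1 : G)) V) →
              (lG F).germ = ((l ∘ f : G → W) : Filter.Germ (𝓝 (1 : G)) W)) ∧
          ∀ Q : DistributionAt L n K (1 : G) →ₗ[K] ClaGerm L n K W (1 : G) →ₗ[K] W,
            IsGermPairing L n 1 Q → ∀ μ F, Q μ (lG F) = l (P μ F)) ∧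
      -- naturality in `G`
      (∀ (m : ℕ) (H : Type uH) [TopologicalSpace H] [T2Space H] [SecondCountableTopology H]
        [Group H] [ChartedSpace (Fin m → L) H] [LieGroup 𝓘(L, Fin m → L) ω H] (h : G →* H),
        ContMDiff 𝓘(L, Fin n → L) 𝓘(L, Fin m → L) ω h →
        ∃ (hV : ClaGerm L m K V (1 : H) →L[K] ClaGerm L n K V (1 : G))
          (hG : ClaGerm L m K K (1 : H) →L[K] ClaGerm L n K K (1 : G)),
          (∀ (F : ClaGerm L m K V (1 : H)) (f : H → V),
            F.germ = (f : Filter.Germ (𝓝 (1 : H)) V) →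
              (hV F).germ = ((f ∘ h : G → V) : Filter.Germ (𝓝 (1 : G)) V)) ∧
          (∀ (F : ClaGerm L m K K (1 : H)) (f : H → K),
            F.germ = (f : Filter.Germ (𝓝 (1 : H)) K) →
              (hG F).germ = ((f ∘ h : G → K) : Filter.Germ (𝓝 (1 : G)) K)) ∧
          ∀ Q : DistributionAt L m K (1 : H) →ₗ[K] ClaGerm L m K V (1 : H) →ₗ[K] V,
            IsGermPairing L m 1 Q → ∀ μ F, P μ (hV F) = Q (μ.comp hG) F) ∧
      -- the restriction of the pairing to `C^rig(U, E) ⊆ C^la_e(G, V)`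
      (∀ φ ∈ charts L n G, (1 : G) ∈ φ.source → ∀ (a : Fin n → L) (r : Fin n → ℝ≥0),
        (∀ i, 0 < r i) → φ.target = polyBall a r → ∀ B : BHSubspace K V,
        ∃ (c : PowSer K r B.E →L[K] ClaGerm L n K V (1 : G))
          (cK : PowSer K r K →L[K] ClaGerm L n K K (1 : G))
          (j : PowSer K r B.E →L[K] CompletedTensor K (ClaGerm L n K K (1 : G)) B.E),
          Function.Injective c ∧
          (∀ g, (c g).germ =
            ((fun y => B.ι (g.eval (φ y - a)) : G → V) : Filter.Germ (𝓝 (1 : G)) V)) ∧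
          (∀ g, (cK g).germ =
            ((fun y => g.eval (φ y - a) : G → K) : Filter.Germ (𝓝 (1 : G)) K)) ∧
          (∀ (g : PowSer K r K) (v : B.E),
            j (g.map (ContinuousLinearMap.toSpanSingleton K v)) = ctmul K (cK g) v) ∧
          ∀ μ : DistributionAt L n K (1 : G),
            ∃ T : CompletedTensor K (ClaGerm L n K K (1 : G)) B.E →L[K] B.E,
              (∀ F v, T (ctmul K F v) = μ F • v) ∧ ∀ g, P μ (c g) = B.ι (T (j g))) ∧
      -- the restriction of the pairing to the hyperalgebra is non-degenerate
      (P.domRestrict (hy L n K (1 : G))).Nondegenerate) ∧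
    -- the hyperalgebra is dense in `D_e(G)`
    Dense (hy L n K (1 : G) : Set (DistributionAt L n K (1 : G))) ∧
    -- the hyperalgebra is a subalgebra of `D_e(G) ⊆ D(G)` with respect to the convolution product
    Function.Injective (DistributionAt.incl L n K (1 : G)) ∧
    (∃ m : LaDistribution L n K G →ₗ[K] LaDistribution L n K G →ₗ[K] LaDistribution L n K G,
      IsConvolution L n m ∧ (∀ m', IsConvolution L n m' → m' = m) ∧
      (∀ μ ν ξ, m (m μ ν) ξ = m μ (m ν ξ)) ∧
      (∀ μ, m (dirac L n K 1) μ = μ ∧ m μ (dirac L n K 1) = μ) ∧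
      (∃ δ ∈ hy L n K (1 : G), DistributionAt.incl L n K 1 δ = dirac L n K 1) ∧
      (∀ μ ν : DistributionAt L n K (1 : G), ∃ ξ : DistributionAt L n K (1 : G),
        DistributionAt.incl L n K 1 ξ =
          m (DistributionAt.incl L n K 1 μ) (DistributionAt.incl L n K 1 ν)) ∧
      (∀ μ ∈ hy L n K (1 : G), ∀ ν ∈ hy L n K (1 : G), ∃ ξ ∈ hy L n K (1 : G),
        DistributionAt.incl L n K 1 ξ =
          m (DistributionAt.incl L n K 1 μ) (DistributionAt.incl L n K 1 ν))) := by
  refine ⟨⟨integration L n K G V, isIntegrationMap_integration, fun I hI => hI.eq_integration⟩,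
    ⟨germPairing 1, isGermPairing_germPairing 1, fun P' hP' => hP'.eq_germPairing,
      separatelyContinuous_germPairing 1, nondegenerate_germPairing 1, ?_, ?_, ?_,
      nondegenerate_germPairing_domRestrict fun i => taylorK_mem_hy 1 i⟩,
    dense_hy 1, incl_injective 1, convolution L n K G, isConvolution_convolution L n K G,
    fun m' hm' => hm'.eq (isConvolution_convolution L n K G),
    (isConvolution_convolution L n K G).assoc,
    fun μ => ⟨(isConvolution_convolution L n K G).dirac_one_mul μ,
      (isConvolution_convolution L n K G).mul_dirac_one μ⟩,
    ⟨taylorK 1 0, taylorK_mem_hy 1 0, incl_taylorK_zero 1⟩, exists_incl_eq_convolution,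
    fun μ hμ ν hν => exists_mem_hy_incl_eq_convolution hμ hν⟩
  · intro W _ _ _ _ _ _ _ _ l
    obtain ⟨T, hT, hT'⟩ := ClaGerm.exists_postcomp (L := L) (n := n) l (1 : G)
    refine ⟨T, fun F f hf => ?_, fun Q hQ μ F => ?_⟩
    · rw [hT, hf, Germ.map_coe]
    · rw [hQ.eq_germPairing, hT']
  · intro m H _ _ _ _ _ _ h hh
    obtain ⟨T, hT⟩ := ClaGerm.exists_precomp (K := K) (V := V) (hh 1) (map_one h)
    have : IsLinearTopology (IntegerRing K) K := (isLocConvex_self (K := K)).isLinearTopology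
    obtain ⟨S, hS⟩ := ClaGerm.exists_precomp (K := K) (V := K) (hh 1) (map_one h)
    refine ⟨T, S, hT, hS, fun Q hQ μ F => ?_⟩
    rw [hQ.eq_germPairing]
    exact germPairing_precomp hT hS μ F
  · intro φ hφ hx a r hr htarget B
    let D : PolyChart L n G := ⟨φ, hφ, a, r, hr, htarget⟩
    obtain ⟨j, hj⟩ := exists_powSer_completedTensor (E := B.E) (rigGermK (K := K) D hx)
    refine ⟨rigGerm D hx B, rigGermK D hx, j, rigGerm_injective D hx B, germ_rigGerm D hx B,
      germ_rigGermK D hx, hj, fun μ => ?_⟩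
    obtain ⟨T, hT⟩ := exists_completedTensor_lift (E := B.E) μ
    exact ⟨T, hT, germPairing_rigGerm_eq D hx B hj μ hT⟩
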